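/- Let $(X,J)$ be a connected complex surface with a Kähler metric $g$ of vanishing scalar curvature, oriented by $J$. Assume that $(X,g,J)$ is asymptotically locally Euclidean (ALE) of order $k\ge 2$ (the classical ALE condition being $k=4$) in the following sense: there are a compact set $K\subset X$, a closed ball $B\subset\mathbb C^2$ centred at $0$, a finite group $\Gamma\subset U(2)$ acting freely on $\mathbb C^2\setminus\{0\}$, and a biholomorphic map $\phi:(\mathbb C^2\setminus B)/\Gamma\to X\setminus K$, which identifies neighbourhoods of infinity (for every $r$ larger than the radius of $B$, the complement in $X$ of the image of $\{|z|>r\}$ is compact), such that, for the Euclidean metric $g_0$ with covariant derivative $\nabla_0$ and $R=|z|$, $$|\nabla_0^j(\phi^*g-g_0)|=O(R^{-k-j})\quad\text{as }R\to\infty,\text{ for all } j\ge 0 .$$ Let $\Lambda^\pm$ be the bundles of (anti-)self-dual two-forms, let $S^2_0\Lambda^+$ be the trace-free part of $S^2\Lambda^+$, let $\delta=d^*$, and let $d^-$ be $d$ followed by projection to $\Lambda^-$. Let $\Phi$ be the trace-free Ricci tensor, acting as the bundle map $\Lambda^+\to\Lambda^-$, $(\Phi\alpha)_{ab}=-\tfrac12(\Phi_a{}^{c}\alpha_{cb}+\Phi_b{}^{c}\alpha_{ac})$.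 Put $$S^*=d^-\delta+\Phi:\ C^\infty(\Lambda^+)\to C^\infty(\Lambda^-),\qquad D^*=d^-_{\Lambda^+}\delta_{\Lambda^+}+\Phi\otimes 1:\ C^\infty(S^2_0\Lambda^+)\to C^\infty(\Lambda^-\otimes\Lambda^+),$$ where in $D^*$ the operators act on the first factor of $S^2_0\Lambda^+\subset\Lambda^+\otimes\Lambda^+$ and are coupled to the second factor by the Levi-Civita connection. (Under $\Lambda^-\otimes\Lambda^+=S^2_0T^*X$, $D^*$ is, up to a constant factor, the formal adjoint of the linearization at $g$ of the map sending a conformal structure to its self-dual Weyl tensor; $S^*$ is the analogue for $J$-Hermitian conformal structures.) A smooth tensor field $T$ is said to be $O(R^{-2})$ if $|\nabla^jT|_g=O(R^{-2-j})$ at infinity for all $j\ge0$. Define $$H^2_g(X)=\{\psi\in C^\infty(X,S^2_0\Lambda^+):\ D^*\psi=0,\ \psi=O(R^{-2})\},$$ $$H^2_{g,J}(X)=\{\varphi\in C^\infty(X,\Lambda^+):\ S^*\varphi=0,\ \varphi=O(R^{-2})\}.$$ Then $H^2_g(X)=0$ and $H^2_{g,J}(X)=0$. -/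

import Mathlib

open scoped Manifold ContDiff BigOperators

noncomputable section

namespace ALEKahler

/-- The model `ℂ²` with its standard Hermitian norm. -/
abbrev C2 : Type := EuclideanSpace ℂ (Fin 2)

/-- The real coordinate frame `∂/∂x₁, ∂/∂y₁, ∂/∂x₂, ∂/∂y₂` of `ℂ² = ℝ⁴`, `z_a = x_a + i y_a`;
it is positive for the complex orientation. -/
def realFrame : Fin 4 → C2 :=
  ![!₂[1, 0], !₂[Complex.I, 0], !₂[0, 1], !₂[0, Complex.I]]

/-! ### Riemannian geometry in the real coordinates of `ℂ²` -/

/-- Component functions, in the real frame, of a covariant `k`-tensor on (an open subset of) `ℂ²`. -/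
abbrev Comp (k : ℕ) : Type := C2 → (Fin k → Fin 4) → ℝ

/-- Partial derivative in the `i`-th real coordinate direction. -/
def pd (i : Fin 4) (f : C2 → ℝ) (z : C2) : ℝ := fderiv ℝ f z (realFrame i)

/-- The matrix `g_{ij}`. -/
def metricMatrix (G : Comp 2) (z : C2) : Matrix (Fin 4) (Fin 4) ℝ :=
  Matrix.of fun i j => G z ![i, j]

/-- The inverse matrix `g^{ij}`. -/
def metricInv (G : Comp 2) (z : C2) : Matrix (Fin 4) (Fin 4) ℝ := (metricMatrix G z)⁻¹

/-- The Christoffel symbol `Γ^k_{ij}` of the Levi-Civita connection. -/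
def christoffel (G : Comp 2) (k i j : Fin 4) (z : C2) : ℝ :=
  (1 / 2) * ∑ l, metricInv G z k l *
    (pd i (fun w => G w ![j, l]) z + pd j (fun w => G w ![i, l]) z
      - pd l (fun w => G w ![i, j]) z)

/-- The Ricci tensor (positive on round spheres). -/
def ricci (G : Comp 2) (i j : Fin 4) (z : C2) : ℝ :=
  ∑ k, (pd k (christoffel G k i j) z - pd i (christoffel G k k j) z
    + ∑ l, (christoffel G k k l z * christoffel G l i j z
      - christoffel G k i l z * christoffel G l k j z))

/-- The scalar curvature. -/
def scalarCurv (G : Comp 2) (z : C2) : ℝ := ∑ i, ∑ j, metricInv G z i j * ricci G i j z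

/-- The trace-free part of the Ricci tensor. -/
def tracelessRicci (G : Comp 2) (i j : Fin 4) (z : C2) : ℝ :=
  ricci G i j z - scalarCurv G z / 4 * G z ![i, j]

/-- The Levi-Civita covariant derivative `(∇T)_{m i₁ … i_k} = ∇_m T_{i₁ … i_k}`. -/
def cov (G : Comp 2) {k : ℕ} (T : Comp k) : Comp (k + 1) := fun z I =>
  pd (I 0) (fun w => T w (Fin.tail I)) z
    - ∑ a : Fin k, ∑ p : Fin 4,
        christoffel G p (I 0) (I a.succ) z * T z (Function.update (Fin.tail I) a p)

/-- The iterated covariant derivative `∇^j T`. -/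
def covIter (G : Comp 2) {k : ℕ} (T : Comp k) : (j : ℕ) → Comp (k + j)
  | 0 => T
  | j + 1 => cov G (covIter G T j)

/-- The pointwise norm `|T|_g` of a covariant tensor. -/
def tensorNorm (G : Comp 2) {k : ℕ} (T : Comp k) (z : C2) : ℝ :=
  Real.sqrt (∑ I : Fin k → Fin 4, ∑ J : Fin k → Fin 4,
    (∏ a, metricInv G z (I a) (J a)) * (T z I * T z J))

/-- The Levi-Civita symbol on four indices. -/
def eps (i j k l : Fin 4) : ℝ :=
  ((1 : Matrix (Fin 4) (Fin 4) ℝ).submatrix ![i, j, k, l] id).det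

/-! A section of `Λ² ⊗ V`, with `V` a bundle of covariant `k`-tensors, is written as a covariant
`(k+2)`-tensor; the operators below act on the form indices (the first ones) and are coupled to
`V` by the Levi-Civita connection. -/

/-- The Hodge star on the first two indices,
`(∗T)_{ab…} = ½ √(det g) ε_{abcd} g^{cp} g^{dq} T_{pq…}`. -/
def star {k : ℕ} (G : Comp 2) (T : Comp (k + 2)) : Comp (k + 2) := fun z I =>
  (1 / 2) * Real.sqrt (metricMatrix G z).det *
    ∑ c, ∑ d, ∑ p, ∑ q, eps (I 0) (I 1) c d * metricInv G z c p * metricInv G z d q *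
      T z (Matrix.vecCons p (Matrix.vecCons q fun a => I a.succ.succ))

/-- Projection of the first two (form) indices to `Λ⁻`. -/
def asdPart {k : ℕ} (G : Comp 2) (T : Comp (k + 2)) : Comp (k + 2) := fun z I =>
  (1 / 2) * (T z I - star G T z I)

/-- The coupled codifferential `δ : Ω²(V) → Ω¹(V)`, `(δT)_{b…} = -∇^a T_{ab…}`. -/
def codiff {k : ℕ} (G : Comp 2) (T : Comp (k + 2)) : Comp (k + 1) := fun z I =>
  - ∑ m, ∑ a, metricInv G z m a * cov G T z (Matrix.vecCons m (Matrix.vecCons a I))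

/-- The coupled exterior derivative `d : Ω¹(V) → Ω²(V)`,
`(dα)_{ab…} = ∇_a α_{b…} - ∇_b α_{a…}`. -/
def extDiff {k : ℕ} (G : Comp 2) (α : Comp (k + 1)) : Comp (k + 2) := fun z I =>
  cov G α z I
    - cov G α z (Matrix.vecCons (I 1) (Matrix.vecCons (I 0) fun a => I a.succ.succ))

/-- The action of the trace-free Ricci tensor `Φ` as a bundle map `Λ⁺ ⊗ V → Λ⁻ ⊗ V`,
`(ΦT)_{ab…} = -½ (Φ_a{}^d T_{db…} + Φ_b{}^d T_{ad…})`.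
If `Φ = ∑ f_{rs} I_r Ī_s` in the quaternionic frames of `Λ⁺` and `Λ⁻`, this is
`e_r ↦ ∑ f_{rs} ē_s`. -/
def ricciAction {k : ℕ} (G : Comp 2) (T : Comp (k + 2)) : Comp (k + 2) := fun z I =>
  -(1 / 2) * ∑ c, ∑ d, metricInv G z c d *
    (tracelessRicci G (I 0) c z *
        T z (Matrix.vecCons d (Matrix.vecCons (I 1) fun a => I a.succ.succ))
      + tracelessRicci G (I 1) c z *
        T z (Matrix.vecCons (I 0) (Matrix.vecCons d fun a => I a.succ.succ)))

/-- The coupled operator `d⁻δ + Φ : C^∞(Λ⁺ ⊗ V) → C^∞(Λ⁻ ⊗ V)`. -/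
def coupledOp {k : ℕ} (G : Comp 2) (T : Comp (k + 2)) : Comp (k + 2) := fun z I =>
  asdPart G (extDiff G (codiff G T)) z I + ricciAction G T z I

/-- `S^* = d⁻δ + Φ : C^∞(Λ⁺) → C^∞(Λ⁻)`. -/
def Sstar (G : Comp 2) (φ : Comp 2) : Comp 2 := coupledOp (k := 0) G φ

/-- `D^* = d⁻δ + Φ : C^∞(S²₀Λ⁺) → C^∞(Λ⁻ ⊗ Λ⁺) = C^∞(S²₀T^*)`, the operator coupled to `Λ⁺`;
it is the formal adjoint of the linearization at a metric with `W⁺ = 0` of the map sending a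
conformal structure to its self-dual Weyl tensor. -/
def Dstar (G : Comp 2) (ψ : Comp 4) : Comp 4 := coupledOp (k := 2) G ψ

/-- `φ` is self-dual at `z`. -/
def IsSelfDualAt (G : Comp 2) (φ : Comp 2) (z : C2) : Prop :=
  (∀ a b, φ z ![a, b] = - φ z ![b, a]) ∧ ∀ I, star (k := 0) G φ z I = φ z I

/-- `ψ` lies in `S²₀Λ⁺` at `z`. -/
def IsS20SelfDualAt (G : Comp 2) (ψ : Comp 4) (z : C2) : Prop :=
  (∀ a b c d, ψ z ![a, b, c, d] = - ψ z ![b, a, c, d]) ∧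
  (∀ a b c d, ψ z ![a, b, c, d] = ψ z ![c, d, a, b]) ∧
  (∀ I, star (k := 2) G ψ z I = ψ z I) ∧
  ∑ a, ∑ b, ∑ c, ∑ d, metricInv G z a c * metricInv G z b d * ψ z ![a, b, c, d] = 0

/-! ### Tensors on a complex surface -/

section Surface

variable {X : Type*} [TopologicalSpace X] [ChartedSpace C2 X]

/-- (Set-theoretic) real covariant `k`-tensor fields on the complex surface `X`. The complex
structure `J` is multiplication by `i` on the tangent spaces. -/
abbrev CovTensorField (X : Type*) [TopologicalSpace X] [ChartedSpace C2 X] (k : ℕ) : Type _ :=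
  ∀ x : X, MultilinearMap ℝ (fun _ : Fin k => TangentSpace 𝓘(ℂ, C2) x) ℝ

/-- The coordinate vector field `f_* ∂_i` at `f z`, for a holomorphic `f` defined near `z`. -/
def frameAt (f : C2 → X) (z : C2) (i : Fin 4) : TangentSpace 𝓘(ℂ, C2) (f z) :=
  mfderiv 𝓘(ℂ, C2) 𝓘(ℂ, C2) f z (realFrame i)

/-- The components of the pull-back `f^* T` by a holomorphic map `f`. -/
def comps {k : ℕ} (f : C2 → X) (T : CovTensorField X k) : Comp k := fun z I =>
  T (f z) fun a => frameAt f z (I a)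

/-- `T` is `C^∞`: its components in all charts are. -/
def IsSmooth {k : ℕ} (T : CovTensorField X k) : Prop :=
  ∀ e ∈ atlas C2 X, ∀ I, ContDiffOn ℝ ∞ (fun z => comps e.symm T z I) e.target

/-- The components `ω_{ij} = g(J∂_i, ∂_j)` of the fundamental two-form in the coordinates `f`. -/
def kahlerForm (f : C2 → X) (g : CovTensorField X 2) (i j : Fin 4) (z : C2) : ℝ :=
  g (f z) ![Complex.I • frameAt f z i, frameAt f z j]

/-- `g` is a Kähler metric: a smooth Riemannian metric, `J`-Hermitian, with `dω = 0`. -/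
structure IsKahlerMetric (g : CovTensorField X 2) : Prop where
  smooth : IsSmooth g
  symm : ∀ (x : X) (v w : TangentSpace 𝓘(ℂ, C2) x), g x ![v, w] = g x ![w, v]
  pos : ∀ (x : X) (v : TangentSpace 𝓘(ℂ, C2) x), v ≠ 0 → 0 < g x ![v, v]
  hermitian : ∀ (x : X) (v w : TangentSpace 𝓘(ℂ, C2) x),
    g x ![Complex.I • v, Complex.I • w] = g x ![v, w]
  closed : ∀ e ∈ atlas C2 X, ∀ z ∈ e.target, ∀ i j k,
    pd i (kahlerForm e.symm g j k) z + pd j (kahlerForm e.symm g k i) z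
      + pd k (kahlerForm e.symm g i j) z = 0

/-- The scalar curvature of `g` vanishes. -/
def IsScalarFlat (g : CovTensorField X 2) : Prop :=
  ∀ e ∈ atlas C2 X, ∀ z ∈ e.target, scalarCurv (comps e.symm g) z = 0

/-- A holomorphic chart at infinity in which `g` is (weakly) asymptotically locally Euclidean of
order `k`; ALE in the strict sense is `k = 4`. The biholomorphic map
`(ℂ² ∖ B)/Γ → X ∖ K` is given by its lift `chart` to `ℂ² ∖ B`, a holomorphic local
diffeomorphism whose fibres are the `Γ`-orbits. -/
structure ALEEnd (g : CovTensorField X 2) (k : ℕ) where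
  /-- The compact set whose complement is the end. -/
  K : Set X
  isCompact_K : IsCompact K
  /-- The radius of the closed ball `B`. -/
  radius : ℝ
  radius_pos : 0 < radius
  /-- The finite group `Γ ⊂ U(2)`, acting freely on `ℂ² ∖ 0`. -/
  Γ : Subgroup (C2 ≃ₗᵢ[ℂ] C2)
  finite_Γ : Finite Γ
  free_Γ : ∀ γ ∈ Γ, γ ≠ 1 → ∀ z : C2, z ≠ 0 → γ z ≠ z
  /-- The lifted chart; its values on the ball `B` are irrelevant. -/
  chart : C2 → X
  holomorphic : MDifferentiableOn 𝓘(ℂ, C2) 𝓘(ℂ, C2) chart {z | radius < ‖z‖}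
  bijective_mfderiv : ∀ z : C2, radius < ‖z‖ →
    Function.Bijective (mfderiv 𝓘(ℂ, C2) 𝓘(ℂ, C2) chart z)
  image_eq : chart '' {z | radius < ‖z‖} = Kᶜ
  eq_iff : ∀ z w : C2, radius < ‖z‖ → radius < ‖w‖ →
    (chart z = chart w ↔ ∃ γ ∈ Γ, γ z = w)
  /-- The chart covers a neighbourhood of infinity of `X`: `‖z‖ → ∞` is the only way to leave
  every compact set. -/
  isCompact_compl : ∀ r : ℝ, radius < r → IsCompact (chart '' {z | r < ‖z‖})ᶜ
  /-- `|∇₀^j (g - g₀)| = O(r^{-k-j})` for all `j`. -/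
  decay : ∀ (j : ℕ) (a b : Fin 4),
    (fun z : C2 => iteratedFDeriv ℝ j
        (fun w => comps chart g w ![a, b] - if a = b then 1 else 0) z)
      =O[Bornology.cobounded C2] fun z : C2 => ‖z‖ ^ (-((k : ℤ) + j))

/-- `T ∈ O(R^{-m})`: `|∇^j T|_g = O(R^{-m-j})` at infinity, for all `j`. -/
def DecaysToOrder {g : CovTensorField X 2} {k : ℕ} (A : ALEEnd g k) {n : ℕ}
    (T : CovTensorField X n) (m : ℕ) : Prop :=
  ∀ j : ℕ, (fun z : C2 => tensorNorm (comps A.chart g)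
      (covIter (comps A.chart g) (comps A.chart T) j) z)
    =O[Bornology.cobounded C2] fun z : C2 => ‖z‖ ^ (-((m : ℤ) + j))

/-- `H²_g(X)`: the smooth sections `ψ` of `S²₀Λ⁺` with `D^* ψ = 0` and `ψ = O(R^{-2})`. -/
def H2 {g : CovTensorField X 2} {k : ℕ} (A : ALEEnd g k) : Set (CovTensorField X 4) :=
  {ψ | IsSmooth ψ ∧
    (∀ e ∈ atlas C2 X, ∀ z ∈ e.target,
      IsS20SelfDualAt (comps e.symm g) (comps e.symm ψ) z) ∧
    (∀ e ∈ atlas C2 X, ∀ z ∈ e.target, Dstar (comps e.symm g) (comps e.symm ψ) z = 0) ∧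
    DecaysToOrder A ψ 2}

/-- `H²_{g,J}(X)`: the smooth self-dual two-forms `φ` with `S^* φ = 0` and `φ = O(R^{-2})`. -/
def H2J {g : CovTensorField X 2} {k : ℕ} (A : ALEEnd g k) : Set (CovTensorField X 2) :=
  {φ | IsSmooth φ ∧
    (∀ e ∈ atlas C2 X, ∀ z ∈ e.target,
      IsSelfDualAt (comps e.symm g) (comps e.symm φ) z) ∧
    (∀ e ∈ atlas C2 X, ∀ z ∈ e.target, Sstar (comps e.symm g) (comps e.symm φ) z = 0) ∧
    DecaysToOrder A φ 2}

end Surface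

end ALEKahler

end

open scoped Manifold ContDiff BigOperators

noncomputable section

namespace ALEKahler

open TopologicalSpace (Opens)

/-! ### Kähler metrics in a holomorphic chart: components and Christoffel symbols -/

section

/-! On a Kähler surface `Λ⁺ = ℝω ⊕ Re K`, where `K` is the canonical bundle, so a self-dual form is
`φ = f ω + Re (x dz₁ ∧ dz₂)` with a global function `f` and a section `x` of `K`. When the scalar
curvature vanishes, the Ricci form `ρ` is trace-free. Hence `Φ` maps `f ω` to `-f ρ` and kills `Re
K` (`ricciAction_eq`). Let `b` be the (1,0)-form dual to `∂̄x`. Then `δφ = df ∘ J + 2 Re b`, and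
`S^* φ = 0` becomes an equation between (1,1)-forms: in components, `2 ∂∂̄f - f ∂∂̄ log vol + T g =
i (∂̄b - ∂b̄)` with a free multiplier `T` (`sstar_equations`).

The function `f`. The trace of `∂̄b` is zero, so `T = -□f`; applying `∂∂̄` once more removes `b`
altogether. What remains is the Lichnerowicz equation for `f` (`lichnerowicz`), which is the
divergence of the divergence of `∂̄ grad f` (`div_current`). Thus `∫ ⟨∂̄ grad f, ∂̄ grad u⟩ = 0` for
every compactly supported `u`. The pairing is positive on such fields because `∂̄ grad u` becomes
symmetric when its index is lowered. Test with `u = χ⁴ f`, `χ` a cut-off at radius `r`: completing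
the square (`caccioppoli`) leaves an error `O(r⁻⁸)` on an annulus of volume `O(r⁴)`. Letting `r → ∞`
gives `∂̄ grad f = 0`. So `grad f` is a holomorphic vector field tending to zero. Complex lines in
`ℂ²` that miss the ball `B` and Liouville's theorem show that it vanishes near infinity, and unique
continuation that it vanishes everywhere. Hence `f` is constant, and by decay it is zero.

The section `x`. With `f = 0` the equation says that `P = ∂̄b` is Hermitian, and it is trace-free;
therefore `-det P ≥ 0`, with equality only for `P = 0` (`HermTraceFree`). On the other hand `det
(∂̄b)` is a null Lagrangian, a divergence (`null_lagrangian`). Testing with `χ²` and completing the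
square again leaves an error `O(r⁻⁸)`, so `P = 0`. Now `b` is a holomorphic form tending to zero, so
`b = 0`; then `x` is holomorphic and tends to zero, so `x = 0` (`eq_zero_of_pmat`). This gives
`H²_{g,J} = 0`.

The tensor `ψ`. Since `ω` is parallel, contracting one factor of `ψ` with `ω` yields a decaying
solution of `S^* φ = 0`, hence zero. Together with the trace condition this leaves `ψ = Re (x (dz₁ ∧
dz₂)²)`, with `x` a section of `K²`. For such `ψ` the equation `D^* ψ = 0` says directly that `∂̄b`
is a multiple of the metric, and being trace-free it vanishes (`pmat_eq_zero_of_dstar`). The last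
part of the previous argument applies with `K²` in place of `K`.

Local identities are proved in a commutative ring with four commuting derivations (`KahlerRing`) and
then specialised to smooth functions on a chart. Integration over the surface goes through
`NullOperator`: a local linear operator that integrates to zero in every chart integrates to zero
globally, by a partition of unity. The decay used is only that of the components of `φ`, `ψ` and of
their first derivatives. -/

/-- The components of a Kähler metric in a holomorphic chart with domain `U`. -/
structure KahlerComps (U : Set C2) (G : Comp 2) : Prop where
  isOpen : IsOpen U
  smooth : ∀ I, ContDiffOn ℝ ∞ (fun z => G z I) U
  -- The algebraic identities are asked for at every `z`, not only on `U`, so that they can be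
  -- rewritten inside a function under `pd`. This costs nothing: where a parametrization is not
  -- differentiable, its differential is zero by default and so are the components.
  symm : ∀ z i j, G z ![i, j] = G z ![j, i]
  h11 : ∀ z, G z ![1, 1] = G z ![0, 0]
  h33 : ∀ z, G z ![3, 3] = G z ![2, 2]
  h13 : ∀ z, G z ![1, 3] = G z ![0, 2]
  h12 : ∀ z, G z ![1, 2] = - G z ![0, 3]
  h01 : ∀ z, G z ![0, 1] = 0
  h23 : ∀ z, G z ![2, 3] = 0
  pos : ∀ z ∈ U, 0 < G z ![0, 0]
  det_pos : ∀ z ∈ U, 0 < G z ![0, 0] * G z ![2, 2] - G z ![0, 2] ^ 2 - G z ![0, 3] ^ 2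
  k2 : ∀ z ∈ U, pd 2 (fun w => G w ![0, 0]) z =
    pd 0 (fun w => G w ![0, 2]) z - pd 1 (fun w => G w ![0, 3]) z
  k3 : ∀ z ∈ U, pd 3 (fun w => G w ![0, 0]) z =
    pd 0 (fun w => G w ![0, 3]) z + pd 1 (fun w => G w ![0, 2]) z
  k0 : ∀ z ∈ U, pd 0 (fun w => G w ![2, 2]) z =
    pd 2 (fun w => G w ![0, 2]) z + pd 3 (fun w => G w ![0, 3]) z
  k1 : ∀ z ∈ U, pd 1 (fun w => G w ![2, 2]) z =
    pd 3 (fun w => G w ![0, 2]) z - pd 2 (fun w => G w ![0, 3]) z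

/-- The determinant of the Hermitian matrix of the metric; also the density of its volume form. -/
def vol (G : Comp 2) (z : C2) : ℝ :=
  G z ![0, 0] * G z ![2, 2] - G z ![0, 2] ^ 2 - G z ![0, 3] ^ 2

variable {U : Set C2} {G : Comp 2}

namespace KahlerComps

theorem hermitian_table (h : KahlerComps U G) (z : C2) :
    G z ![1, 0] = 0 ∧ G z ![2, 0] = G z ![0, 2] ∧ G z ![3, 0] = G z ![0, 3] ∧
    G z ![2, 1] = - G z ![0, 3] ∧ G z ![3, 1] = G z ![0, 2] ∧ G z ![3, 2] = 0 := by
  refine ⟨?_, ?_, ?_, ?_, ?_, ?_⟩ <;> rw [h.symm]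
  · exact h.h01 z
  · exact h.h12 z
  · exact h.h13 z
  · exact h.h23 z

theorem metricMatrix_eq (h : KahlerComps U G) (z : C2) :
    metricMatrix G z = !![G z ![0, 0], 0, G z ![0, 2], G z ![0, 3];
      0, G z ![0, 0], -G z ![0, 3], G z ![0, 2];
      G z ![0, 2], -G z ![0, 3], G z ![2, 2], 0;
      G z ![0, 3], G z ![0, 2], 0, G z ![2, 2]] := by
  obtain ⟨h1, h2, h3, h4, h5, h6⟩ := h.hermitian_table z
  ext i j
  fin_cases i <;> fin_cases j <;>
    simp [metricMatrix, h1, h2, h3, h4, h5, h6, h.h11 z, h.h33 z, h.h13 z, h.h12 z, h.h01 z,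
      h.h23 z]

theorem vol_pos (h : KahlerComps U G) {z : C2} (hz : z ∈ U) : 0 < vol G z := h.det_pos z hz

theorem det_metricMatrix (h : KahlerComps U G) (z : C2) :
    (metricMatrix G z).det = vol G z ^ 2 := by
  rw [h.metricMatrix_eq]
  simp [Matrix.det_succ_row_zero, Fin.sum_univ_succ, Fin.succAbove, vol]
  ring

theorem sqrt_det (h : KahlerComps U G) {z : C2} (hz : z ∈ U) :
    Real.sqrt (metricMatrix G z).det = vol G z := by
  rw [h.det_metricMatrix, Real.sqrt_sq (h.vol_pos hz).le]

theorem metricInv_eq (h : KahlerComps U G) {z : C2} (hz : z ∈ U) :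
    metricInv G z = (vol G z)⁻¹ • !![G z ![2, 2], 0, -G z ![0, 2], -G z ![0, 3];
      0, G z ![2, 2], G z ![0, 3], -G z ![0, 2];
      -G z ![0, 2], G z ![0, 3], G z ![0, 0], 0;
      -G z ![0, 3], -G z ![0, 2], 0, G z ![0, 0]] := by
  have hv := (h.vol_pos hz).ne'
  rw [metricInv, h.metricMatrix_eq]
  apply Matrix.inv_eq_right_inv
  rw [Matrix.mul_smul, inv_smul_eq_iff₀ hv]
  ext i j
  fin_cases i <;> fin_cases j <;> simp [vol] <;> ring

end KahlerComps

theorem pd_neg (i : Fin 4) (f : C2 → ℝ) (z : C2) : pd i (fun w => - f w) z = - pd i f z := by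
  simp [pd, fderiv_fun_neg]

theorem pd_const (i : Fin 4) (c : ℝ) (z : C2) : pd i (fun _ => c) z = 0 := by
  simp [pd]

theorem christoffel_comm (h : ∀ z i j, G z ![i, j] = G z ![j, i]) (k i j : Fin 4) (z : C2) :
    christoffel G k i j z = christoffel G k j i z := by
  simp only [christoffel, h _ j i]
  congr 1
  refine Finset.sum_congr rfl fun l _ => ?_
  ring

namespace KahlerComps

/-- The Christoffel symbols commute with the complex structure. -/
theorem christoffel_J (h : KahlerComps U G) {z : C2} (hz : z ∈ U) (i : Fin 4) :
    (christoffel G 0 i 1 z = - christoffel G 1 i 0 z ∧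
      christoffel G 1 i 1 z = christoffel G 0 i 0 z ∧
      christoffel G 2 i 1 z = - christoffel G 3 i 0 z ∧
      christoffel G 3 i 1 z = christoffel G 2 i 0 z) ∧
    (christoffel G 0 i 3 z = - christoffel G 1 i 2 z ∧
      christoffel G 1 i 3 z = christoffel G 0 i 2 z ∧
      christoffel G 2 i 3 z = - christoffel G 3 i 2 z ∧
      christoffel G 3 i 3 z = christoffel G 2 i 2 z) := by
  have t := fun w => h.hermitian_table w
  simp only [christoffel, h.metricInv_eq hz, Fin.sum_univ_four]
  fin_cases i <;>
    simp [(t _).1, (t _).2.1, (t _).2.2.1, (t _).2.2.2.1, (t _).2.2.2.2.1, (t _).2.2.2.2.2,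
      h.h11, h.h33, h.h13, h.h12, h.h01, h.h23, pd_neg, pd_const, h.k0 z hz, h.k1 z hz,
      h.k2 z hz, h.k3 z hz] <;>
    refine ⟨⟨?_, ?_, ?_, ?_⟩, ?_, ?_, ?_, ?_⟩ <;> ring

/-- The Levi-Civita connection is compatible with the metric. -/
theorem pd_metric (h : KahlerComps U G) {z : C2} (hz : z ∈ U) (m : Fin 4) :
    pd m (fun w => G w ![0, 0]) z = 2 * (christoffel G 0 m 0 z * G z ![0, 0] +
      christoffel G 2 m 0 z * G z ![0, 2] + christoffel G 3 m 0 z * G z ![0, 3]) ∧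
    pd m (fun w => G w ![2, 2]) z = 2 * (christoffel G 0 m 2 z * G z ![0, 2] -
      christoffel G 1 m 2 z * G z ![0, 3] + christoffel G 2 m 2 z * G z ![2, 2]) ∧
    pd m (fun w => G w ![0, 2]) z = christoffel G 0 m 0 z * G z ![0, 2] -
      christoffel G 1 m 0 z * G z ![0, 3] + christoffel G 2 m 0 z * G z ![2, 2] +
      christoffel G 0 m 2 z * G z ![0, 0] + christoffel G 2 m 2 z * G z ![0, 2] +
      christoffel G 3 m 2 z * G z ![0, 3] ∧
    pd m (fun w => G w ![0, 3]) z = christoffel G 0 m 0 z * G z ![0, 3] +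
      christoffel G 1 m 0 z * G z ![0, 2] + christoffel G 3 m 0 z * G z ![2, 2] -
      christoffel G 1 m 2 z * G z ![0, 0] - christoffel G 3 m 2 z * G z ![0, 2] +
      christoffel G 2 m 2 z * G z ![0, 3] := by
  have t := fun w => h.hermitian_table w
  have hv := (h.vol_pos hz).ne'
  simp only [christoffel, h.metricInv_eq hz, Fin.sum_univ_four]
  fin_cases m <;>
    simp [(t _).1, (t _).2.1, (t _).2.2.1, (t _).2.2.2.1, (t _).2.2.2.2.1, (t _).2.2.2.2.2,
      h.h11, h.h33, h.h13, h.h12, h.h01, h.h23, pd_neg, pd_const, h.k0 z hz, h.k1 z hz,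
      h.k2 z hz, h.k3 z hz] <;>
    refine ⟨?_, ?_, ?_, ?_⟩ <;> field_simp <;> simp only [vol] <;> ring

end KahlerComps

end

/-! ### Partial derivatives, covariant derivatives on explicit indices, self-dual forms -/

section

theorem pd_add {f g : C2 → ℝ} {z : C2} (hf : DifferentiableAt ℝ f z) (hg : DifferentiableAt ℝ g z)
    (i : Fin 4) : pd i (fun w => f w + g w) z = pd i f z + pd i g z := by
  simp [pd, fderiv_fun_add hf hg]

theorem pd_sub {f g : C2 → ℝ} {z : C2} (hf : DifferentiableAt ℝ f z) (hg : DifferentiableAt ℝ g z)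
    (i : Fin 4) : pd i (fun w => f w - g w) z = pd i f z - pd i g z := by
  simp [pd, fderiv_fun_sub hf hg]

theorem pd_mul {f g : C2 → ℝ} {z : C2} (hf : DifferentiableAt ℝ f z) (hg : DifferentiableAt ℝ g z)
    (i : Fin 4) : pd i (fun w => f w * g w) z = f z * pd i g z + g z * pd i f z := by
  simp [pd, fderiv_fun_mul hf hg]

theorem pd_congr {f g : C2 → ℝ} {U : Set C2} (hU : IsOpen U) {z : C2} (hz : z ∈ U)
    (h : ∀ w ∈ U, f w = g w) (i : Fin 4) : pd i f z = pd i g z := by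
  have : f =ᶠ[nhds z] g := by
    filter_upwards [hU.mem_nhds hz] with w hw using h w hw
  simp [pd, this.fderiv_eq]

theorem cov_one (G : Comp 2) (T : Comp 1) (z : C2) (m a : Fin 4) :
    cov G T z ![m, a] = pd m (fun w => T w ![a]) z - ∑ p, christoffel G p m a z * T z ![p] := by
  have h0 : ∀ p, Function.update ![a] 0 p = ![p] := by
    intro p; ext i; fin_cases i; rfl
  have ht : Fin.tail ![m, a] = ![a] := rfl
  simp only [cov, ht, Fin.sum_univ_one, h0]
  rfl

theorem cov_two (G : Comp 2) (T : Comp 2) (z : C2) (m a b : Fin 4) :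
    cov G T z ![m, a, b] = pd m (fun w => T w ![a, b]) z
      - ∑ p, christoffel G p m a z * T z ![p, b] - ∑ p, christoffel G p m b z * T z ![a, p] := by
  have h0 : ∀ p, Function.update ![a, b] 0 p = ![p, b] := by
    intro p; ext i; fin_cases i <;> rfl
  have h1 : ∀ p, Function.update ![a, b] 1 p = ![a, p] := by
    intro p; ext i; fin_cases i <;> rfl
  have ht : Fin.tail ![m, a, b] = ![a, b] := rfl
  simp only [cov, ht, Fin.sum_univ_two, h0, h1, sub_sub]
  rfl

theorem cov_three (G : Comp 2) (T : Comp 3) (z : C2) (m a b c : Fin 4) :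
    cov G T z ![m, a, b, c] = pd m (fun w => T w ![a, b, c]) z
      - ∑ p, christoffel G p m a z * T z ![p, b, c] - ∑ p, christoffel G p m b z * T z ![a, p, c]
      - ∑ p, christoffel G p m c z * T z ![a, b, p] := by
  have h0 : ∀ p, Function.update ![a, b, c] 0 p = ![p, b, c] := by
    intro p; ext i; fin_cases i <;> rfl
  have h1 : ∀ p, Function.update ![a, b, c] 1 p = ![a, p, c] := by
    intro p; ext i; fin_cases i <;> rfl
  have h2 : ∀ p, Function.update ![a, b, c] 2 p = ![a, b, p] := by
    intro p; ext i; fin_cases i <;> rfl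
  have ht : Fin.tail ![m, a, b, c] = ![a, b, c] := rfl
  simp only [cov, ht, Fin.sum_univ_three, h0, h1, h2, sub_sub, add_assoc]
  rfl

theorem cov_four (G : Comp 2) (T : Comp 4) (z : C2) (m a b c d : Fin 4) :
    cov G T z ![m, a, b, c, d] = pd m (fun w => T w ![a, b, c, d]) z
      - ∑ p, christoffel G p m a z * T z ![p, b, c, d]
      - ∑ p, christoffel G p m b z * T z ![a, p, c, d]
      - ∑ p, christoffel G p m c z * T z ![a, b, p, d]
      - ∑ p, christoffel G p m d z * T z ![a, b, c, p] := by
  have h0 : ∀ p, Function.update ![a, b, c, d] 0 p = ![p, b, c, d] := by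
    intro p; ext i; fin_cases i <;> rfl
  have h1 : ∀ p, Function.update ![a, b, c, d] 1 p = ![a, p, c, d] := by
    intro p; ext i; fin_cases i <;> rfl
  have h2 : ∀ p, Function.update ![a, b, c, d] 2 p = ![a, b, p, d] := by
    intro p; ext i; fin_cases i <;> rfl
  have h3 : ∀ p, Function.update ![a, b, c, d] 3 p = ![a, b, c, p] := by
    intro p; ext i; fin_cases i <;> rfl
  have ht : Fin.tail ![m, a, b, c, d] = ![a, b, c, d] := rfl
  simp only [cov, ht, Fin.sum_univ_four, h0, h1, h2, h3, sub_sub, add_assoc]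
  rfl

variable {U : Set C2} {G : Comp 2}

/-- The components of the self-dual form `f ω + Re ((p + i q) dz₁ ∧ dz₂)`. -/
def sdMat (G : Comp 2) (f p q : ℝ) (z : C2) : Matrix (Fin 4) (Fin 4) ℝ :=
  !![0, f * G z ![0, 0], -(f * G z ![0, 3]) + p, f * G z ![0, 2] - q;
    -(f * G z ![0, 0]), 0, -(f * G z ![0, 2]) - q, -(f * G z ![0, 3]) - p;
    f * G z ![0, 3] - p, f * G z ![0, 2] + q, 0, f * G z ![2, 2];
    -(f * G z ![0, 2]) + q, f * G z ![0, 3] + p, -(f * G z ![2, 2]), 0]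

/-- Real and imaginary parts of the connection form of `dz₁ ∧ dz₂`. -/
def traceRe (G : Comp 2) (m : Fin 4) (z : C2) : ℝ := christoffel G 0 m 0 z + christoffel G 2 m 2 z
def traceIm (G : Comp 2) (m : Fin 4) (z : C2) : ℝ := christoffel G 1 m 0 z + christoffel G 3 m 2 z

theorem KahlerComps.differentiableAt (h : KahlerComps U G) {z : C2} (hz : z ∈ U)
    (I : Fin 2 → Fin 4) : DifferentiableAt ℝ (fun w => G w I) z :=
  ((h.smooth I).contDiffAt (h.isOpen.mem_nhds hz)).differentiableAt (by simp)

/-- Since `ω` is parallel and `dz₁ ∧ dz₂` is differentiated through the connection form of `K`,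
covariant differentiation preserves the shape of a self-dual form. It replaces `f` by `df`, and `p +
i q` by `d(p + i q) - θ (p + i q)` with `θ = traceRe + i traceIm`. -/
theorem KahlerComps.cov_sdMat (h : KahlerComps U G) {z : C2} (hz : z ∈ U) {f p q : C2 → ℝ}
    (hf : DifferentiableAt ℝ f z) (hp : DifferentiableAt ℝ p z) (hq : DifferentiableAt ℝ q z)
    (m i j : Fin 4) :
    pd m (fun w => sdMat G (f w) (p w) (q w) w i j) z
      - ∑ l, christoffel G l m i z * sdMat G (f z) (p z) (q z) z l j
      - ∑ l, christoffel G l m j z * sdMat G (f z) (p z) (q z) z i l =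
    sdMat G (pd m f z) (pd m p z - (p z * traceRe G m z - q z * traceIm G m z))
      (pd m q z - (p z * traceIm G m z + q z * traceRe G m z)) z i j := by
  have hG := h.differentiableAt hz
  have e0 : ∀ g : Fin 2 → Fin 4, pd m (fun w => f w * G w g) z =
    f z * pd m (fun w => G w g) z + G z g * pd m f z := fun g => pd_mul hf (hG g) m
  obtain ⟨m1, m2, m3, m4⟩ := h.pd_metric hz m
  obtain ⟨⟨j1, j2, j3, j4⟩, j5, j6, j7, j8⟩ := h.christoffel_J hz m
  have d1 : ∀ g : Fin 2 → Fin 4, DifferentiableAt ℝ (fun w => f w * G w g) z :=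
    fun g => hf.mul (hG g)
  have d2 : ∀ g : Fin 2 → Fin 4, DifferentiableAt ℝ (fun w => -(f w * G w g)) z :=
    fun g => (hf.mul (hG g)).neg
  fin_cases i <;> fin_cases j <;>
    simp [sdMat, Fin.sum_univ_four, pd_const, pd_neg, pd_add, pd_sub, d1, d2, hp, hq, e0,
      j1, j2, j3, j4, j5, j6, j7, j8, m1, m2, m3, m4, traceRe, traceIm] <;> ring

end

/-! ### The algebra of smooth functions on a chart and its complex derivations -/

section

/-- The extension by zero of a function on `U`. -/
def extendZero {U : Opens C2} (F : U → ℂ) : C2 → ℂ := by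
  classical exact fun z => if h : z ∈ U then F ⟨z, h⟩ else 0

theorem extendZero_apply {U : Opens C2} (F : U → ℂ) {z : C2} (hz : z ∈ U) :
    extendZero F z = F ⟨z, hz⟩ := by
  simp [extendZero, hz]

/-- The algebra of smooth complex valued functions on `U`. -/
def smoothSubalgebra (U : Opens C2) : Subalgebra ℂ (U → ℂ) where
  carrier := {F | ContDiffOn ℝ ∞ (extendZero F) U}
  mul_mem' {F G} hF hG := (ContDiffOn.mul hF hG).congr fun z hz => by
    simp [extendZero_apply _ hz]
  add_mem' {F G} hF hG := (ContDiffOn.add hF hG).congr fun z hz => by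
    simp [extendZero_apply _ hz]
  algebraMap_mem' c := (contDiffOn_const (c := c)).congr fun z hz => by
    simp [extendZero_apply _ hz]

/-- The algebra of smooth complex valued functions on `U`. -/
def SmoothAlg (U : Opens C2) : Type := smoothSubalgebra U

namespace SmoothAlg

variable {U : Opens C2}

instance : CommRing (SmoothAlg U) := inferInstanceAs (CommRing (smoothSubalgebra U))
instance : Algebra ℂ (SmoothAlg U) := inferInstanceAs (Algebra ℂ (smoothSubalgebra U))

/-- The underlying function. -/
def fn (F : SmoothAlg U) : U → ℂ := F.1

theorem contDiffAt (F : SmoothAlg U) {z : C2} (hz : z ∈ U) :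
    ContDiffAt ℝ ∞ (extendZero F.fn) z :=
  ContDiffOn.contDiffAt F.2 (U.isOpen.mem_nhds hz)

theorem differentiableAt (F : SmoothAlg U) {z : C2} (hz : z ∈ U) :
    DifferentiableAt ℝ (extendZero F.fn) z := (F.contDiffAt hz).differentiableAt (by simp)

/-- The restriction of a function to `U`. -/
def mk (F : C2 → ℂ) (hF : ContDiffOn ℝ ∞ F U) : SmoothAlg U :=
  ⟨fun z => F z, hF.congr fun z hz => by simp [extendZero_apply _ hz]⟩

@[simp] theorem fn_mk (F : C2 → ℂ) (hF : ContDiffOn ℝ ∞ F U) (z : U) : (mk F hF).fn z = F z := rfl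
@[simp] theorem fn_add (F H : SmoothAlg U) (z : U) : (F + H).fn z = F.fn z + H.fn z := rfl
@[simp] theorem fn_sub (F H : SmoothAlg U) (z : U) : (F - H).fn z = F.fn z - H.fn z := rfl
@[simp] theorem fn_neg (F : SmoothAlg U) (z : U) : (-F).fn z = -F.fn z := rfl
@[simp] theorem fn_mul (F H : SmoothAlg U) (z : U) : (F * H).fn z = F.fn z * H.fn z := rfl
@[simp] theorem fn_zero (z : U) : (0 : SmoothAlg U).fn z = 0 := rfl
@[simp] theorem fn_one (z : U) : (1 : SmoothAlg U).fn z = 1 := rfl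
@[simp] theorem fn_smul (c : ℂ) (F : SmoothAlg U) (z : U) : (c • F).fn z = c * F.fn z := rfl

@[ext] theorem ext {F H : SmoothAlg U} (h : ∀ z : U, F.fn z = H.fn z) : F = H :=
  Subtype.ext (funext h)

theorem extendZero_eventuallyEq {F : SmoothAlg U} {H : C2 → ℂ} (h : ∀ z : U, F.fn z = H z) {z : C2}
    (hz : z ∈ U) : extendZero F.fn =ᶠ[nhds z] H := by
  filter_upwards [U.isOpen.mem_nhds hz] with w hw
  rw [extendZero_apply _ hw, h]

/-- The derivative along a linear combination of two real coordinate directions. -/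
def dir (i j : Fin 4) (α : ℂ) : Derivation ℂ (SmoothAlg U) (SmoothAlg U) :=
  Derivation.mk'
    { toFun := fun F => mk (fun z => 1 / 2 * (fderiv ℝ (extendZero F.fn) z (realFrame i)
          + α * fderiv ℝ (extendZero F.fn) z (realFrame j)))
        (by
          have := ContDiffOn.fderiv_of_isOpen (m := ∞) F.2 U.isOpen (by simp)
          exact contDiffOn_const.mul ((this.clm_apply contDiffOn_const).add
            (contDiffOn_const.mul (this.clm_apply contDiffOn_const))))
      map_add' := fun F G => by
        ext z
        have h : extendZero (F + G).fn =ᶠ[nhds z.1] extendZero F.fn + extendZero G.fn :=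
          extendZero_eventuallyEq (fun w => by simp [extendZero_apply _ w.2]) z.2
        simp [h.fderiv_eq, fderiv_add (F.differentiableAt z.2) (G.differentiableAt z.2)]
        ring
      map_smul' := fun c F => by
        ext z
        have h : extendZero (c • F).fn =ᶠ[nhds z.1] c • extendZero F.fn :=
          extendZero_eventuallyEq (fun w => by simp [extendZero_apply _ w.2]) z.2
        simp [h.fderiv_eq, fderiv_const_smul (F.differentiableAt z.2)]
        ring }
    fun F G => by
      ext z
      have h : extendZero (F * G).fn =ᶠ[nhds z.1] extendZero F.fn * extendZero G.fn :=
        extendZero_eventuallyEq (fun w => by simp [extendZero_apply _ w.2]) z.2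
      simp [h.fderiv_eq, fderiv_mul (F.differentiableAt z.2) (G.differentiableAt z.2),
        extendZero_apply _ z.2]
      ring

theorem dir_apply (i j : Fin 4) (α : ℂ) (F : SmoothAlg U) (z : U) :
    (dir i j α F).fn z = 1 / 2 * (fderiv ℝ (extendZero F.fn) z (realFrame i)
      + α * fderiv ℝ (extendZero F.fn) z (realFrame j)) := rfl

theorem dir_apply_of_eq (i j : Fin 4) (α : ℂ) {F : SmoothAlg U} {H : C2 → ℂ}
    (h : ∀ z : U, F.fn z = H z) (z : U) :
    (dir i j α F).fn z = 1 / 2 * (fderiv ℝ H z (realFrame i) + α * fderiv ℝ H z (realFrame j)) := by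
  rw [dir_apply, (extendZero_eventuallyEq h z.2).fderiv_eq]

/-- Symmetry of the second derivative. It is the only analytic input for the commuting derivations
of `KahlerRing`. -/
theorem dir_comm (i j k l : Fin 4) (α β : ℂ) (F : SmoothAlg U) :
    dir i j α (dir k l β F) = dir k l β (dir i j α F) := by
  ext z
  have hs : ContDiffAt ℝ 2 (extendZero F.fn) z := contDiffAt_infty.mp (F.contDiffAt z.2) 2
  have hd : DifferentiableAt ℝ (fderiv ℝ (extendZero F.fn)) z :=
    (hs.fderiv_right (m := 1) (by norm_num)).differentiableAt (by simp)
  have key : ∀ (i j k l : Fin 4) (α β : ℂ), (dir i j α (dir k l β F)).fn z =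
      1 / 4 * (fderiv ℝ (fderiv ℝ (extendZero F.fn)) z (realFrame i) (realFrame k)
        + β * fderiv ℝ (fderiv ℝ (extendZero F.fn)) z (realFrame i) (realFrame l)
        + α * fderiv ℝ (fderiv ℝ (extendZero F.fn)) z (realFrame j) (realFrame k)
        + α * β * fderiv ℝ (fderiv ℝ (extendZero F.fn)) z (realFrame j) (realFrame l)) := by
    intro i j k l α β
    have hk : ∀ k : Fin 4, HasFDerivAt (fun z => fderiv ℝ (extendZero F.fn) z (realFrame k))
        ((fderiv ℝ (fderiv ℝ (extendZero F.fn)) z.1).flip (realFrame k)) z.1 := by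
      intro k
      simpa using hd.hasFDerivAt.clm_apply (hasFDerivAt_const (realFrame k) z.1)
    rw [dir_apply_of_eq i j α (H := fun z => 1 / 2 * (fderiv ℝ (extendZero F.fn) z (realFrame k)
      + β * fderiv ℝ (extendZero F.fn) z (realFrame l))) (fun w => dir_apply k l β F w)]
    have := ((hk k).add ((hk l).const_mul β)).const_mul (1 / 2)
    rw [HasFDerivAt.fderiv (f := fun z => 1 / 2 * (fderiv ℝ (extendZero F.fn) z (realFrame k)
      + β * fderiv ℝ (extendZero F.fn) z (realFrame l))) this]
    simp
    ring
  rw [key, key]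
  have sym := fun v w => (hs.isSymmSndFDerivAt (by simp)).eq v w
  rw [sym (realFrame i), sym (realFrame i), sym (realFrame j), sym (realFrame j)]
  ring

/-- The holomorphic derivatives `∂/∂z₁`, `∂/∂z₂`. -/
abbrev dz1 : Derivation ℂ (SmoothAlg U) (SmoothAlg U) := dir 0 1 (-Complex.I)
abbrev dz2 : Derivation ℂ (SmoothAlg U) (SmoothAlg U) := dir 2 3 (-Complex.I)
/-- The antiholomorphic derivatives `∂/∂z̄₁`, `∂/∂z̄₂`. -/
abbrev db1 : Derivation ℂ (SmoothAlg U) (SmoothAlg U) := dir 0 1 Complex.I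
abbrev db2 : Derivation ℂ (SmoothAlg U) (SmoothAlg U) := dir 2 3 Complex.I

end SmoothAlg

end

section

/-! ### Identities of Kähler geometry in a ring with commuting derivations -/

section Algebra

variable {R : Type*} [CommRing R] [Algebra ℂ R]

/-- The coefficients of a Kähler metric in a ring with four commuting derivations. -/
structure KahlerRing (d1 d2 e1 e2 : Derivation ℂ R R) (g11 g12 g21 g22 D D' : R) : Prop where
  hd : ∀ x, d1 (d2 x) = d2 (d1 x)
  he : ∀ x, e1 (e2 x) = e2 (e1 x)
  h11 : ∀ x, e1 (d1 x) = d1 (e1 x)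
  h12 : ∀ x, e2 (d1 x) = d1 (e2 x)
  h21 : ∀ x, e1 (d2 x) = d2 (e1 x)
  h22 : ∀ x, e2 (d2 x) = d2 (e2 x)
  k1 : d1 g21 = d2 g11
  k2 : d1 g22 = d2 g12
  l1 : e1 g12 = e2 g11
  l2 : e1 g22 = e2 g21
  hD : D = g11 * g22 - g12 * g21
  inv : D * D' = 1

variable {d1 d2 e1 e2 : Derivation ℂ R R} {g11 g12 g21 g22 D D' : R}

/-- The trace over the first two indices of the vanishing `(2,0)` part of the curvature. -/
theorem curvature_two_zero {δ ε : Derivation ℂ R R} (hc : ∀ x, δ (ε x) = ε (δ x))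
    {g1 g2 k1 k2 D D' : R}
    (hD : D = g1 * k2 - k1 * g2) (inv : D * D' = 1)
    {s1 s2 t1 t2 u1 u2 x1 x2 : R}
    (r1 : g1 * s1 + g2 * s2 = δ g1) (r2 : k1 * s1 + k2 * s2 = δ k1)
    (r3 : g1 * t1 + g2 * t2 = δ g2) (r4 : k1 * t1 + k2 * t2 = δ k2)
    (r5 : g1 * u1 + g2 * u2 = ε g1) (r6 : k1 * u1 + k2 * u2 = ε k1)
    (r7 : g1 * x1 + g2 * x2 = ε g2) (r8 : k1 * x1 + k2 * x2 = ε k2) :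
    δ u1 - ε s1 + (s1 * u1 + t1 * u2) - (u1 * s1 + x1 * s2) = 0 ∧
    δ u2 - ε s2 + (s2 * u1 + t2 * u2) - (u2 * s1 + x2 * s2) = 0 ∧
    δ x1 - ε t1 + (s1 * x1 + t1 * x2) - (u1 * t1 + x1 * t2) = 0 ∧
    δ x2 - ε t2 + (s2 * x1 + t2 * x2) - (u2 * t1 + x2 * t2) = 0 := by
  have a1 := congrArg ε r1
  have a2 := congrArg ε r2
  have a3 := congrArg ε r3
  have a4 := congrArg ε r4
  have b1 := congrArg δ r5
  have b2 := congrArg δ r6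
  have b3 := congrArg δ r7
  have b4 := congrArg δ r8
  simp only [map_add, Derivation.leibniz, smul_eq_mul] at a1 a2 a3 a4 b1 b2 b3 b4
  -- The determinant `D` is invertible, so a vector vanishes once its contraction with the metric
  -- does. Differentiating `Γ g = ∂g` and using that `δ` and `ε` commute shows that the contracted
  -- curvature is zero.
  have cramer : ∀ F1 F2 : R, g1 * F1 + g2 * F2 = 0 → k1 * F1 + k2 * F2 = 0 → F1 = 0 ∧ F2 = 0 := by
    intro F1 F2 h1 h2
    constructor
    · linear_combination D' * (k2 * h1 - g2 * h2) - F1 * inv + D' * F1 * hD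
    · linear_combination D' * (g1 * h2 - k1 * h1) - F2 * inv + D' * F2 * hD
  have c1 := cramer (δ u1 - ε s1 + (s1 * u1 + t1 * u2) - (u1 * s1 + x1 * s2))
    (δ u2 - ε s2 + (s2 * u1 + t2 * u2) - (u2 * s1 + x2 * s2))
    (by linear_combination b1 - a1 + hc g1 + u1 * r1 + u2 * r3 - s1 * r5 - s2 * r7)
    (by linear_combination b2 - a2 + hc k1 + u1 * r2 + u2 * r4 - s1 * r6 - s2 * r8)
  have c2 := cramer (δ x1 - ε t1 + (s1 * x1 + t1 * x2) - (u1 * t1 + x1 * t2))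
    (δ x2 - ε t2 + (s2 * x1 + t2 * x2) - (u2 * t1 + x2 * t2))
    (by linear_combination b3 - a3 + hc g2 + x1 * r1 + x2 * r3 - t1 * r5 - t2 * r7)
    (by linear_combination b4 - a4 + hc k2 + x1 * r2 + x2 * r4 - t1 * r6 - t2 * r8)
  exact ⟨c1.1, c1.2, c2.1, c2.2⟩

namespace KahlerRing

/-- Complex conjugation exchanges `∂` with `∂̄` and `g12` with `g21`; each identity for `∂̄b`
thereby yields the one for `∂b̄`. -/
theorem conj (h : KahlerRing d1 d2 e1 e2 g11 g12 g21 g22 D D') :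
    KahlerRing e1 e2 d1 d2 g11 g21 g12 g22 D D' where
  hd := h.he
  he := h.hd
  h11 x := (h.h11 x).symm
  h12 x := (h.h21 x).symm
  h21 x := (h.h12 x).symm
  h22 x := (h.h22 x).symm
  k1 := h.l1
  k2 := h.l2
  l1 := h.k1
  l2 := h.k2
  hD := by rw [h.hD]; ring
  inv := h.inv

/-- The Laplacian `g^{αβ̄} ∂_α ∂_β̄`. -/
def box (d1 d2 e1 e2 : Derivation ℂ R R) (g11 g12 g21 g22 D' x : R) : R :=
  D' * (g22 * d1 (e1 x) + g11 * d2 (e2 x) - g21 * d1 (e2 x) - g12 * d2 (e1 x))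

/-- The trace of `∂̄` of the `(1,0)` form dual to `∂̄ h` vanishes. -/
theorem trace_debar (h : KahlerRing d1 d2 e1 e2 g11 g12 g21 g22 D D') {x b1 b2 : R}
    (hb1 : b1 = D' * (g11 * e2 x - g12 * e1 x)) (hb2 : b2 = D' * (g21 * e2 x - g22 * e1 x)) :
    g22 * e1 b1 + g11 * e2 b2 - g21 * e2 b1 - g12 * e1 b2 = 0 := by
  have c1 : D * b1 = g11 * e2 x - g12 * e1 x := by
    rw [hb1]; linear_combination (g11 * e2 x - g12 * e1 x) * h.inv
  have c2 : D * b2 = g21 * e2 x - g22 * e1 x := by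
    rw [hb2]; linear_combination (g21 * e2 x - g22 * e1 x) * h.inv
  have a11 := congrArg e1 c1
  have a12 := congrArg e2 c1
  have a21 := congrArg e1 c2
  have a22 := congrArg e2 c2
  have hD1 := congrArg e1 h.hD
  have hD2 := congrArg e2 h.hD
  simp only [map_sub, Derivation.leibniz, smul_eq_mul, h.l1, h.l2, h.he] at a11 a12 a21 a22 hD1 hD2
  -- Multiplying by `D²` lets the equations `D b = …` be differentiated instead of `D'`, about which
  -- only `D D' = 1` is known.
  have key : D * D * (g22 * e1 b1 + g11 * e2 b2 - g21 * e2 b1 - g12 * e1 b2) = 0 := by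
    linear_combination D * (g22 * a11 + g11 * a22 - g21 * a12 - g12 * a21)
      - (g22 * e1 D - g21 * e2 D) * c1 - (g11 * e2 D - g12 * e1 D) * c2
      - D * e2 x * hD1 + D * e1 x * hD2 + (e1 D * e2 x - e2 D * e1 x) * h.hD
  linear_combination D' * D' * key - (D * D' + 1) *
    (g22 * e1 b1 + g11 * e2 b2 - g21 * e2 b1 - g12 * e1 b2) * h.inv

/-- Applying `∂∂̄` to the equation for a self-dual form in the kernel of `d⁻δ + Φ`. -/
theorem lichnerowicz (h : KahlerRing d1 d2 e1 e2 g11 g12 g21 g22 D D') {f L x y T b1 b2 c1 c2 : R}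
    {κ : ℂ}
    (hb1 : b1 = D' * (g11 * e2 x - g12 * e1 x)) (hb2 : b2 = D' * (g21 * e2 x - g22 * e1 x))
    (hc1 : c1 = D' * (g11 * d2 y - g21 * d1 y)) (hc2 : c2 = D' * (g12 * d2 y - g22 * d1 y))
    (hs : g22 * d1 (e1 L) + g11 * d2 (e2 L) - g21 * d1 (e2 L) - g12 * d2 (e1 L) = 0)
    (q11 : 2 * d1 (e1 f) - f * d1 (e1 L) + T * g11 = κ • (e1 b1 - d1 c1))
    (q12 : 2 * d1 (e2 f) - f * d1 (e2 L) + T * g12 = κ • (e2 b1 - d1 c2))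
    (q21 : 2 * d2 (e1 f) - f * d2 (e1 L) + T * g21 = κ • (e1 b2 - d2 c1))
    (q22 : 2 * d2 (e2 f) - f * d2 (e2 L) + T * g22 = κ • (e2 b2 - d2 c2)) :
    D * box d1 d2 e1 e2 g11 g12 g21 g22 D' (box d1 d2 e1 e2 g11 g12 g21 g22 D' f) +
      (d1 (e1 f) * d2 (e2 L) + d2 (e2 f) * d1 (e1 L) - d1 (e2 f) * d2 (e1 L)
        - d2 (e1 f) * d1 (e2 L)) = 0 := by
  have t1 := h.trace_debar hb1 hb2
  have t2 := h.conj.trace_debar hc1 hc2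
  set Y := box d1 d2 e1 e2 g11 g12 g21 g22 D' f with hY
  have hDY : D * Y = g22 * d1 (e1 f) + g11 * d2 (e2 f) - g21 * d1 (e2 f) - g12 * d2 (e1 f) := by
    rw [hY, box]
    linear_combination (g22 * d1 (e1 f) + g11 * d2 (e2 f) - g21 * d1 (e2 f)
      - g12 * d2 (e1 f)) * h.inv
  have hDY2 : D * box d1 d2 e1 e2 g11 g12 g21 g22 D' Y =
      g22 * d1 (e1 Y) + g11 * d2 (e2 Y) - g21 * d1 (e2 Y) - g12 * d2 (e1 Y) := by
    rw [box]
    linear_combination (g22 * d1 (e1 Y) + g11 * d2 (e2 Y) - g21 * d1 (e2 Y)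
        - g12 * d2 (e1 Y)) * h.inv
  simp only [Algebra.smul_def] at q11 q12 q21 q22
  have two : algebraMap ℂ R 2 = 2 := map_ofNat _ _
  have half : algebraMap ℂ R (1 / 2) * 2 = 1 := by
    rw [← two, ← map_mul]; norm_num
  -- The trace of the four equations with respect to `g`: the `b` and `c` terms drop out by
  -- `trace_debar` and its conjugate, and the `f ∂∂̄L` term by scalar-flatness.
  have hT : T = -Y := by
    have : 2 * (D * (T + Y)) = 0 := by
      linear_combination g22 * q11 + g11 * q22 - g21 * q12 - g12 * q21 + f * hs
        + algebraMap ℂ R κ * (t1 - t2) + 2 * hDY + 2 * T * h.hD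
    linear_combination algebraMap ℂ R (1 / 2) * D' * this - D * D' * (T + Y) * half
      - (T + Y) * h.inv
  subst hT
  have two' : ∀ δ : Derivation ℂ R R, δ 2 = 0 := fun δ => by
    rw [← two]; exact δ.map_algebraMap 2
  -- The combination `w1 + w2 - w3 - w4` is `∂∂̄` applied to the (1,1)-form equation. It annihilates
  -- `∂∂̄f`, `∂̄b` and `∂b̄` since the derivations commute. As `∂∂̄L` and `g` are closed, their
  -- coefficients `f` and `T = -Y` take both derivatives.
  have w1 := congrArg (fun u => d1 (e1 u)) q22
  have w2 := congrArg (fun u => d2 (e2 u)) q11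
  have w3 := congrArg (fun u => d1 (e2 u)) q21
  have w4 := congrArg (fun u => d2 (e1 u)) q12
  simp only [map_add, map_sub, Derivation.leibniz, smul_eq_mul, Derivation.map_algebraMap, two',
    mul_zero, add_zero, map_neg, h.hd, h.he, h.h11, h.h12, h.h21, h.h22,
    h.k1, h.k2, h.l1, h.l2] at w1 w2 w3 w4
  rw [hDY2]
  linear_combination -(w1 + w2 - w3 - w4)

/-- The divergence of the current of the Lichnerowicz operator. -/
theorem div_current (h : KahlerRing d1 d2 e1 e2 g11 g12 g21 g22 D D') {f L v1 v2 Z1 Z2 : R}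
    (hv1 : v1 = D' * (g22 * e1 f - g21 * e2 f)) (hv2 : v2 = D' * (g11 * e2 f - g12 * e1 f))
    (hL1 : e1 D = D * e1 L) (hL2 : e2 D = D * e2 L)
    (hs : g22 * d1 (e1 L) + g11 * d2 (e2 L) - g21 * d1 (e2 L) - g12 * d2 (e1 L) = 0)
    (hZ1 : Z1 = d1 (D * e1 v1) + d2 (D * e1 v2)) (hZ2 : Z2 = d1 (D * e2 v1) + d2 (D * e2 v2)) :
    d1 (D' * (g22 * Z1 - g21 * Z2)) + d2 (D' * (g11 * Z2 - g12 * Z1)) =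
    D * box d1 d2 e1 e2 g11 g12 g21 g22 D' (box d1 d2 e1 e2 g11 g12 g21 g22 D' f) +
      (d1 (e1 f) * d2 (e2 L) + d2 (e2 f) * d1 (e1 L) - d1 (e2 f) * d2 (e1 L)
        - d2 (e1 f) * d1 (e2 L)) := by
  set Y := box d1 d2 e1 e2 g11 g12 g21 g22 D' f with hY
  have n1 : D * v1 = g22 * e1 f - g21 * e2 f := by
    rw [hv1]; linear_combination (g22 * e1 f - g21 * e2 f) * h.inv
  have n2 : D * v2 = g11 * e2 f - g12 * e1 f := by
    rw [hv2]; linear_combination (g11 * e2 f - g12 * e1 f) * h.inv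
  have hDY : d1 (D * v1) + d2 (D * v2) = D * Y := by
    have : D * Y = g22 * d1 (e1 f) + g11 * d2 (e2 f) - g21 * d1 (e2 f) - g12 * d2 (e1 f) := by
      rw [hY, box]
      linear_combination (g22 * d1 (e1 f) + g11 * d2 (e2 f) - g21 * d1 (e2 f)
        - g12 * d2 (e1 f)) * h.inv
    rw [this, n1, n2]
    simp only [map_sub, Derivation.leibniz, smul_eq_mul, h.k1, h.k2]
    ring
  -- Applying `∂̄₁` to `div v = □f` gives `Z₁ = D (∂̄₁ □f - v · ∂∂̄₁L)`; the derivatives of the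
  -- density are absorbed through `∂̄D = D ∂̄L`.
  have z1 : Z1 = D * e1 Y - (D * v1 * d1 (e1 L) + D * v2 * d2 (e1 L)) := by
    have e : e1 (d1 (D * v1) + d2 (D * v2)) = e1 (D * Y) := by rw [hDY]
    rw [map_add, h.h11, h.h21, e1.leibniz, e1.leibniz, e1.leibniz] at e
    simp only [smul_eq_mul, hL1] at e
    have e' : d1 (D * v1 * e1 L) + d2 (D * v2 * e1 L) =
      D * Y * e1 L + D * v1 * d1 (e1 L) + D * v2 * d2 (e1 L) := by
      rw [d1.leibniz (D * v1), d2.leibniz (D * v2), ← hDY]; simp only [smul_eq_mul]; ring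
    rw [show v1 * (D * e1 L) = D * v1 * e1 L by ring,
      show v2 * (D * e1 L) = D * v2 * e1 L by ring, map_add d1, map_add d2] at e
    rw [hZ1]
    linear_combination e - e'
  have z2 : Z2 = D * e2 Y - (D * v1 * d1 (e2 L) + D * v2 * d2 (e2 L)) := by
    have e : e2 (d1 (D * v1) + d2 (D * v2)) = e2 (D * Y) := by rw [hDY]
    rw [map_add, h.h12, h.h22, e2.leibniz, e2.leibniz, e2.leibniz] at e
    simp only [smul_eq_mul, hL2] at e
    have e' : d1 (D * v1 * e2 L) + d2 (D * v2 * e2 L) =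
      D * Y * e2 L + D * v1 * d1 (e2 L) + D * v2 * d2 (e2 L) := by
      rw [d1.leibniz (D * v1), d2.leibniz (D * v2), ← hDY]; simp only [smul_eq_mul]; ring
    rw [show v1 * (D * e2 L) = D * v1 * e2 L by ring,
      show v2 * (D * e2 L) = D * v2 * e2 L by ring, map_add d1, map_add d2] at e
    rw [hZ2]
    linear_combination e - e'
  -- The form `∂∂̄L` is trace-free, so raising both of its indices gives minus its cofactor matrix
  -- divided by `D`. The cofactor matrix of `∂∂̄L` is divergence-free, so only `∂∂̄f` paired with
  -- `∂∂̄L` survives the last divergence.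
  have x1 : D' * (g22 * Z1 - g21 * Z2) = g22 * e1 Y - g21 * e2 Y
      + (d2 (e2 L) * e1 f - d2 (e1 L) * e2 f) := by
    rw [z1, z2]
    linear_combination (g22 * e1 Y - g21 * e2 Y + (d2 (e2 L) * e1 f - d2 (e1 L) * e2 f)) * h.inv
      + D' * (-(g22 * d1 (e1 L) - g21 * d1 (e2 L)) * n1 - (g22 * d2 (e1 L) - g21 * d2 (e2 L)) * n2
        - (g22 * e1 f - g21 * e2 f) * hs - (d2 (e2 L) * e1 f - d2 (e1 L) * e2 f) * h.hD)
  have x2 : D' * (g11 * Z2 - g12 * Z1) = g11 * e2 Y - g12 * e1 Y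
      + (d1 (e1 L) * e2 f - d1 (e2 L) * e1 f) := by
    rw [z1, z2]
    linear_combination (g11 * e2 Y - g12 * e1 Y + (d1 (e1 L) * e2 f - d1 (e2 L) * e1 f)) * h.inv
      + D' * (-(g11 * d1 (e2 L) - g12 * d1 (e1 L)) * n1 - (g11 * d2 (e2 L) - g12 * d2 (e1 L)) * n2
        - (g11 * e2 f - g12 * e1 f) * hs - (d1 (e1 L) * e2 f - d1 (e2 L) * e1 f) * h.hD)
  rw [x1, x2]
  have hDY2 : D * box d1 d2 e1 e2 g11 g12 g21 g22 D' Y =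
      g22 * d1 (e1 Y) + g11 * d2 (e2 Y) - g21 * d1 (e2 Y) - g12 * d2 (e1 Y) := by
    rw [box]
    linear_combination (g22 * d1 (e1 Y) + g11 * d2 (e2 Y) - g21 * d1 (e2 Y)
        - g12 * d2 (e1 Y)) * h.inv
  rw [hDY2]
  simp only [map_add, map_sub, Derivation.leibniz, smul_eq_mul, h.k1, h.k2, h.hd]
  ring

end KahlerRing

end Algebra

end

/-! ### The Hermitian coefficients of a Kähler metric as elements of the algebra -/

section

theorem contDiffOn_pd {F : C2 → ℝ} {U : Set C2} (hU : IsOpen U) (hF : ContDiffOn ℝ ∞ F U)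
    (i : Fin 4) : ContDiffOn ℝ ∞ (pd i F) U :=
  (hF.fderiv_of_isOpen (m := ∞) hU (by simp)).clm_apply contDiffOn_const

theorem pd_pd_comm {F : C2 → ℝ} {U : Set C2} (hU : IsOpen U) (hF : ContDiffOn ℝ ∞ F U) {z : C2}
    (hz : z ∈ U) (i j : Fin 4) : pd i (pd j F) z = pd j (pd i F) z := by
  have hs : ContDiffAt ℝ 2 F z := contDiffAt_infty.mp (hF.contDiffAt (hU.mem_nhds hz)) 2
  have hd : DifferentiableAt ℝ (fderiv ℝ F) z :=
    (hs.fderiv_right (m := 1) (by norm_num)).differentiableAt (by simp)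
  have key : ∀ i j, pd i (pd j F) z = fderiv ℝ (fderiv ℝ F) z (realFrame i) (realFrame j) := by
    intro i j
    have : HasFDerivAt (fun y => fderiv ℝ F y (realFrame j)) ((fderiv ℝ (fderiv ℝ F) z).flip (realFrame j)) z := by
      simpa using hd.hasFDerivAt.clm_apply (hasFDerivAt_const (realFrame j) z)
    change fderiv ℝ (fun y => fderiv ℝ F y (realFrame j)) z (realFrame i) = _
    rw [this.fderiv]; rfl
  rw [key, key]
  exact (hs.isSymmSndFDerivAt (by simp)).eq _ _

namespace SmoothAlg

variable {U : Opens C2}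

/-- A real valued smooth function as an element of the algebra of smooth functions. -/
def ofReal (F : C2 → ℝ) (hF : ContDiffOn ℝ ∞ F U) : SmoothAlg U :=
  mk (fun z => (F z : ℂ)) (Complex.ofRealCLM.contDiff.comp_contDiffOn hF)

@[simp] theorem fn_ofReal (F : C2 → ℝ) (hF : ContDiffOn ℝ ∞ F U) (z : U) :
    (ofReal F hF).fn z = F z := rfl

theorem fderiv_ofReal {F : C2 → ℝ} {z : C2} (hF : DifferentiableAt ℝ F z) (v : C2) :
    fderiv ℝ (fun w => (F w : ℂ)) z v = (fderiv ℝ F z v : ℂ) := by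
  have := Complex.ofRealCLM.hasFDerivAt.comp z hF.hasFDerivAt
  have h2 : HasFDerivAt (fun w => (F w : ℂ)) (Complex.ofRealCLM.comp (fderiv ℝ F z)) z := this
  rw [h2.fderiv]; rfl

theorem dir_ofReal (k l : Fin 4) (β : ℂ) (F : C2 → ℝ) (hF : ContDiffOn ℝ ∞ F U) :
    dir k l β (ofReal F hF) = (1 / 2 : ℂ) • (ofReal (pd k F) (contDiffOn_pd U.isOpen hF k)
      + β • ofReal (pd l F) (contDiffOn_pd U.isOpen hF l)) := by
  ext z
  have hd : DifferentiableAt ℝ F z :=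
    (hF.contDiffAt (U.isOpen.mem_nhds z.2)).differentiableAt (by simp)
  rw [dir_apply_of_eq k l β (H := fun z => (F z : ℂ)) (fun w => rfl), fderiv_ofReal hd,
    fderiv_ofReal hd]
  rfl

end SmoothAlg

namespace KahlerComps

open SmoothAlg

theorem contDiffOn_vol {U : Set C2} {G : Comp 2} (h : KahlerComps U G) :
    ContDiffOn ℝ ∞ (vol G) U := by
  unfold vol
  exact (((h.smooth _).mul (h.smooth _)).sub ((h.smooth _).pow 2)).sub ((h.smooth _).pow 2)

/-- The logarithm of the volume density. -/
def logVol (G : Comp 2) (z : C2) : ℝ := Real.log (vol G z)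

theorem contDiffOn_logVol {U : Set C2} {G : Comp 2} (h : KahlerComps U G) :
    ContDiffOn ℝ ∞ (logVol G) U :=
  h.contDiffOn_vol.log fun _ hz => (h.vol_pos hz).ne'

theorem contDiffOn_metricInv {U : Set C2} {G : Comp 2} (h : KahlerComps U G) (i j : Fin 4) :
    ContDiffOn ℝ ∞ (fun z => metricInv G z i j) U := by
  have hv := h.contDiffOn_vol.inv fun z hz => (h.vol_pos hz).ne'
  have hg := h.smooth
  suffices H : ContDiffOn ℝ ∞ (fun z => ((vol G z)⁻¹ • !![G z ![2, 2], 0, -G z ![0, 2],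
      -G z ![0, 3]; 0, G z ![2, 2], G z ![0, 3], -G z ![0, 2];
      -G z ![0, 2], G z ![0, 3], G z ![0, 0], 0;
      -G z ![0, 3], -G z ![0, 2], 0, G z ![0, 0]] : Matrix (Fin 4) (Fin 4) ℝ) i j) U from
    H.congr fun z hz => by rw [h.metricInv_eq hz]
  fin_cases i <;> fin_cases j <;> simp <;>
    first
      | exact contDiffOn_const
      | exact hv.mul (hg _)
      | exact (hv.mul (hg _)).neg

theorem contDiffOn_christoffel {U : Set C2} {G : Comp 2} (h : KahlerComps U G) (k i j : Fin 4) :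
    ContDiffOn ℝ ∞ (christoffel G k i j) U := by
  unfold christoffel
  refine contDiffOn_const.mul (ContDiffOn.sum fun l _ => (h.contDiffOn_metricInv k l).mul ?_)
  exact ((contDiffOn_pd h.isOpen (h.smooth _) i).add (contDiffOn_pd h.isOpen (h.smooth _) j)).sub
    (contDiffOn_pd h.isOpen (h.smooth _) l)

variable {U : Opens C2} {G : Comp 2}

/-- The Hermitian coefficients of the metric. -/
def g11 (h : KahlerComps U G) : SmoothAlg U := ofReal (fun z => G z ![0, 0]) (h.smooth _)
def g22 (h : KahlerComps U G) : SmoothAlg U := ofReal (fun z => G z ![2, 2]) (h.smooth _)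
def g12 (h : KahlerComps U G) : SmoothAlg U :=
  ofReal (fun z => G z ![0, 2]) (h.smooth _) + Complex.I • ofReal (fun z => G z ![0, 3]) (h.smooth _)
def g21 (h : KahlerComps U G) : SmoothAlg U :=
  ofReal (fun z => G z ![0, 2]) (h.smooth _) - Complex.I • ofReal (fun z => G z ![0, 3]) (h.smooth _)
def gD (h : KahlerComps U G) : SmoothAlg U := ofReal (vol G) h.contDiffOn_vol
def gD' (h : KahlerComps U G) : SmoothAlg U :=
  ofReal (fun z => (vol G z)⁻¹) (h.contDiffOn_vol.inv fun _ hz => (h.vol_pos hz).ne')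
def gL (h : KahlerComps U G) : SmoothAlg U := ofReal (logVol G) h.contDiffOn_logVol

/-- The four real equations `k0`–`k3` express `dω = 0`; in pairs they are the real and imaginary
parts of the complex relations `∂₁g₂₁ = ∂₂g₁₁` and `∂₁g₂₂ = ∂₂g₁₂` and of their conjugates. -/
theorem kahlerRing (h : KahlerComps U G) :
    KahlerRing dz1 dz2 db1 db2 h.g11 h.g12 h.g21 h.g22 h.gD h.gD' where
  hd := dir_comm _ _ _ _ _ _
  he := dir_comm _ _ _ _ _ _
  h11 := dir_comm _ _ _ _ _ _
  h12 := dir_comm _ _ _ _ _ _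
  h21 := dir_comm _ _ _ _ _ _
  h22 := dir_comm _ _ _ _ _ _
  k1 := by
    ext z
    simp [g21, g11, dir_ofReal, h.k2 z z.2, h.k3 z z.2]
    linear_combination (pd 1 (fun w => G w ![0, 3]) z : ℂ) / 2 * Complex.I_sq
  k2 := by
    ext z
    simp [g12, g22, dir_ofReal, h.k0 z z.2, h.k1 z z.2]
    linear_combination (pd 3 (fun w => G w ![0, 3]) z : ℂ) / 2 * Complex.I_sq
  l1 := by
    ext z
    simp [g12, g11, dir_ofReal, h.k2 z z.2, h.k3 z z.2]
    linear_combination (pd 1 (fun w => G w ![0, 3]) z : ℂ) / 2 * Complex.I_sq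
  l2 := by
    ext z
    simp [g21, g22, dir_ofReal, h.k0 z z.2, h.k1 z z.2]
    linear_combination (pd 3 (fun w => G w ![0, 3]) z : ℂ) / 2 * Complex.I_sq
  hD := by
    ext z
    simp [g11, g12, g21, g22, gD, vol]
    linear_combination -(G z ![0, 3] : ℂ) ^ 2 * Complex.I_sq
  inv := by
    ext z
    have := (h.vol_pos z.2).ne'
    simp [gD, gD', this]

end KahlerComps

end

/-! ### The Ricci tensor in terms of the connection of the canonical bundle -/

section

namespace KahlerComps
open SmoothAlg

section
variable {U : Set C2} {G : Comp 2}

/-- Metric compatibility: the logarithmic derivative of the determinant of the Hermitian matrix is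
twice the real part of the trace of the connection. -/
theorem pd_logVol (h : KahlerComps U G) {z : C2} (hz : z ∈ U) (m : Fin 4) :
    pd m (logVol G) z = 2 * traceRe G m z := by
  have hG := h.differentiableAt hz
  have hv := (h.vol_pos hz).ne'
  have e1 : pd m (vol G) z = 2 * traceRe G m z * vol G z := by
    obtain ⟨m1, m2, m3, m4⟩ := h.pd_metric hz m
    have : vol G = fun w => G w ![0, 0] * G w ![2, 2] - G w ![0, 2] * G w ![0, 2]
      - G w ![0, 3] * G w ![0, 3] := by ext w; simp only [vol]; ring
    have d1 : ∀ g g', DifferentiableAt ℝ (fun w => G w g * G w g') z :=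
      fun g g' => (hG g).mul (hG g')
    have d2 : DifferentiableAt ℝ
      (fun w => G w ![0, 0] * G w ![2, 2] - G w ![0, 2] * G w ![0, 2]) z := (d1 _ _).sub (d1 _ _)
    rw [this, pd_sub d2 (d1 _ _), pd_sub (d1 _ _) (d1 _ _), pd_mul (hG _) (hG _),
      pd_mul (hG _) (hG _), pd_mul (hG _) (hG _), m1, m2, m3, m4, traceRe]
    ring
  have hd : DifferentiableAt ℝ (vol G) z :=
    (h.contDiffOn_vol.contDiffAt (h.isOpen.mem_nhds hz)).differentiableAt (by simp)
  have : pd m (logVol G) z = (vol G z)⁻¹ * pd m (vol G) z := by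
    change fderiv ℝ (fun w => Real.log (vol G w)) z _ = _
    rw [fderiv.log hd hv]; rfl
  rw [this, e1]
  field_simp

/-- The relations of `christoffel_J` hold on the open set `U`, hence may be differentiated there. -/
theorem pd_christoffel_J (h : KahlerComps U G) {z : C2} (hz : z ∈ U) (m i : Fin 4) :
    (pd m (christoffel G 0 i 1) z = - pd m (christoffel G 1 i 0) z ∧
      pd m (christoffel G 1 i 1) z = pd m (christoffel G 0 i 0) z ∧
      pd m (christoffel G 2 i 1) z = - pd m (christoffel G 3 i 0) z ∧
      pd m (christoffel G 3 i 1) z = pd m (christoffel G 2 i 0) z) ∧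
    (pd m (christoffel G 0 i 3) z = - pd m (christoffel G 1 i 2) z ∧
      pd m (christoffel G 1 i 3) z = pd m (christoffel G 0 i 2) z ∧
      pd m (christoffel G 2 i 3) z = - pd m (christoffel G 3 i 2) z ∧
      pd m (christoffel G 3 i 3) z = pd m (christoffel G 2 i 2) z) := by
  have J := fun w (hw : w ∈ U) => h.christoffel_J hw i
  have c := fun {F H : C2 → ℝ} (e : ∀ w ∈ U, F w = H w) => pd_congr h.isOpen hz e m
  refine ⟨⟨?_, ?_, ?_, ?_⟩, ?_, ?_, ?_, ?_⟩
  · rw [← pd_neg]; exact c fun w hw => (J w hw).1.1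
  · exact c fun w hw => (J w hw).1.2.1
  · rw [← pd_neg]; exact c fun w hw => (J w hw).1.2.2.1
  · exact c fun w hw => (J w hw).1.2.2.2
  · rw [← pd_neg]; exact c fun w hw => (J w hw).2.1
  · exact c fun w hw => (J w hw).2.2.1
  · rw [← pd_neg]; exact c fun w hw => (J w hw).2.2.2.1
  · exact c fun w hw => (J w hw).2.2.2.2

end

variable {U : Opens C2} {G : Comp 2}

/-- The complex Christoffel symbol `Γ^α_{βγ}`, for the real index `2α` and a pair of even
indices. -/
def cGamma (h : KahlerComps U G) (k l i j : Fin 4) : SmoothAlg U :=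
  ofReal (christoffel G k i j) (h.contDiffOn_christoffel k i j)
    + Complex.I • ofReal (christoffel G l i j) (h.contDiffOn_christoffel l i j)

/-- An orientation of the symmetry of the lower indices for rewriting: whenever the two indices
differ in parity the odd one goes last, where `christoffel_J` removes it. -/
theorem christoffel_normal (h : KahlerComps U G) (z : C2) :
    (∀ k, christoffel G k 1 0 z = christoffel G k 0 1 z) ∧
    (∀ k, christoffel G k 2 0 z = christoffel G k 0 2 z) ∧
    (∀ k, christoffel G k 3 0 z = christoffel G k 0 3 z) ∧
    (∀ k, christoffel G k 1 2 z = christoffel G k 2 1 z) ∧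
    (∀ k, christoffel G k 3 2 z = christoffel G k 2 3 z) :=
  ⟨fun _ => christoffel_comm h.symm _ _ _ _, fun _ => christoffel_comm h.symm _ _ _ _,
    fun _ => christoffel_comm h.symm _ _ _ _, fun _ => christoffel_comm h.symm _ _ _ _,
    fun _ => christoffel_comm h.symm _ _ _ _⟩

/-- `Γ^μ_{βγ} g_{μδ̄} = ∂_β g_{γδ̄}`. -/
theorem cGamma_equations (h : KahlerComps U G) :
    (h.g11 * h.cGamma 0 1 0 0 + h.g21 * h.cGamma 2 3 0 0 = dz1 h.g11 ∧
      h.g12 * h.cGamma 0 1 0 0 + h.g22 * h.cGamma 2 3 0 0 = dz1 h.g12) ∧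
    (h.g11 * h.cGamma 0 1 0 2 + h.g21 * h.cGamma 2 3 0 2 = dz1 h.g21 ∧
      h.g12 * h.cGamma 0 1 0 2 + h.g22 * h.cGamma 2 3 0 2 = dz1 h.g22) ∧
    (h.g11 * h.cGamma 0 1 2 2 + h.g21 * h.cGamma 2 3 2 2 = dz2 h.g21 ∧
      h.g12 * h.cGamma 0 1 2 2 + h.g22 * h.cGamma 2 3 2 2 = dz2 h.g22) := by
  refine ⟨⟨?_, ?_⟩, ⟨?_, ?_⟩, ?_, ?_⟩ <;>
  · ext z
    have M := fun m => h.pd_metric z.2 m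
    have J := fun i => h.christoffel_J z.2 i
    obtain ⟨c1, c2, c3, c4, c5⟩ := h.christoffel_normal z
    apply Complex.ext <;>
    · simp [g11, g12, g21, g22, cGamma, dir_ofReal, (M _).1, (M _).2.1, (M _).2.2.1, (M _).2.2.2,
        c1, c2, c3, c4, c5, (J _).1.1, (J _).1.2.1, (J _).1.2.2.1, (J _).1.2.2.2, (J _).2.1,
        (J _).2.2.1, (J _).2.2.2.1, (J _).2.2.2.2]
      ring

/-- The Ricci tensor of a Kähler metric, in terms of the connection form of the canonical
bundle. -/
theorem ricci_eq_traceRe (h : KahlerComps U G) {z : C2} (hz : z ∈ U) :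
    (ricci G 0 0 z = -(pd 0 (traceRe G 0) z + pd 1 (traceRe G 1) z) ∧
      ricci G 0 1 z = -(pd 0 (traceRe G 1) z - pd 1 (traceRe G 0) z) ∧
      ricci G 0 2 z = -(pd 0 (traceRe G 2) z + pd 1 (traceRe G 3) z) ∧
      ricci G 0 3 z = -(pd 0 (traceRe G 3) z - pd 1 (traceRe G 2) z)) ∧
    (ricci G 1 0 z = -(pd 1 (traceRe G 0) z - pd 0 (traceRe G 1) z) ∧
      ricci G 1 1 z = -(pd 1 (traceRe G 1) z + pd 0 (traceRe G 0) z) ∧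
      ricci G 1 2 z = -(pd 1 (traceRe G 2) z - pd 0 (traceRe G 3) z) ∧
      ricci G 1 3 z = -(pd 1 (traceRe G 3) z + pd 0 (traceRe G 2) z)) ∧
    (ricci G 2 0 z = -(pd 2 (traceRe G 0) z + pd 3 (traceRe G 1) z) ∧
      ricci G 2 1 z = -(pd 2 (traceRe G 1) z - pd 3 (traceRe G 0) z) ∧
      ricci G 2 2 z = -(pd 2 (traceRe G 2) z + pd 3 (traceRe G 3) z) ∧
      ricci G 2 3 z = -(pd 2 (traceRe G 3) z - pd 3 (traceRe G 2) z)) ∧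
    (ricci G 3 0 z = -(pd 3 (traceRe G 0) z - pd 2 (traceRe G 1) z) ∧
      ricci G 3 1 z = -(pd 3 (traceRe G 1) z + pd 2 (traceRe G 0) z) ∧
      ricci G 3 2 z = -(pd 3 (traceRe G 2) z - pd 2 (traceRe G 3) z) ∧
      ricci G 3 3 z = -(pd 3 (traceRe G 3) z + pd 2 (traceRe G 2) z)) := by
  obtain ⟨⟨r1, r2⟩, ⟨r3, r4⟩, r5, r6⟩ := h.cGamma_equations
  have hK := h.kahlerRing
  -- The (2,0) part of the curvature vanishes. Each component of `ricci` differs from the asserted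
  -- expression by plus or minus twice the real or imaginary part of one of these four quantities.
  obtain ⟨F1, F2, F3, F4⟩ := curvature_two_zero (δ := dz1 (U := U)) (ε := dz2)
    (dir_comm _ _ _ _ _ _) hK.hD hK.inv r1 r2 r3 r4 (r3.trans hK.k1) (r4.trans hK.k2) r5 r6
  have J := fun i => h.christoffel_J hz i
  have PJ := fun m i => h.pd_christoffel_J hz m i
  obtain ⟨c1, c2, c3, c4, c5⟩ := h.christoffel_normal z
  have pc : ∀ m k i j, pd m (christoffel G k i j) z = pd m (christoffel G k j i) z := fun m k i j =>
    congrArg (fun F => pd m F z) (funext fun w => christoffel_comm h.symm k i j w)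
  have p1 := fun m k => pc m k 1 0
  have p2 := fun m k => pc m k 2 0
  have p3 := fun m k => pc m k 3 0
  have p4 := fun m k => pc m k 1 2
  have p5 := fun m k => pc m k 3 2
  clear pc
  have hd : ∀ k i j, DifferentiableAt ℝ (christoffel G k i j) z := fun k i j =>
    ((h.contDiffOn_christoffel k i j).contDiffAt (h.isOpen.mem_nhds hz)).differentiableAt (by simp)
  have ht : ∀ m i, pd m (traceRe G i) z =
      pd m (christoffel G 0 i 0) z + pd m (christoffel G 2 i 2) z := fun m i =>
    pd_add (hd _ _ _) (hd _ _ _) m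
  have unpack : ∀ {F : SmoothAlg U}, F = 0 → (F.fn ⟨z, hz⟩).re = 0 ∧ (F.fn ⟨z, hz⟩).im = 0 := by
    rintro F rfl; simp
  have F1 := unpack F1
  have F2 := unpack F2
  have F3 := unpack F3
  have F4 := unpack F4
  clear unpack
  simp [cGamma, dir_ofReal] at F1 F2 F3 F4
  obtain ⟨a1, b1⟩ := F1
  obtain ⟨a2, b2⟩ := F2
  obtain ⟨a3, b3⟩ := F3
  obtain ⟨a4, b4⟩ := F4
  simp only [ricci, Fin.sum_univ_four, ht, p1, p2, p3, p4, p5, c1, c2, c3, c4, c5,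
    (J _).1.1, (J _).1.2.1, (J _).1.2.2.1, (J _).1.2.2.2, (J _).2.1,
    (J _).2.2.1, (J _).2.2.2.1, (J _).2.2.2.2, (PJ _ _).1.1, (PJ _ _).1.2.1, (PJ _ _).1.2.2.1,
    (PJ _ _).1.2.2.2, (PJ _ _).2.1, (PJ _ _).2.2.1, (PJ _ _).2.2.2.1, (PJ _ _).2.2.2.2]
  clear J PJ p1 p2 p3 p4 p5 c1 c2 c3 c4 c5 r1 r2 r3 r4 r5 r6 ht hd
  refine ⟨⟨?_, ?_, ?_, ?_⟩, ⟨?_, ?_, ?_, ?_⟩, ⟨?_, ?_, ?_, ?_⟩, ?_, ?_, ?_, ?_⟩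
  · linear_combination -2 * a2
  · linear_combination 2 * b2
  · linear_combination -2 * a4
  · linear_combination 2 * b4
  · linear_combination 2 * b2
  · linear_combination 2 * a2
  · linear_combination 2 * b4
  · linear_combination 2 * a4
  · linear_combination 2 * a1
  · linear_combination -2 * b1
  · linear_combination 2 * a3
  · linear_combination -2 * b3
  · linear_combination -2 * b1
  · linear_combination -2 * a1
  · linear_combination -2 * b3
  · linear_combination -2 * a3

end KahlerComps

end

/-! ### The Hodge star and the action of the Ricci tensor on a Kähler surface -/

section

theorem det_four (M : Matrix (Fin 4) (Fin 4) ℝ) : M.det =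
    M 0 0 * (M 1 1 * (M 2 2 * M 3 3 - M 2 3 * M 3 2) - M 1 2 * (M 2 1 * M 3 3 - M 2 3 * M 3 1)
      + M 1 3 * (M 2 1 * M 3 2 - M 2 2 * M 3 1))
    - M 0 1 * (M 1 0 * (M 2 2 * M 3 3 - M 2 3 * M 3 2) - M 1 2 * (M 2 0 * M 3 3 - M 2 3 * M 3 0)
      + M 1 3 * (M 2 0 * M 3 2 - M 2 2 * M 3 0))
    + M 0 2 * (M 1 0 * (M 2 1 * M 3 3 - M 2 3 * M 3 1) - M 1 1 * (M 2 0 * M 3 3 - M 2 3 * M 3 0)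
      + M 1 3 * (M 2 0 * M 3 1 - M 2 1 * M 3 0))
    - M 0 3 * (M 1 0 * (M 2 1 * M 3 2 - M 2 2 * M 3 1) - M 1 1 * (M 2 0 * M 3 2 - M 2 2 * M 3 0)
      + M 1 2 * (M 2 0 * M 3 1 - M 2 1 * M 3 0)) := by
  simp [Matrix.det_succ_row_zero, Fin.sum_univ_succ, Fin.succAbove]
  ring

/-- The contraction of the Levi-Civita symbol with a matrix over its last two indices. -/
theorem sum_eps (X : Fin 4 → Fin 4 → ℝ) :
    (∑ c, ∑ d, eps 0 1 c d * X c d = X 2 3 - X 3 2) ∧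
    (∑ c, ∑ d, eps 2 3 c d * X c d = X 0 1 - X 1 0) ∧
    (∑ c, ∑ d, eps 0 2 c d * X c d = X 3 1 - X 1 3) ∧
    (∑ c, ∑ d, eps 1 3 c d * X c d = X 2 0 - X 0 2) ∧
    (∑ c, ∑ d, eps 0 3 c d * X c d = X 1 2 - X 2 1) ∧
    (∑ c, ∑ d, eps 1 2 c d * X c d = X 0 3 - X 3 0) := by
  simp only [eps, det_four, Matrix.submatrix_apply, Matrix.one_apply, Fin.sum_univ_four]
  refine ⟨?_, ?_, ?_, ?_, ?_, ?_⟩ <;>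
  · simp
    try ring

section
variable {U : Set C2} {G : Comp 2}

/-- The Hodge star of the two-form `N` at `z`. -/
def starMat (G : Comp 2) (N : Fin 4 → Fin 4 → ℝ) (z : C2) (i j : Fin 4) : ℝ :=
  (1 / 2) * Real.sqrt (metricMatrix G z).det *
    ∑ c, ∑ d, ∑ p, ∑ q, eps i j c d * metricInv G z c p * metricInv G z d q * N p q

/-- The trace of a two-form with respect to `ω`. -/
def lambdaTrace (G : Comp 2) (N : Fin 4 → Fin 4 → ℝ) (z : C2) : ℝ :=
  (vol G z)⁻¹ * (G z ![2, 2] * N 0 1 + G z ![0, 0] * N 2 3 + G z ![0, 3] * (N 0 2 + N 1 3)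
    - G z ![0, 2] * (N 0 3 - N 1 2))

/-- These are the components of `∗N = (ΛN) ω - N(J·, J·)`, where `ω₀₁ = g₀₀`, `ω₀₂ = -g₀₃`, `ω₀₃ =
g₀₂` and so on. All later statements about self-duality are read off from this formula. -/
theorem KahlerComps.starMat_eq (h : KahlerComps U G) {z : C2} (hz : z ∈ U)
    {N : Fin 4 → Fin 4 → ℝ} (hN : ∀ i j, N i j = - N j i) :
    starMat G N z 0 1 = lambdaTrace G N z * G z ![0, 0] - N 0 1 ∧
    starMat G N z 2 3 = lambdaTrace G N z * G z ![2, 2] - N 2 3 ∧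
    starMat G N z 0 2 = - N 1 3 - lambdaTrace G N z * G z ![0, 3] ∧
    starMat G N z 1 3 = - N 0 2 - lambdaTrace G N z * G z ![0, 3] ∧
    starMat G N z 0 3 = N 1 2 + lambdaTrace G N z * G z ![0, 2] ∧
    starMat G N z 1 2 = N 0 3 - lambdaTrace G N z * G z ![0, 2] := by
  have hv := (h.vol_pos hz).ne'
  have d0 : ∀ i, N i i = 0 := fun i => by have := hN i i; linarith
  obtain ⟨e1, e2, e3, e4, e5, e6⟩ := sum_eps
    (fun c d => ∑ p, ∑ q, metricInv G z c p * metricInv G z d q * N p q)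
  have key : ∀ i j, starMat G N z i j = (1 / 2) * vol G z * ∑ c, ∑ d, eps i j c d *
      ∑ p, ∑ q, metricInv G z c p * metricInv G z d q * N p q := by
    intro i j
    rw [starMat, h.sqrt_det hz]
    simp only [Finset.mul_sum, mul_assoc]
  simp only [key, e1, e2, e3, e4, e5, e6]
  simp only [h.metricInv_eq hz, lambdaTrace, Fin.sum_univ_four]
  simp [d0, hN 1 0, hN 2 0, hN 3 0, hN 2 1, hN 3 1, hN 3 2]
  refine ⟨?_, ?_, ?_, ?_, ?_, ?_⟩ <;> field_simp <;> simp only [vol] <;> ring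

/-- A Ricci tensor with the symmetries of a Hermitian form. -/
structure HermitianRicci (G : Comp 2) (z : C2) (r0 r2 rc rd : ℝ) : Prop where
  r00 : ricci G 0 0 z = r0
  r11 : ricci G 1 1 z = r0
  r22 : ricci G 2 2 z = r2
  r33 : ricci G 3 3 z = r2
  r01 : ricci G 0 1 z = 0
  r10 : ricci G 1 0 z = 0
  r23 : ricci G 2 3 z = 0
  r32 : ricci G 3 2 z = 0
  r02 : ricci G 0 2 z = rc
  r20 : ricci G 2 0 z = rc
  r13 : ricci G 1 3 z = rc
  r31 : ricci G 3 1 z = rc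
  r03 : ricci G 0 3 z = rd
  r30 : ricci G 3 0 z = rd
  r12 : ricci G 1 2 z = - rd
  r21 : ricci G 2 1 z = - rd

theorem KahlerComps.scalarCurv_eq (h : KahlerComps U G) {z : C2} (hz : z ∈ U) {r0 r2 rc rd : ℝ}
    (hr : HermitianRicci G z r0 r2 rc rd) :
    scalarCurv G z = (vol G z)⁻¹ * (2 * (G z ![2, 2] * r0 + G z ![0, 0] * r2
      - 2 * G z ![0, 2] * rc - 2 * G z ![0, 3] * rd)) := by
  simp only [scalarCurv, h.metricInv_eq hz, Fin.sum_univ_four, hr.r00, hr.r11, hr.r22, hr.r33,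
    hr.r01, hr.r10, hr.r23, hr.r32, hr.r02, hr.r20, hr.r13, hr.r31, hr.r03, hr.r30, hr.r12, hr.r21]
  simp
  ring

/-- The Ricci tensor is `J`-invariant and trace-free, so it acts on `ω` as `-ρ`, with `ρ = Ric(J·,
·)`, and annihilates `Re (dz₁ ∧ dz₂)` and `Im (dz₁ ∧ dz₂)`. The vanishing of the scalar curvature is
what removes `p` and `q`. The extra indices `K` are spectators, so that the result also serves for
the coupled operator. -/
theorem KahlerComps.ricciAction_eq (h : KahlerComps U G) {z : C2} (hz : z ∈ U) {r0 r2 rc rd : ℝ}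
    (hr : HermitianRicci G z r0 r2 rc rd) (hs : scalarCurv G z = 0) {k : ℕ} (T : Comp (k + 2))
    (K : Fin k → Fin 4) {f p q : ℝ}
    (hT : ∀ i j, T z (Matrix.vecCons i (Matrix.vecCons j K)) = sdMat G f p q z i j) :
    ricciAction G T z (Matrix.vecCons 0 (Matrix.vecCons 1 K)) = - f * r0 ∧
    ricciAction G T z (Matrix.vecCons 2 (Matrix.vecCons 3 K)) = - f * r2 ∧
    ricciAction G T z (Matrix.vecCons 0 (Matrix.vecCons 2 K)) = f * rd ∧
    ricciAction G T z (Matrix.vecCons 0 (Matrix.vecCons 3 K)) = - f * rc := by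
  have hv := (h.vol_pos hz).ne'
  have tr : G z ![2, 2] * r0 + G z ![0, 0] * r2 - 2 * G z ![0, 2] * rc
      - 2 * G z ![0, 3] * rd = 0 := by
    have := h.scalarCurv_eq hz hr
    rw [hs] at this
    field_simp at this
    linarith
  have hT' : ∀ i j i' j', T z (Matrix.vecCons i (Matrix.vecCons j
      fun a => (Matrix.vecCons i' (Matrix.vecCons j' K) : Fin (k + 2) → Fin 4) a.succ.succ)) =
      sdMat G f p q z i j := fun i j i' j' => hT i j
  have e0 : ∀ i' j', (Matrix.vecCons i' (Matrix.vecCons j' K) : Fin (k + 2) → Fin 4) 0 = i' :=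
    fun _ _ => rfl
  have e1 : ∀ i' j', (Matrix.vecCons i' (Matrix.vecCons j' K) : Fin (k + 2) → Fin 4) 1 = j' :=
    fun _ _ => rfl
  simp only [ricciAction, hT', e0, e1, tracelessRicci, hs, zero_div, zero_mul, sub_zero,
    h.metricInv_eq hz, Fin.sum_univ_four, hr.r00, hr.r11, hr.r22, hr.r33,
    hr.r01, hr.r10, hr.r23, hr.r32, hr.r02, hr.r20, hr.r13, hr.r31, hr.r03, hr.r30, hr.r12, hr.r21]
  simp [sdMat]
  have hD : vol G z = G z ![0, 0] * G z ![2, 2] - G z ![0, 2] ^ 2 - G z ![0, 3] ^ 2 := rfl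
  refine ⟨?_, ?_, ?_, ?_⟩ <;> field_simp <;> rw [hD]
  · ring
  · ring
  · linear_combination -p * tr
  · linear_combination -q * tr
end

end

/-! ### The codifferential of a self-dual form and the Ricci form as a complex Hessian -/

section

section
variable {U : Set C2} {G : Comp 2}

/-- The components of the codifferential, in terms of the derivatives `F m`, `P m`, `Q m` of the
coefficients of a self-dual form. -/
theorem KahlerComps.contraction_eq (h : KahlerComps U G) {z : C2} (hz : z ∈ U)
    (F P Q : Fin 4 → ℝ) :
    (-∑ m, ∑ a, metricInv G z m a * sdMat G (F m) (P m) (Q m) z a 0 =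
      F 1 + (vol G z)⁻¹ * (-G z ![0, 2] * (P 0 - Q 1) + G z ![0, 3] * (Q 0 + P 1)
        + G z ![0, 0] * (P 2 - Q 3))) ∧
    (-∑ m, ∑ a, metricInv G z m a * sdMat G (F m) (P m) (Q m) z a 1 =
      -F 0 - (vol G z)⁻¹ * (-G z ![0, 2] * (Q 0 + P 1) - G z ![0, 3] * (P 0 - Q 1)
        + G z ![0, 0] * (Q 2 + P 3))) ∧
    (-∑ m, ∑ a, metricInv G z m a * sdMat G (F m) (P m) (Q m) z a 2 =
      F 3 + (vol G z)⁻¹ * (-G z ![2, 2] * (P 0 - Q 1) + G z ![0, 2] * (P 2 - Q 3)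
        + G z ![0, 3] * (Q 2 + P 3))) ∧
    (-∑ m, ∑ a, metricInv G z m a * sdMat G (F m) (P m) (Q m) z a 3 =
      -F 2 - (vol G z)⁻¹ * (-G z ![2, 2] * (Q 0 + P 1) + G z ![0, 2] * (Q 2 + P 3)
        - G z ![0, 3] * (P 2 - Q 3))) := by
  have hv := (h.vol_pos hz).ne'
  simp only [h.metricInv_eq hz, Fin.sum_univ_four]
  simp [sdMat]
  refine ⟨?_, ?_, ?_, ?_⟩ <;> field_simp <;> simp only [vol] <;> ring

/-- By `∗N = (ΛN) ω - N(J·, J·)`, a self-dual `N` has `J`-invariant part `½ (ΛN) ω`, and its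
`J`-anti-invariant part is the real part of a multiple of `dz₁ ∧ dz₂`. -/
theorem sdMat_of_star (h : KahlerComps U G) {z : C2} (hz : z ∈ U) {N : Fin 4 → Fin 4 → ℝ}
    (hN : ∀ i j, N i j = - N j i) (hs : ∀ i j, starMat G N z i j = N i j) (i j : Fin 4) :
    N i j = sdMat G (N 0 1 / G z ![0, 0]) (1 / 2 * (N 0 2 - N 1 3))
      (-(1 / 2) * (N 1 2 + N 0 3)) z i j := by
  obtain ⟨e1, e2, e3, e4, e5, e6⟩ := h.starMat_eq hz hN
  rw [hs] at e1 e2 e3 e4 e5 e6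
  have ha := (h.pos z hz).ne'
  have d0 : ∀ i, N i i = 0 := fun i => by have := hN i i; linarith
  set t := lambdaTrace G N z
  have ht : N 0 1 / G z ![0, 0] = t / 2 := by
    rw [div_eq_iff ha]; linarith
  rw [ht]
  fin_cases i <;> fin_cases j <;>
    simp [sdMat, d0, hN 1 0, hN 2 0, hN 3 0, hN 2 1, hN 3 1, hN 3 2] <;> linarith

/-- The connection form of `dz₁ ∧ dz₂` is of type (1,0). Hence it drops out of every expression that
involves only `∂̄` of the coefficient. -/
theorem traceRe_J (h : KahlerComps U G) {z : C2} (hz : z ∈ U) :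
    traceRe G 1 z = - traceIm G 0 z ∧ traceIm G 1 z = traceRe G 0 z ∧
    traceRe G 3 z = - traceIm G 2 z ∧ traceIm G 3 z = traceRe G 2 z := by
  have J := fun i => h.christoffel_J hz i
  have c := fun k i j => christoffel_comm h.symm k i j z
  simp only [traceRe, traceIm, c _ 1 0, c _ 1 2, c _ 3 0, c _ 3 2, (J _).1.1, (J _).1.2.1,
    (J _).1.2.2.1, (J _).1.2.2.2, (J _).2.1, (J _).2.2.1, (J _).2.2.2.1, (J _).2.2.2.2, c _ 2 0]
  refine ⟨?_, ?_, ?_, ?_⟩ <;> first | trivial | ring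

theorem extDiff_one (hG : ∀ z i j, G z ![i, j] = G z ![j, i]) (α : Comp 1) (z : C2)
    (a b : Fin 4) :
    extDiff (k := 0) G α z ![a, b] = pd a (fun w => α w ![b]) z - pd b (fun w => α w ![a]) z := by
  have e1 : extDiff (k := 0) G α z ![a, b] = cov G α z ![a, b] - cov G α z ![b, a] := by
    have : (Matrix.vecCons b (Matrix.vecCons a fun i : Fin 0 =>
      (![a, b] : Fin 2 → Fin 4) i.succ.succ) : Fin 2 → Fin 4) = ![b, a] := by
      ext i; fin_cases i <;> rfl
    rw [extDiff]
    simp only [Matrix.cons_val_one, Matrix.cons_val_zero]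
    rw [this]
  rw [e1, cov_one, cov_one]
  simp only [christoffel_comm hG _ b a]
  ring

end

variable {U : Opens C2} {G : Comp 2}

namespace KahlerComps
open SmoothAlg

theorem pd_traceRe {U : Set C2} (h : KahlerComps U G) {z : C2} (hz : z ∈ U) (m i : Fin 4) :
    pd m (traceRe G i) z = 1 / 2 * pd m (pd i (logVol G)) z := by
  have := pd_congr h.isOpen hz (f := traceRe G i) (g := fun w => 1 / 2 * pd i (logVol G) w)
    (fun w hw => by rw [h.pd_logVol hw]; ring) m
  rw [this]
  have hd := ((contDiffOn_pd h.isOpen h.contDiffOn_logVol i).contDiffAt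
    (h.isOpen.mem_nhds hz)).differentiableAt (by simp)
  rw [pd_mul (differentiableAt_const _) hd, pd_const]
  ring

/-- The Ricci form is minus the complex Hessian of the logarithm of the volume density, and is
therefore of type (1,1). -/
theorem hermitianRicci (h : KahlerComps U G) {z : C2} (hz : z ∈ U) :
    HermitianRicci G z
      (-(1 / 2) * (pd 0 (pd 0 (logVol G)) z + pd 1 (pd 1 (logVol G)) z))
      (-(1 / 2) * (pd 2 (pd 2 (logVol G)) z + pd 3 (pd 3 (logVol G)) z))
      (-(1 / 2) * (pd 0 (pd 2 (logVol G)) z + pd 1 (pd 3 (logVol G)) z))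
      (-(1 / 2) * (pd 0 (pd 3 (logVol G)) z - pd 1 (pd 2 (logVol G)) z)) := by
  obtain ⟨⟨a1, a2, a3, a4⟩, ⟨b1, b2, b3, b4⟩, ⟨c1, c2, c3, c4⟩, d1, d2, d3, d4⟩ :=
    h.ricci_eq_traceRe hz
  have sym := fun i j => pd_pd_comm h.isOpen h.contDiffOn_logVol hz i j
  simp only [h.pd_traceRe hz, sym 1 0, sym 2 0, sym 3 0, sym 2 1, sym 3 1, sym 3 2] at *
  constructor <;> linarith

/-- Vanishing of the scalar curvature in terms of the logarithm of the volume density. -/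
theorem trace_gL (h : KahlerComps U G) (hs : ∀ z ∈ U, scalarCurv G z = 0) :
    h.g22 * dz1 (db1 h.gL) + h.g11 * dz2 (db2 h.gL) - h.g21 * dz1 (db2 h.gL)
      - h.g12 * dz2 (db1 h.gL) = 0 := by
  ext z
  have e := h.scalarCurv_eq z.2 (h.hermitianRicci z.2)
  have hv := (h.vol_pos z.2).ne'
  rw [hs z z.2] at e
  field_simp at e
  have sym := fun i j => pd_pd_comm h.isOpen h.contDiffOn_logVol z.2 i j
  apply Complex.ext
  · simp [g11, g12, g21, g22, gL, dir_ofReal, sym 2 0, sym 3 0, sym 2 1, sym 3 1]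
    linear_combination 1 / 4 * e
  · simp [g11, g12, g21, g22, gL, dir_ofReal, sym 2 0, sym 3 0, sym 2 1, sym 3 1, sym 1 0, sym 3 2]
    ring

theorem db_gD {U : Opens C2} (h : KahlerComps U G) :
    db1 h.gD = h.gD * db1 h.gL ∧ db2 h.gD = h.gD * db2 h.gL := by
  have key : ∀ z : U, ∀ m, pd m (vol G) z = vol G z * pd m (logVol G) z := by
    intro z m
    have hv := (h.vol_pos z.2).ne'
    have hd : DifferentiableAt ℝ (vol G) z :=
      (h.contDiffOn_vol.contDiffAt (h.isOpen.mem_nhds z.2)).differentiableAt (by simp)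
    have : pd m (logVol G) z = (vol G z)⁻¹ * pd m (vol G) z := by
      change fderiv ℝ (fun w => Real.log (vol G w)) z _ = _
      rw [fderiv.log hd hv]; rfl
    rw [this]; field_simp
  constructor <;> ext z <;> simp [gD, gL, dir_ofReal, key z] <;> ring

end KahlerComps

end

/-! ### The equation `S^* φ = 0` in complex coordinates -/

section

namespace SmoothAlg
variable {U : Opens C2}

/-- Complex conjugation. -/
def conj (F : SmoothAlg U) : SmoothAlg U :=
  ⟨fun z => (starRingEnd ℂ) (F.fn z),
    (Complex.conjCLE.contDiff.comp_contDiffOn (s := (U : Set C2)) F.2).congr fun z hz => by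
      simp only [extendZero_apply _ hz, Function.comp_apply]; rfl⟩

@[simp] theorem fn_conj (F : SmoothAlg U) (z : U) : F.conj.fn z = (starRingEnd ℂ) (F.fn z) := rfl

theorem exists_re_im (F : SmoothAlg U) : ∃ (r s : C2 → ℝ) (hr : ContDiffOn ℝ ∞ r U)
    (hs : ContDiffOn ℝ ∞ s U), F = ofReal r hr + Complex.I • ofReal s hs := by
  have hF : ContDiffOn ℝ ∞ (extendZero F.fn) U := F.2
  have hr : ContDiffOn ℝ ∞ (fun z => (extendZero F.fn z).re) U :=
    Complex.reCLM.contDiff.comp_contDiffOn hF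
  have hs : ContDiffOn ℝ ∞ (fun z => (extendZero F.fn z).im) U :=
    Complex.imCLM.contDiff.comp_contDiffOn hF
  refine ⟨_, _, hr, hs, ?_⟩
  ext z
  rw [fn_add, fn_smul, fn_ofReal, fn_ofReal, extendZero_apply _ z.2, mul_comm]
  exact (Complex.re_add_im _).symm

theorem conj_ofReal_add (r s : C2 → ℝ) (hr : ContDiffOn ℝ ∞ r U) (hs : ContDiffOn ℝ ∞ s U) :
    (ofReal r hr + Complex.I • ofReal s hs).conj = ofReal r hr - Complex.I • ofReal s hs := by
  ext z
  simp
  ring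

theorem conj_mul (F H : SmoothAlg U) : (F * H).conj = F.conj * H.conj := by ext z; simp
theorem conj_sub (F H : SmoothAlg U) : (F - H).conj = F.conj - H.conj := by ext z; simp

theorem conj_dir (i j : Fin 4) (α : ℂ) (F : SmoothAlg U) :
    (dir i j α F).conj = dir i j ((starRingEnd ℂ) α) F.conj := by
  obtain ⟨r, s, hr, hs, rfl⟩ := F.exists_re_im
  rw [conj_ofReal_add]
  ext z
  have two : (starRingEnd ℂ) 2 = 2 := map_ofNat _ 2
  simp [dir_ofReal, two]
  ring

end SmoothAlg

section
variable {U : Set C2} {G : Comp 2}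

/-- The coefficients of a self-dual form. -/
def coefF (G φ : Comp 2) (z : C2) : ℝ := φ z ![0, 1] / G z ![0, 0]
def coefP (φ : Comp 2) (z : C2) : ℝ := 1 / 2 * (φ z ![0, 2] - φ z ![1, 3])
def coefQ (φ : Comp 2) (z : C2) : ℝ := -(1 / 2) * (φ z ![1, 2] + φ z ![0, 3])

/-- The equations for a section of `Λ⁺ ⊗ V` with `(d⁻δ + Φ) T = 0`. -/
theorem KahlerComps.coupledOp_equations (h : KahlerComps U G) {z : C2} (hz : z ∈ U)
    {r0 r2 rc rd : ℝ} (hr : HermitianRicci G z r0 r2 rc rd) (hs : scalarCurv G z = 0) {k : ℕ}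
    (T : Comp (k + 2)) (K : Fin k → Fin 4) {f p q : ℝ}
    (hT : ∀ i j, T z (Matrix.vecCons i (Matrix.vecCons j K)) = sdMat G f p q z i j)
    {N : Fin 4 → Fin 4 → ℝ}
    (hN : ∀ i j, extDiff G (codiff G T) z (Matrix.vecCons i (Matrix.vecCons j K)) = N i j)
    (hN' : ∀ i j, N i j = - N j i)
    (h0 : ∀ i j, coupledOp G T z (Matrix.vecCons i (Matrix.vecCons j K)) = 0) :
    N 0 1 - 1 / 2 * lambdaTrace G N z * G z ![0, 0] - f * r0 = 0 ∧
    N 2 3 - 1 / 2 * lambdaTrace G N z * G z ![2, 2] - f * r2 = 0 ∧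
    1 / 2 * (N 0 2 + N 1 3) + 1 / 2 * lambdaTrace G N z * G z ![0, 3] + f * rd = 0 ∧
    1 / 2 * (N 0 3 - N 1 2) - 1 / 2 * lambdaTrace G N z * G z ![0, 2] - f * rc = 0 := by
  obtain ⟨s1, s2, s3, s4, s5, s6⟩ := h.starMat_eq hz hN'
  obtain ⟨a1, a2, a3, a4⟩ := h.ricciAction_eq hz hr hs T K hT
  have e : ∀ i j, coupledOp G T z (Matrix.vecCons i (Matrix.vecCons j K)) =
      1 / 2 * (N i j - starMat G N z i j) +
        ricciAction G T z (Matrix.vecCons i (Matrix.vecCons j K)) := by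
    intro i j
    have : (fun i j => extDiff G (codiff G T) z (Matrix.vecCons i (Matrix.vecCons j K))) = N := by
      ext i j; exact hN i j
    rw [← this]
    rfl
  have e1 := (e 0 1).symm.trans (h0 0 1)
  have e2 := (e 2 3).symm.trans (h0 2 3)
  have e3 := (e 0 2).symm.trans (h0 0 2)
  have e4 := (e 0 3).symm.trans (h0 0 3)
  rw [s1, a1] at e1
  rw [s2, a2] at e2
  rw [s3, a3] at e3
  rw [s5, a4] at e4
  refine ⟨?_, ?_, ?_, ?_⟩
  · linear_combination e1
  · linear_combination e2
  · linear_combination e3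
  · linear_combination e4

theorem extDiff_antisymm {k : ℕ} (α : Comp (k + 1)) (z : C2) (K : Fin k → Fin 4) (i j : Fin 4) :
    extDiff G α z (Matrix.vecCons i (Matrix.vecCons j K)) =
      - extDiff G α z (Matrix.vecCons j (Matrix.vecCons i K)) := by
  have : ∀ i j, extDiff G α z (Matrix.vecCons i (Matrix.vecCons j K)) =
    cov G α z (Matrix.vecCons i (Matrix.vecCons j K))
      - cov G α z (Matrix.vecCons j (Matrix.vecCons i K)) := fun i j => rfl
  rw [this, this]
  ring

end

namespace KahlerComps
open SmoothAlg
variable {U : Opens C2} {G : Comp 2}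

/-- The components of the `(1,0)` form dual to `∂̄ x`. -/
def b1 (h : KahlerComps U G) (x : SmoothAlg U) : SmoothAlg U :=
  h.gD' * (h.g11 * db2 x - h.g12 * db1 x)
def b2 (h : KahlerComps U G) (x : SmoothAlg U) : SmoothAlg U :=
  h.gD' * (h.g21 * db2 x - h.g22 * db1 x)

theorem conj_b1 (h : KahlerComps U G) (x : SmoothAlg U) :
    (h.b1 x).conj = h.gD' * (h.g11 * dz2 x.conj - h.g21 * dz1 x.conj) := by
  have e1 : h.gD'.conj = h.gD' := by ext z; simp [gD']
  have e2 : h.g11.conj = h.g11 := by ext z; simp [g11]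
  have e3 : h.g12.conj = h.g21 := by ext z; simp [g12, g21]; ring
  rw [b1, conj_mul, conj_sub, conj_mul, conj_mul, conj_dir, conj_dir, e1, e2, e3, Complex.conj_I]

theorem conj_b2 (h : KahlerComps U G) (x : SmoothAlg U) :
    (h.b2 x).conj = h.gD' * (h.g12 * dz2 x.conj - h.g22 * dz1 x.conj) := by
  have e1 : h.gD'.conj = h.gD' := by ext z; simp [gD']
  have e2 : h.g22.conj = h.g22 := by ext z; simp [g22]
  have e3 : h.g21.conj = h.g12 := by ext z; simp [g12, g21]
  rw [b2, conj_mul, conj_sub, conj_mul, conj_mul, conj_dir, conj_dir, e1, e2, e3, Complex.conj_I]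

/-- The codifferential of `f ω + Re (x dz₁ ∧ dz₂)` is `df ∘ J + 2 Re b`. The connection form of the
canonical bundle enters with weight `c` and, being of type (1,0), cancels for every `c`. The weight
is `1` for forms and `2` for squares of `dz₁ ∧ dz₂`. -/
theorem contraction_b (h : KahlerComps U G) (z : U) {p q : C2 → ℝ} (hp : ContDiffOn ℝ ∞ p U)
    (hq : ContDiffOn ℝ ∞ q U) (F : Fin 4 → ℝ) (c : ℝ) :
    let x := ofReal p hp + Complex.I • ofReal q hq
    let S := fun j => -∑ m, ∑ a, metricInv G z m a * sdMat G (F m)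
      (pd m p z - c * (p z * traceRe G m z - q z * traceIm G m z))
      (pd m q z - c * (p z * traceIm G m z + q z * traceRe G m z)) z a j
    S 0 = F 1 + 2 * ((h.b1 x).fn z).re ∧ S 1 = - F 0 - 2 * ((h.b1 x).fn z).im ∧
    S 2 = F 3 + 2 * ((h.b2 x).fn z).re ∧ S 3 = - F 2 - 2 * ((h.b2 x).fn z).im := by
  intro x S
  obtain ⟨c0, c1, c2, c3⟩ := h.contraction_eq z.2 F
    (fun m => pd m p z - c * (p z * traceRe G m z - q z * traceIm G m z))
    (fun m => pd m q z - c * (p z * traceIm G m z + q z * traceRe G m z))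
  obtain ⟨j1, j2, j3, j4⟩ := traceRe_J h z.2
  have hb1 : 2 * (h.b1 x).fn z = ((vol G z)⁻¹ : ℝ) * ((G z ![0, 0] : ℝ) *
      ((pd 2 p z - pd 3 q z : ℝ) + Complex.I * (pd 2 q z + pd 3 p z : ℝ))
      - (G z ![0, 2] + Complex.I * G z ![0, 3]) *
      ((pd 0 p z - pd 1 q z : ℝ) + Complex.I * (pd 0 q z + pd 1 p z : ℝ))) := by
    simp [x, b1, gD', g11, g12, dir_ofReal]
    linear_combination ((vol G z : ℂ)⁻¹ * (G z ![0, 0] * pd 3 q z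
      - (G z ![0, 2] + Complex.I * G z ![0, 3]) * pd 1 q z)) * Complex.I_sq
  have hb2 : 2 * (h.b2 x).fn z = ((vol G z)⁻¹ : ℝ) * ((G z ![0, 2] - Complex.I * G z ![0, 3]) *
      ((pd 2 p z - pd 3 q z : ℝ) + Complex.I * (pd 2 q z + pd 3 p z : ℝ))
      - (G z ![2, 2] : ℝ) *
      ((pd 0 p z - pd 1 q z : ℝ) + Complex.I * (pd 0 q z + pd 1 p z : ℝ))) := by
    simp [x, b2, gD', g21, g22, dir_ofReal]
    linear_combination ((vol G z : ℂ)⁻¹ * ((G z ![0, 2] - Complex.I * G z ![0, 3]) * pd 3 q z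
      - G z ![2, 2] * pd 1 q z)) * Complex.I_sq
  have r1 := congrArg Complex.re hb1
  have i1 := congrArg Complex.im hb1
  have r2 := congrArg Complex.re hb2
  have i2 := congrArg Complex.im hb2
  simp only [Complex.mul_re, Complex.mul_im, Complex.add_re, Complex.add_im, Complex.sub_re,
    Complex.sub_im, Complex.ofReal_re, Complex.ofReal_im, Complex.I_re, Complex.I_im,
    Complex.re_ofNat, Complex.im_ofNat] at r1 i1 r2 i2
  refine ⟨?_, ?_, ?_, ?_⟩
  · refine c0.trans ?_
    simp only [j1, j2, j3, j4]
    linear_combination -r1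
  · refine c1.trans ?_
    simp only [j1, j2, j3, j4]
    linear_combination i1
  · refine c2.trans ?_
    simp only [j1, j2, j3, j4]
    linear_combination -r2
  · refine c3.trans ?_
    simp only [j1, j2, j3, j4]
    linear_combination i2

theorem codiff_zero_apply (T : Comp 2) (z : C2) (j : Fin 4) :
    codiff (k := 0) G T z ![j] = -∑ m, ∑ a, metricInv G z m a * cov G T z ![m, a, j] := rfl

variable {φ : Comp 2}

theorem cov_eq_sdMat {U : Set C2} (h : KahlerComps U G) {φ : Comp 2} {f p q : C2 → ℝ}
    (hf : ContDiffOn ℝ ∞ f U) (hp : ContDiffOn ℝ ∞ p U) (hq : ContDiffOn ℝ ∞ q U)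
    (hφ : ∀ z ∈ U, ∀ i j, φ z ![i, j] = sdMat G (f z) (p z) (q z) z i j) {z : C2} (hz : z ∈ U)
    (m i j : Fin 4) : cov G φ z ![m, i, j] =
      sdMat G (pd m f z) (pd m p z - (p z * traceRe G m z - q z * traceIm G m z))
      (pd m q z - (p z * traceIm G m z + q z * traceRe G m z)) z i j := by
  have hd : ∀ {F : C2 → ℝ}, ContDiffOn ℝ ∞ F U → DifferentiableAt ℝ F z := fun hF =>
    (hF.contDiffAt (h.isOpen.mem_nhds hz)).differentiableAt (by simp)
  rw [cov_two, ← h.cov_sdMat hz (hd hf) (hd hp) (hd hq) m i j]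
  simp only [hφ z hz]
  rw [pd_congr h.isOpen hz (fun w hw => hφ w hw i j) m]

/-- The equation `S^* φ = 0` for `φ = f ω + Re (x dz₁ ∧ dz₂)`, in complex coordinates. -/
theorem sstar_equations (h : KahlerComps U G) (hs : ∀ z ∈ U, scalarCurv G z = 0) {f p q : C2 → ℝ}
    (hf : ContDiffOn ℝ ∞ f U) (hp : ContDiffOn ℝ ∞ p U) (hq : ContDiffOn ℝ ∞ q U)
    (hφ : ∀ z ∈ U, ∀ i j, φ z ![i, j] = sdMat G (f z) (p z) (q z) z i j)
    (h0 : ∀ z ∈ U, Sstar G φ z = 0) {x F : SmoothAlg U}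
    (hx : x = ofReal p hp + Complex.I • ofReal q hq) (hF : F = ofReal f hf) :
    ∃ T : SmoothAlg U,
      2 * dz1 (db1 F) - F * dz1 (db1 h.gL) + T * h.g11 =
        Complex.I • (db1 (h.b1 x) - dz1 (h.b1 x).conj) ∧
      2 * dz1 (db2 F) - F * dz1 (db2 h.gL) + T * h.g12 =
        Complex.I • (db2 (h.b1 x) - dz1 (h.b2 x).conj) ∧
      2 * dz2 (db1 F) - F * dz2 (db1 h.gL) + T * h.g21 =
        Complex.I • (db1 (h.b2 x) - dz2 (h.b1 x).conj) ∧
      2 * dz2 (db2 F) - F * dz2 (db2 h.gL) + T * h.g22 =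
        Complex.I • (db2 (h.b2 x) - dz2 (h.b2 x).conj) := by
  obtain ⟨r1, s1, hr1, hs1, e1⟩ := (h.b1 x).exists_re_im
  obtain ⟨r2, s2, hr2, hs2, e2⟩ := (h.b2 x).exists_re_im
  have hγ : ∀ z ∈ U, codiff (k := 0) G φ z ![0] = pd 1 f z + 2 * r1 z ∧
      codiff (k := 0) G φ z ![1] = - pd 0 f z - 2 * s1 z ∧
      codiff (k := 0) G φ z ![2] = pd 3 f z + 2 * r2 z ∧
      codiff (k := 0) G φ z ![3] = - pd 2 f z - 2 * s2 z := by
    intro z hz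
    have := h.contraction_b ⟨z, hz⟩ hp hq (fun m => pd m f z) 1
    rw [← hx] at this
    simp only [one_mul] at this
    simp only [codiff_zero_apply, h.cov_eq_sdMat hf hp hq hφ hz]
    simpa [e1, e2] using this
  have a_ne : ∀ z ∈ U, G z ![0, 0] ≠ 0 := fun z hz => (h.pos z hz).ne'
  let ainv : SmoothAlg U := ofReal (fun z => (G z ![0, 0])⁻¹) ((h.smooth _).inv a_ne)
  -- The multiplier is solved for from the `11̄` equation. This shows that it is smooth, which its
  -- pointwise description in `main` does not.
  let T : SmoothAlg U := ainv * (Complex.I • (db1 (h.b1 x) - dz1 (h.b1 x).conj)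
    - 2 * dz1 (db1 F) + F * dz1 (db1 h.gL))
  have hd : ∀ {H : C2 → ℝ}, ContDiffOn ℝ ∞ H U → ∀ z ∈ U, DifferentiableAt ℝ H z :=
    fun hH z hz => (hH.contDiffAt (h.isOpen.mem_nhds hz)).differentiableAt (by simp)
  -- On `J`-invariant forms the projection to `Λ⁻` subtracts a multiple of `ω`, so at each point the
  -- equation holds modulo the metric. The real multiplier is a quarter of the `ω`-trace of `dδφ`.
  have main : ∀ z : U, ∃ t : ℝ,
      (2 * dz1 (db1 F) - F * dz1 (db1 h.gL) - Complex.I • (db1 (h.b1 x) - dz1 (h.b1 x).conj)).fn z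
        = - t * h.g11.fn z ∧
      (2 * dz1 (db2 F) - F * dz1 (db2 h.gL) - Complex.I • (db2 (h.b1 x) - dz1 (h.b2 x).conj)).fn z
        = - t * h.g12.fn z ∧
      (2 * dz2 (db1 F) - F * dz2 (db1 h.gL) - Complex.I • (db1 (h.b2 x) - dz2 (h.b1 x).conj)).fn z
        = - t * h.g21.fn z ∧
      (2 * dz2 (db2 F) - F * dz2 (db2 h.gL) - Complex.I • (db2 (h.b2 x) - dz2 (h.b2 x).conj)).fn z
        = - t * h.g22.fn z := by
    rintro ⟨z, hz⟩
    set N : Fin 4 → Fin 4 → ℝ := fun i j => extDiff (k := 0) G (codiff (k := 0) G φ) z ![i, j]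
      with hN
    obtain ⟨E1, E2, E3, E4⟩ := h.coupledOp_equations hz (h.hermitianRicci hz) (hs z hz) (k := 0) φ
      ![] (fun i j => hφ z hz i j) (N := N) (fun i j => rfl)
      (fun i j => extDiff_antisymm (k := 0) _ _ _ _ _)
      (fun i j => congrFun (h0 z hz) ![i, j])
    have hpf := fun i => contDiffOn_pd h.isOpen hf i
    have two : ∀ {H : C2 → ℝ} (_ : ContDiffOn ℝ ∞ H U) i, pd i (fun w => 2 * H w) z = 2 * pd i H z :=
      fun hH i => by rw [pd_mul (differentiableAt_const _) (hd hH z hz), pd_const]; ring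
    have d2 : ∀ {H : C2 → ℝ} (_ : ContDiffOn ℝ ∞ H U), DifferentiableAt ℝ (fun w => 2 * H w) z :=
      fun hH => (hd hH z hz).const_mul 2
    have g0 : ∀ i, pd i (fun w => codiff (k := 0) G φ w ![0]) z
        = pd i (pd 1 f) z + 2 * pd i r1 z := fun i => by
      rw [pd_congr h.isOpen hz (fun w hw => (hγ w hw).1) i, pd_add (hd (hpf 1) z hz) (d2 hr1),
        two hr1]
    have g1 : ∀ i, pd i (fun w => codiff (k := 0) G φ w ![1]) z
        = - pd i (pd 0 f) z - 2 * pd i s1 z := fun i => by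
      rw [pd_congr h.isOpen hz (fun w hw => (hγ w hw).2.1) i,
        pd_sub (f := fun w => -pd 0 f w) (hd (hpf 0) z hz).neg (d2 hs1), two hs1, pd_neg]
    have g2 : ∀ i, pd i (fun w => codiff (k := 0) G φ w ![2]) z
        = pd i (pd 3 f) z + 2 * pd i r2 z := fun i => by
      rw [pd_congr h.isOpen hz (fun w hw => (hγ w hw).2.2.1) i, pd_add (hd (hpf 3) z hz) (d2 hr2),
        two hr2]
    have g3 : ∀ i, pd i (fun w => codiff (k := 0) G φ w ![3]) z
        = - pd i (pd 2 f) z - 2 * pd i s2 z := fun i => by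
      rw [pd_congr h.isOpen hz (fun w hw => (hγ w hw).2.2.2) i,
        pd_sub (f := fun w => -pd 2 f w) (hd (hpf 2) z hz).neg (d2 hs2), two hs2, pd_neg]
    refine ⟨1 / 4 * lambdaTrace G N z, ?_⟩
    set t := lambdaTrace G N z
    clear_value t
    have sym := fun i j => pd_pd_comm h.isOpen h.contDiffOn_logVol hz i j
    have symf := fun i j => pd_pd_comm h.isOpen hf hz i j
    simp only [hN, extDiff_one h.symm, g0, g1, g2, g3, symf 2 1, symf 3 0, symf 3 1, symf 2 0]
      at E1 E2 E3 E4
    have ftwo : (2 : SmoothAlg U).fn ⟨z, hz⟩ = 2 := rfl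
    rw [e1, e2, conj_ofReal_add, conj_ofReal_add, hF]
    refine ⟨?_, ?_, ?_, ?_⟩ <;> apply Complex.ext <;>
      simp [g11, g12, g21, g22, gL, dir_ofReal, ftwo, sym 1 0, sym 2 0, sym 3 0, sym 2 1, sym 3 1,
        sym 3 2, symf 1 0, symf 2 0, symf 3 0, symf 2 1, symf 3 1, symf 3 2]
    · linear_combination -1 / 2 * E1
    · linear_combination -1 / 2 * E4
    · linear_combination 1 / 2 * E3
    · linear_combination -1 / 2 * E4
    · linear_combination -1 / 2 * E3
    · linear_combination -1 / 2 * E2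
  have hT : ∀ z : U, ∀ t : ℝ, (2 * dz1 (db1 F) - F * dz1 (db1 h.gL)
      - Complex.I • (db1 (h.b1 x) - dz1 (h.b1 x).conj)).fn z = - t * h.g11.fn z → T.fn z = t := by
    intro z t ht
    have ha : (G z ![0, 0] : ℂ) ≠ 0 := by exact_mod_cast a_ne z z.2
    have : T.fn z = (G z ![0, 0] : ℂ)⁻¹ * -((2 * dz1 (db1 F) - F * dz1 (db1 h.gL)
      - Complex.I • (db1 (h.b1 x) - dz1 (h.b1 x).conj)).fn z) := by
      simp only [T, ainv, fn_mul, fn_add, fn_sub, fn_ofReal, Complex.ofReal_inv]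
      ring
    rw [this, ht]
    simp only [g11, fn_ofReal]
    field_simp
  refine ⟨T, ?_, ?_, ?_, ?_⟩ <;> ext z <;> obtain ⟨t, m1, m2, m3, m4⟩ := main z <;>
    have ht := hT z t m1 <;> simp only [fn_sub, fn_add, fn_mul] at m1 m2 m3 m4 ⊢ <;> rw [ht]
  · linear_combination m1
  · linear_combination m2
  · linear_combination m3
  · linear_combination m4

end KahlerComps

end

/-! ### Integral identities: the energy of `∂̄ grad f` and the null Lagrangian -/

section

section Algebra
variable {R : Type*} [CommRing R] [Algebra ℂ R]
variable {d1 d2 e1 e2 : Derivation ℂ R R} {g11 g12 g21 g22 D D' : R}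

namespace KahlerRing

/-- The energy density paired with a function `u` is a divergence. -/
theorem energy_identity (_h : KahlerRing d1 d2 e1 e2 g11 g12 g21 g22 D D') {u v1 v2 w1 w2 Z1 Z2 : R}
    (hw1 : w1 = D' * (g22 * d1 u - g12 * d2 u)) (hw2 : w2 = D' * (g11 * d2 u - g21 * d1 u))
    (hZ1 : Z1 = d1 (D * e1 v1) + d2 (D * e1 v2)) (hZ2 : Z2 = d1 (D * e2 v1) + d2 (D * e2 v2))
    (hX : d1 (D' * (g22 * Z1 - g21 * Z2)) + d2 (D' * (g11 * Z2 - g12 * Z1)) = 0) :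
    D * (e1 v1 * d1 w1 + e2 v1 * d1 w2 + e1 v2 * d2 w1 + e2 v2 * d2 w2) =
      d1 (D * e1 v1 * w1 + D * e2 v1 * w2 - u * (D' * (g22 * Z1 - g21 * Z2))) +
      d2 (D * e1 v2 * w1 + D * e2 v2 * w2 - u * (D' * (g11 * Z2 - g12 * Z1))) := by
  have hZ : Z1 * w1 + Z2 * w2 = d1 u * (D' * (g22 * Z1 - g21 * Z2))
      + d2 u * (D' * (g11 * Z2 - g12 * Z1)) := by rw [hw1, hw2]; ring
  rw [map_sub, map_add, map_sub, map_add, d1.leibniz _ w1, d1.leibniz _ w2, d2.leibniz _ w1,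
    d2.leibniz _ w2, d1.leibniz u, d2.leibniz u]
  simp only [smul_eq_mul]
  linear_combination u * hX - hZ + w1 * hZ1 + w2 * hZ2

/-- The mixed discriminant of `∂̄b` and `b ⊗ ∂̄u` completes `2 u det (∂̄b)` to a divergence. -/
theorem null_lagrangian {b1 b2 u : R} (he : ∀ x, e1 (e2 x) = e2 (e1 x)) :
    2 * u * (e1 b1 * e2 b2 - e2 b1 * e1 b2) + (b1 * (e1 u * e2 b2 - e2 u * e1 b2)
      + b2 * (e2 u * e1 b1 - e1 u * e2 b1)) =
      e1 (u * (b1 * e2 b2 - b2 * e2 b1)) + e2 (u * (b2 * e1 b1 - b1 * e1 b2)) := by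
  simp only [map_sub, Derivation.leibniz, smul_eq_mul, he]
  ring

end KahlerRing
end Algebra

open MeasureTheory

theorem integral_fderiv_eq_zero {H : C2 → ℂ} (hH : ContDiff ℝ 1 H) (hc : HasCompactSupport H)
    (v : C2) : ∫ z, fderiv ℝ H z v = 0 := by
  have hcont : Continuous fun z => fderiv ℝ H z v := by
    have := hH.continuous_fderiv (by simp)
    fun_prop
  have hc' : HasCompactSupport fun z => fderiv ℝ H z v := hc.fderiv_apply (𝕜 := ℝ) v
  have := integral_smul_fderiv_eq_neg_fderiv_smul_of_integrable (𝕜 := ℝ) (μ := volume)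
    (f := fun _ : C2 => (1 : ℝ)) (g := H) (v := v) (by simp)
    (by simpa using hcont.integrable_of_hasCompactSupport hc')
    (by simpa using hH.continuous.integrable_of_hasCompactSupport hc) (by fun_prop)
    (fun x _ => hH.differentiable (by simp) x)
  simpa using this

namespace SmoothAlg
variable {U : Opens C2}

/-- `F` vanishes outside a compact subset of `U`. -/
def SuppIn (K : Set C2) (F : SmoothAlg U) : Prop := ∀ z : U, z.1 ∉ K → F.fn z = 0

theorem SuppIn.mul_left {K : Set C2} {F : SmoothAlg U} (hF : SuppIn K F) (H : SmoothAlg U) :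
    SuppIn K (H * F) := fun z hz => by simp [hF z hz]
theorem SuppIn.mul_right {K : Set C2} {F : SmoothAlg U} (hF : SuppIn K F) (H : SmoothAlg U) :
    SuppIn K (F * H) := fun z hz => by simp [hF z hz]
theorem SuppIn.add {K : Set C2} {F H : SmoothAlg U} (hF : SuppIn K F) (hH : SuppIn K H) :
    SuppIn K (F + H) := fun z hz => by simp [hF z hz, hH z hz]
theorem SuppIn.sub {K : Set C2} {F H : SmoothAlg U} (hF : SuppIn K F) (hH : SuppIn K H) :
    SuppIn K (F - H) := fun z hz => by simp [hF z hz, hH z hz]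

theorem SuppIn.contDiff {K : Set C2} (hK : IsCompact K) (hKU : K ⊆ U) {F : SmoothAlg U}
    (hF : SuppIn K F) : ContDiff ℝ ∞ (extendZero F.fn) := by
  rw [contDiff_iff_contDiffAt]
  intro z
  by_cases hz : z ∈ U
  · exact F.contDiffAt hz
  · have : extendZero F.fn =ᶠ[nhds z] fun _ => 0 := by
      filter_upwards [hK.isClosed.isOpen_compl.mem_nhds fun h => hz (hKU h)] with w hw
      by_cases hw' : w ∈ U
      · rw [extendZero_apply _ hw', hF ⟨w, hw'⟩ hw]
      · simp [extendZero, hw']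
    exact contDiffAt_const.congr_of_eventuallyEq this

theorem SuppIn.hasCompactSupport {K : Set C2} (hK : IsCompact K) {F : SmoothAlg U}
    (hF : SuppIn K F) : HasCompactSupport (extendZero F.fn) :=
  HasCompactSupport.intro hK fun z hz => by
    by_cases hz' : z ∈ U
    · rw [extendZero_apply _ hz', hF _ hz]
    · simp [extendZero, hz']

theorem SuppIn.dir {K : Set C2} (hK : IsCompact K) {F : SmoothAlg U} (hF : SuppIn K F)
    (i j : Fin 4) (α : ℂ) : SuppIn K (SmoothAlg.dir i j α F) := by
  intro z hz
  have : extendZero F.fn =ᶠ[nhds z.1] fun _ => 0 := by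
    filter_upwards [hK.isClosed.isOpen_compl.mem_nhds hz] with w hw
    by_cases hw' : w ∈ U
    · rw [extendZero_apply _ hw', hF ⟨w, hw'⟩ hw]
    · simp [extendZero, hw']
  rw [dir_apply, this.fderiv_eq]
  simp

theorem SuppIn.integrable {K : Set C2} (hK : IsCompact K) (hKU : K ⊆ U) {F : SmoothAlg U}
    (hF : SuppIn K F) : Integrable (extendZero F.fn) :=
  (hF.contDiff hK hKU).continuous.integrable_of_hasCompactSupport (hF.hasCompactSupport hK)

theorem SuppIn.integral_dir {K : Set C2} (hK : IsCompact K) (hKU : K ⊆ U) {F : SmoothAlg U}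
    (hF : SuppIn K F) (i j : Fin 4) (α : ℂ) : ∫ z, extendZero (SmoothAlg.dir i j α F).fn z = 0 := by
  have hs := (hF.contDiff hK hKU).of_le (m := 1) (by simp)
  have hc := hF.hasCompactSupport hK
  have e : ∀ z, extendZero (SmoothAlg.dir i j α F).fn z =
      1 / 2 * (fderiv ℝ (extendZero F.fn) z (realFrame i)
      + α * fderiv ℝ (extendZero F.fn) z (realFrame j)) := by
    intro z
    by_cases hz : z ∈ U
    · rw [extendZero_apply _ hz, dir_apply]
    · have : extendZero F.fn =ᶠ[nhds z] fun _ => 0 := by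
        filter_upwards [hK.isClosed.isOpen_compl.mem_nhds fun h => hz (hKU h)] with w hw
        by_cases hw' : w ∈ U
        · rw [extendZero_apply _ hw', hF ⟨w, hw'⟩ hw]
        · simp [extendZero, hw']
      rw [this.fderiv_eq]
      simp [extendZero, hz]
  have hi : ∀ v : C2, Integrable fun z => fderiv ℝ (extendZero F.fn) z v := fun v => by
    have hcont : Continuous fun z => fderiv ℝ (extendZero F.fn) z v := by
      have := hs.continuous_fderiv (by simp)
      fun_prop
    exact hcont.integrable_of_hasCompactSupport (hc.fderiv_apply (𝕜 := ℝ) v)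
  simp_rw [e]
  rw [integral_const_mul, integral_add (hi _) ((hi _).const_mul α), integral_const_mul,
    integral_fderiv_eq_zero hs hc, integral_fderiv_eq_zero hs hc]
  simp

theorem extendZero_add' (F H : SmoothAlg U) (z : C2) :
    extendZero (F + H).fn z = extendZero F.fn z + extendZero H.fn z := by
  by_cases hz : z ∈ U
  · simp [extendZero_apply _ hz]
  · simp [extendZero, hz]

end SmoothAlg

namespace KahlerComps
open SmoothAlg
variable {U : Opens C2} {G : Comp 2}

/-- Half the complex gradient. -/
def grad1 (h : KahlerComps U G) (x : SmoothAlg U) : SmoothAlg U :=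
  h.gD' * (h.g22 * db1 x - h.g21 * db2 x)
def grad2 (h : KahlerComps U G) (x : SmoothAlg U) : SmoothAlg U :=
  h.gD' * (h.g11 * db2 x - h.g12 * db1 x)

theorem conj_g (h : KahlerComps U G) : h.gD.conj = h.gD ∧ h.gD'.conj = h.gD' ∧
    h.g11.conj = h.g11 ∧ h.g22.conj = h.g22 ∧ h.g12.conj = h.g21 ∧ h.g21.conj = h.g12 := by
  refine ⟨?_, ?_, ?_, ?_, ?_, ?_⟩ <;> ext z <;> simp [gD, gD', g11, g22, g12, g21]
  ring

/-- The Lichnerowicz equation for `f`, integrated against `u` twice by parts. The equations for `φ`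
make the current of `f` divergence-free, so by `energy_identity` the integrand is a divergence of
fields supported in `K`. That `u` is real identifies the conjugate of `∂̄ grad u` with `∂` of the
conjugate gradient. -/
theorem integral_energy (h : KahlerComps U G) (hs : ∀ z ∈ U, scalarCurv G z = 0)
    {f p q : C2 → ℝ} {φ : Comp 2}
    (hf : ContDiffOn ℝ ∞ f U) (hp : ContDiffOn ℝ ∞ p U) (hq : ContDiffOn ℝ ∞ q U)
    (hφ : ∀ z ∈ U, ∀ i j, φ z ![i, j] = sdMat G (f z) (p z) (q z) z i j)
    (h0 : ∀ z ∈ U, Sstar G φ z = 0) {K : Set C2} (hK : IsCompact K) (hKU : K ⊆ U)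
    {u F : SmoothAlg U} (hF : F = ofReal f hf) (hu : SuppIn K u) (hur : u.conj = u) :
    ∫ z, extendZero (h.gD *
      (db1 (h.grad1 F) * (db1 (h.grad1 u)).conj + db2 (h.grad1 F) * (db1 (h.grad2 u)).conj
      + db1 (h.grad2 F) * (db2 (h.grad1 u)).conj + db2 (h.grad2 F) * (db2 (h.grad2 u)).conj)).fn z
      = 0 := by
  obtain ⟨c1, c2, c3, c4, c5, c6⟩ := h.conj_g
  obtain ⟨T, q1, q2, q3, q4⟩ := h.sstar_equations hs hf hp hq hφ h0 rfl hF
  have L := h.kahlerRing.lichnerowicz (L := h.gL) (y := (ofReal p hp + Complex.I • ofReal q hq).conj)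
    rfl rfl (h.conj_b1 _) (h.conj_b2 _) (h.trace_gL hs) q1 q2 q3 q4
  have hX := h.kahlerRing.div_current (f := F) (L := h.gL) (v1 := h.grad1 F) (v2 := h.grad2 F)
    rfl rfl h.db_gD.1 h.db_gD.2 (h.trace_gL hs) rfl rfl
  rw [L] at hX
  have E := h.kahlerRing.energy_identity (u := u) (v1 := h.grad1 F) (v2 := h.grad2 F) rfl rfl
    rfl rfl hX
  have w1 : (h.grad1 u).conj = h.gD' * (h.g22 * dz1 u - h.g12 * dz2 u) := by
    simp only [grad1, conj_mul, conj_sub, conj_dir, c2, c4, c6, hur, Complex.conj_I]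
  have w2 : (h.grad2 u).conj = h.gD' * (h.g11 * dz2 u - h.g21 * dz1 u) := by
    simp only [grad2, conj_mul, conj_sub, conj_dir, c2, c3, c5, hur, Complex.conj_I]
  rw [conj_dir, conj_dir, conj_dir, conj_dir, w1, w2, Complex.conj_I, E]
  simp_rw [extendZero_add']
  have du1 := hu.dir hK 0 1 (-Complex.I)
  have du2 := hu.dir hK 2 3 (-Complex.I)
  have s1 := ((du1.mul_left h.g22).sub (du2.mul_left h.g12)).mul_left h.gD'
  have s2 := ((du2.mul_left h.g11).sub (du1.mul_left h.g21)).mul_left h.gD'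
  have S : ∀ a b X : SmoothAlg U, SuppIn K (a * (h.gD' * (h.g22 * dz1 u - h.g12 * dz2 u))
    + b * (h.gD' * (h.g11 * dz2 u - h.g21 * dz1 u)) - u * X) := fun a b X =>
    ((s1.mul_left a).add (s2.mul_left b)).sub (hu.mul_right X)
  rw [integral_add (((S _ _ _).dir hK _ _ _).integrable hK hKU)
    (((S _ _ _).dir hK _ _ _).integrable hK hKU), (S _ _ _).integral_dir hK hKU,
    (S _ _ _).integral_dir hK hKU, add_zero]

/-- `det (∂̄b)` is the determinant of a Jacobian in the two antiholomorphic directions, so weighting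
it by `u` costs only a term with `∂̄u`. No equation for `b1`, `b2` is needed. -/
theorem integral_null_lagrangian {K : Set C2} (hK : IsCompact K) (hKU : K ⊆ U) {u b1 b2 : SmoothAlg U}
    (hu : SuppIn K u) :
    ∫ z, extendZero (2 * u * (db1 b1 * db2 b2 - db2 b1 * db1 b2)
      + (b1 * (db1 u * db2 b2 - db2 u * db1 b2) + b2 * (db2 u * db1 b1 - db1 u * db2 b1))).fn z
      = 0 := by
  rw [KahlerRing.null_lagrangian (dir_comm _ _ _ _ _ _)]
  simp_rw [extendZero_add']
  have S : ∀ a : SmoothAlg U, SuppIn K (u * a) := fun a => hu.mul_right a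
  rw [integral_add (((S _).dir hK _ _ _).integrable hK hKU)
    (((S _).dir hK _ _ _).integrable hK hKU), (S _).integral_dir hK hKU,
    (S _).integral_dir hK hKU, add_zero]

end KahlerComps

end

section

/-! ### Holomorphic functions on open subsets of `ℂ²` -/

section Holomorphic
open Metric

/-- Cauchy's estimate on each complex line through `y`. -/
theorem norm_fderiv_le_of_ball {H : C2 → ℂ} {y : C2} {ρ M : ℝ} (hρ : 0 < ρ)
    (hd : ∀ x ∈ closedBall y ρ, DifferentiableAt ℂ H x) (hM : ∀ x ∈ closedBall y ρ, ‖H x‖ ≤ M) :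
    ‖fderiv ℂ H y‖ ≤ M / ρ := by
  have hM0 : 0 ≤ M := (norm_nonneg _).trans (hM y (mem_closedBall_self hρ.le))
  refine ContinuousLinearMap.opNorm_le_bound _ (by positivity) fun v => ?_
  by_cases hv : v = 0
  · simp [hv]
  have hv' : 0 < ‖v‖ := norm_pos_iff.mpr hv
  have hmem : ∀ ζ ∈ closedBall (0 : ℂ) (ρ / ‖v‖), y + ζ • v ∈ closedBall y ρ := by
    intro ζ hζ
    rw [mem_closedBall, dist_zero_right, le_div_iff₀ hv'] at hζ
    simpa [mem_closedBall, dist_eq_norm, norm_smul] using hζ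
  have hline : ∀ ζ : ℂ, HasDerivAt (fun ζ : ℂ => y + ζ • v) v ζ := fun ζ => by
    simpa using ((hasDerivAt_id ζ).smul_const v).const_add y
  have hder : ∀ ζ ∈ closedBall (0 : ℂ) (ρ / ‖v‖),
      HasDerivAt (fun ζ : ℂ => H (y + ζ • v)) (fderiv ℂ H (y + ζ • v) v) ζ := fun ζ hζ =>
    (hd _ (hmem ζ hζ)).hasFDerivAt.comp_hasDerivAt ζ (hline ζ)
  have hR : 0 < ρ / ‖v‖ := by positivity
  have h0 := hder 0 (mem_closedBall_self hR.le)
  have := Complex.norm_deriv_le_of_forall_mem_sphere_norm_le (f := fun ζ : ℂ => H (y + ζ • v))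
    (C := M) hR
    (DifferentiableOn.diffContOnCl fun ζ hζ =>
      (hder ζ (closure_ball_subset_closedBall hζ)).differentiableAt.differentiableWithinAt)
    fun ζ hζ => hM _ (hmem ζ (sphere_subset_closedBall hζ))
  rw [h0.deriv, zero_smul, add_zero] at this
  calc _ ≤ _ := this
    _ = _ := by field_simp

/-- The derivative in direction `w` is a one-variable Cauchy integral over a small circle in the
line `z + ℂ w`. Its integrand is holomorphic in `z` with derivative bounded by Cauchy's estimate, so
it can be differentiated under the integral sign. -/
theorem differentiableOn_fderiv_apply {H : C2 → ℂ} {U : Set C2} (hU : IsOpen U)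
    (hH : DifferentiableOn ℂ H U) (w : C2) : DifferentiableOn ℂ (fun z => fderiv ℂ H z w) U := by
  intro z₀ hz₀
  refine DifferentiableAt.differentiableWithinAt ?_
  obtain ⟨ε, hε, hεU⟩ := Metric.isOpen_iff.mp hU z₀ hz₀
  -- Three nested radii are needed: `z` stays within `ρ` of `z₀`, the circles within `2ρ`, and
  -- Cauchy's estimate on those points uses balls inside `3ρ < ε`.
  set ρ := ε / 4
  have hρ : 0 < ρ := by positivity
  have hsub : closedBall z₀ (3 * ρ) ⊆ U := (closedBall_subset_ball (by simp only [ρ]; linarith)).trans hεU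
  have hdiff : ∀ x ∈ closedBall z₀ (3 * ρ), DifferentiableAt ℂ H x := fun x hx =>
    hH.differentiableAt (hU.mem_nhds (hsub hx))
  obtain ⟨M, hM⟩ := (isCompact_closedBall z₀ (3 * ρ)).exists_bound_of_continuousOn
    (hH.continuousOn.mono hsub)
  have hb : ∀ y ∈ closedBall z₀ (2 * ρ), ‖fderiv ℂ H y‖ ≤ M / ρ := by
    intro y hy
    have : closedBall y ρ ⊆ closedBall z₀ (3 * ρ) :=
      closedBall_subset_closedBall' (by rw [mem_closedBall] at hy; linarith)
    exact norm_fderiv_le_of_ball hρ (fun x hx => hdiff x (this hx)) fun x hx => hM x (this hx)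
  -- The circle of radius `r` in direction `w` moves a point by at most `ρ`; the summand `1` covers
  -- `w = 0`.
  set r := ρ / (‖w‖ + 1)
  have hr : 0 < r := by positivity
  have hrw : r * ‖w‖ ≤ ρ := by
    have : r * (‖w‖ + 1) = ρ := by simp only [r]; field_simp
    nlinarith [norm_nonneg w]
  have hmem : ∀ z ∈ closedBall z₀ ρ, ∀ ζ ∈ closedBall (0 : ℂ) r, z + ζ • w ∈ closedBall z₀ (2 * ρ) := by
    intro z hz ζ hζ
    rw [mem_closedBall, dist_zero_right] at hζ
    rw [mem_closedBall, dist_eq_norm] at hz ⊢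
    calc ‖z + ζ • w - z₀‖ = ‖(z - z₀) + ζ • w‖ := by congr 1; abel
      _ ≤ ‖z - z₀‖ + ‖ζ‖ * ‖w‖ := (norm_add_le _ _).trans (by rw [norm_smul])
      _ ≤ ρ + r * ‖w‖ := by gcongr
      _ ≤ 2 * ρ := by linarith
  have h23 : closedBall z₀ (2 * ρ) ⊆ closedBall z₀ (3 * ρ) := closedBall_subset_closedBall (by linarith)
  have hline : ∀ z ζ, HasDerivAt (fun ζ : ℂ => z + ζ • w) w ζ := fun z ζ => by
    simpa using ((hasDerivAt_id ζ).smul_const w).const_add z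
  let coef : ℝ → ℂ := fun θ => (2 * Real.pi * Complex.I : ℂ)⁻¹ * (deriv (circleMap 0 r) θ * ((circleMap 0 r θ) ^ 2)⁻¹)
  have hcoef : Continuous coef := by
    have h1 : ∀ θ, circleMap 0 r θ ^ 2 ≠ 0 := fun θ => by
      simpa [circleMap] using hr.ne'
    have h2 : Continuous (deriv (circleMap 0 r)) := by
      have : deriv (circleMap 0 r) = fun θ => circleMap 0 r θ * Complex.I := by
        ext θ; simp
      rw [this]
      fun_prop
    exact continuous_const.mul (h2.mul (Continuous.inv₀ (by fun_prop) h1))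
  have hcm : ∀ θ, circleMap 0 r θ ∈ closedBall (0 : ℂ) r := fun θ => circleMap_mem_closedBall 0 hr.le θ
  have key : ∀ z ∈ ball z₀ ρ, fderiv ℂ H z w =
      ∫ θ in (0 : ℝ)..2 * Real.pi, coef θ • H (z + circleMap 0 r θ • w) := by
    intro z hz
    have hz' := ball_subset_closedBall hz
    have hopen : IsOpen ((fun ζ : ℂ => z + ζ • w) ⁻¹' U) := hU.preimage (by fun_prop)
    have hd : DifferentiableOn ℂ (fun ζ : ℂ => H (z + ζ • w)) ((fun ζ : ℂ => z + ζ • w) ⁻¹' U) :=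
      hH.comp (fun ζ _ => (hline z ζ).differentiableAt.differentiableWithinAt) fun _ h => h
    have c := Complex.two_pi_I_inv_smul_circleIntegral_sub_sq_inv_smul_of_differentiable hopen
      (c := 0) (w₀ := 0) (R := r) (fun ζ hζ => hsub (h23 (hmem z hz' ζ hζ))) hd (mem_ball_self hr)
    have d0 : HasDerivAt (fun ζ : ℂ => H (z + ζ • w)) (fderiv ℂ H (z + (0 : ℂ) • w) w) 0 :=
      (hdiff _ (h23 (hmem z hz' 0 (mem_closedBall_self hr.le)))).hasFDerivAt.comp_hasDerivAt 0
        (hline z 0)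
    rw [d0.deriv, zero_smul, add_zero] at c
    rw [← c, circleIntegral, ← intervalIntegral.integral_smul]
    simp only [coef, sub_zero, smul_smul, mul_assoc]
  have cont : ∀ z ∈ closedBall z₀ ρ, Continuous fun θ : ℝ => H (z + circleMap 0 r θ • w) := by
    intro z hz
    have : ContinuousOn H (closedBall z₀ (3 * ρ)) := hH.continuousOn.mono hsub
    exact this.comp_continuous (by fun_prop) fun θ => h23 (hmem z hz _ (hcm θ))
  have D := intervalIntegral.hasFDerivAt_integral_of_dominated_of_fderiv_le (𝕜 := ℂ)
    (μ := MeasureTheory.volume) (a := 0) (b := 2 * Real.pi)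
    (F := fun z θ => coef θ • H (z + circleMap 0 r θ • w))
    (F' := fun z θ => coef θ • fderiv ℂ H (z + circleMap 0 r θ • w)) (x₀ := z₀)
    (s := ball z₀ ρ) (bound := fun θ => ‖coef θ‖ * (M / ρ)) (ball_mem_nhds z₀ hρ)
    (by
      filter_upwards [ball_mem_nhds z₀ hρ] with z hz
      exact (hcoef.smul (cont z (ball_subset_closedBall hz))).aestronglyMeasurable)
    ((hcoef.smul (cont z₀ (mem_closedBall_self hρ.le))).intervalIntegrable _ _)
    (by
      have m : Measurable fun θ : ℝ => fderiv ℂ H (z₀ + circleMap 0 r θ • w) :=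
        (measurable_fderiv ℂ H).comp (by fun_prop : Continuous fun θ : ℝ => z₀ + circleMap 0 r θ • w).measurable
      exact (hcoef.measurable.smul m).aestronglyMeasurable)
    (by
      refine Filter.Eventually.of_forall fun θ _ z hz => ?_
      rw [norm_smul]
      gcongr
      exact hb _ (hmem z (ball_subset_closedBall hz) _ (hcm θ)))
    ((hcoef.norm.mul continuous_const).intervalIntegrable _ _)
    (by
      refine Filter.Eventually.of_forall fun θ _ z hz => ?_
      have h1 : HasFDerivAt (fun z : C2 => z + circleMap 0 r θ • w) (ContinuousLinearMap.id ℂ C2) z :=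
        (hasFDerivAt_id z).add_const _
      have h2 := (hdiff _ (h23 (hmem z (ball_subset_closedBall hz) _ (hcm θ)))).hasFDerivAt
      exact (h2.comp z h1).const_smul (coef θ))
  refine D.differentiableAt.congr_of_eventuallyEq ?_
  filter_upwards [ball_mem_nhds z₀ hρ] with z hz using key z hz

/-- By induction on the order: each directional derivative of a holomorphic function is again
holomorphic. -/
theorem contDiffOn_of_differentiableOn {H : C2 → ℂ} {U : Set C2} (hU : IsOpen U)
    (hH : DifferentiableOn ℂ H U) : ContDiffOn ℂ ∞ H U := by
  rw [contDiffOn_infty]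
  intro n
  induction n generalizing H with
  | zero => exact contDiffOn_zero.mpr hH.continuousOn
  | succ n ih =>
    push_cast
    rw [contDiffOn_succ_iff_fderiv_of_isOpen hU]
    refine ⟨hH, by simp, ?_⟩
    rw [contDiffOn_clm_apply]
    exact fun w => ih (differentiableOn_fderiv_apply hU hH w)

theorem contDiffOn_of_differentiableOn_C2 {H : C2 → C2} {U : Set C2} (hU : IsOpen U)
    (hH : DifferentiableOn ℂ H U) : ContDiffOn ℂ ∞ H U := by
  rw [contDiffOn_euclidean]
  intro i
  exact contDiffOn_of_differentiableOn hU fun z hz =>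
    ((EuclideanSpace.proj (𝕜 := ℂ) i).differentiableAt.comp_differentiableWithinAt z (hH z hz))

/-- A holomorphic function near infinity in `ℂ²` which tends to zero vanishes near infinity. -/
theorem eq_zero_of_tendsto_cobounded {H : C2 → ℂ} {r : ℝ} (hr : 0 ≤ r)
    (hH : DifferentiableOn ℂ H {z | r < ‖z‖})
    (h0 : Filter.Tendsto H (Bornology.cobounded C2) (nhds 0)) {z : C2} (hz : 2 * r < ‖z‖) :
    H z = 0 := by
  -- If one coordinate exceeds `r` in modulus, the complex line along the other coordinate axis
  -- misses the ball of radius `r`. So `H` is entire on that line and tends to zero there, and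
  -- Liouville's theorem applies.
  have slice : ∀ i : Fin 2, r < ‖z i‖ → H z = 0 := by
    intro i hi
    set j : Fin 2 := 1 - i
    have hij : i ≠ j := by fin_cases i <;> simp [j]
    let w : C2 := EuclideanSpace.single j (1 : ℂ)
    let L : ℂ → C2 := fun ζ => z + (ζ - z j) • w
    have hLi : ∀ ζ, L ζ i = z i := fun ζ => by simp [L, w, hij]
    have hLj : ∀ ζ, L ζ j = ζ := fun ζ => by simp [L, w]
    have hL : ∀ ζ, HasDerivAt L w ζ := fun ζ => by
      have := (((hasDerivAt_id ζ).sub_const (z j)).smul_const w).const_add z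
      rwa [one_smul] at this
    have hmem : ∀ ζ, r < ‖L ζ‖ := fun ζ => by
      have := PiLp.norm_apply_le (L ζ) i
      rw [hLi] at this
      linarith
    have hd : Differentiable ℂ fun ζ => H (L ζ) := fun ζ =>
      (hH.differentiableAt ((isOpen_lt continuous_const continuous_norm).mem_nhds
        (hmem ζ))).comp ζ (hL ζ).differentiableAt
    have ht : Filter.Tendsto L (Filter.cocompact ℂ) (Bornology.cobounded C2) := by
      rw [← Metric.cobounded_eq_cocompact, ← tendsto_norm_atTop_iff_cobounded]
      refine Filter.tendsto_atTop_mono (fun ζ => ?_) tendsto_norm_cobounded_atTop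
      have := PiLp.norm_apply_le (L ζ) j
      rwa [hLj] at this
    have := hd.apply_eq_of_tendsto_cocompact (z j) (h0.comp ht)
    simpa [L] using this
  by_cases h1 : r < ‖z 0‖
  · exact slice 0 h1
  by_cases h2 : r < ‖z 1‖
  · exact slice 1 h2
  -- If both coordinates are at most `r` in modulus then `‖z‖ ≤ √2 r`, which is excluded by `2 r <
  -- ‖z‖`.
  exfalso
  have : ‖z‖ ^ 2 = ‖z 0‖ ^ 2 + ‖z 1‖ ^ 2 := by
    rw [EuclideanSpace.norm_sq_eq]; simp [Fin.sum_univ_two]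
  push Not at h1 h2
  nlinarith [norm_nonneg (z 0), norm_nonneg (z 1), norm_nonneg z]

/-- The identity theorem on a ball. -/
theorem eqOn_zero_of_ball {H : C2 → ℂ} {c : C2} {ρ : ℝ} (hH : DifferentiableOn ℂ H (ball c ρ))
    {y : C2} (hy : y ∈ ball c ρ) (h0 : H =ᶠ[nhds y] 0) {x : C2} (hx : x ∈ ball c ρ) : H x = 0 := by
  let L : ℂ → C2 := fun ζ => y + ζ • (x - y)
  have hL : ∀ ζ, HasDerivAt L (x - y) ζ := fun ζ => by
    have := ((hasDerivAt_id ζ).smul_const (x - y)).const_add y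
    rwa [one_smul] at this
  have hLc : Continuous L := continuous_iff_continuousAt.mpr fun ζ => (hL ζ).continuousAt
  have hV : IsOpen (L ⁻¹' ball c ρ) := isOpen_ball.preimage hLc
  have hconv : Convex ℝ (L ⁻¹' ball c ρ) := by
    intro a ha b hb s t hs ht hst
    have : L (s • a + t • b) = s • L a + t • L b := by
      simp only [L, smul_add, add_smul, smul_assoc]
      have : s • y + t • y = y := by rw [← add_smul, hst, one_smul]
      nth_rewrite 1 [← this]
      abel
    rw [Set.mem_preimage, this]
    exact (convex_ball c ρ) ha hb hs ht hst
  have hd : DifferentiableOn ℂ (fun ζ => H (L ζ)) (L ⁻¹' ball c ρ) :=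
    hH.comp (fun ζ _ => (hL ζ).differentiableAt.differentiableWithinAt) fun _ h => h
  have h00 : (fun ζ => H (L ζ)) =ᶠ[nhds 0] 0 := by
    have : Filter.Tendsto L (nhds 0) (nhds y) := by simpa [L] using hLc.tendsto 0
    exact this.eventually h0
  have := (hd.analyticOnNhd hV).eqOn_zero_of_preconnected_of_eventuallyEq_zero
    hconv.isPreconnected (z₀ := 0) (by simpa [L] using hy) h00 (x := 1) (by simpa [L] using hx)
  simpa [L] using this

end Holomorphic

end

section

/-! ### Real coordinates -/

/-- The real coordinates of a vector of `ℂ²`. -/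
def realCoord (v : C2) : Fin 4 → ℝ := ![(v 0).re, (v 0).im, (v 1).re, (v 1).im]

theorem sum_realCoord (v : C2) : ∑ i, realCoord v i • realFrame i = v := by
  ext a
  fin_cases a <;> apply Complex.ext <;> simp [Fin.sum_univ_four, realCoord, realFrame]

theorem realFrame_one : realFrame 1 = Complex.I • realFrame 0 := by
  ext a; fin_cases a <;> simp [realFrame]
theorem realFrame_three : realFrame 3 = Complex.I • realFrame 2 := by
  ext a; fin_cases a <;> simp [realFrame]

/-- The real coordinate frame as a basis. -/
def realBasis : Module.Basis (Fin 4) ℝ C2 :=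
  Module.Basis.ofEquivFun
    { toFun := realCoord
      map_add' := fun v w => by ext i; fin_cases i <;> simp [realCoord]
      map_smul' := fun c v => by ext i; fin_cases i <;> simp [realCoord]
      invFun := fun x => ∑ i, x i • realFrame i
      left_inv := sum_realCoord
      right_inv := fun x => by
        ext i; fin_cases i <;> simp [Fin.sum_univ_four, realCoord, realFrame] }

theorem realBasis_apply (i : Fin 4) : realBasis i = realFrame i := by
  rw [realBasis, Module.Basis.coe_ofEquivFun]
  change ∑ j, (Pi.single i (1 : ℝ) : Fin 4 → ℝ) j • realFrame j = _
  simp [Pi.single_apply]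

theorem bilin_expand (B : MultilinearMap ℝ (fun _ : Fin 2 => C2) ℝ) (v w : C2) :
    B ![v, w] = ∑ i, ∑ j, realCoord v i * realCoord w j * B ![realFrame i, realFrame j] := by
  have h0 : ∀ v w : C2, B ![v, w] = ∑ i, realCoord v i * B ![realFrame i, w] := by
    intro v w
    have : ∀ x : C2, B ![x, w] = B.toLinearMap ![0, w] 0 x := fun x => by
      rw [MultilinearMap.toLinearMap_apply]; congr 1; ext a; fin_cases a <;> rfl
    conv_lhs => rw [← sum_realCoord v, this, map_sum]
    simp [this]
  have h1 : ∀ v w : C2, B ![v, w] = ∑ i, realCoord w i * B ![v, realFrame i] := by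
    intro v w
    have : ∀ x : C2, B ![v, x] = B.toLinearMap ![v, 0] 1 x := fun x => by
      rw [MultilinearMap.toLinearMap_apply]; congr 1; ext a; fin_cases a <;> rfl
    conv_lhs => rw [← sum_realCoord w, this, map_sum]
    simp [this]
  rw [h0]
  refine Finset.sum_congr rfl fun i _ => ?_
  rw [h1, Finset.mul_sum]
  exact Finset.sum_congr rfl fun j _ => by ring

/-! ### Holomorphic parametrizations -/

section Surface

variable {X : Type*} [TopologicalSpace X] [ChartedSpace C2 X]

/-- A holomorphic local diffeomorphism. -/
structure IsParam (F : C2 → X) (U : Set C2) : Prop where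
  isOpen : IsOpen U
  mdiff : MDifferentiableOn 𝓘(ℂ, C2) 𝓘(ℂ, C2) F U
  bij : ∀ z ∈ U, Function.Bijective (mfderiv 𝓘(ℂ, C2) 𝓘(ℂ, C2) F z)

theorem ALEEnd.isParam {g : CovTensorField X 2} {k : ℕ} (A : ALEEnd g k) :
    IsParam A.chart {z | A.radius < ‖z‖} :=
  ⟨isOpen_lt continuous_const continuous_norm, A.holomorphic, A.bijective_mfderiv⟩

theorem IsParam.mono {F : C2 → X} {U V : Set C2} (h : IsParam F U) (hV : IsOpen V) (hVU : V ⊆ U) :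
    IsParam F V := ⟨hV, h.mdiff.mono hVU, fun z hz => h.bij z (hVU hz)⟩

theorem IsParam.continuousOn {F : C2 → X} {U : Set C2} (h : IsParam F U) : ContinuousOn F U :=
  h.mdiff.continuousOn

/-- The overlap of a parametrization with a chart. -/
def overlap (F : C2 → X) (U : Set C2) (e : OpenPartialHomeomorph X C2) : Set C2 :=
  U ∩ F ⁻¹' e.source

theorem IsParam.isOpen_overlap {F : C2 → X} {U : Set C2} (h : IsParam F U)
    (e : OpenPartialHomeomorph X C2) : IsOpen (overlap F U e) :=
  h.continuousOn.isOpen_inter_preimage h.isOpen e.open_source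

variable [IsManifold 𝓘(ℂ, C2) ω X]

theorem isParam_of_mem_atlas {e : OpenPartialHomeomorph X C2} (he : e ∈ atlas C2 X) :
    IsParam e.symm e.target := by
  have : IsManifold 𝓘(ℂ, C2) 1 X := IsManifold.of_le (n := ω) le_top
  refine ⟨e.open_target, mdifferentiableOn_atlas_symm he, fun z hz => ?_⟩
  have h1 := mdifferentiableAt_atlas_symm (I := 𝓘(ℂ, C2)) he hz
  have h2 := mdifferentiableAt_atlas (I := 𝓘(ℂ, C2)) he (e.map_target hz)
  have hE : e.MDifferentiable 𝓘(ℂ, C2) 𝓘(ℂ, C2) := mdifferentiable_of_mem_atlas he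
  exact (hE.symm.mfderiv_bijective (x := z) (by simpa using hz))

section Transition

variable {F : C2 → X} {U : Set C2} {e : OpenPartialHomeomorph X C2}

theorem IsParam.mdifferentiableAt_transition (h : IsParam F U) (he : e ∈ atlas C2 X)
    {z : C2} (hz : z ∈ overlap F U e) :
    MDifferentiableAt 𝓘(ℂ, C2) 𝓘(ℂ, C2) (e ∘ F) z := by
  have : IsManifold 𝓘(ℂ, C2) 1 X := IsManifold.of_le (n := ω) le_top
  exact (mdifferentiableAt_atlas (I := 𝓘(ℂ, C2)) he hz.2).comp z
    ((h.mdiff z hz.1).mdifferentiableAt (h.isOpen.mem_nhds hz.1))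

theorem IsParam.differentiableOn_transition (h : IsParam F U) (he : e ∈ atlas C2 X) :
    DifferentiableOn ℂ (e ∘ F) (overlap F U e) :=
  fun _ hz => (h.mdifferentiableAt_transition he hz).differentiableAt.differentiableWithinAt

theorem IsParam.contDiffOn_transition (h : IsParam F U) (he : e ∈ atlas C2 X) :
    ContDiffOn ℝ ∞ (e ∘ F) (overlap F U e) :=
  (contDiffOn_of_differentiableOn_C2 (h.isOpen_overlap e)
    (h.differentiableOn_transition he)).restrict_scalars ℝ

theorem IsParam.mfderiv_eq (h : IsParam F U) (he : e ∈ atlas C2 X)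
    {z : C2} (hz : z ∈ overlap F U e) (v : C2) :
    mfderiv 𝓘(ℂ, C2) 𝓘(ℂ, C2) F z v =
      mfderiv 𝓘(ℂ, C2) 𝓘(ℂ, C2) e.symm ((e ∘ F) z) (fderiv ℂ (e ∘ F) z v) := by
  have : IsManifold 𝓘(ℂ, C2) 1 X := IsManifold.of_le (n := ω) le_top
  have hev : F =ᶠ[nhds z] e.symm ∘ (e ∘ F) := by
    filter_upwards [(h.isOpen_overlap e).mem_nhds hz] with w hw
    simp [e.left_inv hw.2]
  have h1 := mdifferentiableAt_atlas_symm (I := 𝓘(ℂ, C2)) he (e.map_source hz.2)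
  have hc := mfderiv_comp (I := 𝓘(ℂ, C2)) (I' := 𝓘(ℂ, C2)) (I'' := 𝓘(ℂ, C2)) z h1
    (h.mdifferentiableAt_transition he hz)
  have := hev.mfderiv_eq (I := 𝓘(ℂ, C2)) (I' := 𝓘(ℂ, C2))
  rw [this, hc, mfderiv_eq_fderiv]
  rfl

theorem IsParam.bijective_fderiv (h : IsParam F U) (he : e ∈ atlas C2 X)
    {z : C2} (hz : z ∈ overlap F U e) :
    Function.Bijective (fderiv ℂ (e ∘ F) z) := by
  have hb := (isParam_of_mem_atlas he).bij _ (e.map_source hz.2)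
  have hF := h.bij z hz.1
  constructor
  · intro v w hvw
    apply hF.1
    rw [h.mfderiv_eq he hz, h.mfderiv_eq he hz, hvw]
  · intro w
    obtain ⟨v, hv⟩ := hF.2 (mfderiv 𝓘(ℂ, C2) 𝓘(ℂ, C2) e.symm ((e ∘ F) z) w)
    exact ⟨v, hb.1 ((h.mfderiv_eq he hz v).symm.trans hv)⟩

end Transition
end Surface

end

/-! ### Pull-backs of tensor fields and of the Kähler metric by parametrizations -/

section

section Surface

variable {X : Type*} [TopologicalSpace X] [ChartedSpace C2 X]

/-- The pull-back of a tensor field at a point. -/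
def pullAt {k : ℕ} (F : C2 → X) (T : CovTensorField X k) (z : C2) :
    MultilinearMap ℝ (fun _ : Fin k => C2) ℝ :=
  (T (F z)).compLinearMap fun _ =>
    ((mfderiv 𝓘(ℂ, C2) 𝓘(ℂ, C2) F z).toLinearMap.restrictScalars ℝ :)

theorem pullAt_apply {k : ℕ} (F : C2 → X) (T : CovTensorField X k) (z : C2) (v : Fin k → C2) :
    pullAt F T z v = T (F z) fun a => mfderiv 𝓘(ℂ, C2) 𝓘(ℂ, C2) F z (v a) := rfl

theorem comps_eq_pullAt {k : ℕ} (F : C2 → X) (T : CovTensorField X k) (z : C2) (I : Fin k → Fin 4) :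
    comps F T z I = pullAt F T z fun a => realFrame (I a) := rfl

theorem comps_two (F : C2 → X) (T : CovTensorField X 2) (z : C2) (i j : Fin 4) :
    comps F T z ![i, j] = pullAt F T z ![realFrame i, realFrame j] := by
  rw [comps_eq_pullAt]; congr 1; ext a; fin_cases a <;> rfl

theorem pullAt_two (F : C2 → X) (T : CovTensorField X 2) (z v w : C2) :
    pullAt F T z ![v, w] = T (F z) ![mfderiv 𝓘(ℂ, C2) 𝓘(ℂ, C2) F z v,
      mfderiv 𝓘(ℂ, C2) 𝓘(ℂ, C2) F z w] := by
  rw [pullAt_apply]; congr 1; ext a; fin_cases a <;> rfl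

theorem pullAt_expand (F : C2 → X) (T : CovTensorField X 2) (z v w : C2) :
    pullAt F T z ![v, w] = ∑ i, ∑ j, realCoord v i * realCoord w j * comps F T z ![i, j] := by
  rw [bilin_expand]; simp only [comps_two]

variable {g : CovTensorField X 2}

theorem pullAt_symm (hg : IsKahlerMetric g) (F : C2 → X) (z v w : C2) :
    pullAt F g z ![v, w] = pullAt F g z ![w, v] := by
  rw [pullAt_two, pullAt_two, hg.symm]

theorem pullAt_hermitian (hg : IsKahlerMetric g) (F : C2 → X) (z v w : C2) :
    pullAt F g z ![Complex.I • v, Complex.I • w] = pullAt F g z ![v, w] := by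
  have key : ∀ v : C2, (mfderiv 𝓘(ℂ, C2) 𝓘(ℂ, C2) F z (Complex.I • v) : TangentSpace 𝓘(ℂ, C2) (F z))
      = Complex.I • mfderiv 𝓘(ℂ, C2) 𝓘(ℂ, C2) F z v := fun v =>
    (mfderiv 𝓘(ℂ, C2) 𝓘(ℂ, C2) F z).map_smul Complex.I v
  have := hg.hermitian (F z) (mfderiv 𝓘(ℂ, C2) 𝓘(ℂ, C2) F z v) (mfderiv 𝓘(ℂ, C2) 𝓘(ℂ, C2) F z w)
  rw [← key, ← key] at this
  rw [pullAt_two, pullAt_two]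
  exact this

theorem pullAt_pos (hg : IsKahlerMetric g) {F : C2 → X} {U : Set C2} (hF : IsParam F U) {z : C2}
    (hz : z ∈ U) {v : C2} (hv : v ≠ 0) : 0 < pullAt F g z ![v, v] := by
  rw [pullAt_two]
  refine hg.pos _ _ fun h => hv ((hF.bij z hz).1 (h.trans (map_zero _).symm))

theorem pullAt_neg_left (F : C2 → X) (T : CovTensorField X 2) (z v w : C2) :
    pullAt F T z ![-v, w] = - pullAt F T z ![v, w] := by
  rw [pullAt_expand, pullAt_expand]
  have : realCoord (-v) = -realCoord v := by ext i; fin_cases i <;> simp [realCoord]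
  simp [this]

/-- The algebraic properties of the components of a Hermitian metric. -/
structure HermTable (G : Comp 2) : Prop where
  symm : ∀ z i j, G z ![i, j] = G z ![j, i]
  h11 : ∀ z, G z ![1, 1] = G z ![0, 0]
  h33 : ∀ z, G z ![3, 3] = G z ![2, 2]
  h13 : ∀ z, G z ![1, 3] = G z ![0, 2]
  h12 : ∀ z, G z ![1, 2] = - G z ![0, 3]
  h01 : ∀ z, G z ![0, 1] = 0
  h23 : ∀ z, G z ![2, 3] = 0

/-- Only complex linearity of the differential of `F` is used, and this persists when `F` is not
differentiable, the differential then being zero. Hence there is no hypothesis on `F`. -/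
theorem hermTable (hg : IsKahlerMetric g) (F : C2 → X) : HermTable (comps F g) := by
  have I2 : ∀ v : C2, Complex.I • Complex.I • v = -v := fun v => by
    rw [smul_smul, Complex.I_mul_I, neg_one_smul]
  have J : ∀ z v w, pullAt F g z ![Complex.I • v, w] = - pullAt F g z ![v, Complex.I • w] := by
    intro z v w
    rw [← pullAt_hermitian hg, I2, pullAt_neg_left]
  refine ⟨?_, ?_, ?_, ?_, ?_, ?_, ?_⟩ <;> intros <;>
    simp only [comps_two, realFrame_one, realFrame_three, pullAt_hermitian hg]
  · exact pullAt_symm hg _ _ _ _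
  · rw [J]
  · have := J ‹C2› (realFrame 0) (realFrame 0)
    rw [pullAt_symm hg] at this
    linarith
  · have := J ‹C2› (realFrame 2) (realFrame 2)
    rw [pullAt_symm hg] at this
    linarith

theorem comps_pos (hg : IsKahlerMetric g) {F : C2 → X} {U : Set C2} (hF : IsParam F U) {z : C2}
    (hz : z ∈ U) : 0 < comps F g z ![0, 0] ∧ 0 < vol (comps F g) z := by
  have ht := hermTable hg F
  have h0 : 0 < comps F g z ![0, 0] := by
    rw [comps_two]
    refine pullAt_pos hg hF hz fun h => ?_
    have := congrArg (fun v : C2 => v 0) h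
    simp [realFrame] at this
  refine ⟨h0, ?_⟩
  set a := comps F g z ![0, 0]
  set b := comps F g z ![2, 2] with hb
  set c := comps F g z ![0, 2] with hc
  set d := comps F g z ![0, 3] with hd
  -- This vector is orthogonal to the first coordinate direction for the Hermitian metric, and its
  -- square length is `a` times the determinant.
  have hv : (!₂[-((c : ℂ) - d * Complex.I), (a : ℂ)] : C2) ≠ 0 := fun h => by
    have := congrArg (fun v : C2 => v 1) h
    simp at this
    exact h0.ne' this
  have := pullAt_pos hg hF hz hv
  rw [pullAt_expand] at this
  simp [Fin.sum_univ_four, realCoord, ht.h11 z, ht.h33 z, ht.h13 z, ht.h12 z, ht.h01 z, ht.h23 z,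
    ht.symm z 1 0, ht.symm z 2 0, ht.symm z 3 0, ht.symm z 2 1, ht.symm z 3 1, ht.symm z 3 2] at this
  have e : 0 < a * vol (comps F g) z := by
    rw [vol]
    convert this using 1
    ring
  exact (mul_pos_iff_of_pos_left h0).mp e

theorem kahlerForm_eq (F : C2 → X) (i j : Fin 4) (z : C2) :
    kahlerForm F g i j z = pullAt F g z ![Complex.I • realFrame i, realFrame j] := by
  have key : (mfderiv 𝓘(ℂ, C2) 𝓘(ℂ, C2) F z (Complex.I • realFrame i) :
      TangentSpace 𝓘(ℂ, C2) (F z)) = Complex.I • mfderiv 𝓘(ℂ, C2) 𝓘(ℂ, C2) F z (realFrame i) :=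
    (mfderiv 𝓘(ℂ, C2) 𝓘(ℂ, C2) F z).map_smul Complex.I (realFrame i)
  rw [pullAt_two, kahlerForm, frameAt, frameAt, ← key]

/-- The components of a Kähler metric in a chart. -/
theorem IsKahlerMetric.kahlerComps [IsManifold 𝓘(ℂ, C2) ω X] (hg : IsKahlerMetric g)
    {e : OpenPartialHomeomorph X C2} (he : e ∈ atlas C2 X) :
    KahlerComps e.target (comps e.symm g) := by
  have ht := hermTable hg e.symm
  have hp := isParam_of_mem_atlas he
  have I2 : ∀ v : C2, Complex.I • Complex.I • v = -v := fun v => by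
    rw [smul_smul, Complex.I_mul_I, neg_one_smul]
  have w01 : kahlerForm e.symm g 0 1 = fun z => comps e.symm g z ![0, 0] := by
    ext z; rw [kahlerForm_eq, ← realFrame_one, ← comps_two, ht.h11]
  have w23 : kahlerForm e.symm g 2 3 = fun z => comps e.symm g z ![2, 2] := by
    ext z; rw [kahlerForm_eq, ← realFrame_three, ← comps_two, ht.h33]
  have w02 : kahlerForm e.symm g 0 2 = fun z => - comps e.symm g z ![0, 3] := by
    ext z; rw [kahlerForm_eq, ← realFrame_one, ← comps_two, ht.h12]
  have w20 : kahlerForm e.symm g 2 0 = fun z => comps e.symm g z ![0, 3] := by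
    ext z; rw [kahlerForm_eq, ← realFrame_three, ← comps_two, ht.symm]
  have w03 : kahlerForm e.symm g 0 3 = fun z => comps e.symm g z ![0, 2] := by
    ext z; rw [kahlerForm_eq, ← realFrame_one, ← comps_two, ht.h13]
  have w30 : kahlerForm e.symm g 3 0 = fun z => - comps e.symm g z ![0, 2] := by
    ext z
    rw [kahlerForm_eq, realFrame_three, I2, pullAt_neg_left, ← comps_two, ht.symm]
  have w12 : kahlerForm e.symm g 1 2 = fun z => - comps e.symm g z ![0, 2] := by
    ext z
    rw [kahlerForm_eq, realFrame_one, I2, pullAt_neg_left, ← comps_two]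
  have w31 : kahlerForm e.symm g 3 1 = fun z => comps e.symm g z ![0, 3] := by
    ext z
    rw [kahlerForm_eq, realFrame_three, I2, pullAt_neg_left, ← comps_two, ht.symm, ht.h12, neg_neg]
  have w13 : kahlerForm e.symm g 1 3 = fun z => - comps e.symm g z ![0, 3] := by
    ext z
    rw [kahlerForm_eq, realFrame_one, I2, pullAt_neg_left, ← comps_two]
  refine ⟨e.open_target, fun I => hg.smooth e he I, ht.symm, ht.h11, ht.h33, ht.h13, ht.h12, ht.h01,
    ht.h23, fun z hz => (comps_pos hg hp hz).1, fun z hz => (comps_pos hg hp hz).2, ?_, ?_, ?_, ?_⟩ <;>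
    intro z hz
  · have := hg.closed e he z hz 0 1 2
    rw [w12, w20, w01, pd_neg] at this
    linarith
  · have := hg.closed e he z hz 0 1 3
    rw [w13, w30, w01, pd_neg, pd_neg] at this
    linarith
  · have := hg.closed e he z hz 0 2 3
    rw [w23, w30, w02, pd_neg, pd_neg] at this
    linarith
  · have := hg.closed e he z hz 1 2 3
    rw [w23, w31, w12, pd_neg] at this
    linarith

variable [IsManifold 𝓘(ℂ, C2) ω X] {F : C2 → X} {U : Set C2} {e : OpenPartialHomeomorph X C2}

theorem IsParam.pullAt_eq (h : IsParam F U) (he : e ∈ atlas C2 X) {k : ℕ} (T : CovTensorField X k)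
    {z : C2} (hz : z ∈ overlap F U e) (v : Fin k → C2) :
    pullAt F T z v = pullAt e.symm T ((e ∘ F) z) fun a => fderiv ℂ (e ∘ F) z (v a) := by
  simp only [pullAt_apply]
  -- The points `F z` and `e.symm (e (F z))` are equal only by a proof, so the tangent spaces at
  -- them are identified through the common model `C2`.
  have key : ∀ (x y : X) (w : Fin k → C2), x = y → T x w = T y w := by
    intro x y w hxy; subst hxy; rfl
  have h1 : (fun a => (mfderiv 𝓘(ℂ, C2) 𝓘(ℂ, C2) F z (v a) : C2)) = fun a =>
    (mfderiv 𝓘(ℂ, C2) 𝓘(ℂ, C2) e.symm ((e ∘ F) z) (fderiv ℂ (e ∘ F) z (v a)) : C2) :=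
    funext fun a => h.mfderiv_eq he hz (v a)
  have h2 := key (F z) (e.symm ((e ∘ F) z))
    (fun a => (mfderiv 𝓘(ℂ, C2) 𝓘(ℂ, C2) F z (v a) : C2)) (e.left_inv hz.2).symm
  rw [h1] at h2
  rw [← h2, ← h1]

theorem IsParam.comps_eq_sum (h : IsParam F U) (he : e ∈ atlas C2 X) (T : CovTensorField X 2)
    {z : C2} (hz : z ∈ overlap F U e) (i j : Fin 4) :
    comps F T z ![i, j] = ∑ k, ∑ l, realCoord (fderiv ℂ (e ∘ F) z (realFrame i)) k *
      realCoord (fderiv ℂ (e ∘ F) z (realFrame j)) l * comps e.symm T ((e ∘ F) z) ![k, l] := by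
  rw [comps_two, h.pullAt_eq he T hz, ← pullAt_expand]
  congr 1; ext a; fin_cases a <;> rfl

end Surface

end

section

open scoped ComplexConjugate

/-! ### The Cauchy-Riemann operator -/

/-- The antilinear part of the differential. -/
def dbar (F : C2 → ℂ) (z v : C2) : ℂ :=
  1 / 2 * (fderiv ℝ F z v + Complex.I * fderiv ℝ F z (Complex.I • v))

/-- The complex coordinate frame. -/
def cFrame : Fin 2 → C2 := ![realFrame 0, realFrame 2]

/-- The derivatives `∂/∂z̄_β`. -/
def eb (β : Fin 2) (F : C2 → ℂ) (z : C2) : ℂ := dbar F z (cFrame β)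

theorem eb_zero (F : C2 → ℂ) (z : C2) : eb 0 F z =
    1 / 2 * (fderiv ℝ F z (realFrame 0) + Complex.I * fderiv ℝ F z (realFrame 1)) := by
  rw [realFrame_one]; rfl
theorem eb_one (F : C2 → ℂ) (z : C2) : eb 1 F z =
    1 / 2 * (fderiv ℝ F z (realFrame 2) + Complex.I * fderiv ℝ F z (realFrame 3)) := by
  rw [realFrame_three]; rfl

theorem sum_cFrame (v : C2) : ∑ β, v β • cFrame β = v := by
  ext a; fin_cases a <;> simp [cFrame, realFrame]

theorem dbar_add_right (F : C2 → ℂ) (z v w : C2) :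
    dbar F z (v + w) = dbar F z v + dbar F z w := by
  simp only [dbar, smul_add, map_add]; ring

theorem dbar_smul_right (F : C2 → ℂ) (z : C2) (c : ℂ) (v : C2) :
    dbar F z (c • v) = conj c * dbar F z v := by
  have e1 : c • v = c.re • v + c.im • (Complex.I • v) := by
    conv_lhs => rw [← Complex.re_add_im c, add_smul, mul_smul]
    simp only [Complex.coe_smul]
  have e2 : Complex.I • c • v = c.re • (Complex.I • v) - c.im • v := by
    rw [e1, smul_add, smul_comm Complex.I c.re, smul_comm Complex.I c.im, smul_smul Complex.I,
      Complex.I_mul_I, neg_one_smul, smul_neg]; abel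
  have e3 : conj c = c.re - c.im * Complex.I := by
    apply Complex.ext <;> simp
  have f1 : fderiv ℝ F z (c • v) = c.re * fderiv ℝ F z v + c.im * fderiv ℝ F z (Complex.I • v) := by
    rw [e1, map_add, (fderiv ℝ F z).map_smul, (fderiv ℝ F z).map_smul]; simp only [Complex.real_smul]
  have f2 : fderiv ℝ F z (Complex.I • c • v) =
      c.re * fderiv ℝ F z (Complex.I • v) - c.im * fderiv ℝ F z v := by
    rw [e2, map_sub, (fderiv ℝ F z).map_smul, (fderiv ℝ F z).map_smul]; simp only [Complex.real_smul]
  rw [dbar, f1, f2, dbar, e3]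
  linear_combination (1 / 2 * (c.im : ℂ) * fderiv ℝ F z (Complex.I • v)) * Complex.I_sq

theorem dbar_eq_sum (F : C2 → ℂ) (z v : C2) : dbar F z v = ∑ β, conj (v β) * eb β F z := by
  conv_lhs => rw [← sum_cFrame v]
  simp [Fin.sum_univ_two, dbar_add_right, dbar_smul_right, eb]

theorem dbar_comp {F : C2 → ℂ} {τ : C2 → C2} {z : C2} (hF : DifferentiableAt ℝ F (τ z))
    (hτ : DifferentiableAt ℂ τ z) (v : C2) :
    dbar (F ∘ τ) z v = dbar F (τ z) (fderiv ℂ τ z v) := by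
  have h := (hF.hasFDerivAt.comp z (hτ.hasFDerivAt.restrictScalars ℝ)).fderiv
  simp [dbar, h]

theorem eb_comp {F : C2 → ℂ} {τ : C2 → C2} {z : C2} (hF : DifferentiableAt ℝ F (τ z))
    (hτ : DifferentiableAt ℂ τ z) (ε : Fin 2) :
    eb ε (F ∘ τ) z = ∑ β, conj (fderiv ℂ τ z (cFrame ε) β) * eb β F (τ z) := by
  rw [eb, dbar_comp hF hτ, dbar_eq_sum]

theorem eb_add {F H : C2 → ℂ} {z : C2} (hF : DifferentiableAt ℝ F z) (hH : DifferentiableAt ℝ H z)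
    (ε : Fin 2) : eb ε (fun w => F w + H w) z = eb ε F z + eb ε H z := by
  have : fderiv ℝ (fun w => F w + H w) z = fderiv ℝ F z + fderiv ℝ H z := fderiv_add hF hH
  simp only [eb, dbar, this, add_apply]; ring

theorem eb_mul {F H : C2 → ℂ} {z : C2} (hF : DifferentiableAt ℝ F z) (hH : DifferentiableAt ℝ H z)
    (ε : Fin 2) : eb ε (fun w => F w * H w) z = eb ε F z * H z + F z * eb ε H z := by
  have : fderiv ℝ (fun w => F w * H w) z = F z • fderiv ℝ H z + H z • fderiv ℝ F z := fderiv_mul hF hH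
  simp only [eb, dbar, this, add_apply, smul_apply, smul_eq_mul]; ring

theorem eb_holomorphic {F : C2 → ℂ} {z : C2} (hF : DifferentiableAt ℂ F z) (ε : Fin 2) :
    eb ε F z = 0 := by
  rw [eb, dbar, (hF.hasFDerivAt.restrictScalars ℝ).fderiv]
  simp only [ContinuousLinearMap.coe_restrictScalars', map_smul, smul_eq_mul]
  linear_combination (1 / 2 * fderiv ℂ F z (cFrame ε)) * Complex.I_mul_I

theorem eb_congr {F H : C2 → ℂ} {z : C2} (h : F =ᶠ[nhds z] H) (ε : Fin 2) : eb ε F z = eb ε H z := by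
  simp only [eb, dbar, h.fderiv_eq]

theorem contDiffOn_eb {F : C2 → ℂ} {U : Set C2} (hU : IsOpen U) (hF : ContDiffOn ℝ ∞ F U)
    (ε : Fin 2) : ContDiffOn ℝ ∞ (eb ε F) U := by
  have := ContDiffOn.fderiv_of_isOpen (m := ∞) hF hU (by simp)
  exact contDiffOn_const.mul ((this.clm_apply contDiffOn_const).add
    (contDiffOn_const.mul (this.clm_apply contDiffOn_const)))

/-- A real differentiable function with vanishing `∂̄` is holomorphic. -/
theorem differentiableAt_of_eb {F : C2 → ℂ} {z : C2} (hF : DifferentiableAt ℝ F z)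
    (h : ∀ ε, eb ε F z = 0) : DifferentiableAt ℂ F z := by
  rw [differentiableAt_iff_restrictScalars ℝ hF]
  have hI : ∀ v, fderiv ℝ F z (Complex.I • v) = Complex.I * fderiv ℝ F z v := by
    intro v
    have : dbar F z v = 0 := by rw [dbar_eq_sum]; simp [h]
    rw [dbar] at this
    linear_combination (-2 * Complex.I) * this + (fderiv ℝ F z (Complex.I • v)) * Complex.I_mul_I
  refine ⟨{ toFun := fderiv ℝ F z, map_add' := map_add _, map_smul' := fun c v => ?_,
            cont := (fderiv ℝ F z).cont }, rfl⟩
  have e1 : c • v = c.re • v + c.im • (Complex.I • v) := by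
    conv_lhs => rw [← Complex.re_add_im c, add_smul, mul_smul]
    simp only [Complex.coe_smul]
  rw [e1, map_add, map_smul, map_smul, hI]
  simp only [Complex.real_smul, RingHom.id_apply, smul_eq_mul]
  conv_rhs => rw [← Complex.re_add_im c]
  ring

/-! ### Hermitian coefficients -/

/-- The Hermitian matrix of the metric. -/
def hmat (G : Comp 2) (z : C2) : Matrix (Fin 2) (Fin 2) ℂ :=
  !![(G z ![0, 0] : ℂ), G z ![0, 2] + Complex.I * G z ![0, 3];
    G z ![0, 2] - Complex.I * G z ![0, 3], (G z ![2, 2] : ℂ)]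

theorem det_hmat (G : Comp 2) (z : C2) : (hmat G z).det = vol G z := by
  simp [hmat, Matrix.det_fin_two, vol]
  linear_combination (G z ![0, 3] : ℂ) ^ 2 * Complex.I_sq

/-- The components of a Hermitian metric on `U`. -/
structure HermComps (U : Set C2) (G : Comp 2) : Prop where
  isOpen : IsOpen U
  smooth : ∀ I, ContDiffOn ℝ ∞ (fun z => G z I) U
  table : HermTable G
  pos : ∀ z ∈ U, 0 < G z ![0, 0]
  vol_pos : ∀ z ∈ U, 0 < vol G z

/-- Half the gradient, as a complex vector. -/
def gv (G : Comp 2) (u : C2 → ℝ) (z : C2) : Fin 2 → ℂ :=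
  ![(vol G z : ℂ)⁻¹ * (hmat G z 1 1 * eb 0 (fun w => (u w : ℂ)) z
      - hmat G z 1 0 * eb 1 (fun w => (u w : ℂ)) z),
    (vol G z : ℂ)⁻¹ * (hmat G z 0 0 * eb 1 (fun w => (u w : ℂ)) z
      - hmat G z 0 1 * eb 0 (fun w => (u w : ℂ)) z)]

/-- The antiholomorphic derivative of the gradient. -/
def hess (G : Comp 2) (u : C2 → ℝ) (z : C2) : Matrix (Fin 2) (Fin 2) ℂ :=
  Matrix.of fun δ ε => eb ε (fun w => gv G u w δ) z

/-- The `(1,0)` form dual to `∂̄h`. -/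
def bv (G : Comp 2) (h : C2 → ℂ) (z : C2) : Fin 2 → ℂ :=
  ![(vol G z : ℂ)⁻¹ * (hmat G z 0 0 * eb 1 h z - hmat G z 0 1 * eb 0 h z),
    (vol G z : ℂ)⁻¹ * (hmat G z 1 0 * eb 1 h z - hmat G z 1 1 * eb 0 h z)]

/-- Its antiholomorphic derivative. -/
def pmat (G : Comp 2) (h : C2 → ℂ) (z : C2) : Matrix (Fin 2) (Fin 2) ℂ :=
  Matrix.of fun α β => eb β (fun w => bv G h w α) z

namespace HermComps
variable {U : Set C2} {G : Comp 2}

theorem contDiffOn_ofReal {F : C2 → ℝ} (hF : ContDiffOn ℝ ∞ F U) :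
    ContDiffOn ℝ ∞ (fun z => (F z : ℂ)) U := Complex.ofRealCLM.contDiff.comp_contDiffOn hF

theorem contDiffOn_hmat (h : HermComps U G) (α β : Fin 2) :
    ContDiffOn ℝ ∞ (fun z => hmat G z α β) U := by
  have s := fun I => contDiffOn_ofReal (h.smooth I)
  fin_cases α <;> fin_cases β <;> simp only [hmat] <;> simp
  · exact s _
  · exact (s _).add (contDiffOn_const.mul (s _))
  · exact (s _).sub (contDiffOn_const.mul (s _))
  · exact s _

theorem contDiffOn_vol_inv (h : HermComps U G) :
    ContDiffOn ℝ ∞ (fun z => (vol G z : ℂ)⁻¹) U := by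
  have : ContDiffOn ℝ ∞ (vol G) U := by
    unfold vol
    exact (((h.smooth _).mul (h.smooth _)).sub ((h.smooth _).pow 2)).sub ((h.smooth _).pow 2)
  exact (contDiffOn_ofReal this).inv fun z hz => by exact_mod_cast (h.vol_pos z hz).ne'

theorem contDiffOn_gv (h : HermComps U G) {u : C2 → ℝ} (hu : ContDiffOn ℝ ∞ u U) (δ : Fin 2) :
    ContDiffOn ℝ ∞ (fun z => gv G u z δ) U := by
  have e := contDiffOn_eb h.isOpen (contDiffOn_ofReal hu)
  have s := h.contDiffOn_hmat
  fin_cases δ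
  · exact h.contDiffOn_vol_inv.mul (((s _ _).mul (e _)).sub ((s _ _).mul (e _)))
  · exact h.contDiffOn_vol_inv.mul (((s _ _).mul (e _)).sub ((s _ _).mul (e _)))

theorem contDiffOn_bv (h : HermComps U G) {x : C2 → ℂ} (hx : ContDiffOn ℝ ∞ x U) (α : Fin 2) :
    ContDiffOn ℝ ∞ (fun z => bv G x z α) U := by
  have e := contDiffOn_eb h.isOpen hx
  have s := h.contDiffOn_hmat
  fin_cases α
  · exact h.contDiffOn_vol_inv.mul (((s _ _).mul (e _)).sub ((s _ _).mul (e _)))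
  · exact h.contDiffOn_vol_inv.mul (((s _ _).mul (e _)).sub ((s _ _).mul (e _)))

end HermComps

/-! ### Behaviour under holomorphic changes of coordinates -/

/-- The complex Jacobian matrix. -/
def jac (τ : C2 → C2) (z : C2) : Matrix (Fin 2) (Fin 2) ℂ :=
  Matrix.of fun a b => fderiv ℂ τ z (cFrame b) a

/-- `G` is the pull-back of `G'` by `τ` on `V`. -/
def IsPull (τ : C2 → C2) (V : Set C2) (T T' : Comp 2) : Prop :=
  ∀ z ∈ V, ∀ i j, T z ![i, j] = ∑ k, ∑ l, realCoord (fderiv ℂ τ z (realFrame i)) k *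
      realCoord (fderiv ℂ τ z (realFrame j)) l * T' (τ z) ![k, l]

theorem realCoord_fderiv (τ : C2 → C2) (z : C2) :
    realCoord (fderiv ℂ τ z (realFrame 0)) =
      ![(jac τ z 0 0).re, (jac τ z 0 0).im, (jac τ z 1 0).re, (jac τ z 1 0).im] ∧
    realCoord (fderiv ℂ τ z (realFrame 1)) =
      ![-(jac τ z 0 0).im, (jac τ z 0 0).re, -(jac τ z 1 0).im, (jac τ z 1 0).re] ∧
    realCoord (fderiv ℂ τ z (realFrame 2)) =
      ![(jac τ z 0 1).re, (jac τ z 0 1).im, (jac τ z 1 1).re, (jac τ z 1 1).im] ∧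
    realCoord (fderiv ℂ τ z (realFrame 3)) =
      ![-(jac τ z 0 1).im, (jac τ z 0 1).re, -(jac τ z 1 1).im, (jac τ z 1 1).re] := by
  rw [realFrame_one, realFrame_three, map_smul, map_smul]
  refine ⟨?_, ?_, ?_, ?_⟩ <;> ext i <;> fin_cases i <;> simp [realCoord, jac, cFrame]

theorem IsPull.hmat_eq {τ : C2 → C2} {V : Set C2} {G G' : Comp 2} (h : IsPull τ V G G')
    (ht : HermTable G') {z : C2} (hz : z ∈ V) :
    hmat G z = (jac τ z).transpose * hmat G' (τ z) * (jac τ z).map conj := by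
  obtain ⟨r0, r1, r2, r3⟩ := realCoord_fderiv τ z
  have H := h z hz
  generalize jac τ z = J at *
  have T := ht.symm (τ z)
  ext a b
  fin_cases a <;> fin_cases b <;> simp only [hmat, H, Fin.sum_univ_four, r0, r2, r3] <;>
    apply Complex.ext <;>
    simp [Matrix.mul_apply, Fin.sum_univ_two, T 1 0, T 2 0, T 3 0, T 2 1, T 3 1, T 3 2,
      ht.h11, ht.h33, ht.h13, ht.h12, ht.h01, ht.h23] <;> ring

end

/-! ### Behaviour of gradients, Hessians and dual forms under holomorphic maps -/

section

open scoped ComplexConjugate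

/-- A holomorphic change of coordinates between two Hermitian metrics. -/
structure Pull (τ : C2 → C2) (V : Set C2) (G : Comp 2) (U' : Set C2) (G' : Comp 2) : Prop where
  diff : DifferentiableOn ℂ τ V
  maps : ∀ z ∈ V, τ z ∈ U'
  det : ∀ z ∈ V, (jac τ z).det ≠ 0
  pull : IsPull τ V G G'
  herm : HermComps V G
  herm' : HermComps U' G'

namespace Pull
variable {τ : C2 → C2} {V : Set C2} {G : Comp 2} {U' : Set C2} {G' : Comp 2}

theorem vol_eq (P : Pull τ V G U' G') {z : C2} (hz : z ∈ V) :
    (vol G z : ℂ) = (jac τ z).det * conj (jac τ z).det * vol G' (τ z) := by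
  have hc : ((jac τ z).map conj).det = conj (jac τ z).det := by
    simp [Matrix.det_fin_two]
  rw [← det_hmat, P.pull.hmat_eq P.herm'.table hz, Matrix.det_mul, Matrix.det_mul,
    Matrix.det_transpose, det_hmat, hc]
  ring

theorem differentiableAt (P : Pull τ V G U' G') {z : C2} (hz : z ∈ V) : DifferentiableAt ℂ τ z :=
  P.diff.differentiableAt (P.herm.isOpen.mem_nhds hz)

theorem differentiableOn_jac (P : Pull τ V G U' G') (a b : Fin 2) :
    DifferentiableOn ℂ (fun z => jac τ z a b) V := by
  have h := (contDiffOn_infty_iff_fderiv_of_isOpen P.herm.isOpen).mp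
    (contDiffOn_of_differentiableOn_C2 P.herm.isOpen P.diff)
  have h2 : DifferentiableOn ℂ (fun z => fderiv ℂ τ z (cFrame b)) V :=
    (h.2.differentiableOn (by simp)).clm_apply (differentiableOn_const _)
  exact fun z hz => (EuclideanSpace.proj (𝕜 := ℂ) a).differentiableAt.comp_differentiableWithinAt z
    (h2 z hz)

theorem differentiableAt_jac (P : Pull τ V G U' G') (a b : Fin 2) {z : C2} (hz : z ∈ V) :
    DifferentiableAt ℂ (fun z => jac τ z a b) z :=
  (P.differentiableOn_jac a b).differentiableAt (P.herm.isOpen.mem_nhds hz)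

theorem hmat_entries (P : Pull τ V G U' G') {z : C2} (hz : z ∈ V) (α β : Fin 2) :
    hmat G z α β = (jac τ z 0 α * hmat G' (τ z) 0 0 + jac τ z 1 α * hmat G' (τ z) 1 0)
      * conj (jac τ z 0 β) +
      (jac τ z 0 α * hmat G' (τ z) 0 1 + jac τ z 1 α * hmat G' (τ z) 1 1) * conj (jac τ z 1 β) := by
  rw [P.pull.hmat_eq P.herm'.table hz]
  simp [Matrix.mul_apply, Fin.sum_univ_two]

theorem eb_comp (P : Pull τ V G U' G') {z : C2} (hz : z ∈ V) {x : C2 → ℂ}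
    (hx : ContDiffOn ℝ ∞ x U') (ε : Fin 2) :
    eb ε (fun w => x (τ w)) z =
      conj (jac τ z 0 ε) * eb 0 x (τ z) + conj (jac τ z 1 ε) * eb 1 x (τ z) := by
  have hd : DifferentiableAt ℝ x (τ z) :=
    (hx.contDiffAt (P.herm'.isOpen.mem_nhds (P.maps z hz))).differentiableAt (by simp)
  have := ALEKahler.eb_comp hd (P.differentiableAt hz) ε
  rw [Fin.sum_univ_two] at this
  exact this

theorem contDiffOn_comp (P : Pull τ V G U' G') {E : Type*} [NormedAddCommGroup E] [NormedSpace ℝ E]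
    {x : C2 → E} (hx : ContDiffOn ℝ ∞ x U') : ContDiffOn ℝ ∞ (fun z => x (τ z)) V :=
  hx.comp ((contDiffOn_of_differentiableOn_C2 P.herm.isOpen P.diff).restrict_scalars ℝ) P.maps

/-- The gradient is a (1,0) vector field: `∂̄u` and the inverse metric transform by conjugate
Jacobians, which cancel and leave the holomorphic one. -/
theorem gv_eq (P : Pull τ V G U' G') {z : C2} (hz : z ∈ V) {u : C2 → ℝ} (hu : ContDiffOn ℝ ∞ u U')
    (a : Fin 2) : jac τ z a 0 * gv G (fun w => u (τ w)) z 0 + jac τ z a 1 * gv G (fun w => u (τ w)) z 1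
      = gv G' u (τ z) a := by
  have e := P.eb_comp hz (HermComps.contDiffOn_ofReal hu)
  have hd := P.det z hz
  have hd' : conj (jac τ z).det ≠ 0 := by simpa using hd
  have hv : (vol G' (τ z) : ℂ) ≠ 0 := by exact_mod_cast (P.herm'.vol_pos _ (P.maps z hz)).ne'
  simp only [gv, e, P.vol_eq hz, P.hmat_entries hz]
  generalize (vol G' (τ z) : ℂ) = W at *
  generalize eb 0 (fun w => (u w : ℂ)) (τ z) = x0
  generalize eb 1 (fun w => (u w : ℂ)) (τ z) = x1
  generalize hmat G' (τ z) = h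
  rw [Matrix.det_fin_two] at hd hd' ⊢
  simp only [map_sub, map_mul] at hd' ⊢
  clear e
  fin_cases a <;>
    simp only [Fin.zero_eta, Fin.mk_one, Matrix.cons_val_zero, Matrix.cons_val_one] <;>
    generalize jac τ z 0 0 = j00, jac τ z 0 1 = j01, jac τ z 1 0 = j10, jac τ z 1 1 = j11 at * <;>
    generalize conj j00 = k00, conj j01 = k01, conj j10 = k10, conj j11 = k11 at * <;>
    generalize hΔ : j00 * j11 - j01 * j10 = Δ at * <;>
    generalize hΔ' : k00 * k11 - k01 * k10 = Δ' at * <;>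
    field_simp <;> rw [← hΔ, ← hΔ'] <;> ring

/-- Apply `∂̄` to `gv_eq`. The Jacobian is holomorphic, so it produces no extra term, and `∂̄` of a
vector field is a tensor without any connection. -/
theorem hess_eq (P : Pull τ V G U' G') {z : C2} (hz : z ∈ V) {u : C2 → ℝ} (hu : ContDiffOn ℝ ∞ u U') :
    jac τ z * hess G (fun w => u (τ w)) z = hess G' u (τ z) * (jac τ z).map conj := by
  have hVn := P.herm.isOpen.mem_nhds hz
  ext a ε
  have hev : (fun w => jac τ w a 0 * gv G (fun w => u (τ w)) w 0
      + jac τ w a 1 * gv G (fun w => u (τ w)) w 1) =ᶠ[nhds z] fun w => gv G' u (τ w) a := by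
    filter_upwards [hVn] with w hw using P.gv_eq hw hu a
  have hg : ∀ b, DifferentiableAt ℝ (fun w => gv G (fun w => u (τ w)) w b) z := fun b =>
    ((P.herm.contDiffOn_gv (P.contDiffOn_comp hu) b).contDiffAt hVn).differentiableAt (by simp)
  have hj : ∀ b, DifferentiableAt ℝ (fun w => jac τ w a b) z := fun b =>
    (P.differentiableAt_jac a b hz).restrictScalars ℝ
  have key := eb_congr hev ε
  rw [P.eb_comp hz (P.herm'.contDiffOn_gv hu a), eb_add ((hj 0).fun_mul (hg 0)) ((hj 1).fun_mul (hg 1)),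
    eb_mul (hj 0) (hg 0), eb_mul (hj 1) (hg 1), eb_holomorphic (P.differentiableAt_jac a 0 hz),
    eb_holomorphic (P.differentiableAt_jac a 1 hz)] at key
  simp only [Matrix.mul_apply, Fin.sum_univ_two, hess, Matrix.of_apply, Matrix.map_apply]
  linear_combination key

/-- Duality uses the determinant once, to turn a `K`-valued vector into a (1,0)-form. The remaining
holomorphic factor `c` is carried along; it will be `det ^ n`, for sections of `K^(n+1)`. -/
theorem bv_eq (P : Pull τ V G U' G') {z : C2} (hz : z ∈ V) {x x' c : C2 → ℂ}
    (hx' : ContDiffOn ℝ ∞ x' U') (hc : DifferentiableOn ℂ c V)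
    (hx : ∀ w ∈ V, x w = c w * (jac τ w).det * x' (τ w)) (α : Fin 2) :
    bv G x z α = c z * (jac τ z 0 α * bv G' x' (τ z) 0 + jac τ z 1 α * bv G' x' (τ z) 1) := by
  have hVn := P.herm.isOpen.mem_nhds hz
  have hdet : DifferentiableAt ℂ (fun w => c w * (jac τ w).det) z := by
    simp only [Matrix.det_fin_two]
    have j := fun a b => P.differentiableAt_jac a b hz
    exact (hc.differentiableAt hVn).mul (((j 0 0).mul (j 1 1)).sub ((j 0 1).mul (j 1 0)))
  have hxd : DifferentiableAt ℝ (fun w => x' (τ w)) z :=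
    ((P.contDiffOn_comp hx').contDiffAt hVn).differentiableAt (by simp)
  have e : ∀ ε, eb ε x z = c z * (jac τ z).det *
      (conj (jac τ z 0 ε) * eb 0 x' (τ z) + conj (jac τ z 1 ε) * eb 1 x' (τ z)) := by
    intro ε
    have hev : x =ᶠ[nhds z] fun w => (c w * (jac τ w).det) * x' (τ w) := by
      filter_upwards [hVn] with w hw using hx w hw
    rw [eb_congr hev, eb_mul (hdet.restrictScalars ℝ) hxd, eb_holomorphic hdet, P.eb_comp hz hx']
    ring
  have hd := P.det z hz
  have hd' : conj (jac τ z).det ≠ 0 := by simpa using hd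
  have hv : (vol G' (τ z) : ℂ) ≠ 0 := by exact_mod_cast (P.herm'.vol_pos _ (P.maps z hz)).ne'
  simp only [bv, e, P.vol_eq hz, P.hmat_entries hz]
  generalize (vol G' (τ z) : ℂ) = W at *
  generalize eb 0 x' (τ z) = x0
  generalize eb 1 x' (τ z) = x1
  generalize hmat G' (τ z) = h
  generalize c z = C
  rw [Matrix.det_fin_two] at hd hd' ⊢
  simp only [map_sub, map_mul] at hd' ⊢
  fin_cases α <;> simp <;> field_simp <;> ring

/-- Apply `∂̄` to `bv_eq`: `c` and the Jacobian are holomorphic and behave as constants. -/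
theorem pmat_eq (P : Pull τ V G U' G') {z : C2} (hz : z ∈ V) {x x' c : C2 → ℂ}
    (hx' : ContDiffOn ℝ ∞ x' U') (hc : DifferentiableOn ℂ c V)
    (hx : ∀ w ∈ V, x w = c w * (jac τ w).det * x' (τ w)) :
    pmat G x z = c z • ((jac τ z).transpose * pmat G' x' (τ z) * (jac τ z).map conj) := by
  have hVn := P.herm.isOpen.mem_nhds hz
  ext α β
  have hev : (fun w => bv G x w α) =ᶠ[nhds z] fun w => c w *
      (jac τ w 0 α * bv G' x' (τ w) 0 + jac τ w 1 α * bv G' x' (τ w) 1) := by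
    filter_upwards [hVn] with w hw using P.bv_eq hw hx' hc hx α
  have hcz := hc.differentiableAt hVn
  have hb : ∀ b, DifferentiableAt ℝ (fun w => bv G' x' (τ w) b) z := fun b =>
    ((P.contDiffOn_comp (P.herm'.contDiffOn_bv hx' b)).contDiffAt hVn).differentiableAt (by simp)
  have hj : ∀ b, DifferentiableAt ℝ (fun w => jac τ w b α) z := fun b =>
    (P.differentiableAt_jac b α hz).restrictScalars ℝ
  rw [pmat, Matrix.of_apply, eb_congr hev, eb_mul (hcz.restrictScalars ℝ)
    (((hj 0).fun_mul (hb 0)).fun_add ((hj 1).fun_mul (hb 1))), eb_add ((hj 0).fun_mul (hb 0)) ((hj 1).fun_mul (hb 1)),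
    eb_mul (hj 0) (hb 0), eb_mul (hj 1) (hb 1), eb_holomorphic hcz,
    eb_holomorphic (P.differentiableAt_jac 0 α hz), eb_holomorphic (P.differentiableAt_jac 1 α hz),
    P.eb_comp hz (P.herm'.contDiffOn_bv hx' 0), P.eb_comp hz (P.herm'.contDiffOn_bv hx' 1)]
  simp only [Matrix.smul_apply, Matrix.mul_apply, Fin.sum_univ_two, pmat, Matrix.of_apply,
    Matrix.map_apply, Matrix.transpose_apply, smul_eq_mul]
  ring

/-- The pull-back of a self-dual form. -/
theorem sdMat_eq (P : Pull τ V G U' G') {φ φ' : Comp 2} (hφ : IsPull τ V φ φ') {z : C2} (hz : z ∈ V)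
    {f p q : ℝ} (h : ∀ i j, φ' (τ z) ![i, j] = sdMat G' f p q (τ z) i j) (i j : Fin 4) :
    φ z ![i, j] = sdMat G f ((jac τ z).det * (p + Complex.I * q)).re
      ((jac τ z).det * (p + Complex.I * q)).im z i j := by
  obtain ⟨r0, r1, r2, r3⟩ := realCoord_fderiv τ z
  have HG := P.pull z hz
  have H := hφ z hz
  have ht := P.herm'.table
  have T := ht.symm (τ z)
  rw [Matrix.det_fin_two]
  generalize jac τ z = J at *
  fin_cases i <;> fin_cases j <;>
    simp [sdMat, H, h, HG, Fin.sum_univ_four, r0, r1, r2, r3, T 1 0, T 2 0, T 3 0, T 2 1, T 3 1, T 3 2,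
      ht.h11, ht.h33, ht.h13, ht.h12, ht.h01, ht.h23] <;> ring

end Pull

section Surface

variable {X : Type*} [TopologicalSpace X] [ChartedSpace C2 X] [IsManifold 𝓘(ℂ, C2) ω X]
variable {g : CovTensorField X 2} {F : C2 → X} {U : Set C2} {e : OpenPartialHomeomorph X C2}

theorem contDiffOn_of_overlap {E : Type*} [NormedAddCommGroup E] [NormedSpace ℝ E] {x : C2 → E}
    (h : ∀ e ∈ atlas C2 X, ContDiffOn ℝ ∞ x (overlap F U e)) (hF : IsParam F U) :
    ContDiffOn ℝ ∞ x U := by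
  intro z hz
  have := (h _ (chart_mem_atlas C2 (F z))).contDiffAt
    ((hF.isOpen_overlap _).mem_nhds ⟨hz, mem_chart_source C2 (F z)⟩)
  exact this.contDiffWithinAt

/-- The components of a smooth tensor in a holomorphic parametrization are smooth. -/
theorem IsParam.contDiffOn_comps (h : IsParam F U) {n : ℕ}
    {T : CovTensorField X n} (hT : IsSmooth T) (I : Fin n → Fin 4) :
    ContDiffOn ℝ ∞ (fun z => comps F T z I) U := by
  refine contDiffOn_of_overlap (fun e he => ?_) h
  have hV := h.isOpen_overlap e
  have hτ := (contDiffOn_infty_iff_fderiv_of_isOpen hV).mp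
    (contDiffOn_of_differentiableOn_C2 hV (h.differentiableOn_transition he))
  have hc : ∀ i : Fin 4, ∀ k, ContDiffOn ℝ ∞
      (fun z => realCoord (fderiv ℂ (e ∘ F) z (realFrame i)) k) (overlap F U e) := by
    intro i k
    have h1 : ContDiffOn ℝ ∞ (fun z => fderiv ℂ (e ∘ F) z (realFrame i)) (overlap F U e) :=
      (hτ.2.clm_apply contDiffOn_const).restrict_scalars ℝ
    have h2 : ∀ a : Fin 2, ContDiffOn ℝ ∞ (fun z => fderiv ℂ (e ∘ F) z (realFrame i) a)
        (overlap F U e) := fun a =>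
      (((EuclideanSpace.proj (𝕜 := ℂ) a).restrictScalars ℝ).contDiff).comp_contDiffOn h1
    fin_cases k
    · exact Complex.reCLM.contDiff.comp_contDiffOn (h2 0)
    · exact Complex.imCLM.contDiff.comp_contDiffOn (h2 0)
    · exact Complex.reCLM.contDiff.comp_contDiffOn (h2 1)
    · exact Complex.imCLM.contDiff.comp_contDiffOn (h2 1)
  have hexp : ∀ z ∈ overlap F U e, comps F T z I = ∑ K : Fin n → Fin 4,
      (∏ a, realCoord (fderiv ℂ (e ∘ F) z (realFrame (I a))) (K a)) *
        comps e.symm T ((e ∘ F) z) K := by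
    intro z hz
    rw [comps_eq_pullAt, h.pullAt_eq he T hz]
    conv_lhs =>
      arg 2
      ext a
      rw [← sum_realCoord (fderiv ℂ (e ∘ F) z (realFrame (I a)))]
    rw [MultilinearMap.map_sum]
    refine Finset.sum_congr rfl fun K _ => ?_
    rw [MultilinearMap.map_smul_univ, smul_eq_mul, comps_eq_pullAt]
  refine ContDiffOn.congr ?_ hexp
  refine ContDiffOn.sum fun K _ => ContDiffOn.mul (contDiffOn_prod fun a _ => hc _ _) ?_
  exact (hT e he K).comp (h.contDiffOn_transition he) fun z hz => e.map_source hz.2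

theorem IsParam.hermComps (h : IsParam F U) (hg : IsKahlerMetric g) : HermComps U (comps F g) :=
  ⟨h.isOpen, h.contDiffOn_comps hg.smooth, hermTable hg F, fun _ hz => (comps_pos hg h hz).1,
    fun _ hz => (comps_pos hg h hz).2⟩

theorem IsParam.pull (h : IsParam F U) (hg : IsKahlerMetric g) (he : e ∈ atlas C2 X) :
    Pull (e ∘ F) (overlap F U e) (comps F g) e.target (comps e.symm g) where
  diff := h.differentiableOn_transition he
  maps z hz := e.map_source hz.2
  det z hz := by
    intro hdet
    obtain ⟨v, hv, hv0⟩ := Matrix.exists_mulVec_eq_zero_iff.mpr hdet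
    have : fderiv ℂ (e ∘ F) z (WithLp.toLp 2 v) = 0 := by
      rw [← sum_cFrame (WithLp.toLp 2 v), map_sum]
      ext a
      have := congrFun hv0 a
      simp only [Matrix.mulVec, dotProduct, Fin.sum_univ_two, jac, Matrix.of_apply] at this
      simp only [Fin.sum_univ_two, map_smul]
      simpa [mul_comm] using this
    have h0 := (h.bijective_fderiv he hz).1 (this.trans (map_zero _).symm)
    exact hv (by simpa using congrArg WithLp.ofLp h0)
  pull z hz i j := h.comps_eq_sum he g hz i j
  herm := (h.mono (h.isOpen_overlap e) fun _ hz => hz.1).hermComps hg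
  herm' := (isParam_of_mem_atlas he).hermComps hg

end Surface

end

section

open scoped ComplexConjugate

/-! ### Quadratic forms on two by two matrices -/

section Matrices

abbrev M2 : Type := Matrix (Fin 2) (Fin 2) ℂ

/-- The pairing of two antilinear endomorphisms. -/
def hpair (M N : M2) : ℝ := (M * N.map conj).trace.re

theorem hpair_apply (M N : M2) : hpair M N =
    (M 0 0 * conj (N 0 0) + M 0 1 * conj (N 1 0) + (M 1 0 * conj (N 0 1) + M 1 1 * conj (N 1 1))).re := by
  simp [hpair, Matrix.trace_fin_two, Matrix.mul_apply, Fin.sum_univ_two]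

theorem hpair_comm (M N : M2) : hpair M N = hpair N M := by
  simp [hpair_apply]; ring

theorem hpair_add_right (M N N' : M2) : hpair M (N + N') = hpair M N + hpair M N' := by
  simp [hpair_apply]; ring

theorem hpair_smul_right (M N : M2) (c : ℝ) : hpair M (c • N) = c * hpair M N := by
  simp [hpair_apply]; ring

/-- Both matrices represent antilinear endomorphisms. The composite of two of these is linear, so
its trace does not depend on the frame. -/
theorem hpair_conj {J M N M' N' : M2} (hJ : J.det ≠ 0) (hM : J * M = M' * J.map conj)
    (hN : J * N = N' * J.map conj) : hpair M N = hpair M' N' := by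
  have hu : IsUnit J.det := isUnit_iff_ne_zero.mpr hJ
  have hcc : (J.map conj).map conj = J := by ext; simp
  have h1 : M = J⁻¹ * M' * J.map conj := by
    rw [Matrix.mul_assoc, ← hM, ← Matrix.mul_assoc, Matrix.nonsing_inv_mul _ hu, Matrix.one_mul]
  have h2 : J.map conj * N.map conj = N'.map conj * J := by
    have := congrArg (fun K : M2 => K.map conj) hN
    simpa [Matrix.map_mul, hcc] using this
  rw [hpair, hpair, h1, Matrix.mul_assoc, h2, Matrix.mul_assoc, Matrix.trace_mul_comm,
    Matrix.mul_assoc, Matrix.mul_assoc, Matrix.mul_nonsing_inv _ hu, Matrix.mul_one]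

/-- The polarization of twice the determinant. -/
def mix (M P : M2) : ℂ := M 0 0 * P 1 1 + M 1 1 * P 0 0 - M 0 1 * P 1 0 - M 1 0 * P 0 1

theorem mix_congr (J M P : M2) : mix (J.transpose * M * J.map conj) (J.transpose * P * J.map conj) =
    J.det * conj J.det * mix M P := by
  simp [mix, Matrix.mul_apply, Fin.sum_univ_two, Matrix.det_fin_two]
  ring

/-- The matrix `[[a, s], [s̄, b]]` is Hermitian and positive definite. -/
structure PosHerm (h : M2) (a b : ℝ) (s : ℂ) : Prop where
  h00 : h 0 0 = a
  h11 : h 1 1 = b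
  h01 : h 0 1 = s
  h10 : h 1 0 = conj s
  pos : 0 < a
  det_pos : 0 < a * b - Complex.normSq s

/-- When `hᵀ M` is symmetric, `Re tr (M M̄)` is the square norm of `M` with respect to `h`, written
here as a sum of squares. Without the symmetry this form is indefinite. -/
theorem PosHerm.hpair_self {h : M2} {a b : ℝ} {s : ℂ} (H : PosHerm h a b s) {M : M2}
    (hM : h 0 0 * M 0 1 + h 1 0 * M 1 1 = h 0 1 * M 0 0 + h 1 1 * M 1 0) :
    a ^ 2 * hpair M M = Complex.normSq (a * M 0 0 + conj s * M 1 0) +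
      Complex.normSq (a * M 1 1 - s * M 1 0) + 2 * (a * b - Complex.normSq s) * Complex.normSq (M 1 0) := by
  rw [H.h00, H.h11, H.h01, H.h10] at hM
  have r := congrArg Complex.re hM
  have i := congrArg Complex.im hM
  simp at r i
  simp [hpair_apply, Complex.normSq_apply]
  linear_combination (2 * a * (M 1 0).re) * r + (2 * a * (M 1 0).im) * i

theorem PosHerm.hpair_self_nonneg {h : M2} {a b : ℝ} {s : ℂ} (H : PosHerm h a b s) {M : M2}
    (hM : h 0 0 * M 0 1 + h 1 0 * M 1 1 = h 0 1 * M 0 0 + h 1 1 * M 1 0) : 0 ≤ hpair M M := by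
  have e := H.hpair_self hM
  have h1 := H.pos
  have h2 := H.det_pos
  have : 0 ≤ a ^ 2 * hpair M M := by
    rw [e]
    have := Complex.normSq_nonneg (M 1 0)
    have := Complex.normSq_nonneg (a * M 0 0 + conj s * M 1 0)
    have := Complex.normSq_nonneg (a * M 1 1 - s * M 1 0)
    positivity
  exact nonneg_of_mul_nonneg_right this (by positivity)

theorem PosHerm.eq_zero_of_hpair_self {h : M2} {a b : ℝ} {s : ℂ} (H : PosHerm h a b s) {M : M2}
    (hM : h 0 0 * M 0 1 + h 1 0 * M 1 1 = h 0 1 * M 0 0 + h 1 1 * M 1 0) (h0 : hpair M M = 0) :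
    M = 0 := by
  have e := H.hpair_self hM
  have h1 := H.pos
  have h2 := H.det_pos
  have ha : (a : ℂ) ≠ 0 := by exact_mod_cast h1.ne'
  rw [h0, mul_zero] at e
  have n1 := Complex.normSq_nonneg (M 1 0)
  have n2 := Complex.normSq_nonneg (a * M 0 0 + conj s * M 1 0)
  have n3 := Complex.normSq_nonneg (a * M 1 1 - s * M 1 0)
  have z10 : M 1 0 = 0 := by
    have : Complex.normSq (M 1 0) = 0 := by nlinarith [mul_nonneg h2.le n1]
    simpa using this
  have z00 : M 0 0 = 0 := by
    have : Complex.normSq (a * M 0 0 + conj s * M 1 0) = 0 := by nlinarith [mul_nonneg h2.le n1]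
    simpa [z10, h1.ne'] using this
  have z11 : M 1 1 = 0 := by
    have : Complex.normSq (a * M 1 1 - s * M 1 0) = 0 := by nlinarith [mul_nonneg h2.le n1]
    simpa [z10, h1.ne'] using this
  have z01 : M 0 1 = 0 := by
    simpa [z00, z11, z10, H.h00, ha] using hM
  ext i j
  fin_cases i <;> fin_cases j <;> simp [z00, z01, z10, z11]

/-- Hermitian and trace-free with respect to `h`. -/
structure HermTraceFree (h N : M2) : Prop where
  r0 : (N 0 0).im = 0
  r1 : (N 1 1).im = 0
  off : N 1 0 = conj (N 0 1)
  tr : mix h N = 0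

/-- `mix N N` is twice the determinant. A Hermitian form which is trace-free relative to `h` has
opposite eigenvalues, so its determinant is at most zero; the identity makes this explicit. -/
theorem HermTraceFree.mix_self {h N : M2} {a b : ℝ} {s : ℂ} (H : PosHerm h a b s)
    (hN : HermTraceFree h N) : a * (-(mix N N).re) * a = 2 * (Complex.normSq (a * N 0 1 - (N 0 0).re * s)
      + (a * b - Complex.normSq s) * (N 0 0).re ^ 2) := by
  have tr := congrArg Complex.re hN.tr
  simp [mix, H.h00, H.h11, H.h01, H.h10, hN.off, hN.r0, hN.r1] at tr
  simp [mix, hN.off, hN.r0, hN.r1, Complex.normSq_apply]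
  linear_combination (-2 * a * (N 0 0).re) * tr

theorem HermTraceFree.mix_self_nonneg {h N : M2} {a b : ℝ} {s : ℂ} (H : PosHerm h a b s)
    (hN : HermTraceFree h N) : 0 ≤ -(mix N N).re := by
  have e := hN.mix_self H
  have h1 := H.pos
  have h2 := H.det_pos
  have : 0 ≤ (a * a) * -(mix N N).re := by
    rw [mul_right_comm] at e
    rw [e]
    have := Complex.normSq_nonneg (a * N 0 1 - (N 0 0).re * s)
    positivity
  exact nonneg_of_mul_nonneg_right this (by positivity)

theorem HermTraceFree.eq_zero {h N : M2} {a b : ℝ} {s : ℂ} (H : PosHerm h a b s)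
    (hN : HermTraceFree h N) (h0 : (mix N N).re = 0) : N = 0 := by
  have e := hN.mix_self H
  have h1 := H.pos
  have h2 := H.det_pos
  have ha : (a : ℂ) ≠ 0 := by exact_mod_cast h1.ne'
  rw [h0] at e
  have n1 := Complex.normSq_nonneg (a * N 0 1 - (N 0 0).re * s)
  have z0 : (N 0 0).re = 0 := by
    have : (N 0 0).re ^ 2 = 0 := by nlinarith [mul_nonneg h2.le (sq_nonneg (N 0 0).re)]
    simpa using this
  have z00 : N 0 0 = 0 := Complex.ext z0 hN.r0
  have z01 : N 0 1 = 0 := by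
    have : Complex.normSq (a * N 0 1 - (N 0 0).re * s) = 0 := by
      nlinarith [mul_nonneg h2.le (sq_nonneg (N 0 0).re)]
    simpa [z0, h1.ne'] using this
  have z10 : N 1 0 = 0 := by rw [hN.off, z01, map_zero]
  have z11 : N 1 1 = 0 := by
    simpa [mix, z00, z01, z10, H.h00, ha] using hN.tr
  ext i j
  fin_cases i <;> fin_cases j <;> simp [z00, z01, z10, z11]

/-- Completing the square. -/
theorem HermTraceFree.complete_square {h P : M2} {a b : ℝ} {s : ℂ} (H : PosHerm h a b s)
    (hP : HermTraceFree h P) (M : M2) (χ : ℝ) :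
    let m : M2 := (1 / 2 : ℂ) • (M + M.conjTranspose)
    (mix m m).re - (mix h m).re ^ 2 / (2 * (a * b - Complex.normSq s)) ≤
      -(χ * χ * mix P P + 2 * χ * mix M P).re := by
  intro m
  have hd := H.det_pos
  -- Only the Hermitian part `m` of `M` pairs with the Hermitian `P`. Subtracting `lam • h` makes it
  -- trace-free, because `mix h h = 2 det h`. Then `N = χ P + m - lam h` is Hermitian and
  -- trace-free, and `-mix N N ≥ 0` is the asserted inequality.
  set lam : ℝ := (mix h m).re / (2 * (a * b - Complex.normSq s)) with hlam
  let N : M2 := (χ : ℂ) • P + (m - (lam : ℂ) • h)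
  have m00 : m 0 0 = (M 0 0).re := by
    apply Complex.ext <;> simp [m]
    ring
  have m11 : m 1 1 = (M 1 1).re := by
    apply Complex.ext <;> simp [m]
    ring
  have m10 : m 1 0 = conj (m 0 1) := by
    apply Complex.ext <;> simp [m] <;> ring
  have hhm : (mix h m).re = a * (M 1 1).re + b * (M 0 0).re - (s * conj (m 0 1) + conj s * m 0 1).re := by
    simp [mix, m00, m11, m10, H.h00, H.h11, H.h01, H.h10]; ring
  have hl : lam * (2 * (a * b - Complex.normSq s)) = (mix h m).re := by
    rw [hlam]; field_simp
  have trP := congrArg Complex.re hP.tr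
  simp [mix, H.h00, H.h11, H.h01, H.h10, hP.off, hP.r0, hP.r1] at trP
  have hN : HermTraceFree h N := by
    refine ⟨?_, ?_, ?_, ?_⟩
    · simp [N, m00, H.h00, hP.r0]
    · simp [N, m11, H.h11, hP.r1]
    · simp [N, m10, hP.off, H.h10, H.h01]
    · rw [hhm] at hl
      simp [Complex.normSq_apply] at hl
      apply Complex.ext
      · simp [N, mix, m00, m11, m10, H.h00, H.h11, H.h01, H.h10, hP.off, hP.r0, hP.r1]
        linear_combination χ * trP - hl
      · simp [N, mix, m00, m11, m10, H.h00, H.h11, H.h01, H.h10, hP.off, hP.r0, hP.r1]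
        ring
  have key := hN.mix_self_nonneg H
  have e : (mix m m).re - (mix h m).re ^ 2 / (2 * (a * b - Complex.normSq s)) =
      -(χ * χ * mix P P + 2 * χ * mix M P).re + (mix N N).re := by
    have e1 : (mix h m).re ^ 2 / (2 * (a * b - Complex.normSq s)) = lam * (mix h m).re := by
      rw [hlam]; ring
    rw [e1]
    rw [hhm] at hl ⊢
    clear_value lam
    have m01r : (m 0 1).re = ((M 0 1).re + (M 1 0).re) / 2 := by simp [m]; ring
    have m01i : (m 0 1).im = ((M 0 1).im - (M 1 0).im) / 2 := by simp [m]; ring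
    simp [Complex.normSq_apply] at hl
    simp [N, mix, m00, m11, m10, H.h00, H.h11, H.h01, H.h10, hP.off, hP.r0, hP.r1, m01r, m01i] at hl ⊢
    linear_combination -lam * hl + 2 * χ * lam * trP
  rw [e]
  linarith

end Matrices

end

/-! ### The integral identities for functions on a chart -/

section

open scoped ComplexConjugate

open SmoothAlg MeasureTheory

theorem HermComps.posHerm {U : Set C2} {G : Comp 2} (h : HermComps U G) {z : C2} (hz : z ∈ U) :
    PosHerm (hmat G z) (G z ![0, 0]) (G z ![2, 2]) (G z ![0, 2] + Complex.I * G z ![0, 3]) where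
  h00 := rfl
  h11 := rfl
  h01 := rfl
  h10 := by simp [hmat]; ring
  pos := h.pos z hz
  det_pos := by
    have := h.vol_pos z hz
    rw [vol] at this
    simp [Complex.normSq_apply]
    nlinarith

theorem KahlerComps.hermComps {U : Set C2} {G : Comp 2} (h : KahlerComps U G) : HermComps U G :=
  ⟨h.isOpen, h.smooth, ⟨h.symm, h.h11, h.h33, h.h13, h.h12, h.h01, h.h23⟩, h.pos, h.det_pos⟩

/-- The coefficient of `dz₁ ∧ dz₂` in a self-dual form. -/
def hcoef (φ : Comp 2) (z : C2) : ℂ := coefP φ z + Complex.I * coefQ φ z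

theorem KahlerComps.eq_sdMat {U : Set C2} {G φ : Comp 2} (h : KahlerComps U G) {z : C2} (hz : z ∈ U)
    (hφ : IsSelfDualAt G φ z) (i j : Fin 4) :
    φ z ![i, j] = sdMat G (coefF G φ z) (coefP φ z) (coefQ φ z) z i j :=
  sdMat_of_star h hz (N := fun i j => φ z ![i, j]) hφ.1 (fun i j => by
    have := hφ.2 ![i, j]
    rw [← this]
    rfl) i j

theorem setIntegral_re_extendZero {U : Opens C2} (F : U → ℂ) (H : C2 → ℝ)
    (h : ∀ z : U, (F z).re = H z) (hi : Integrable (extendZero F)) (h0 : ∫ z, extendZero F z = 0) :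
    ∫ z in (U : Set C2), H z = 0 := by
  have e : ∫ z in (U : Set C2), H z = ∫ z, (extendZero F z).re := by
    rw [← integral_indicator U.isOpen.measurableSet]
    congr 1
    ext z
    by_cases hz : z ∈ U
    · rw [Set.indicator_of_mem hz, extendZero_apply _ hz, h]
    · rw [Set.indicator_of_notMem hz]; simp [extendZero, hz]
  rw [e]
  have := Complex.reCLM.integral_comp_comm hi
  simp only [Complex.reCLM_apply] at this
  rw [this, h0, Complex.zero_re]

namespace KahlerComps
variable {U : Opens C2} {G : Comp 2}

theorem fn_g (h : KahlerComps U G) (z : U) : h.g11.fn z = hmat G z 0 0 ∧ h.g12.fn z = hmat G z 0 1 ∧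
    h.g21.fn z = hmat G z 1 0 ∧ h.g22.fn z = hmat G z 1 1 ∧ h.gD.fn z = vol G z ∧
    h.gD'.fn z = (vol G z : ℂ)⁻¹ := by
  refine ⟨rfl, rfl, rfl, rfl, rfl, ?_⟩
  simp [gD']

theorem fn_db {F : SmoothAlg U} {H : C2 → ℂ} (hF : ∀ w : U, F.fn w = H w) (z : U) :
    (db1 F).fn z = eb 0 H z ∧ (db2 F).fn z = eb 1 H z := by
  rw [dir_apply_of_eq _ _ _ hF, dir_apply_of_eq _ _ _ hF, eb_zero, eb_one]
  exact ⟨rfl, rfl⟩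

theorem fn_grad (h : KahlerComps U G) {u : C2 → ℝ} (hu : ContDiffOn ℝ ∞ u U) (z : U) :
    (h.grad1 (ofReal u hu)).fn z = gv G u z 0 ∧ (h.grad2 (ofReal u hu)).fn z = gv G u z 1 := by
  obtain ⟨e1, e2, e3, e4, e5, e6⟩ := h.fn_g z
  obtain ⟨d1, d2⟩ := fn_db (F := ofReal u hu) (H := fun w => (u w : ℂ)) (fun w => rfl) z
  simp only [grad1, grad2, fn_mul, fn_sub, e1, e2, e3, e4, e6, d1, d2, gv]
  exact ⟨rfl, rfl⟩

theorem fn_b (h : KahlerComps U G) {x : SmoothAlg U} {H : C2 → ℂ} (hx : ∀ w : U, x.fn w = H w)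
    (z : U) : (h.b1 x).fn z = bv G H z 0 ∧ (h.b2 x).fn z = bv G H z 1 := by
  obtain ⟨e1, e2, e3, e4, e5, e6⟩ := h.fn_g z
  obtain ⟨d1, d2⟩ := fn_db hx z
  simp only [b1, b2, fn_mul, fn_sub, e1, e2, e3, e4, e6, d1, d2, bv]
  exact ⟨rfl, rfl⟩

theorem fn_hess (h : KahlerComps U G) {u : C2 → ℝ} (hu : ContDiffOn ℝ ∞ u U) (z : U) :
    (db1 (h.grad1 (ofReal u hu))).fn z = hess G u z 0 0 ∧
    (db2 (h.grad1 (ofReal u hu))).fn z = hess G u z 0 1 ∧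
    (db1 (h.grad2 (ofReal u hu))).fn z = hess G u z 1 0 ∧
    (db2 (h.grad2 (ofReal u hu))).fn z = hess G u z 1 1 := by
  obtain ⟨a1, a2⟩ := fn_db (H := fun w => gv G u w 0) (fun w => (h.fn_grad hu w).1) z
  obtain ⟨a3, a4⟩ := fn_db (H := fun w => gv G u w 1) (fun w => (h.fn_grad hu w).2) z
  exact ⟨a1, a2, a3, a4⟩

theorem fn_pmat (h : KahlerComps U G) {x : SmoothAlg U} {H : C2 → ℂ} (hx : ∀ w : U, x.fn w = H w)
    (z : U) : (db1 (h.b1 x)).fn z = pmat G H z 0 0 ∧ (db2 (h.b1 x)).fn z = pmat G H z 0 1 ∧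
    (db1 (h.b2 x)).fn z = pmat G H z 1 0 ∧ (db2 (h.b2 x)).fn z = pmat G H z 1 1 := by
  obtain ⟨a1, a2⟩ := fn_db (H := fun w => bv G H w 0) (fun w => (h.fn_b hx w).1) z
  obtain ⟨a3, a4⟩ := fn_db (H := fun w => bv G H w 1) (fun w => (h.fn_b hx w).2) z
  exact ⟨a1, a2, a3, a4⟩

/-- Lowering the index of the gradient gives `∂̄u`, whose mixed `∂̄` derivatives commute. The
derivatives that fall on the metric match by the Kähler condition, so `hᵀ ∂̄ grad u` is symmetric.
-/
theorem hess_symm (h : KahlerComps U G) {u : C2 → ℝ} (hu : ContDiffOn ℝ ∞ u U) {z : C2}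
    (hz : z ∈ U) : hmat G z 0 0 * hess G u z 0 1 + hmat G z 1 0 * hess G u z 1 1 =
      hmat G z 0 1 * hess G u z 0 0 + hmat G z 1 1 * hess G u z 1 0 := by
  have K := h.kahlerRing
  set F := ofReal u hu
  have r1 : h.g11 * h.grad1 F + h.g21 * h.grad2 F = db1 F := by
    rw [grad1, grad2]; linear_combination db1 F * K.inv - h.gD' * db1 F * K.hD
  have r2 : h.g12 * h.grad1 F + h.g22 * h.grad2 F = db2 F := by
    rw [grad1, grad2]; linear_combination db2 F * K.inv - h.gD' * db2 F * K.hD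
  have a1 := congrArg db2 r1
  have a2 := congrArg db1 r2
  rw [K.he] at a2
  simp only [map_add, Derivation.leibniz, smul_eq_mul, K.l1, K.l2] at a1 a2
  have key : h.g11 * db2 (h.grad1 F) + h.g21 * db2 (h.grad2 F) =
    h.g12 * db1 (h.grad1 F) + h.g22 * db1 (h.grad2 F) := by linear_combination a1 - a2
  have := congrArg (fun X => SmoothAlg.fn X ⟨z, hz⟩) key
  obtain ⟨e1, e2, e3, e4, e5, e6⟩ := h.fn_g ⟨z, hz⟩
  obtain ⟨d1, d2, d3, d4⟩ := h.fn_hess hu ⟨z, hz⟩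
  simpa only [fn_add, fn_mul, e1, e2, e3, e4, F, d1, d2, d3, d4] using this

/-- The weak form of the equation for the coefficient of the Kähler form. -/
theorem setIntegral_hpair (h : KahlerComps U G) (hs : ∀ z ∈ U, scalarCurv G z = 0) {φ : Comp 2}
    (hsm : ∀ I, ContDiffOn ℝ ∞ (fun z => φ z I) U) (hφ : ∀ z ∈ U, IsSelfDualAt G φ z)
    (h0 : ∀ z ∈ U, Sstar G φ z = 0) {K : Set C2} (hK : IsCompact K) (hKU : K ⊆ U) {u : C2 → ℝ}
    (hu : ContDiffOn ℝ ∞ u U) (huK : ∀ z ∈ U, z ∉ K → u z = 0) :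
    ∫ z in (U : Set C2), vol G z * hpair (hess G (coefF G φ) z) (hess G u z) = 0 := by
  have hf : ContDiffOn ℝ ∞ (coefF G φ) U := (hsm _).div (h.smooth _) fun z hz => (h.pos z hz).ne'
  have hp : ContDiffOn ℝ ∞ (coefP φ) U := contDiffOn_const.mul ((hsm _).sub (hsm _))
  have hq : ContDiffOn ℝ ∞ (coefQ φ) U := contDiffOn_const.mul ((hsm _).add (hsm _))
  have hS : SuppIn K (ofReal u hu) := fun z hz => by simp [huK z z.2 hz]
  have I := h.integral_energy hs hf hp hq (fun z hz => h.eq_sdMat hz (hφ z hz)) h0 hK hKU rfl hS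
    (by ext z; simp)
  refine setIntegral_re_extendZero _ _ (fun z => ?_) ?_ I
  · obtain ⟨e1, e2, e3, e4, e5, e6⟩ := h.fn_g z
    obtain ⟨d1, d2, d3, d4⟩ := h.fn_hess hu z
    obtain ⟨f1, f2, f3, f4⟩ := h.fn_hess hf z
    simp only [fn_mul, fn_add, fn_conj, e5, d1, d2, d3, d4, f1, f2, f3, f4, hpair_apply]
    rw [Complex.re_ofReal_mul]
    congr 2
    ring
  · have du1 := hS.dir hK 0 1 Complex.I
    have du2 := hS.dir hK 2 3 Complex.I
    have s1 : SuppIn K (h.grad1 (ofReal u hu)) :=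
      ((du1.mul_left _).sub (du2.mul_left _)).mul_left _
    have s2 : SuppIn K (h.grad2 (ofReal u hu)) :=
      ((du2.mul_left _).sub (du1.mul_left _)).mul_left _
    have sc : ∀ {X : SmoothAlg U}, SuppIn K X → SuppIn K X.conj := fun hX z hz => by
      simp [hX z hz]
    refine SuppIn.integrable hK hKU (SuppIn.mul_left ?_ _)
    exact ((((sc (s1.dir hK _ _ _)).mul_left _).add ((sc (s2.dir hK _ _ _)).mul_left _)).add
      ((sc (s1.dir hK _ _ _)).mul_left _)).add ((sc (s2.dir hK _ _ _)).mul_left _)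

theorem mix_pmat (h : KahlerComps U G) {x : C2 → ℂ} (hx : ContDiffOn ℝ ∞ x U) {z : C2} (hz : z ∈ U) :
    mix (hmat G z) (pmat G x z) = 0 := by
  have t := h.kahlerRing.trace_debar (x := SmoothAlg.mk x hx) (b1 := h.b1 (SmoothAlg.mk x hx))
    (b2 := h.b2 (SmoothAlg.mk x hx)) rfl rfl
  have := congrArg (fun X => SmoothAlg.fn X ⟨z, hz⟩) t
  obtain ⟨e1, e2, e3, e4, e5, e6⟩ := h.fn_g ⟨z, hz⟩
  obtain ⟨d1, d2, d3, d4⟩ := h.fn_pmat (x := SmoothAlg.mk x hx) (fun w => rfl) ⟨z, hz⟩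
  simp only [fn_add, fn_sub, fn_mul, e1, e2, e3, e4, d1, d2, d3, d4, fn_zero] at this
  rw [mix]
  linear_combination this

/-- For `f = 0` the equation reads `T h = i (P - P^*)`. Since `P` is trace-free, taking the trace
gives `T = 0`, and then `P` is Hermitian. -/
theorem hermTraceFree_pmat (h : KahlerComps U G) (hs : ∀ z ∈ U, scalarCurv G z = 0) {φ : Comp 2}
    (hsm : ∀ I, ContDiffOn ℝ ∞ (fun z => φ z I) U) (hφ : ∀ z ∈ U, IsSelfDualAt G φ z)
    (h0 : ∀ z ∈ U, Sstar G φ z = 0) (hF : ∀ z ∈ U, coefF G φ z = 0) {z : C2} (hz : z ∈ U) :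
    HermTraceFree (hmat G z) (pmat G (hcoef φ) z) := by
  have hf : ContDiffOn ℝ ∞ (coefF G φ) U := (hsm _).div (h.smooth _) fun z hz => (h.pos z hz).ne'
  have hp : ContDiffOn ℝ ∞ (coefP φ) U := contDiffOn_const.mul ((hsm _).sub (hsm _))
  have hq : ContDiffOn ℝ ∞ (coefQ φ) U := contDiffOn_const.mul ((hsm _).add (hsm _))
  have hx : ContDiffOn ℝ ∞ (hcoef φ) U := (HermComps.contDiffOn_ofReal hp).add
    (contDiffOn_const.mul (HermComps.contDiffOn_ofReal hq))
  obtain ⟨T, q1, q2, q3, q4⟩ := h.sstar_equations hs hf hp hq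
    (fun z hz => h.eq_sdMat hz (hφ z hz)) h0 rfl rfl
  have hF0 : ofReal (coefF G φ) hf = 0 := by ext z; simp [hF z z.2]
  have cd : ∀ (X : SmoothAlg U), dz1 X.conj = (db1 X).conj ∧ dz2 X.conj = (db2 X).conj := fun X => by
    rw [conj_dir, conj_dir, Complex.conj_I]; exact ⟨rfl, rfl⟩
  rw [hF0] at q1 q2 q3 q4
  simp only [map_zero, mul_zero, zero_mul, sub_zero, zero_add, cd] at q1 q2 q3 q4
  replace q1 := congrArg (fun X => SmoothAlg.fn X ⟨z, hz⟩) q1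
  replace q2 := congrArg (fun X => SmoothAlg.fn X ⟨z, hz⟩) q2
  replace q3 := congrArg (fun X => SmoothAlg.fn X ⟨z, hz⟩) q3
  replace q4 := congrArg (fun X => SmoothAlg.fn X ⟨z, hz⟩) q4
  obtain ⟨e1, e2, e3, e4, e5, e6⟩ := h.fn_g ⟨z, hz⟩
  obtain ⟨d1, d2, d3, d4⟩ := h.fn_pmat (H := hcoef φ)
    (x := ofReal (coefP φ) hp + Complex.I • ofReal (coefQ φ) hq) (fun w => rfl) ⟨z, hz⟩
  have tr := h.mix_pmat hx hz
  have P := h.hermComps.posHerm hz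
  simp only [fn_mul, fn_smul, fn_sub, fn_conj, e1, e2, e3, e4, d1, d2, d3, d4] at q1 q2 q3 q4
  have hT : T.fn ⟨z, hz⟩ = 0 := by
    have tr' := congrArg conj tr
    simp only [mix, P.h00, P.h11, P.h01, P.h10] at tr tr'
    simp only [map_add, map_sub, map_mul, Complex.conj_ofReal, map_zero, Complex.conj_I, map_neg] at tr'
    simp only [P.h00, P.h11, P.h01, P.h10, map_add, map_mul, Complex.conj_ofReal,
      Complex.conj_I] at q1 q2 q3 q4 tr
    have hv : (vol G z : ℂ) ≠ 0 := by exact_mod_cast (h.vol_pos hz).ne'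
    have : (2 * vol G z : ℂ) * T.fn ⟨z, hz⟩ = 0 := by
      rw [vol]
      push_cast
      linear_combination (G z ![2, 2] : ℂ) * q1 + (G z ![0, 0] : ℂ) * q4
        - (G z ![0, 2] - Complex.I * G z ![0, 3] : ℂ) * q2
        - (G z ![0, 2] + Complex.I * G z ![0, 3] : ℂ) * q3 + Complex.I * tr - Complex.I * tr'
        - 2 * (G z ![0, 3] : ℂ) ^ 2 * T.fn ⟨z, hz⟩ * Complex.I_sq
    simpa [hv] using this
  rw [hT] at q1 q2 q3 q4
  simp only [zero_mul, zero_eq_mul, Complex.I_ne_zero, false_or, sub_eq_zero] at q1 q2 q3 q4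
  exact ⟨Complex.conj_eq_iff_im.mp q1.symm, Complex.conj_eq_iff_im.mp q4.symm, q3, tr⟩

/-- Since `mix P P = 2 det P`, this is the null Lagrangian weighted by `u`. It holds for arbitrary
`x`. -/
theorem setIntegral_mix (h : KahlerComps U G) {x : C2 → ℂ} (hx : ContDiffOn ℝ ∞ x U) {K : Set C2}
    (hK : IsCompact K) (hKU : K ⊆ U) {u : C2 → ℝ} (hu : ContDiffOn ℝ ∞ u U)
    (huK : ∀ z ∈ U, z ∉ K → u z = 0) :
    ∫ z in (U : Set C2), ((u z : ℂ) * mix (pmat G x z) (pmat G x z) +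
      mix (Matrix.vecMulVec (bv G x z) fun β => eb β (fun w => (u w : ℂ)) z) (pmat G x z)).re = 0 := by
  have hS : SuppIn K (ofReal u hu) := fun z hz => by simp [huK z z.2 hz]
  have I := integral_null_lagrangian hK hKU hS (b1 := h.b1 (SmoothAlg.mk x hx))
    (b2 := h.b2 (SmoothAlg.mk x hx))
  refine setIntegral_re_extendZero _ _ (fun z => ?_) ?_ I
  · obtain ⟨d1, d2, d3, d4⟩ := h.fn_pmat (x := SmoothAlg.mk x hx) (fun w => rfl) z
    obtain ⟨c1, c2⟩ := h.fn_b (x := SmoothAlg.mk x hx) (fun w => rfl) z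
    obtain ⟨u1, u2⟩ := fn_db (F := ofReal u hu) (H := fun w => (u w : ℂ)) (fun w => rfl) z
    have ftwo : (2 : SmoothAlg U).fn z = 2 := rfl
    congr 1
    simp only [fn_add, fn_mul, fn_sub, d1, d2, d3, d4, c1, c2, u1, u2, fn_ofReal, mix, ftwo,
      Matrix.vecMulVec_apply]
    ring
  · have du1 := hS.dir hK 0 1 Complex.I
    have du2 := hS.dir hK 2 3 Complex.I
    refine SuppIn.integrable hK hKU ?_
    exact ((hS.mul_left _).mul_right _).add
      ((((du1.mul_right _).sub (du2.mul_right _)).mul_left _).add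
        (((du2.mul_right _).sub (du1.mul_right _)).mul_left _))

end KahlerComps

end

/-! ### Estimates for the metric near infinity and local inverses of parametrizations -/

section

open scoped ComplexConjugate

theorem exists_bound_of_isBigO {E : Type*} [NormedAddCommGroup E] {f : C2 → E} {n : ℤ}
    (h : f =O[Bornology.cobounded C2] fun z : C2 => ‖z‖ ^ n) :
    ∃ R C : ℝ, 0 < C ∧ ∀ z, R ≤ ‖z‖ → ‖f z‖ ≤ C * ‖z‖ ^ n := by
  obtain ⟨C, hC, h⟩ := h.exists_pos
  rw [Asymptotics.IsBigOWith, Filter.Eventually, ← comap_norm_atTop, Filter.mem_comap] at h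
  obtain ⟨s, hs, hsub⟩ := h
  obtain ⟨R, hR⟩ := Filter.mem_atTop_sets.mp hs
  refine ⟨R, C, hC, fun z hz => ?_⟩
  have := hsub (show z ∈ (fun z : C2 => ‖z‖) ⁻¹' s from hR _ hz)
  simpa using this

theorem eventually_cobounded {p : C2 → Prop} {R : ℝ} (h : ∀ z, R ≤ ‖z‖ → p z) :
    ∀ᶠ z in Bornology.cobounded C2, p z := by
  filter_upwards [tendsto_norm_cobounded_atTop.eventually_ge_atTop R] with z hz using h z hz

theorem norm_realFrame (i : Fin 4) : ‖realFrame i‖ = 1 := by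
  fin_cases i <;> simp [realFrame, EuclideanSpace.norm_eq, Fin.sum_univ_two]

theorem abs_pd_le (i : Fin 4) (f : C2 → ℝ) (z : C2) : |pd i f z| ≤ ‖fderiv ℝ f z‖ := by
  have := (fderiv ℝ f z).le_opNorm (realFrame i)
  rwa [norm_realFrame, mul_one] at this

theorem sum_sq_realCoord (v : C2) : ∑ i, realCoord v i ^ 2 = ‖v‖ ^ 2 := by
  rw [EuclideanSpace.norm_sq_eq]
  simp [Fin.sum_univ_four, Fin.sum_univ_two, realCoord, ← Complex.normSq_eq_norm_sq,
    Complex.normSq_apply]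
  ring

/-- A form whose coefficients are close to the Euclidean ones is comparable to the Euclidean one. -/
theorem quadratic_ge {G : Comp 2} {z : C2}
    (h : ∀ a b : Fin 4, |G z ![a, b] - if a = b then 1 else 0| ≤ 1 / 100) (v : C2) :
    1 / 2 * ‖v‖ ^ 2 ≤ ∑ i, ∑ j, realCoord v i * realCoord v j * G z ![i, j] := by
  have e : ∑ i, ∑ j, realCoord v i * realCoord v j * G z ![i, j] = ‖v‖ ^ 2 +
      ∑ i, ∑ j, realCoord v i * realCoord v j * (G z ![i, j] - if i = j then 1 else 0) := by
    simp only [mul_sub, Finset.sum_sub_distrib, ← sum_sq_realCoord, mul_ite, mul_one, mul_zero,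
      Finset.sum_ite_eq, Finset.mem_univ, if_true]
    simp only [← pow_two]
    ring
  have hb : ∀ i j : Fin 4, -(1 / 100) * ‖v‖ ^ 2 ≤
      realCoord v i * realCoord v j * (G z ![i, j] - if i = j then 1 else 0) := by
    intro i j
    have h1 : ∀ i, |realCoord v i| ≤ ‖v‖ := fun i => by
      refine abs_le_of_sq_le_sq ?_ (norm_nonneg v)
      rw [← sum_sq_realCoord]
      exact Finset.single_le_sum (f := fun i => realCoord v i ^ 2) (fun _ _ => sq_nonneg _)
        (Finset.mem_univ i)
    have h2 : |realCoord v i * realCoord v j * (G z ![i, j] - if i = j then 1 else 0)| ≤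
        ‖v‖ * ‖v‖ * (1 / 100) := by
      rw [abs_mul, abs_mul]
      gcongr
      · exact h1 i
      · exact h1 j
      · exact h i j
    nlinarith [(abs_le.mp h2).1]
  -- There are sixteen entries, each off by at most `1/100`, and `16/100 ≤ 1/2`.
  have hs : -(16 / 100) * ‖v‖ ^ 2 ≤
      ∑ i, ∑ j, realCoord v i * realCoord v j * (G z ![i, j] - if i = j then 1 else 0) := by
    have : ∑ i : Fin 4, ∑ j : Fin 4, -(1 / 100) * ‖v‖ ^ 2 ≤
      ∑ i, ∑ j, realCoord v i * realCoord v j * (G z ![i, j] - if i = j then 1 else 0) :=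
      Finset.sum_le_sum fun i _ => Finset.sum_le_sum fun j _ => hb i j
    simp at this ⊢
    linarith
  rw [e]
  nlinarith [sq_nonneg ‖v‖]

section Surface

variable {X : Type*} [TopologicalSpace X] [ChartedSpace C2 X]
variable {g : CovTensorField X 2} {k : ℕ}

/-- The asymptotics of the metric that are used: `g - g₀ = O(R⁻²)` and `∂g = O(R⁻³)`. -/
structure ALEBounds (A : ALEEnd g k) (R C : ℝ) : Prop where
  one_le : 1 ≤ R
  radius_lt : A.radius < R
  C_pos : 0 < C
  metric : ∀ z : C2, R ≤ ‖z‖ → ∀ a b : Fin 4,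
    |comps A.chart g z ![a, b] - if a = b then 1 else 0| ≤ C * ‖z‖ ^ (-2 : ℤ)
  small : ∀ z : C2, R ≤ ‖z‖ → ∀ a b : Fin 4,
    |comps A.chart g z ![a, b] - if a = b then 1 else 0| ≤ 1 / 100
  deriv : ∀ z : C2, R ≤ ‖z‖ → ∀ i a b : Fin 4,
    |pd i (fun w => comps A.chart g w ![a, b]) z| ≤ C * ‖z‖ ^ (-3 : ℤ)

theorem ALEEnd.exists_bounds (A : ALEEnd g k) (hk : 2 ≤ k) : ∃ R C, ALEBounds A R C := by
  choose R0 C0 hC0 h0 using fun a b => exists_bound_of_isBigO (A.decay 0 a b)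
  choose R1 C1 hC1 h1 using fun a b => exists_bound_of_isBigO (A.decay 1 a b)
  let C := 1 + ∑ a, ∑ b, (C0 a b + C1 a b)
  have hle : ∀ a b, C0 a b + C1 a b ≤ C := fun a b => by
    have s1 : C0 a b + C1 a b ≤ ∑ b, (C0 a b + C1 a b) :=
      Finset.single_le_sum (f := fun b => C0 a b + C1 a b)
        (fun b _ => (add_pos (hC0 a b) (hC1 a b)).le) (Finset.mem_univ b)
    have s2 : ∑ b, (C0 a b + C1 a b) ≤ ∑ a, ∑ b, (C0 a b + C1 a b) :=
      Finset.single_le_sum (f := fun a => ∑ b, (C0 a b + C1 a b))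
        (fun a _ => Finset.sum_nonneg fun b _ => (add_pos (hC0 a b) (hC1 a b)).le) (Finset.mem_univ a)
    simp only [C]; linarith
  have hC : 0 < C := by
    have := hle 0 0
    linarith [hC0 0 0, hC1 0 0]
  -- The summand `1` gives `R ≥ 1`, and `100 * C` makes `C R⁻² ≤ 1/100`. The double sum exceeds all
  -- thresholds from which the individual estimates hold.
  let R := 1 + |A.radius| + 100 * C + ∑ a, ∑ b, (|R0 a b| + |R1 a b|)
  have hRle : ∀ a b, |R0 a b| + |R1 a b| ≤ ∑ a, ∑ b, (|R0 a b| + |R1 a b|) := fun a b =>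
    (Finset.single_le_sum (f := fun b => |R0 a b| + |R1 a b|) (fun b _ => by positivity)
      (Finset.mem_univ b)).trans
    (Finset.single_le_sum (f := fun a => ∑ b, (|R0 a b| + |R1 a b|)) (fun a _ => by positivity)
      (Finset.mem_univ a))
  have hS : 0 ≤ ∑ a, ∑ b, (|R0 a b| + |R1 a b|) := by positivity
  have hR1 : 1 ≤ R := by simp only [R]; nlinarith [abs_nonneg A.radius]
  have hRr : A.radius < R := by simp only [R]; nlinarith [le_abs_self A.radius]
  have hRC : 100 * C ≤ R := by simp only [R]; nlinarith [abs_nonneg A.radius]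
  have hR0 : ∀ a b, R0 a b ≤ R ∧ R1 a b ≤ R := fun a b => by
    have := hRle a b
    have h1 := le_abs_self (R0 a b)
    have h2 := le_abs_self (R1 a b)
    have h3 := abs_nonneg (R0 a b)
    have h4 := abs_nonneg (R1 a b)
    have h5 := abs_nonneg A.radius
    constructor <;> simp only [R] <;> linarith
  have hz1 : ∀ z : C2, R ≤ ‖z‖ → 1 ≤ ‖z‖ := fun z hz => hR1.trans hz
  have metric : ∀ z : C2, R ≤ ‖z‖ → ∀ a b : Fin 4,
      |comps A.chart g z ![a, b] - if a = b then 1 else 0| ≤ C * ‖z‖ ^ (-2 : ℤ) := by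
    intro z hz a b
    have := h0 a b z ((hR0 a b).1.trans hz)
    rw [norm_iteratedFDeriv_zero, Real.norm_eq_abs] at this
    refine this.trans (mul_le_mul ?_ ?_ (by positivity) hC.le)
    · linarith [hle a b, hC1 a b]
    · exact zpow_le_zpow_right₀ (hz1 z hz) (by push_cast; omega)
  refine ⟨R, C, hR1, hRr, hC, metric, fun z hz a b => (metric z hz a b).trans ?_, ?_⟩
  · have h1 := hz1 z hz
    have : ‖z‖ ^ (-2 : ℤ) = (‖z‖ ^ 2)⁻¹ := by rw [zpow_neg]; norm_cast
    rw [this, ← div_eq_mul_inv, div_le_div_iff₀ (by positivity) (by norm_num)]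
    nlinarith
  · intro z hz i a b
    have := h1 a b z ((hR0 a b).2.trans hz)
    rw [norm_iteratedFDeriv_one] at this
    have e : fderiv ℝ (fun w => comps A.chart g w ![a, b] - if a = b then (1 : ℝ) else 0) z =
      fderiv ℝ (fun w => comps A.chart g w ![a, b]) z := fderiv_sub_const _
    rw [e] at this
    refine (abs_pd_le i _ z).trans (this.trans (mul_le_mul ?_ ?_ (by positivity) hC.le))
    · linarith [hle a b, hC0 a b]
    · exact zpow_le_zpow_right₀ (hz1 z hz) (by push_cast; omega)

theorem ALEBounds.norm_sq_le {A : ALEEnd g k} {R C : ℝ} (B : ALEBounds A R C) {z : C2} (hz : R ≤ ‖z‖)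
    (v : C2) : 1 / 2 * ‖v‖ ^ 2 ≤ pullAt A.chart g z ![v, v] := by
  rw [pullAt_expand]
  exact quadratic_ge (B.small z hz) v

variable [IsManifold 𝓘(ℂ, C2) ω X]

/-- A holomorphic parametrization has smooth local inverses. -/
theorem IsParam.exists_localInverse {F : C2 → X} {U : Set C2} (h : IsParam F U)
    {e : OpenPartialHomeomorph X C2} (he : e ∈ atlas C2 X) {z : C2} (hz : z ∈ overlap F U e) :
    ∃ σ : C2 → C2, ContDiffAt ℝ ∞ σ (e (F z)) ∧ σ (e (F z)) = z ∧
      ∀ᶠ w in nhds (e (F z)), σ w ∈ overlap F U e ∧ F (σ w) = e.symm w := by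
  have hV := h.isOpen_overlap e
  have hc : ContDiffAt ℂ ∞ (e ∘ F) z :=
    (contDiffOn_of_differentiableOn_C2 hV (h.differentiableOn_transition he)).contDiffAt
      (hV.mem_nhds hz)
  let E : C2 ≃L[ℂ] C2 := (LinearEquiv.ofBijective (fderiv ℂ (e ∘ F) z).toLinearMap
    (h.bijective_fderiv he hz)).toContinuousLinearEquiv
  have hE : HasFDerivAt (e ∘ F) (E : C2 →L[ℂ] C2) z :=
    (hc.differentiableAt (by simp)).hasFDerivAt
  have hs := hc.hasStrictFDerivAt' hE (by simp)
  refine ⟨hc.localInverse hE (by simp), (hc.to_localInverse hE (by simp)).restrict_scalars ℝ,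
    hc.localInverse_apply_image hE (by simp), ?_⟩
  have hcont : Filter.Tendsto (hc.localInverse hE (by simp)) (nhds (e (F z))) (nhds z) := by
    have := (hc.to_localInverse hE (by simp)).continuousAt
    rw [ContinuousAt] at this
    change Filter.Tendsto _ (nhds (e (F z))) (nhds (hc.localInverse hE (by simp) ((e ∘ F) z))) at this
    rwa [hc.localInverse_apply_image hE (by simp)] at this
  have hr : ∀ᶠ w in nhds (e (F z)), e (F (hc.localInverse hE (by simp) w)) = w :=
    hs.eventually_right_inverse
  filter_upwards [hcont.eventually (hV.mem_nhds hz), hr] with w h1 h2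
  refine ⟨h1, ?_⟩
  conv_rhs => rw [← h2]
  exact (e.left_inv h1.2).symm

end Surface

end

/-! ### Smooth functions on the surface, the radius function and cut-offs -/

section

open scoped ComplexConjugate

section Surface

variable {X : Type*} [TopologicalSpace X] [ChartedSpace C2 X]

/-- Smooth real functions on the surface. -/
def SmoothFn (u : X → ℝ) : Prop :=
  ∀ e ∈ atlas C2 X, ContDiffOn ℝ ∞ (fun z => u (e.symm z)) e.target

theorem SmoothFn.mul {u v : X → ℝ} (hu : SmoothFn u) (hv : SmoothFn v) :
    SmoothFn fun x => u x * v x := fun e he => (hu e he).mul (hv e he)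

theorem SmoothFn.sum {ι : Type*} {u : ι → X → ℝ} (s : Finset ι) (hu : ∀ i, SmoothFn (u i)) :
    SmoothFn fun x => ∑ i ∈ s, u i x := fun e he => ContDiffOn.sum fun i _ => hu i e he

theorem smoothFn_of_contDiffAt {u : X → ℝ} (h : ∀ e ∈ atlas C2 X, ∀ x ∈ e.source,
    ContDiffAt ℝ ∞ (fun z => u (e.symm z)) (e x)) : SmoothFn u := by
  intro e he z hz
  have := h e he (e.symm z) (e.map_target hz)
  rw [e.right_inv hz] at this
  exact this.contDiffWithinAt

theorem continuous_of_charts {Y : Type*} [TopologicalSpace Y] {u : X → Y}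
    (h : ∀ e ∈ atlas C2 X, ContinuousOn (fun z => u (e.symm z)) e.target) : Continuous u := by
  rw [continuous_iff_continuousAt]
  intro x
  set e := chartAt C2 x
  have hx := mem_chart_source C2 x
  have h1 : ContinuousAt (fun z => u (e.symm z)) (e x) :=
    (h e (chart_mem_atlas C2 x)).continuousAt (e.open_target.mem_nhds (e.map_source hx))
  have h2 := ContinuousAt.comp (f := e) h1 (e.continuousAt hx)
  refine h2.congr ?_
  filter_upwards [e.open_source.mem_nhds hx] with y hy
  simp [e.left_inv hy]

theorem SmoothFn.continuous {u : X → ℝ} (hu : SmoothFn u) : Continuous u :=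
  continuous_of_charts fun e he => (hu e he).continuousOn

variable {g : CovTensorField X 2} {k : ℕ}

namespace ALEEnd

theorem exists_of_notMem (A : ALEEnd g k) {x : X} (hx : x ∉ A.K) :
    ∃ z, A.radius < ‖z‖ ∧ A.chart z = x := by
  have : x ∈ A.chart '' {z | A.radius < ‖z‖} := by rw [A.image_eq]; exact hx
  exact this

theorem chart_notMem (A : ALEEnd g k) {z : C2} (hz : A.radius < ‖z‖) : A.chart z ∉ A.K := by
  have : A.chart z ∈ A.Kᶜ := by rw [← A.image_eq]; exact ⟨z, hz, rfl⟩
  exact this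

/-- The group `Γ` acts by isometries, so the norm descends to the end; this is what makes `rad`
independent of the chosen preimage. -/
theorem norm_eq_of_chart_eq (A : ALEEnd g k) {z w : C2} (hz : A.radius < ‖z‖) (hw : A.radius < ‖w‖)
    (h : A.chart z = A.chart w) : ‖z‖ = ‖w‖ := by
  obtain ⟨γ, _, rfl⟩ := (A.eq_iff z w hz hw).mp h
  exact (γ.norm_map z).symm

open Classical in
/-- The distance function of the end, extended by zero. -/
def rad (A : ALEEnd g k) (x : X) : ℝ :=
  if h : x ∈ A.K then 0 else ‖(A.exists_of_notMem h).choose‖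

theorem rad_chart (A : ALEEnd g k) {z : C2} (hz : A.radius < ‖z‖) : A.rad (A.chart z) = ‖z‖ := by
  have h := A.chart_notMem hz
  rw [rad, dif_neg h]
  have := (A.exists_of_notMem h).choose_spec
  exact A.norm_eq_of_chart_eq this.1 hz this.2

theorem rad_of_mem (A : ALEEnd g k) {x : X} (hx : x ∈ A.K) : A.rad x = 0 := by
  rw [rad, dif_pos hx]

theorem exists_of_lt_rad (A : ALEEnd g k) {x : X} {r : ℝ} (hr : 0 ≤ r) (h : r < A.rad x) :
    ∃ z, A.radius < ‖z‖ ∧ A.chart z = x ∧ r < ‖z‖ := by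
  by_cases hx : x ∈ A.K
  · rw [A.rad_of_mem hx] at h; linarith
  · obtain ⟨z, hz, rfl⟩ := A.exists_of_notMem hx
    rw [A.rad_chart hz] at h
    exact ⟨z, hz, rfl, h⟩

theorem isOpen_image [T2Space X] (A : ALEEnd g k) {r : ℝ} (hr : A.radius < r) :
    IsOpen (A.chart '' {z | r < ‖z‖}) := by
  rw [← isClosed_compl_iff]; exact (A.isCompact_compl r hr).isClosed

theorem isCompact_annulus (A : ALEEnd g k) {r s : ℝ} (hr : A.radius < r) :
    IsCompact (A.chart '' {z | r ≤ ‖z‖ ∧ ‖z‖ ≤ s}) := by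
  have h1 : IsCompact {z : C2 | r ≤ ‖z‖ ∧ ‖z‖ ≤ s} := by
    have : {z : C2 | r ≤ ‖z‖ ∧ ‖z‖ ≤ s} = Metric.closedBall 0 s ∩ {z | r ≤ ‖z‖} := by
      ext z; simp [and_comm]
    rw [this]
    exact (isCompact_closedBall 0 s).inter_right (isClosed_le continuous_const continuous_norm)
  exact h1.image_of_continuousOn (A.isParam.continuousOn.mono fun z hz => lt_of_lt_of_le hr hz.1)

variable [IsManifold 𝓘(ℂ, C2) ω X]

theorem rad_eventuallyEq (A : ALEEnd g k) {e : OpenPartialHomeomorph X C2}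
    {z : C2} {σ : C2 → C2} (hσ : ∀ᶠ w in nhds (e (A.chart z)),
      σ w ∈ overlap A.chart {z | A.radius < ‖z‖} e ∧ A.chart (σ w) = e.symm w) :
    (fun w => A.rad (e.symm w)) =ᶠ[nhds (e (A.chart z))] fun w => ‖σ w‖ := by
  filter_upwards [hσ] with w hw
  rw [← hw.2, A.rad_chart hw.1.1]

theorem contDiffAt_rad (A : ALEEnd g k) {e : OpenPartialHomeomorph X C2} (he : e ∈ atlas C2 X)
    {x : X} (hx : x ∈ e.source) (hxK : x ∉ A.K) :
    ContDiffAt ℝ ∞ (fun w => A.rad (e.symm w)) (e x) := by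
  obtain ⟨z, hz, rfl⟩ := A.exists_of_notMem hxK
  obtain ⟨σ, h1, h2, h3⟩ := A.isParam.exists_localInverse he ⟨hz, hx⟩
  refine ContDiffAt.congr_of_eventuallyEq ?_ (A.rad_eventuallyEq h3)
  refine h1.norm ℂ ?_
  rw [h2]
  exact norm_pos_iff.mp (A.radius_pos.trans hz)

/-- The gradient of the distance function is bounded in terms of the metric. -/
theorem fderiv_rad_le (A : ALEEnd g k) {R C : ℝ} (B : ALEBounds A R C)
    {e : OpenPartialHomeomorph X C2} (he : e ∈ atlas C2 X) {z : C2} (hz : R ≤ ‖z‖)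
    (hze : A.chart z ∈ e.source) (v : C2) :
    |fderiv ℝ (fun w => A.rad (e.symm w)) (e (A.chart z)) v| ≤
      √(2 * pullAt e.symm g (e (A.chart z)) ![v, v]) := by
  have hzr : A.radius < ‖z‖ := B.radius_lt.trans_le hz
  obtain ⟨σ, h1, h2, h3⟩ := A.isParam.exists_localInverse he ⟨hzr, hze⟩
  have hz0 : z ≠ 0 := norm_pos_iff.mp (A.radius_pos.trans hzr)
  have hσ := (h1.differentiableAt (by simp)).hasFDerivAt
  set S := fderiv ℝ σ (e (A.chart z))
  have hn : DifferentiableAt ℝ (fun w : C2 => ‖w‖) (σ (e (A.chart z))) := by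
    rw [h2]; exact (contDiffAt_norm (n := 1) ℂ hz0).differentiableAt (by simp)
  have hcomp := (hn.hasFDerivAt.comp _ hσ).congr_of_eventuallyEq (A.rad_eventuallyEq h3)
  rw [hcomp.fderiv]
  have hlip : ‖fderiv ℝ (fun w : C2 => ‖w‖) (σ (e (A.chart z)))‖ ≤ (1 : NNReal) :=
    norm_fderiv_le_of_lipschitz ℝ lipschitzWith_one_norm
  have b1 : |fderiv ℝ (fun w : C2 => ‖w‖) (σ (e (A.chart z))) (S v)| ≤ ‖S v‖ := by
    have := (fderiv ℝ (fun w : C2 => ‖w‖) (σ (e (A.chart z)))).le_opNorm (S v)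
    rw [Real.norm_eq_abs] at this
    refine this.trans ?_
    have := mul_le_mul_of_nonneg_right hlip (norm_nonneg (S v))
    simpa using this
  have inv : fderiv ℂ (e ∘ A.chart) z (S v) = v := by
    have hτ : HasFDerivAt (e ∘ A.chart) ((fderiv ℂ (e ∘ A.chart) z).restrictScalars ℝ)
        (σ (e (A.chart z))) := by
      rw [h2]
      exact ((A.isParam.differentiableOn_transition he).differentiableAt
        ((A.isParam.isOpen_overlap e).mem_nhds ⟨hzr, hze⟩)).hasFDerivAt.restrictScalars ℝ
    have hid : HasFDerivAt (fun w => w) (ContinuousLinearMap.id ℝ C2) (e (A.chart z)) :=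
      hasFDerivAt_id _
    have := (hτ.comp _ hσ).congr_of_eventuallyEq (f₁ := fun w => w) (by
      filter_upwards [h3, e.open_target.mem_nhds (e.map_source hze)] with w hw hwt
      change w = e (A.chart (σ w))
      rw [hw.2, e.right_inv hwt])
    have := congrArg (fun L : C2 →L[ℝ] C2 => L v) (this.unique hid)
    exact this
  have b2 := B.norm_sq_le hz (S v)
  rw [A.isParam.pullAt_eq he g ⟨hzr, hze⟩] at b2
  have ev : (fun a => fderiv ℂ (e ∘ A.chart) z ((![S v, S v] : Fin 2 → C2) a)) = ![v, v] := by
    ext a : 1; fin_cases a <;> exact inv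
  rw [ev] at b2
  refine b1.trans (Real.le_sqrt_of_sq_le ?_)
  simp only [Function.comp_apply] at b2
  linarith

theorem exists_pullAt_le (hg : IsKahlerMetric g) {e : OpenPartialHomeomorph X C2} (he : e ∈ atlas C2 X)
    {D : Set C2} (hD : IsCompact D) (hDe : D ⊆ e.target) :
    ∃ M, 0 ≤ M ∧ ∀ w ∈ D, ∀ v : C2, pullAt e.symm g w ![v, v] ≤ M * ‖v‖ ^ 2 := by
  choose M hM using fun i j : Fin 4 => hD.exists_bound_of_continuousOn
    ((hg.smooth e he ![i, j]).continuousOn.mono hDe)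
  refine ⟨∑ i, ∑ j, |M i j|, by positivity, fun w hw v => ?_⟩
  rw [pullAt_expand, Finset.sum_mul]
  refine Finset.sum_le_sum fun i _ => ?_
  rw [Finset.sum_mul]
  refine Finset.sum_le_sum fun j _ => ?_
  have h1 : ∀ i, |realCoord v i| ≤ ‖v‖ := fun i => by
    refine abs_le_of_sq_le_sq ?_ (norm_nonneg v)
    rw [← sum_sq_realCoord]
    exact Finset.single_le_sum (f := fun i => realCoord v i ^ 2) (fun _ _ => sq_nonneg _)
      (Finset.mem_univ i)
  calc realCoord v i * realCoord v j * comps e.symm g w ![i, j]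
      ≤ |realCoord v i * realCoord v j * comps e.symm g w ![i, j]| := le_abs_self _
    _ = |realCoord v i| * |realCoord v j| * |comps e.symm g w ![i, j]| := by rw [abs_mul, abs_mul]
    _ ≤ ‖v‖ * ‖v‖ * |M i j| := by
        exact mul_le_mul (mul_le_mul (h1 i) (h1 j) (abs_nonneg _) (norm_nonneg _))
          ((hM i j w hw).trans (le_abs_self _)) (abs_nonneg _) (by positivity)
    _ = |M i j| * ‖v‖ ^ 2 := by ring

/-- Points of `K` are not limits of points of the end that go to infinity. -/
theorem exists_nhds_of_mem_K [T2Space X] (A : ALEEnd g k) (hg : IsKahlerMetric g) {R C : ℝ}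
    (B : ALEBounds A R C) {y : X} (hy : y ∈ A.K) :
    ∃ V ∈ nhds y, ∀ x ∈ V, A.rad x < R + 1 := by
  -- Compactness of the complements alone does not prevent a point of `K` from closing up the end at
  -- infinity. The metric does: `rad` is Lipschitz for `g` on the end, and `g` is bounded near `y`,
  -- so a short path towards `y` cannot change `rad` by much.
  set e := chartAt C2 y
  have he : e ∈ atlas C2 X := chart_mem_atlas C2 y
  have hye : y ∈ e.source := mem_chart_source C2 y
  obtain ⟨ε, hε, hball⟩ := Metric.isOpen_iff.mp e.open_target (e y) (e.map_source hye)
  have hsub : Metric.closedBall (e y) (ε / 2) ⊆ e.target :=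
    (Metric.closedBall_subset_ball (by linarith)).trans hball
  obtain ⟨M, hM0, hM⟩ := exists_pullAt_le hg he (isCompact_closedBall (e y) (ε / 2)) hsub
  -- Along a segment of length less than `δ` the radius changes by at most `√(2 M) δ ≤ 1/2`; the
  -- summand `1` covers `M = 0`.
  set δ := min (ε / 2) (1 / (4 * (√(2 * M) + 1)))
  have hδ : 0 < δ := by positivity
  have hδM : √(2 * M) * δ ≤ 1 / 2 := by
    have h1 : δ ≤ 1 / (4 * (√(2 * M) + 1)) := min_le_right _ _
    have h2 : √(2 * M) * δ ≤ √(2 * M) * (1 / (4 * (√(2 * M) + 1))) := by gcongr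
    refine h2.trans ?_
    rw [mul_one_div, div_le_div_iff₀ (by positivity) (by norm_num)]
    nlinarith [Real.sqrt_nonneg (2 * M)]
  have hballδ : Metric.ball (e y) δ ⊆ Metric.closedBall (e y) (ε / 2) :=
    (Metric.ball_subset_closedBall).trans (Metric.closedBall_subset_closedBall (min_le_left _ _))
  refine ⟨e.source ∩ e ⁻¹' Metric.ball (e y) δ,
    (e.continuousOn.isOpen_inter_preimage e.open_source Metric.isOpen_ball).mem_nhds
      ⟨hye, Metric.mem_ball_self hδ⟩, ?_⟩
  rintro x ⟨hxe, hxb⟩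
  by_contra! hcon
  let c : ℝ → C2 := fun t => e x + t • (e y - e x)
  have hc : Continuous c := by fun_prop
  have hcb : ∀ t ∈ Set.Icc (0 : ℝ) 1, c t ∈ Metric.ball (e y) δ := by
    intro t ht
    have : c t - e y = (1 - t) • (e x - e y) := by
      simp only [c, sub_smul, one_smul, smul_sub]; abel
    rw [Metric.mem_ball, dist_eq_norm, this, norm_smul, Real.norm_eq_abs, abs_of_nonneg (by linarith [ht.2])]
    have hxb' : ‖e x - e y‖ < δ := by rw [← dist_eq_norm]; exact hxb
    nlinarith [norm_nonneg (e x - e y), ht.1]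
  have hct : ∀ t ∈ Set.Icc (0 : ℝ) 1, c t ∈ e.target := fun t ht => hsub (hballδ (hcb t ht))
  let D := A.chart '' {z | R < ‖z‖}
  have hDo : IsOpen D := A.isOpen_image B.radius_lt
  have hmemD : ∀ x : X, x ∈ D ↔ R < A.rad x := by
    intro x
    constructor
    · rintro ⟨z, hz, rfl⟩
      rwa [A.rad_chart (B.radius_lt.trans hz)]
    · intro h
      obtain ⟨z, _, hz, hz'⟩ := A.exists_of_lt_rad (by linarith [B.one_le]) h
      exact ⟨z, hz', hz⟩
  let p : ℝ → X := fun t => e.symm (c t)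
  have hp : ContinuousOn p (Set.Icc 0 1) := e.continuousOn_symm.comp hc.continuousOn hct
  have hp0 : p 0 = x := by simp [p, c, e.left_inv hxe]
  have hp1 : p 1 = y := by simp [p, c, e.left_inv hye]
  -- Follow the segment from `x` to `y` up to the first time `T` at which it leaves the open set
  -- `D`; it must leave because `y` lies in `K`.
  have hbad : IsCompact (Set.Icc (0 : ℝ) 1 ∩ p ⁻¹' Dᶜ) :=
    isCompact_Icc.of_isClosed_subset
      (hp.preimage_isClosed_of_isClosed isClosed_Icc hDo.isClosed_compl) Set.inter_subset_left
  have hne : (Set.Icc (0 : ℝ) 1 ∩ p ⁻¹' Dᶜ).Nonempty := by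
    refine ⟨1, by simp, ?_⟩
    change p 1 ∉ D
    rw [hp1, hmemD, A.rad_of_mem hy]
    linarith [B.one_le]
  obtain ⟨T, ⟨hT, hTD⟩, hmin⟩ := hbad.exists_isLeast hne
  have hgood : ∀ t ∈ Set.Ico 0 T, p t ∈ D := by
    intro t ht
    by_contra h
    exact absurd (hmin ⟨⟨ht.1, ht.2.le.trans hT.2⟩, h⟩) (not_le.mpr ht.2)
  have hT0 : 0 < T := by
    refine lt_of_le_of_ne hT.1 fun h => hTD ?_
    rw [← h, hp0, hmemD]
    linarith
  have hder : ∀ t ∈ Set.Ico 0 T, HasDerivAt (fun t => A.rad (p t))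
      (fderiv ℝ (fun w => A.rad (e.symm w)) (c t) (e y - e x)) t ∧
      |fderiv ℝ (fun w => A.rad (e.symm w)) (c t) (e y - e x)| ≤ 1 / 2 := by
    intro t ht
    have ht1 : t ∈ Set.Icc (0 : ℝ) 1 := ⟨ht.1, ht.2.le.trans hT.2⟩
    obtain ⟨z, hz, hzp⟩ := hgood t ht
    have hzr := B.radius_lt.trans hz
    have hec : e (A.chart z) = c t := by rw [hzp]; exact e.right_inv (hct t ht1)
    have hze : A.chart z ∈ e.source := by rw [hzp]; exact e.map_target (hct t ht1)
    have hd := (A.contDiffAt_rad he hze (A.chart_notMem hzr)).differentiableAt (by simp)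
    have hb := A.fderiv_rad_le B he (le_of_lt hz) hze (e y - e x)
    rw [hec] at hd hb
    have hcd : HasDerivAt c (e y - e x) t := by
      have := ((hasDerivAt_id t).smul_const (e y - e x)).const_add (e x)
      rwa [one_smul] at this
    refine ⟨hd.hasFDerivAt.comp_hasDerivAt t hcd, hb.trans ?_⟩
    have hn : ‖e y - e x‖ ≤ δ := by
      rw [← dist_eq_norm, dist_comm]; exact le_of_lt hxb
    have h1 := hM (c t) (hballδ (hcb t ht1)) (e y - e x)
    calc √(2 * pullAt e.symm g (c t) ![e y - e x, e y - e x])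
        ≤ √(2 * M * ‖e y - e x‖ ^ 2) := Real.sqrt_le_sqrt (by linarith)
      _ = √(2 * M) * ‖e y - e x‖ := by
          rw [Real.sqrt_mul (by positivity), Real.sqrt_sq (norm_nonneg _)]
      _ ≤ √(2 * M) * δ := by gcongr
      _ ≤ 1 / 2 := hδM
  have hlip : ∀ t ∈ Set.Ico 0 T, |A.rad (p t) - A.rad x| ≤ 1 / 2 := by
    intro t ht
    have := (convex_Ico 0 T).norm_image_sub_le_of_norm_hasDerivWithin_le
      (fun t ht => (hder t ht).1.hasDerivWithinAt) (fun t ht => (hder t ht).2)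
      (show (0 : ℝ) ∈ Set.Ico 0 T from ⟨le_rfl, hT0⟩) ht
    rw [hp0, Real.norm_eq_abs, sub_zero, Real.norm_eq_abs, abs_of_nonneg ht.1] at this
    nlinarith [ht.2, hT.2]
  -- Before time `T` the path stays in the image of an annulus whose inner radius exceeds `R`. This
  -- image is compact, hence closed, and lies in `D`; so the path is still in `D` at time `T`, a
  -- contradiction.
  have hcl : IsClosed (A.chart '' {z | R + 1 / 2 ≤ ‖z‖ ∧ ‖z‖ ≤ A.rad x + 1 / 2}) :=
    (A.isCompact_annulus (by linarith [B.radius_lt])).isClosed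
  have hTmem : p T ∈ A.chart '' {z | R + 1 / 2 ≤ ‖z‖ ∧ ‖z‖ ≤ A.rad x + 1 / 2} := by
    have hlim : Filter.Tendsto p (nhdsWithin T (Set.Iio T)) (nhds (p T)) := by
      have h1 : ContinuousWithinAt p (Set.Ico 0 T) T :=
        (hp T hT).mono fun s hs => ⟨hs.1, hs.2.le.trans hT.2⟩
      have h2 : nhdsWithin T (Set.Iio T) = nhdsWithin T (Set.Ico 0 T) :=
        (nhdsWithin_Ico_eq_nhdsLT hT0).symm
      rw [h2]; exact h1
    refine hcl.mem_of_tendsto hlim ?_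
    filter_upwards [Ico_mem_nhdsLT hT0] with t ht
    obtain ⟨z, hz, hzp⟩ := hgood t ht
    have := hlip t ht
    rw [← hzp, A.rad_chart (B.radius_lt.trans hz), abs_le] at this
    exact ⟨z, ⟨by linarith, by linarith⟩, hzp⟩
  obtain ⟨z, ⟨hz1, -⟩, hzp⟩ := hTmem
  exact hTD ⟨z, show R < ‖z‖ by linarith, hzp⟩

theorem continuousAt_rad (A : ALEEnd g k) {x : X} (hx : x ∉ A.K) : ContinuousAt A.rad x := by
  set e := chartAt C2 x
  have hxe : x ∈ e.source := mem_chart_source C2 x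
  have h1 := (A.contDiffAt_rad (chart_mem_atlas C2 x) hxe hx).continuousAt
  have h2 := ContinuousAt.comp (f := e) h1 (e.continuousAt hxe)
  refine h2.congr ?_
  filter_upwards [e.open_source.mem_nhds hxe] with y hy
  exact congrArg A.rad (e.left_inv hy)

theorem isOpen_rad_lt [T2Space X] (A : ALEEnd g k) (hg : IsKahlerMetric g) {R C : ℝ}
    (B : ALEBounds A R C) {r : ℝ} (hr : R + 1 ≤ r) : IsOpen {x | A.rad x < r} := by
  rw [isOpen_iff_mem_nhds]
  intro x hx
  by_cases hxK : x ∈ A.K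
  · obtain ⟨V, hV, h⟩ := A.exists_nhds_of_mem_K hg B hxK
    filter_upwards [hV] with y hy using (h y hy).trans_le hr
  · exact (A.continuousAt_rad hxK).eventually_lt_const hx

/-- The cut-off functions of the end. -/
def cutoff (A : ALEEnd g k) (r : ℝ) (x : X) : ℝ := Real.smoothTransition (2 - A.rad x / r)

theorem cutoff_eq_one (A : ALEEnd g k) {r : ℝ} (hr : 0 < r) {x : X} (h : A.rad x ≤ r) :
    A.cutoff r x = 1 := by
  refine Real.smoothTransition.one_of_one_le ?_
  have : A.rad x / r ≤ 1 := by rw [div_le_one hr]; exact h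
  linarith

theorem cutoff_eq_zero (A : ALEEnd g k) {r : ℝ} (hr : 0 < r) {x : X} (h : 2 * r ≤ A.rad x) :
    A.cutoff r x = 0 := by
  refine Real.smoothTransition.zero_of_nonpos ?_
  have : 2 ≤ A.rad x / r := by rw [le_div_iff₀ hr]; exact h
  linarith

theorem smoothFn_cutoff [T2Space X] (A : ALEEnd g k) (hg : IsKahlerMetric g) {R C : ℝ}
    (B : ALEBounds A R C) {r : ℝ} (hr : R + 1 ≤ r) : SmoothFn (A.cutoff r) := by
  refine smoothFn_of_contDiffAt fun e he x hx => ?_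
  have hr0 : 0 < r := by linarith [B.one_le]
  by_cases hxK : x ∈ A.K
  -- The function `rad` is set to zero on `K` and may jump there, but the cut-off is identically `1`
  -- in a neighbourhood of `K`.
  · have : (fun z => A.cutoff r (e.symm z)) =ᶠ[nhds (e x)] fun _ => 1 := by
      have hmem := (A.isOpen_rad_lt hg B hr).mem_nhds
        (show x ∈ {x | A.rad x < r} by simp [A.rad_of_mem hxK, hr0])
      have ht : Filter.Tendsto e.symm (nhds (e x)) (nhds x) := by
        have := e.continuousAt_symm (e.map_source hx)
        rw [ContinuousAt, e.left_inv hx] at this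
        exact this
      filter_upwards [ht.eventually hmem] with w hw
      exact A.cutoff_eq_one hr0 (le_of_lt hw)
    exact contDiffAt_const.congr_of_eventuallyEq this
  · exact Real.smoothTransition.contDiffAt.comp (e x)
      (contDiffAt_const.sub ((A.contDiffAt_rad he hx hxK).div_const r))

end ALEEnd
end Surface

end

/-! ### The Riemannian volume measure -/

section

open scoped ComplexConjugate

open MeasureTheory

theorem measurableSet_inter_preimage_of_continuousOn {α β : Type*} [TopologicalSpace α]
    [MeasurableSpace α] [OpensMeasurableSpace α] [TopologicalSpace β] [MeasurableSpace β]
    [BorelSpace β] {f : α → β} {s : Set α} (hf : ContinuousOn f s) (hs : MeasurableSet s)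
    {T : Set β} (hT : MeasurableSet T) : MeasurableSet (s ∩ f ⁻¹' T) := by
  have h1 : Measurable (s.domRestrict f) := (continuousOn_iff_continuous_domRestrict.mp hf).measurable
  have h2 := hs.subtype_image (h1 hT)
  convert h2 using 1
  ext x
  constructor
  · rintro ⟨hx, hT⟩
    exact ⟨⟨x, hx⟩, hT, rfl⟩
  · rintro ⟨y, hy, rfl⟩
    exact ⟨y.2, hy⟩

/-- The real Jacobian determinant of a holomorphic map. -/
theorem det_fderiv_real (τ : C2 → C2) (z : C2) :
    ((fderiv ℂ τ z).restrictScalars ℝ).det = Complex.normSq (jac τ z).det := by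
  have h1 : ((fderiv ℂ τ z).restrictScalars ℝ).det =
      LinearMap.det ((fderiv ℂ τ z).toLinearMap.restrictScalars ℝ) := rfl
  rw [h1, LinearMap.det_restrictScalars, Algebra.norm_complex_apply]
  congr 1
  let b := (EuclideanSpace.basisFun (Fin 2) ℂ).toBasis
  rw [← LinearMap.det_toMatrix b]
  congr 1
  ext a c
  rw [LinearMap.toMatrix_apply]
  simp only [b, OrthonormalBasis.coe_toBasis, EuclideanSpace.basisFun_apply,
    OrthonormalBasis.coe_toBasis_repr_apply, EuclideanSpace.basisFun_repr, jac, Matrix.of_apply]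
  have : (EuclideanSpace.single c 1 : C2) = cFrame c := by
    ext i
    fin_cases c <;> fin_cases i <;> simp [cFrame, realFrame]
  rw [this]
  rfl

section Surface

variable {X : Type*} [TopologicalSpace X] [ChartedSpace C2 X] [MeasurableSpace X] [BorelSpace X]

/-- The Riemannian volume measure of the domain of a chart. -/
def chartMeasure (g : CovTensorField X 2) (e : OpenPartialHomeomorph X C2) : Measure X :=
  Measure.map e.symm ((volume.withDensity fun z => ENNReal.ofReal (vol (comps e.symm g) z)).restrict
    e.target)

variable {g : CovTensorField X 2}

theorem aemeasurable_symm (e : OpenPartialHomeomorph X C2) (ν : Measure C2) :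
    AEMeasurable e.symm (ν.restrict e.target) :=
  e.continuousOn_symm.aemeasurable e.open_target.measurableSet

theorem chartMeasure_apply (e : OpenPartialHomeomorph X C2) {S : Set X} (hS : MeasurableSet S) :
    chartMeasure g e S = ∫⁻ z in e.symm ⁻¹' S ∩ e.target, ENNReal.ofReal (vol (comps e.symm g) z) := by
  rw [chartMeasure, Measure.map_apply_of_aemeasurable (aemeasurable_symm e _) hS,
    Measure.restrict_apply' e.open_target.measurableSet, withDensity_apply']

variable [IsManifold 𝓘(ℂ, C2) ω X]

/-- Change of variables: the real Jacobian determinant of a holomorphic map is `|det J|²`, exactly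
the factor by which the density changes. -/
theorem chartMeasure_image (hg : IsKahlerMetric g) {F : C2 → X} {U : Set C2} (hF : IsParam F U)
    {e : OpenPartialHomeomorph X C2} (he : e ∈ atlas C2 X) {E : Set C2} (hE : MeasurableSet E)
    (hEU : E ⊆ overlap F U e) (hinj : Set.InjOn F E) (hS : MeasurableSet (F '' E)) :
    chartMeasure g e (F '' E) = ∫⁻ z in E, ENNReal.ofReal (vol (comps F g) z) := by
  have himg : e.symm ⁻¹' (F '' E) ∩ e.target = (e ∘ F) '' E := by
    ext w
    constructor
    · rintro ⟨⟨z, hz, hzw⟩, hw⟩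
      exact ⟨z, hz, by simp [hzw, e.right_inv hw]⟩
    · rintro ⟨z, hz, rfl⟩
      exact ⟨⟨z, hz, (e.left_inv (hEU hz).2).symm⟩, e.map_source (hEU hz).2⟩
  have hinj' : Set.InjOn (e ∘ F) E := fun x hx y hy hxy =>
    hinj hx hy (e.injOn (hEU hx).2 (hEU hy).2 hxy)
  have hd : ∀ z ∈ E, HasFDerivWithinAt (e ∘ F) ((fderiv ℂ (e ∘ F) z).restrictScalars ℝ) E z :=
    fun z hz => (((hF.differentiableOn_transition he).differentiableAt
      ((hF.isOpen_overlap e).mem_nhds (hEU hz))).hasFDerivAt.restrictScalars ℝ).hasFDerivWithinAt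
  rw [chartMeasure_apply e hS, himg, lintegral_image_eq_lintegral_abs_det_fderiv_mul volume hE hd hinj']
  refine setLIntegral_congr_fun hE fun z hz => ?_
  simp only
  rw [det_fderiv_real, abs_of_nonneg (Complex.normSq_nonneg _),
    ← ENNReal.ofReal_mul (Complex.normSq_nonneg _)]
  congr 1
  have := (hF.pull hg he).vol_eq (hEU hz)
  rw [Complex.mul_conj] at this
  exact_mod_cast this.symm

theorem chartMeasure_congr (hg : IsKahlerMetric g) {e e' : OpenPartialHomeomorph X C2}
    (he : e ∈ atlas C2 X) (he' : e' ∈ atlas C2 X) {S : Set X} (hS : MeasurableSet S)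
    (hSe : S ⊆ e.source) (hSe' : S ⊆ e'.source) : chartMeasure g e S = chartMeasure g e' S := by
  have hE : MeasurableSet (e'.target ∩ e'.symm ⁻¹' S) := measurableSet_inter_preimage_of_continuousOn
    e'.continuousOn_symm e'.open_target.measurableSet hS
  have himg : e'.symm '' (e'.target ∩ e'.symm ⁻¹' S) = S := by
    ext x
    constructor
    · rintro ⟨z, hz, rfl⟩
      exact hz.2
    · intro hx
      exact ⟨e' x, ⟨e'.map_source (hSe' hx), by rwa [Set.mem_preimage, e'.left_inv (hSe' hx)]⟩,
        e'.left_inv (hSe' hx)⟩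
  have h1 := chartMeasure_image hg (isParam_of_mem_atlas he') he hE
    (fun z hz => ⟨hz.1, hSe hz.2⟩) (e'.symm.injOn.mono fun z hz => hz.1) (by rwa [himg])
  rw [himg] at h1
  rw [h1, chartMeasure_apply e' hS, Set.inter_comm]

/-- `μ` is the Riemannian volume measure. -/
def IsVolume (g : CovTensorField X 2) (μ : Measure X) : Prop :=
  ∀ e ∈ atlas C2 X, ∀ S : Set X, MeasurableSet S → S ⊆ e.source → μ S = chartMeasure g e S

/-- The measures of two charts agree on their overlap. Cut the surface into countably many disjoint
Borel pieces, each inside one chart, and add the measures of the pieces. -/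
theorem exists_isVolume [SecondCountableTopology X] [Nonempty X] (hg : IsKahlerMetric g) :
    ∃ μ : Measure X, IsVolume g μ := by
  obtain ⟨s, hs, hcov⟩ := TopologicalSpace.countable_cover_nhds
    (fun x : X => (chartAt C2 x).open_source.mem_nhds (mem_chart_source C2 x))
  have hne : s.Nonempty := by
    by_contra h
    rw [Set.not_nonempty_iff_eq_empty] at h
    simp [h] at hcov
    exact (Set.univ_nonempty (α := X)).ne_empty hcov.symm
  obtain ⟨x, rfl⟩ := hs.exists_eq_range hne
  let D : ℕ → Set X := disjointed fun n => (chartAt C2 (x n)).source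
  have hD : ∀ n, MeasurableSet (D n) := MeasurableSet.disjointed fun n =>
    (chartAt C2 (x n)).open_source.measurableSet
  have hDs : ∀ n, D n ⊆ (chartAt C2 (x n)).source := fun n => disjointed_subset _ n
  refine ⟨Measure.sum fun n => (chartMeasure g (chartAt C2 (x n))).restrict (D n), ?_⟩
  intro e he S hS hSe
  rw [Measure.sum_apply _ hS]
  have h1 : ∀ n, (chartMeasure g (chartAt C2 (x n))).restrict (D n) S = chartMeasure g e (S ∩ D n) := by
    intro n
    rw [Measure.restrict_apply hS]
    exact chartMeasure_congr hg (chart_mem_atlas C2 _) he (hS.inter (hD n))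
      (fun y hy => hDs n hy.2) fun y hy => hSe hy.1
  simp only [h1]
  rw [← measure_iUnion (fun i j hij => ((disjoint_disjointed _) hij).mono Set.inter_subset_right
    Set.inter_subset_right) fun n => hS.inter (hD n), ← Set.inter_iUnion, iUnion_disjointed]
  congr 1
  have : ⋃ n, (chartAt C2 (x n)).source = Set.univ := by
    rw [← hcov]; simp
  rw [this, Set.inter_univ]

namespace IsVolume

variable {μ : Measure X}

theorem restrict_eq (hμ : IsVolume g μ) {e : OpenPartialHomeomorph X C2} (he : e ∈ atlas C2 X) :
    μ.restrict e.source = chartMeasure g e := by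
  ext S hS
  rw [Measure.restrict_apply hS, hμ e he _ (hS.inter e.open_source.measurableSet)
    Set.inter_subset_right, chartMeasure_apply e (hS.inter e.open_source.measurableSet),
    chartMeasure_apply e hS]
  congr 2
  ext z
  simp only [Set.mem_inter_iff, Set.mem_preimage]
  exact ⟨fun h => ⟨h.1.1, h.2⟩, fun h => ⟨⟨h.1, e.map_target h.2⟩, h.2⟩⟩

theorem integral_eq (hμ : IsVolume g μ) (hg : IsKahlerMetric g) {e : OpenPartialHomeomorph X C2}
    (he : e ∈ atlas C2 X) {S : X → ℝ} (hS : Continuous S) (h0 : ∀ x, x ∉ e.source → S x = 0) :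
    ∫ x, S x ∂μ = ∫ z in e.target, vol (comps e.symm g) z * S (e.symm z) := by
  rw [← setIntegral_eq_integral_of_forall_compl_eq_zero h0, hμ.restrict_eq he, chartMeasure,
    integral_map (aemeasurable_symm e _) hS.measurable.aestronglyMeasurable,
    restrict_withDensity e.open_target.measurableSet,
    integral_withDensity_eq_integral_toReal_smul₀]
  · refine setIntegral_congr_fun e.open_target.measurableSet fun z hz => ?_
    simp only [smul_eq_mul]
    rw [ENNReal.toReal_ofReal (comps_pos hg (isParam_of_mem_atlas he) hz).2.le]
  · refine AEMeasurable.ennreal_ofReal (ContinuousOn.aemeasurable ?_ e.open_target.measurableSet)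
    have := (hg.kahlerComps he).smooth
    exact fun z hz => by
      have c : ∀ I, ContinuousWithinAt (fun z => comps e.symm g z I) e.target z :=
        fun I => (this I).continuousOn z hz
      exact (((c _).mul (c _)).sub ((c _).pow 2)).sub ((c _).pow 2)
  · exact Filter.Eventually.of_forall fun z => ENNReal.ofReal_lt_top

end IsVolume

end Surface

end

/-! ### Local finiteness, positivity and growth of the volume -/

section

open scoped ComplexConjugate

open MeasureTheory

section Surface

variable {X : Type*} [TopologicalSpace X] [ChartedSpace C2 X] [IsManifold 𝓘(ℂ, C2) ω X]
  {g : CovTensorField X 2}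

theorem IsParam.exists_injOn {F : C2 → X} {U : Set C2} (h : IsParam F U) {z : C2} (hz : z ∈ U) :
    ∃ V, IsOpen V ∧ z ∈ V ∧ V ⊆ overlap F U (chartAt C2 (F z)) ∧ Set.InjOn F V := by
  set e := chartAt C2 (F z)
  have he : e ∈ atlas C2 X := chart_mem_atlas C2 _
  have hze : z ∈ overlap F U e := ⟨hz, mem_chart_source C2 _⟩
  have hV := h.isOpen_overlap e
  have hc : ContDiffAt ℂ ∞ (e ∘ F) z :=
    (contDiffOn_of_differentiableOn_C2 hV (h.differentiableOn_transition he)).contDiffAt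
      (hV.mem_nhds hze)
  let E : C2 ≃L[ℂ] C2 := (LinearEquiv.ofBijective (fderiv ℂ (e ∘ F) z).toLinearMap
    (h.bijective_fderiv he hze)).toContinuousLinearEquiv
  have hE : HasFDerivAt (e ∘ F) (E : C2 →L[ℂ] C2) z :=
    (hc.differentiableAt (by simp)).hasFDerivAt
  have hs := hc.hasStrictFDerivAt' hE (by simp)
  let H := hs.toOpenPartialHomeomorph (e ∘ F)
  refine ⟨H.source ∩ overlap F U e, H.open_source.inter hV,
    ⟨hs.mem_toOpenPartialHomeomorph_source, hze⟩, Set.inter_subset_right, ?_⟩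
  intro x hx y hy hxy
  exact H.injOn hx.1 hy.1 (show e (F x) = e (F y) by rw [hxy])

theorem HermComps.continuousOn_vol {U : Set C2} {G : Comp 2} (h : HermComps U G) :
    ContinuousOn (vol G) U := by
  intro z hz
  have c : ∀ I, ContinuousWithinAt (fun z => G z I) U z := fun I => (h.smooth I).continuousOn z hz
  exact (((c _).mul (c _)).sub ((c _).pow 2)).sub ((c _).pow 2)

variable [MeasurableSpace X] [BorelSpace X]

namespace IsVolume

variable {μ : Measure X}

theorem isLocallyFinite (hμ : IsVolume g μ) (hg : IsKahlerMetric g) : IsLocallyFiniteMeasure μ := by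
  refine ⟨fun x => ?_⟩
  set e := chartAt C2 x
  have he : e ∈ atlas C2 X := chart_mem_atlas C2 _
  have hx : x ∈ e.source := mem_chart_source C2 x
  obtain ⟨ε, hε, hball⟩ := Metric.isOpen_iff.mp e.open_target (e x) (e.map_source hx)
  have hsub : Metric.closedBall (e x) (ε / 2) ⊆ e.target :=
    (Metric.closedBall_subset_ball (by linarith)).trans hball
  have hH := (isParam_of_mem_atlas he).hermComps hg
  obtain ⟨M, hM⟩ := (isCompact_closedBall (e x) (ε / 2)).exists_bound_of_continuousOn
    (hH.continuousOn_vol.mono hsub)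
  set S := e.source ∩ e ⁻¹' Metric.ball (e x) (ε / 2)
  have hS : IsOpen S := e.continuousOn.isOpen_inter_preimage e.open_source Metric.isOpen_ball
  refine ⟨S, hS.mem_nhds ⟨hx, Metric.mem_ball_self (by linarith)⟩, ?_⟩
  rw [hμ e he S hS.measurableSet Set.inter_subset_left, chartMeasure_apply e hS.measurableSet]
  have hSb : e.symm ⁻¹' S ∩ e.target ⊆ Metric.closedBall (e x) (ε / 2) := by
    rintro w ⟨h1, h2⟩
    have := h1.2
    rw [Set.mem_preimage, e.right_inv h2] at this
    exact Metric.ball_subset_closedBall this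
  calc ∫⁻ z in e.symm ⁻¹' S ∩ e.target, ENNReal.ofReal (vol (comps e.symm g) z)
      ≤ ∫⁻ z in Metric.closedBall (e x) (ε / 2), ENNReal.ofReal (vol (comps e.symm g) z) :=
        lintegral_mono_set hSb
    _ ≤ ∫⁻ z in Metric.closedBall (e x) (ε / 2), ENNReal.ofReal M :=
        setLIntegral_mono measurable_const fun z hz =>
          ENNReal.ofReal_le_ofReal ((le_abs_self _).trans (hM z hz))
    _ < ⊤ := by
        rw [setLIntegral_const]
        exact ENNReal.mul_lt_top ENNReal.ofReal_lt_top (isCompact_closedBall _ _).measure_lt_top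

theorem measure_pos (hμ : IsVolume g μ) (hg : IsKahlerMetric g) {N : Set X} (hN : IsOpen N) {x : X}
    (hx : x ∈ N) : 0 < μ N := by
  set e := chartAt C2 x
  have he : e ∈ atlas C2 X := chart_mem_atlas C2 _
  have hxe : x ∈ e.source := mem_chart_source C2 x
  have hH := (isParam_of_mem_atlas he).hermComps hg
  set S := N ∩ e.source
  have hS : IsOpen S := hN.inter e.open_source
  have hW : IsOpen (e.symm ⁻¹' S ∩ e.target) := by
    rw [Set.inter_comm]
    exact e.continuousOn_symm.isOpen_inter_preimage e.open_target hS
  have hxW : e x ∈ e.symm ⁻¹' S ∩ e.target :=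
    ⟨by rw [Set.mem_preimage, e.left_inv hxe]; exact ⟨hx, hxe⟩, e.map_source hxe⟩
  have hv := hH.vol_pos (e x) hxW.2
  have hnear : ∀ᶠ z in nhds (e x), vol (comps e.symm g) (e x) / 2 < vol (comps e.symm g) z :=
    (hH.continuousOn_vol.continuousAt (e.open_target.mem_nhds hxW.2)).eventually_const_lt
      (by linarith)
  obtain ⟨ε, hε, hball⟩ := Metric.mem_nhds_iff.mp (Filter.inter_mem (hW.mem_nhds hxW) hnear)
  refine lt_of_lt_of_le ?_ (measure_mono (Set.inter_subset_left : S ⊆ N))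
  rw [hμ e he S hS.measurableSet Set.inter_subset_right, chartMeasure_apply e hS.measurableSet]
  calc (0 : ENNReal) < ENNReal.ofReal (vol (comps e.symm g) (e x) / 2) *
        volume (Metric.ball (e x) ε) :=
        ENNReal.mul_pos (by simpa using hv) (Metric.measure_ball_pos _ _ hε).ne'
    _ = ∫⁻ z in Metric.ball (e x) ε, ENNReal.ofReal (vol (comps e.symm g) (e x) / 2) := by
        rw [setLIntegral_const]
    _ ≤ ∫⁻ z in Metric.ball (e x) ε, ENNReal.ofReal (vol (comps e.symm g) z) :=
        setLIntegral_mono' Metric.isOpen_ball.measurableSet fun z hz =>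
          ENNReal.ofReal_le_ofReal (le_of_lt (hball hz).2)
    _ ≤ _ := lintegral_mono_set fun z hz => (hball hz).1

/-- Only an inequality, because `F` need not be injective: the chart at infinity identifies
`Γ`-orbits. The domain is split into countably many pieces on which `F` is injective. -/
theorem image_le (hμ : IsVolume g μ) (hg : IsKahlerMetric g) {F : C2 → X} {U : Set C2}
    (hF : IsParam F U) {E : Set C2} (hE : MeasurableSet E) (hEU : E ⊆ U) :
    μ (F '' E) ≤ ∫⁻ z in E, ENNReal.ofReal (vol (comps F g) z) := by
  rcases E.eq_empty_or_nonempty with rfl | hne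
  · simp
  choose! V hVo hzV hVs hVi using fun z (hz : z ∈ U) => hF.exists_injOn hz
  obtain ⟨t, htE, htc, hcov⟩ := TopologicalSpace.countable_cover_nhdsWithin (f := V) (s := E)
    fun z hz => mem_nhdsWithin_of_mem_nhds ((hVo z (hEU hz)).mem_nhds (hzV z (hEU hz)))
  have htne : t.Nonempty := by
    by_contra h
    rw [Set.not_nonempty_iff_eq_empty] at h
    rw [h] at hcov
    simp at hcov
    exact hne.ne_empty hcov
  obtain ⟨p, rfl⟩ := htc.exists_eq_range htne
  have hpU : ∀ n, p n ∈ U := fun n => hEU (htE ⟨n, rfl⟩)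
  let D : ℕ → Set C2 := disjointed fun n => V (p n)
  have hD : ∀ n, MeasurableSet (E ∩ D n) := fun n => hE.inter
    (MeasurableSet.disjointed (fun n => (hVo _ (hpU n)).measurableSet) n)
  have hDV : ∀ n, D n ⊆ V (p n) := fun n => disjointed_subset _ n
  have hEeq : E = ⋃ n, E ∩ D n := by
    rw [← Set.inter_iUnion, iUnion_disjointed, eq_comm, Set.inter_eq_left]
    simpa using hcov
  have hpiece : ∀ n, μ (F '' (E ∩ D n)) = ∫⁻ z in E ∩ D n, ENNReal.ofReal (vol (comps F g) z) := by
    intro n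
    set e := chartAt C2 (F (p n))
    have he : e ∈ atlas C2 X := chart_mem_atlas C2 _
    have hov : E ∩ D n ⊆ overlap F U e := fun z hz => hVs _ (hpU n) (hDV n hz.2)
    have hinj : Set.InjOn F (E ∩ D n) := (hVi _ (hpU n)).mono fun z hz => hDV n hz.2
    have himg : F '' (E ∩ D n) = e.source ∩ e ⁻¹' ((e ∘ F) '' (E ∩ D n)) := by
      ext x
      constructor
      · rintro ⟨z, hz, rfl⟩
        exact ⟨(hov hz).2, z, hz, rfl⟩
      · rintro ⟨hx, z, hz, hzx⟩
        exact ⟨z, hz, e.injOn (hov hz).2 hx hzx⟩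
    have hm : MeasurableSet (F '' (E ∩ D n)) := by
      rw [himg]
      refine measurableSet_inter_preimage_of_continuousOn e.continuousOn e.open_source.measurableSet ?_
      refine (hD n).image_of_continuousOn_injOn
        ((hF.differentiableOn_transition he).continuousOn.mono hov) ?_
      exact fun x hx y hy hxy => hinj hx hy (e.injOn (hov hx).2 (hov hy).2 hxy)
    rw [hμ e he _ hm (by rintro x ⟨z, hz, rfl⟩; exact (hov hz).2)]
    exact chartMeasure_image hg hF he (hD n) hov hinj hm
  conv_lhs => rw [hEeq, Set.image_iUnion]
  refine (measure_iUnion_le _).trans ?_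
  simp only [hpiece]
  rw [← lintegral_iUnion hD (fun i j hij => ((disjoint_disjointed _) hij).mono
    Set.inter_subset_right Set.inter_subset_right), ← hEeq]

theorem annulus_le (hμ : IsVolume g μ) (hg : IsKahlerMetric g) {k : ℕ} {A : ALEEnd g k} {R C : ℝ}
    (B : ALEBounds A R C) : ∃ M, 0 < M ∧ ∀ r, R ≤ r →
      μ (A.chart '' {z | r ≤ ‖z‖ ∧ ‖z‖ ≤ 2 * r}) ≤ ENNReal.ofReal (M * r ^ 4) := by
  -- The density is at most `2` and the ball of radius `2 r` has volume `(2 r)⁴` times that of the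
  -- unit ball, so `32 = 2 · 2⁴`; the `1` only ensures positivity.
  refine ⟨1 + 32 * (volume (Metric.ball (0 : C2) 1)).toReal, by positivity, fun r hr => ?_⟩
  have hr0 : 0 ≤ r := by linarith [B.one_le]
  have hE : IsClosed {z : C2 | r ≤ ‖z‖ ∧ ‖z‖ ≤ 2 * r} :=
    (isClosed_le continuous_const continuous_norm).inter (isClosed_le continuous_norm continuous_const)
  refine (hμ.image_le hg A.isParam hE.measurableSet
    fun z hz => B.radius_lt.trans_le (hr.trans hz.1)).trans ?_
  calc ∫⁻ z in {z : C2 | r ≤ ‖z‖ ∧ ‖z‖ ≤ 2 * r}, ENNReal.ofReal (vol (comps A.chart g) z)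
      ≤ ∫⁻ z in {z : C2 | r ≤ ‖z‖ ∧ ‖z‖ ≤ 2 * r}, 2 := by
        refine setLIntegral_mono measurable_const fun z hz => ?_
        have h := B.small z (hr.trans hz.1)
        have h0 := h 0 0
        have h2 := h 2 2
        simp only [if_true, abs_le] at h0 h2
        rw [← ENNReal.ofReal_ofNat]
        refine ENNReal.ofReal_le_ofReal ?_
        rw [vol]
        nlinarith [sq_nonneg (comps A.chart g z ![0, 2]), sq_nonneg (comps A.chart g z ![0, 3])]
    _ ≤ ∫⁻ z in Metric.closedBall (0 : C2) (2 * r), 2 :=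
        lintegral_mono_set fun z hz => by simpa using hz.2
    _ = 2 * volume (Metric.closedBall (0 : C2) (2 * r)) := by rw [setLIntegral_const]
    _ = ENNReal.ofReal (2 * (2 * r) ^ 4 * (volume (Metric.ball (0 : C2) 1)).toReal) := by
        have hfin : Module.finrank ℝ C2 = 4 := by
          rw [Module.finrank_eq_card_basis realBasis, Fintype.card_fin]
        rw [Measure.addHaar_closedBall _ _ (by positivity), hfin,
          ENNReal.ofReal_mul (by positivity), ENNReal.ofReal_mul (by positivity),
          ENNReal.ofReal_toReal measure_ball_lt_top.ne, ENNReal.ofReal_ofNat, mul_assoc]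
    _ ≤ _ := by
        refine ENNReal.ofReal_le_ofReal ?_
        nlinarith [pow_nonneg hr0 4]

end IsVolume

end Surface

end

/-! ### Partitions of unity, null operators and the vanishing argument -/

section

open scoped ComplexConjugate

open MeasureTheory

section Surface

variable {X : Type*} [TopologicalSpace X] [T2Space X] [ChartedSpace C2 X]
  [IsManifold 𝓘(ℂ, C2) ω X] {g : CovTensorField X 2}

theorem tendsto_symm_nhds {e : OpenPartialHomeomorph X C2} {x : X} (hx : x ∈ e.source) :
    Filter.Tendsto e.symm (nhds (e x)) (nhds x) := by
  have := e.continuousAt_symm (e.map_source hx)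
  rwa [ContinuousAt, e.left_inv hx] at this

theorem exists_bump (x : X) : ∃ b : X → ℝ, SmoothFn b ∧ (∀ y, 0 ≤ b y) ∧ 0 < b x ∧
    ∃ K, IsCompact K ∧ K ⊆ (chartAt C2 x).source ∧ ∀ y, y ∉ K → b y = 0 := by
  classical
  set e := chartAt C2 x
  have he : e ∈ atlas C2 X := chart_mem_atlas C2 _
  have hx : x ∈ e.source := mem_chart_source C2 x
  obtain ⟨ε, hε, hball⟩ := Metric.isOpen_iff.mp e.open_target (e x) (e.map_source hx)
  have hsub : Metric.closedBall (e x) (ε / 2) ⊆ e.target :=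
    (Metric.closedBall_subset_ball (by linarith)).trans hball
  let f : ContDiffBump (e x) := ⟨ε / 4, ε / 2, by linarith, by linarith⟩
  let b : X → ℝ := fun y => if y ∈ e.source then f (e y) else 0
  let K := e.symm '' Metric.closedBall (e x) (ε / 2)
  have hK : IsCompact K :=
    (isCompact_closedBall _ _).image_of_continuousOn (e.continuousOn_symm.mono hsub)
  have hb0 : ∀ y, y ∉ K → b y = 0 := by
    intro y hy
    by_cases hye : y ∈ e.source
    · have : e y ∉ Metric.closedBall (e x) (ε / 2) := fun h => hy ⟨e y, h, e.left_inv hye⟩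
      simp only [b, if_pos hye]
      exact f.zero_of_le_dist (by simpa [f] using (not_le.mp this).le)
    · simp [b, hye]
  refine ⟨b, ?_, fun y => ?_, ?_, K, hK, ?_, hb0⟩
  · refine smoothFn_of_contDiffAt fun e' he' y hy => ?_
    by_cases hye : y ∈ e.source
    · have hov : e' y ∈ overlap e'.symm e'.target e :=
        ⟨e'.map_source hy, by rwa [Set.mem_preimage, e'.left_inv hy]⟩
      have ho := (isParam_of_mem_atlas he').isOpen_overlap e
      have ht := ((isParam_of_mem_atlas he').contDiffOn_transition he).contDiffAt (ho.mem_nhds hov)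
      have hf : ContDiffAt ℝ ∞ (fun w => f ((e ∘ e'.symm) w)) (e' y) :=
        (f.contDiff.contDiffAt).comp (e' y) ht
      refine hf.congr_of_eventuallyEq ?_
      filter_upwards [ho.mem_nhds hov] with w hw
      have : e'.symm w ∈ e.source := hw.2
      simp only [b, if_pos this, Function.comp_apply]
    · have hyK : y ∉ K := by
        rintro ⟨z, hz, rfl⟩
        exact hye (e.map_target (hsub hz))
      refine contDiffAt_const (c := (0 : ℝ)) |>.congr_of_eventuallyEq ?_
      filter_upwards [(tendsto_symm_nhds hy).eventually (hK.isClosed.isOpen_compl.mem_nhds hyK)]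
        with w hw using hb0 _ hw
  · simp only [b]
    split_ifs
    · exact f.nonneg
    · exact le_rfl
  · simp only [b, if_pos hx]
    rw [f.one_of_mem_closedBall (Metric.mem_closedBall_self f.rIn_pos.le)]
    norm_num
  · rintro y ⟨z, hz, rfl⟩
    exact e.map_target (hsub hz)

/-- Decomposition of a compactly supported function into functions supported in charts. -/
theorem SmoothFn.exists_decomposition {u : X → ℝ} (hu : SmoothFn u) {K : Set X} (hK : IsCompact K)
    (hu0 : ∀ x, x ∉ K → u x = 0) : ∃ (s : Finset X) (v : X → X → ℝ), (∀ i, SmoothFn (v i)) ∧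
      (∀ i, ∃ D, IsCompact D ∧ D ⊆ (chartAt C2 i).source ∧ ∀ y, y ∉ D → v i y = 0) ∧
      u = fun x => ∑ i ∈ s, v i x := by
  choose b hb hb0 hbp D hD hDs hbD using exists_bump (X := X)
  obtain ⟨s, -, hs⟩ := hK.elim_nhds_subcover (fun x => {y | 0 < b x y}) fun x _ =>
    (isOpen_lt continuous_const (hb x).continuous).mem_nhds (hbp x)
  let S : X → ℝ := fun x => ∑ i ∈ s, b i x
  have hS : SmoothFn S := SmoothFn.sum s hb
  have hpos : ∀ x ∈ K, 0 < S x := by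
    intro x hx
    obtain ⟨i, hi, hix⟩ := Set.mem_iUnion₂.mp (hs hx)
    exact Finset.sum_pos' (fun j _ => hb0 j x) ⟨i, hi, hix⟩
  refine ⟨s, fun i x => u x * b i x / S x, fun i => ?_, fun i => ⟨D i, hD i, hDs i, fun y hy => ?_⟩, ?_⟩
  · refine smoothFn_of_contDiffAt fun e he x hx => ?_
    have hn := e.open_target.mem_nhds (e.map_source hx)
    by_cases hxK : x ∈ K
    · refine ContDiffAt.div (((hu e he).contDiffAt hn).mul ((hb i e he).contDiffAt hn))
        ((hS e he).contDiffAt hn) ?_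
      rw [e.left_inv hx]
      exact (hpos x hxK).ne'
    · refine contDiffAt_const (c := (0 : ℝ)) |>.congr_of_eventuallyEq ?_
      filter_upwards [(tendsto_symm_nhds hx).eventually (hK.isClosed.isOpen_compl.mem_nhds hxK)]
        with w hw
      simp [hu0 _ hw]
  · simp [hbD i y hy]
  · ext x
    by_cases hxK : x ∈ K
    · rw [← Finset.sum_div, ← Finset.mul_sum]
      exact (mul_div_cancel_right₀ _ (hpos x hxK).ne').symm
    · simp [hu0 x hxK]

/-- A linear local operator on functions whose values on functions with compact support in a chart
have zero integral. -/
structure NullOperator (g : CovTensorField X 2) (L : (X → ℝ) → X → ℝ) : Prop where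
  map_sum : ∀ (s : Finset X) (u : X → X → ℝ), (∀ i, SmoothFn (u i)) →
    ∀ x, L (fun y => ∑ i ∈ s, u i y) x = ∑ i ∈ s, L (u i) x
  map_eventually_zero : ∀ u x, (∀ᶠ y in nhds x, u y = 0) → L u x = 0
  continuous : ∀ u, SmoothFn u → Continuous (L u)
  integral : ∀ e ∈ atlas C2 X, ∀ K, IsCompact K → K ⊆ e.source → ∀ u, SmoothFn u →
    (∀ x, x ∉ K → u x = 0) → ∫ z in e.target, vol (comps e.symm g) z * L u (e.symm z) = 0

namespace NullOperator

variable {L : (X → ℝ) → X → ℝ} [MeasurableSpace X] [BorelSpace X] {μ : Measure X}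

theorem eq_zero_of_notMem (hL : NullOperator g L) {u : X → ℝ} {K : Set X} (hK : IsClosed K)
    (hu0 : ∀ x, x ∉ K → u x = 0) {x : X} (hx : x ∉ K) : L u x = 0 := by
  refine hL.map_eventually_zero u x ?_
  filter_upwards [hK.isOpen_compl.mem_nhds hx] with y hy using hu0 y hy

theorem integrable (hL : NullOperator g L) (hg : IsKahlerMetric g) (hμ : IsVolume g μ) {u : X → ℝ}
    (hu : SmoothFn u) {K : Set X} (hK : IsCompact K) (hu0 : ∀ x, x ∉ K → u x = 0) :
    Integrable (L u) μ := by
  have := hμ.isLocallyFinite hg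
  exact (hL.continuous u hu).integrable_of_hasCompactSupport
    (HasCompactSupport.intro hK fun x hx => hL.eq_zero_of_notMem hK.isClosed hu0 hx)

/-- Decompose `u` into pieces supported in charts; by linearity the integral is a finite sum of
integrals that vanish by hypothesis. -/
theorem integral_eq_zero (hL : NullOperator g L) (hg : IsKahlerMetric g) (hμ : IsVolume g μ)
    {u : X → ℝ} (hu : SmoothFn u) {K : Set X} (hK : IsCompact K) (hu0 : ∀ x, x ∉ K → u x = 0) :
    ∫ x, L u x ∂μ = 0 := by
  obtain ⟨s, v, hv, hD, rfl⟩ := hu.exists_decomposition hK hu0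
  choose D hD hDs hvD using hD
  simp only [hL.map_sum s v hv]
  rw [integral_finsetSum _ fun i _ => hL.integrable hg hμ (hv i) (hD i) (hvD i)]
  refine Finset.sum_eq_zero fun i _ => ?_
  have he := chart_mem_atlas C2 i
  rw [hμ.integral_eq hg he (hL.continuous _ (hv i)) fun x hx =>
    hL.eq_zero_of_notMem (hD i).isClosed (hvD i) fun h => hx (hDs i h)]
  exact hL.integral _ he (D i) (hD i) (hDs i) _ (hv i) (hvD i)

/-- A nonnegative density that is bounded by null Lagrangians up to small errors vanishes. -/
theorem eq_zero (hL : NullOperator g L) (hg : IsKahlerMetric g) (hμ : IsVolume g μ) {k : ℕ}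
    {A : ALEEnd g k} {R C M r₀ : ℝ} (B : ALEBounds A R C) {q : X → ℝ} (hq : Continuous q)
    (hq0 : ∀ x, 0 ≤ q x) {u : ℝ → X → ℝ} (hu : ∀ r, r₀ ≤ r → SmoothFn (u r))
    (hu0 : ∀ r, r₀ ≤ r → ∀ x, 2 * r ≤ A.rad x → u r x = 0)
    (hin : ∀ r, r₀ ≤ r → ∀ x, A.rad x < r → q x ≤ L (u r) x)
    (hann : ∀ r, r₀ ≤ r → ∀ z, r ≤ ‖z‖ → ‖z‖ ≤ 2 * r → - (M / r ^ 8) ≤ L (u r) (A.chart z)) (x₀ : X) :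
    q x₀ = 0 := by
  by_contra hne
  have hpos : 0 < q x₀ := lt_of_le_of_ne (hq0 x₀) (Ne.symm hne)
  have := hμ.isLocallyFinite hg
  obtain ⟨N₁, hN₁, hfin⟩ := μ.finiteAt_nhds x₀
  obtain ⟨N₂, hN₂s, hN₂, hxN₂⟩ := mem_nhds_iff.mp hN₁
  -- `N` is a fixed open neighbourhood of `x₀` of finite measure on which `q` exceeds half of `q
  -- x₀`. For `r ≥ r₁` it lies in the region `rad < r`, where `q ≤ L (u r)`.
  set r₁ := max (R + 1) (A.rad x₀ + 1)
  let N := N₂ ∩ {x | q x₀ / 2 < q x} ∩ {x | A.rad x < r₁}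
  have hNo : IsOpen N := (hN₂.inter (isOpen_lt continuous_const hq)).inter
    (A.isOpen_rad_lt hg B (le_max_left _ _))
  have hxN : x₀ ∈ N := ⟨⟨hxN₂, show q x₀ / 2 < q x₀ by linarith⟩,
    show A.rad x₀ < r₁ from lt_of_lt_of_le (by linarith) (le_max_right _ _)⟩
  have hNfin : μ N ≠ ⊤ :=
    ((measure_mono fun x hx => hN₂s hx.1.1).trans_lt hfin).ne
  have hNpos : 0 < (μ N).toReal := ENNReal.toReal_pos (hμ.measure_pos hg hNo hxN).ne' hNfin
  obtain ⟨M', hM', hvol⟩ := hμ.annulus_le hg B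
  -- The integral of `L (u r)` is zero. It is at least the contribution of `N` minus `|M| / r⁸`
  -- times the volume `M' r⁴` of the annulus, so the contribution of `N` is `O(r⁻⁴)`.
  have key : ∀ r, max r₀ r₁ ≤ r → q x₀ / 2 * (μ N).toReal ≤ |M| * M' / r ^ 4 := by
    intro r hr
    have hr0 : r₀ ≤ r := (le_max_left _ _).trans hr
    have hr1 : r₁ ≤ r := (le_max_right _ _).trans hr
    have hRr : R + 1 ≤ r := (le_max_left _ _).trans hr1
    have hrp : 0 < r := by linarith [B.one_le]
    let S := A.chart '' {z | r ≤ ‖z‖ ∧ ‖z‖ ≤ 2 * r}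
    have hSc : IsCompact S := A.isCompact_annulus (by linarith [B.radius_lt])
    have hKc : IsCompact (A.chart '' {z | 2 * r < ‖z‖})ᶜ :=
      A.isCompact_compl _ (by linarith [B.radius_lt])
    have hz : ∀ x, x ∉ (A.chart '' {z | 2 * r < ‖z‖})ᶜ → u r x = 0 := by
      intro x hx
      obtain ⟨z, hz, rfl⟩ := not_not.mp hx
      have hz' : 2 * r < ‖z‖ := hz
      refine hu0 r hr0 _ ?_
      rw [A.rad_chart (by linarith [B.radius_lt])]
      exact hz'.le
    have hint := hL.integrable hg hμ (hu r hr0) hKc hz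
    have h0 := hL.integral_eq_zero hg hμ (hu r hr0) hKc hz
    have hle : ∀ x, N.indicator (fun _ => q x₀ / 2) x - S.indicator (fun _ => |M| / r ^ 8) x
        ≤ L (u r) x := by
      intro x
      rcases lt_or_ge (A.rad x) r with h | h
      · have h1 := hin r hr0 x h
        have h2 : 0 ≤ S.indicator (fun _ => |M| / r ^ 8) x :=
          Set.indicator_nonneg (fun _ _ => by positivity) x
        have h3 : N.indicator (fun _ => q x₀ / 2) x ≤ q x := by
          refine Set.indicator_le' (fun y hy => ?_) (fun y _ => hq0 y) x
          exact le_of_lt hy.1.2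
        linarith
      · have hxN : x ∉ N := fun hx => absurd (hx.2.trans_le hr1) (not_lt.mpr h)
        rw [Set.indicator_of_notMem hxN]
        obtain ⟨z, hzr, rfl⟩ : ∃ z, A.radius < ‖z‖ ∧ A.chart z = x := by
          refine A.exists_of_notMem fun hx => ?_
          rw [A.rad_of_mem hx] at h
          linarith
        rw [A.rad_chart hzr] at h
        rcases le_or_gt ‖z‖ (2 * r) with h2 | h2
        · rw [Set.indicator_of_mem (show A.chart z ∈ S from ⟨z, ⟨h, h2⟩, rfl⟩)]
          refine le_trans ?_ (hann r hr0 z h h2)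
          have : M / r ^ 8 ≤ |M| / r ^ 8 := by gcongr; exact le_abs_self M
          linarith
        · rw [hL.eq_zero_of_notMem hKc.isClosed hz (not_not.mpr ⟨z, h2, rfl⟩)]
          have : 0 ≤ S.indicator (fun _ => |M| / r ^ 8) (A.chart z) :=
            Set.indicator_nonneg (fun _ _ => by positivity) _
          linarith
    have i1 : Integrable (N.indicator fun _ => q x₀ / 2) μ :=
      (integrable_indicator_iff hNo.measurableSet).mpr (integrableOn_const hNfin)
    have i2 : Integrable (S.indicator fun _ => |M| / r ^ 8) μ :=
      (integrable_indicator_iff hSc.measurableSet).mpr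
        (integrableOn_const hSc.measure_lt_top.ne)
    have := integral_mono (i1.sub i2) hint hle
    simp only [Pi.sub_apply] at this
    rw [h0, integral_sub i1 i2, integral_indicator_const _ hNo.measurableSet,
      integral_indicator_const _ hSc.measurableSet] at this
    have hS : μ.real S ≤ M' * r ^ 4 := by
      refine ENNReal.toReal_le_of_le_ofReal (by positivity) ?_
      exact hvol r (by linarith)
    simp only [smul_eq_mul] at this
    have h5 : μ.real S * (|M| / r ^ 8) ≤ M' * r ^ 4 * (|M| / r ^ 8) := by gcongr
    have h6 : M' * r ^ 4 * (|M| / r ^ 8) = |M| * M' / r ^ 4 := by field_simp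
    have h7 : μ.real N = (μ N).toReal := rfl
    rw [h7] at this
    linarith
  have hlim : Filter.Tendsto (fun r : ℝ => |M| * M' / r ^ 4) Filter.atTop (nhds 0) :=
    (Filter.tendsto_pow_atTop (by norm_num)).const_div_atTop _
  have := ge_of_tendsto hlim (Filter.eventually_atTop.mpr ⟨_, key⟩)
  have hpp : 0 < q x₀ / 2 * (μ N).toReal := by positivity
  linarith

end NullOperator

end Surface

end

/-! ### Product rules for `∂̄ grad` and the Caccioppoli inequality -/

section

open scoped ComplexConjugate

open MeasureTheory

theorem differentiableAt_ofReal {u : C2 → ℝ} {z : C2} (hu : DifferentiableAt ℝ u z) :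
    DifferentiableAt ℝ (fun w => (u w : ℂ)) z := Complex.ofRealCLM.differentiableAt.comp z hu

section Gradient

variable {U : Set C2} {G : Comp 2} {u v : C2 → ℝ} {z : C2}

theorem gv_congr (h : u =ᶠ[nhds z] v) : gv G u z = gv G v z := by
  have e : ∀ β, eb β (fun w => (u w : ℂ)) z = eb β (fun w => (v w : ℂ)) z := fun β =>
    eb_congr (h.fun_comp (fun t : ℝ => (t : ℂ))) β
  simp only [gv, e]

theorem hess_congr (h : u =ᶠ[nhds z] v) : hess G u z = hess G v z := by
  ext δ ε
  refine eb_congr ?_ ε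
  filter_upwards [h.eventuallyEq_nhds] with w hw
  rw [gv_congr hw]

theorem gv_zero (G : Comp 2) (z : C2) : gv G (fun _ => 0) z = 0 := by
  have e : ∀ β, eb β (fun _ => ((0 : ℝ) : ℂ)) z = 0 := fun β => by simp [eb, dbar]
  ext δ
  fin_cases δ <;> simp only [gv, e] <;> simp

theorem hess_zero (G : Comp 2) (z : C2) : hess G (fun _ => 0) z = 0 := by
  ext δ ε
  simp [hess, gv_zero, eb, dbar]

theorem gv_add (hu : DifferentiableAt ℝ u z) (hv : DifferentiableAt ℝ v z) :
    gv G (fun w => u w + v w) z = gv G u z + gv G v z := by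
  have e : ∀ β, eb β (fun w => ((u w + v w : ℝ) : ℂ)) z =
      eb β (fun w => (u w : ℂ)) z + eb β (fun w => (v w : ℂ)) z := fun β => by
    rw [← eb_add (differentiableAt_ofReal hu) (differentiableAt_ofReal hv)]
    congr 1
    ext w
    push_cast
    rfl
  ext δ
  fin_cases δ <;> simp only [gv, e] <;> simp <;> ring

theorem eb_ofReal_mul (hu : DifferentiableAt ℝ u z) (hv : DifferentiableAt ℝ v z) (β : Fin 2) :
    eb β (fun w => ((u w * v w : ℝ) : ℂ)) z =
      u z * eb β (fun w => (v w : ℂ)) z + v z * eb β (fun w => (u w : ℂ)) z := by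
  have : (fun w => ((u w * v w : ℝ) : ℂ)) = fun w => (u w : ℂ) * (v w : ℂ) := by
    ext w; push_cast; rfl
  rw [this, eb_mul (differentiableAt_ofReal hu) (differentiableAt_ofReal hv)]
  ring

theorem gv_mul (hu : DifferentiableAt ℝ u z) (hv : DifferentiableAt ℝ v z) (δ : Fin 2) :
    gv G (fun w => u w * v w) z δ = u z * gv G v z δ + v z * gv G u z δ := by
  have e := eb_ofReal_mul hu hv
  fin_cases δ <;> simp only [gv, e] <;> simp <;> ring

theorem hess_add (h : HermComps U G) (hu : ContDiffOn ℝ ∞ u U) (hv : ContDiffOn ℝ ∞ v U)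
    (hz : z ∈ U) : hess G (fun w => u w + v w) z = hess G u z + hess G v z := by
  have hU := h.isOpen.mem_nhds hz
  have d : ∀ {u : C2 → ℝ}, ContDiffOn ℝ ∞ u U → ∀ w ∈ U, DifferentiableAt ℝ u w := fun hu w hw =>
    (hu.contDiffAt (h.isOpen.mem_nhds hw)).differentiableAt (by simp)
  ext δ ε
  have e : (fun w => gv G (fun w => u w + v w) w δ) =ᶠ[nhds z] fun w => gv G u w δ + gv G v w δ := by
    filter_upwards [hU] with w hw
    rw [gv_add (d hu w hw) (d hv w hw), Pi.add_apply]
  change eb ε _ z = eb ε _ z + eb ε _ z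
  rw [eb_congr e, eb_add]
  · exact ((h.contDiffOn_gv hu δ).contDiffAt hU).differentiableAt (by simp)
  · exact ((h.contDiffOn_gv hv δ).contDiffAt hU).differentiableAt (by simp)

theorem hess_mul (h : HermComps U G) (hu : ContDiffOn ℝ ∞ u U) (hv : ContDiffOn ℝ ∞ v U)
    (hz : z ∈ U) (δ ε : Fin 2) : hess G (fun w => u w * v w) z δ ε =
      u z * hess G v z δ ε + v z * hess G u z δ ε + eb ε (fun w => (u w : ℂ)) z * gv G v z δ
        + eb ε (fun w => (v w : ℂ)) z * gv G u z δ := by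
  have hU := h.isOpen.mem_nhds hz
  have d : ∀ {u : C2 → ℝ}, ContDiffOn ℝ ∞ u U → ∀ w ∈ U, DifferentiableAt ℝ u w := fun hu w hw =>
    (hu.contDiffAt (h.isOpen.mem_nhds hw)).differentiableAt (by simp)
  have e : (fun w => gv G (fun w => u w * v w) w δ) =ᶠ[nhds z]
      fun w => (u w : ℂ) * gv G v w δ + (v w : ℂ) * gv G u w δ := by
    filter_upwards [hU] with w hw using gv_mul (d hu w hw) (d hv w hw) δ
  have du := differentiableAt_ofReal (d hu z hz)
  have dv := differentiableAt_ofReal (d hv z hz)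
  have gu := ((h.contDiffOn_gv hu δ).contDiffAt hU).differentiableAt (by simp)
  have gv' := ((h.contDiffOn_gv hv δ).contDiffAt hU).differentiableAt (by simp)
  change eb ε _ z = _ * eb ε _ z + _ * eb ε _ z + _ + _
  rw [eb_congr e, eb_add (du.fun_mul gv') (dv.fun_mul gu), eb_mul du gv', eb_mul dv gu]
  ring

/-- The error term in the Hessian of `χ⁴ f`. -/
def cutoffError (G : Comp 2) (χ f : C2 → ℝ) (z : C2) : M2 := Matrix.of fun δ ε =>
  2 * (eb ε (fun w => ((χ w * χ w : ℝ) : ℂ)) z * gv G f z δ)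
    + 2 * (eb ε (fun w => (f w : ℂ)) z * gv G (fun w => χ w * χ w) z δ)
    + 2 * (f z * hess G (fun w => χ w * χ w) z δ ε)
    + 8 * (f z * (eb ε (fun w => (χ w : ℂ)) z * gv G χ z δ))

/-- The fourth power is chosen so that every error term still contains `χ²`; with the leading term
`χ⁴ ∂̄ grad f` this allows the square to be completed. The error involves no second derivative of
`f`. -/
theorem hess_cutoff {χ f : C2 → ℝ} (h : HermComps U G) (hχ : ContDiffOn ℝ ∞ χ U)
    (hf : ContDiffOn ℝ ∞ f U) (hz : z ∈ U) : hess G (fun w => (χ w * χ w * (χ w * χ w)) * f w) z =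
      (χ z ^ 4) • hess G f z + (χ z ^ 2) • cutoffError G χ f z := by
  have d : ∀ {u : C2 → ℝ}, ContDiffOn ℝ ∞ u U → DifferentiableAt ℝ u z := fun hu =>
    (hu.contDiffAt (h.isOpen.mem_nhds hz)).differentiableAt (by simp)
  ext δ ε
  have hc := hχ.mul hχ
  rw [hess_mul h (hc.mul hc) hf hz, hess_mul h hc hc hz, eb_ofReal_mul (d hc) (d hc),
    gv_mul (d hc) (d hc)]
  simp only [cutoffError, Matrix.add_apply, Matrix.smul_apply, Matrix.of_apply, Complex.real_smul]
  rw [gv_mul (d hχ) (d hχ), eb_ofReal_mul (d hχ) (d hχ)]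
  push_cast
  ring

theorem hpair_smul_left (M N : M2) (c : ℝ) : hpair (c • M) N = c * hpair M N := by
  rw [hpair_comm, hpair_smul_right, hpair_comm]

theorem hpair_add_left (M M' N : M2) : hpair (M + M') N = hpair M N + hpair M' N := by
  rw [hpair_comm, hpair_add_right, hpair_comm, hpair_comm N]

/-- The Caccioppoli inequality. -/
theorem PosHerm.caccioppoli {h : M2} {a b : ℝ} {s : ℂ} (H : PosHerm h a b s) {M N E : M2} {χ : ℝ}
    (hM : h 0 0 * M 0 1 + h 1 0 * M 1 1 = h 0 1 * M 0 0 + h 1 1 * M 1 0)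
    (hN : h 0 0 * N 0 1 + h 1 0 * N 1 1 = h 0 1 * N 0 0 + h 1 1 * N 1 0)
    (e : N = (χ ^ 4) • M + (χ ^ 2) • E) : -(1 / 4 * |hpair E E|) ≤ hpair M N := by
  by_cases hχ : χ = 0
  · have : N = 0 := by rw [e, hχ]; simp
    rw [this]
    have h0 : hpair M 0 = 0 := by simp [hpair_apply]
    rw [h0]
    have := abs_nonneg (hpair E E)
    linarith
  -- With `N = χ⁴ M + χ² E` one has `⟨K, K⟩ = ⟨M, N⟩ + ¼ ⟨E, E⟩`. Positivity needs the symmetry of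
  -- `K`, which follows from `2 χ² K = N + χ⁴ M`; this is why `χ = 0` is treated apart.
  let K : M2 := (χ ^ 2) • M + (1 / 2 : ℝ) • E
  have hK : h 0 0 * K 0 1 + h 1 0 * K 1 1 = h 0 1 * K 0 0 + h 1 1 * K 1 0 := by
    have hχ' : (χ : ℂ) ≠ 0 := by exact_mod_cast hχ
    subst e
    simp only [K, Matrix.add_apply, Matrix.smul_apply, Complex.real_smul] at hN ⊢
    push_cast at hN ⊢
    have : (2 * (χ : ℂ) ^ 2) ≠ 0 := by simp [hχ']
    refine mul_left_cancel₀ this ?_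
    linear_combination hN + (χ : ℂ) ^ 4 * hM
  have h1 := H.hpair_self_nonneg hK
  have h2 : hpair K K = hpair M N + 1 / 4 * hpair E E := by
    rw [e]
    simp only [K, hpair_add_left, hpair_add_right, hpair_smul_left, hpair_smul_right, hpair_comm E M]
    ring
  have := le_abs_self (hpair E E)
  linarith

/-- The matrix `hᵀ M` is symmetric. -/
def SymmRel (h M : M2) : Prop := h 0 0 * M 0 1 + h 1 0 * M 1 1 = h 0 1 * M 0 0 + h 1 1 * M 1 0

theorem symm_of_conj {J h k M N : M2}
    (hh : ∀ α β, h α β = (J 0 α * k 0 0 + J 1 α * k 1 0) * conj (J 0 β) +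
      (J 0 α * k 0 1 + J 1 α * k 1 1) * conj (J 1 β))
    (hJ : J * M = N * J.map conj)
    (hN : SymmRel k N) : SymmRel h M := by
  rw [SymmRel] at hN ⊢
  have q := fun a b => congrFun (congrFun hJ a) b
  simp only [Matrix.mul_apply, Fin.sum_univ_two, Matrix.map_apply] at q
  rw [hh, hh, hh, hh]
  linear_combination (k 0 0 * conj (J 0 0) + k 0 1 * conj (J 1 0)) * q 0 1 +
    (k 1 0 * conj (J 0 0) + k 1 1 * conj (J 1 0)) * q 1 1 -
    (k 0 0 * conj (J 0 1) + k 0 1 * conj (J 1 1)) * q 0 0 -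
    (k 1 0 * conj (J 0 1) + k 1 1 * conj (J 1 1)) * q 1 0 +
    (conj (J 0 0) * conj (J 1 1) - conj (J 0 1) * conj (J 1 0)) * hN

end Gradient

section Surface

variable {X : Type*} [TopologicalSpace X] [ChartedSpace C2 X]
  [IsManifold 𝓘(ℂ, C2) ω X] {g : CovTensorField X 2} {F : C2 → X} {U : Set C2}
  {e : OpenPartialHomeomorph X C2}

theorem IsParam.contDiffOn_comp (hF : IsParam F U) {u : X → ℝ} (hu : SmoothFn u) :
    ContDiffOn ℝ ∞ (fun z => u (F z)) U := by
  refine contDiffOn_of_overlap (fun e he => ?_) hF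
  refine ((hu e he).comp (hF.contDiffOn_transition he) fun z hz => e.map_source hz.2).congr ?_
  intro z hz
  simp [e.left_inv hz.2]

theorem IsParam.comp_eventuallyEq (hF : IsParam F U) (u : X → ℝ) {z : C2} (hz : z ∈ overlap F U e) :
    (fun w => u (F w)) =ᶠ[nhds z] fun w => u (e.symm ((e ∘ F) w)) := by
  filter_upwards [(hF.isOpen_overlap e).mem_nhds hz] with w hw
  simp [e.left_inv hw.2]

theorem IsParam.hess_eq (hF : IsParam F U) (hg : IsKahlerMetric g) (he : e ∈ atlas C2 X) {u : X → ℝ}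
    (hu : SmoothFn u) {z : C2} (hz : z ∈ overlap F U e) :
    jac (e ∘ F) z * hess (comps F g) (fun w => u (F w)) z =
      hess (comps e.symm g) (fun w => u (e.symm w)) (e (F z)) * (jac (e ∘ F) z).map conj := by
  rw [hess_congr (hF.comp_eventuallyEq u hz)]
  exact Pull.hess_eq (u := fun w => u (e.symm w)) (hF.pull hg he) hz (hu e he)

theorem IsParam.hess_symm (hF : IsParam F U) (hg : IsKahlerMetric g) {u : X → ℝ}
    (hu : SmoothFn u) {z : C2} (hz : z ∈ U) :
    SymmRel (hmat (comps F g) z) (hess (comps F g) (fun w => u (F w)) z) := by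
  set e := chartAt C2 (F z)
  have he : e ∈ atlas C2 X := chart_mem_atlas C2 _
  have hze : z ∈ overlap F U e := ⟨hz, mem_chart_source C2 _⟩
  have P := hF.pull hg he
  have h1 := hF.hess_eq hg he hu hze
  have h2 := (hg.kahlerComps he).hess_symm (U := ⟨e.target, e.open_target⟩) (hu e he)
    (P.maps z hze)
  exact symm_of_conj (P.hmat_entries hze) h1 h2

/-- The pairing of the antiholomorphic derivatives of two gradients. -/
def hessPair (g : CovTensorField X 2) (f u : X → ℝ) (x : X) : ℝ :=
  hpair (hess (comps (chartAt C2 x).symm g) (fun w => f ((chartAt C2 x).symm w)) (chartAt C2 x x))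
    (hess (comps (chartAt C2 x).symm g) (fun w => u ((chartAt C2 x).symm w)) (chartAt C2 x x))

/-- The pairing is invariant under the Jacobian by `hpair_conj`, so it can be computed in any
parametrization, in particular in the chart at infinity, and not only in the preferred chart at the
point. -/
theorem hessPair_eq (hF : IsParam F U) (hg : IsKahlerMetric g) {f u : X → ℝ} (hf : SmoothFn f)
    (hu : SmoothFn u) {z : C2} (hz : z ∈ U) : hessPair g f u (F z) =
      hpair (hess (comps F g) (fun w => f (F w)) z) (hess (comps F g) (fun w => u (F w)) z) := by
  set e := chartAt C2 (F z)
  have he : e ∈ atlas C2 X := chart_mem_atlas C2 _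
  have hze : z ∈ overlap F U e := ⟨hz, mem_chart_source C2 _⟩
  exact (hpair_conj ((hF.pull hg he).det z hze) (hF.hess_eq hg he hf hze)
    (hF.hess_eq hg he hu hze)).symm

theorem hessPair_congr {f u v : X → ℝ} {x : X} (h : ∀ᶠ y in nhds x, u y = v y) :
    hessPair g f u x = hessPair g f v x := by
  have hx := mem_chart_source C2 x
  have ht : Filter.Tendsto (chartAt C2 x).symm (nhds (chartAt C2 x x)) (nhds x) := by
    have := (chartAt C2 x).continuousAt_symm ((chartAt C2 x).map_source hx)
    rwa [ContinuousAt, (chartAt C2 x).left_inv hx] at this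
  rw [hessPair, hessPair]
  congr 1
  exact hess_congr (ht.eventually h)

theorem HermComps.continuousOn_hess {U : Set C2} {G : Comp 2} (h : HermComps U G) {u : C2 → ℝ}
    (hu : ContDiffOn ℝ ∞ u U) (δ ε : Fin 2) : ContinuousOn (fun z => hess G u z δ ε) U :=
  (contDiffOn_eb h.isOpen (h.contDiffOn_gv hu δ) ε).continuousOn

theorem continuousOn_hpair {U : Set C2} {M N : C2 → M2}
    (hM : ∀ i j, ContinuousOn (fun z => M z i j) U) (hN : ∀ i j, ContinuousOn (fun z => N z i j) U) :
    ContinuousOn (fun z => hpair (M z) (N z)) U := by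
  simp only [hpair_apply]
  refine Complex.continuous_re.comp_continuousOn ?_
  have hc : ∀ i j, ContinuousOn (fun z => conj (N z i j)) U := fun i j =>
    Complex.continuous_conj.comp_continuousOn (hN i j)
  exact (((hM _ _).mul (hc _ _)).add ((hM _ _).mul (hc _ _))).add
    (((hM _ _).mul (hc _ _)).add ((hM _ _).mul (hc _ _)))

theorem continuous_hessPair (hg : IsKahlerMetric g) {f u : X → ℝ} (hf : SmoothFn f)
    (hu : SmoothFn u) : Continuous (hessPair g f u) := by
  refine continuous_of_charts fun e he => ?_
  have hp := isParam_of_mem_atlas he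
  refine ContinuousOn.congr ?_ fun z hz => hessPair_eq hp hg hf hu hz
  exact continuousOn_hpair (fun i j => (hp.hermComps hg).continuousOn_hess (hf e he) i j)
    fun i j => (hp.hermComps hg).continuousOn_hess (hu e he) i j

theorem hessPair_add (hg : IsKahlerMetric g) {f u v : X → ℝ}
    (hu : SmoothFn u) (hv : SmoothFn v) (x : X) :
    hessPair g f (fun y => u y + v y) x = hessPair g f u x + hessPair g f v x := by
  have he := chart_mem_atlas C2 x
  rw [hessPair, hess_add ((isParam_of_mem_atlas he).hermComps hg) (hu _ he) (hv _ he)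
    ((chartAt C2 x).map_source (mem_chart_source C2 x)), hpair_add_right]
  rfl

theorem hessPair_zero {f : X → ℝ} (x : X) : hessPair g f (fun _ => 0) x = 0 := by
  rw [hessPair, hess_zero]
  simp [hpair_apply]

theorem hessPair_sum (hg : IsKahlerMetric g) {f : X → ℝ} {ι : Type*} (s : Finset ι) (u : ι → X → ℝ)
    (hu : ∀ i, SmoothFn (u i)) (x : X) :
    hessPair g f (fun y => ∑ i ∈ s, u i y) x = ∑ i ∈ s, hessPair g f (u i) x := by
  classical
  induction s using Finset.induction_on with
  | empty => simpa using hessPair_zero x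
  | insert i s hi ih =>
    simp only [Finset.sum_insert hi]
    rw [hessPair_add hg (hu i) (SmoothFn.sum s hu), ih]

end Surface

end

/-! ### Orders of decay on annuli -/

section

open scoped ComplexConjugate

section Bounds

variable {E : Type*} [NormedField E] [NormedAlgebra ℝ E] {r₀ : ℝ} {n m : ℕ} {x y : ℝ → C2 → E}

/-- Uniform bounds of order `r⁻ⁿ` on the annuli `r ≤ ‖z‖ ≤ 2r`. -/
def Od (r₀ : ℝ) (n : ℕ) (x : ℝ → C2 → E) : Prop :=
  ∃ C, 0 ≤ C ∧ ∀ r, r₀ ≤ r → ∀ z, r ≤ ‖z‖ → ‖z‖ ≤ 2 * r → ‖x r z‖ ≤ C / r ^ n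

/-- Uniform bounds of order `r⁻ⁿ`, and of order `r⁻ⁿ⁻¹` for the derivative. -/
def Bd (r₀ : ℝ) (n : ℕ) (x : ℝ → C2 → E) : Prop :=
  ∃ C, 0 ≤ C ∧ ∀ r, r₀ ≤ r → ∀ z, r ≤ ‖z‖ → ‖z‖ ≤ 2 * r →
    DifferentiableAt ℝ (x r) z ∧ ‖x r z‖ ≤ C / r ^ n ∧ ‖fderiv ℝ (x r) z‖ ≤ C / r ^ (n + 1)

theorem Bd.od (h : Bd r₀ n x) : Od r₀ n x := by
  obtain ⟨C, hC, h⟩ := h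
  exact ⟨C, hC, fun r hr z h1 h2 => (h r hr z h1 h2).2.1⟩

theorem Od.congr (h : Od r₀ n x) (e : ∀ r, r₀ ≤ r → ∀ z, r ≤ ‖z‖ → y r z = x r z) : Od r₀ n y := by
  obtain ⟨C, hC, h⟩ := h
  exact ⟨C, hC, fun r hr z h1 h2 => by rw [e r hr z h1]; exact h r hr z h1 h2⟩

theorem Bd.congr (h : Bd r₀ n x) (e : ∀ r, r₀ ≤ r → ∀ z, r ≤ ‖z‖ → y r =ᶠ[nhds z] x r) :
    Bd r₀ n y := by
  obtain ⟨C, hC, h⟩ := h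
  refine ⟨C, hC, fun r hr z h1 h2 => ?_⟩
  obtain ⟨a, b, c⟩ := h r hr z h1 h2
  have hev := e r hr z h1
  exact ⟨a.congr_of_eventuallyEq hev, by rwa [hev.eq_of_nhds], by rwa [hev.fderiv_eq]⟩

theorem Od.add (hx : Od r₀ n x) (hy : Od r₀ n y) : Od r₀ n fun r z => x r z + y r z := by
  obtain ⟨C, hC, hx⟩ := hx
  obtain ⟨D, hD, hy⟩ := hy
  refine ⟨C + D, by positivity, fun r hr z h1 h2 => (norm_add_le _ _).trans ?_⟩
  rw [add_div]
  exact add_le_add (hx r hr z h1 h2) (hy r hr z h1 h2)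

theorem Od.mul (hx : Od r₀ n x) (hy : Od r₀ m y) : Od r₀ (n + m) fun r z => x r z * y r z := by
  obtain ⟨C, hC, hx⟩ := hx
  obtain ⟨D, hD, hy⟩ := hy
  refine ⟨C * D, by positivity, fun r hr z h1 h2 => ?_⟩
  rw [norm_mul, pow_add, mul_div_mul_comm]
  exact mul_le_mul (hx r hr z h1 h2) (hy r hr z h1 h2) (norm_nonneg _)
    ((norm_nonneg _).trans (hx r hr z h1 h2))

theorem Od.const (c : E) : Od r₀ 0 fun _ _ => c :=
  ⟨‖c‖, norm_nonneg _, fun r _ z _ _ => by simp⟩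

theorem Od.const_mul (c : E) (hx : Od r₀ n x) : Od r₀ n fun r z => c * x r z := by
  have := (Od.const (r₀ := r₀) c).mul hx
  rwa [zero_add] at this

theorem Bd.const (c : E) : Bd r₀ 0 fun _ _ => c := by
  refine ⟨‖c‖, norm_nonneg _, fun r _ z h1 h2 => ⟨by fun_prop, by simp, ?_⟩⟩
  have : 0 ≤ r := by linarith [norm_nonneg z]
  simp only [fderiv_fun_const, Pi.zero_apply, norm_zero]
  positivity

theorem Bd.add (hx : Bd r₀ n x) (hy : Bd r₀ n y) : Bd r₀ n fun r z => x r z + y r z := by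
  obtain ⟨C, hC, hx⟩ := hx
  obtain ⟨D, hD, hy⟩ := hy
  refine ⟨C + D, by positivity, fun r hr z h1 h2 => ?_⟩
  obtain ⟨a, b, c⟩ := hx r hr z h1 h2
  obtain ⟨a', b', c'⟩ := hy r hr z h1 h2
  refine ⟨a.add a', (norm_add_le _ _).trans ?_, ?_⟩
  · rw [add_div]; exact add_le_add b b'
  · rw [fderiv_fun_add a a', add_div]; exact (norm_add_le _ _).trans (add_le_add c c')

theorem Bd.mul (hx : Bd r₀ n x) (hy : Bd r₀ m y) : Bd r₀ (n + m) fun r z => x r z * y r z := by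
  obtain ⟨C, hC, hx⟩ := hx
  obtain ⟨D, hD, hy⟩ := hy
  refine ⟨2 * (C * D), by positivity, fun r hr z h1 h2 => ?_⟩
  obtain ⟨a, b, c⟩ := hx r hr z h1 h2
  obtain ⟨a', b', c'⟩ := hy r hr z h1 h2
  have hr0 : 0 ≤ r := by linarith [norm_nonneg z]
  refine ⟨a.mul a', ?_, ?_⟩
  · rw [norm_mul, mul_div_assoc, two_mul, pow_add, mul_div_mul_comm]
    have := mul_le_mul b b' (norm_nonneg _) ((norm_nonneg _).trans b)
    have h0 : 0 ≤ C / r ^ n * (D / r ^ m) := by positivity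
    linarith
  · rw [fderiv_fun_mul a a']
    have k1 : ‖x r z • fderiv ℝ (y r) z‖ ≤ C / r ^ n * (D / r ^ (m + 1)) := by
      rw [norm_smul]; exact mul_le_mul b c' (norm_nonneg _) ((norm_nonneg _).trans b)
    have k2 : ‖y r z • fderiv ℝ (x r) z‖ ≤ D / r ^ m * (C / r ^ (n + 1)) := by
      rw [norm_smul]; exact mul_le_mul b' c (norm_nonneg _) ((norm_nonneg _).trans b')
    refine (norm_add_le _ _).trans ((add_le_add k1 k2).trans (le_of_eq ?_))
    rw [div_mul_div_comm, div_mul_div_comm, ← pow_add, ← pow_add]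
    have : m + (n + 1) = n + m + 1 := by ring
    rw [this, ← add_assoc]
    ring

theorem Bd.const_mul (c : E) (hx : Bd r₀ n x) : Bd r₀ n fun r z => c * x r z := by
  have := (Bd.const (r₀ := r₀) c).mul hx
  rwa [zero_add] at this

theorem Bd.sub (hx : Bd r₀ n x) (hy : Bd r₀ n y) : Bd r₀ n fun r z => x r z - y r z := by
  have := hx.add (hy.const_mul (-1))
  simpa only [neg_one_mul, ← sub_eq_add_neg] using this

theorem Bd.sq (hx : Bd r₀ 0 x) : Bd r₀ 0 fun r z => x r z ^ 2 := by
  have := hx.mul hx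
  simpa only [← pow_two] using this

theorem Bd.inv {x : ℝ → C2 → ℝ} (hx : Bd r₀ 0 x) {c : ℝ} (hc : 0 < c)
    (h : ∀ r, r₀ ≤ r → ∀ z, r ≤ ‖z‖ → ‖z‖ ≤ 2 * r → c ≤ x r z) : Bd r₀ 0 fun r z => (x r z)⁻¹ := by
  obtain ⟨C, hC, hx⟩ := hx
  refine ⟨c⁻¹ + (c ^ 2)⁻¹ * C, by positivity, fun r hr z h1 h2 => ?_⟩
  obtain ⟨a, b, d⟩ := hx r hr z h1 h2
  have hcx := h r hr z h1 h2
  have hpos : 0 < x r z := hc.trans_le hcx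
  have hr0 : 0 ≤ r := by linarith [norm_nonneg z]
  have hd : HasFDerivAt (fun w => (x r w)⁻¹) (-(x r z ^ 2)⁻¹ • fderiv ℝ (x r) z) z :=
    (hasDerivAt_inv hpos.ne').comp_hasFDerivAt z a.hasFDerivAt
  refine ⟨hd.differentiableAt, ?_, ?_⟩
  · rw [norm_inv, Real.norm_of_nonneg hpos.le, pow_zero, div_one]
    have : (x r z)⁻¹ ≤ c⁻¹ := by gcongr
    have : 0 ≤ (c ^ 2)⁻¹ * C := by positivity
    linarith
  · rw [hd.fderiv, norm_smul, norm_neg, norm_inv, norm_pow, Real.norm_of_nonneg hpos.le]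
    calc (x r z ^ 2)⁻¹ * ‖fderiv ℝ (x r) z‖ ≤ (c ^ 2)⁻¹ * (C / r ^ (0 + 1)) := by gcongr
      _ = (c ^ 2)⁻¹ * C / r ^ (0 + 1) := by ring
      _ ≤ _ := by
        gcongr
        have : 0 ≤ c⁻¹ := by positivity
        linarith

theorem Bd.ofReal {x : ℝ → C2 → ℝ} (hx : Bd r₀ n x) : Bd r₀ n fun r z => (x r z : ℂ) := by
  obtain ⟨C, hC, hx⟩ := hx
  refine ⟨C, hC, fun r hr z h1 h2 => ?_⟩
  obtain ⟨a, b, c⟩ := hx r hr z h1 h2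
  have hd : HasFDerivAt (fun w => (x r w : ℂ)) (Complex.ofRealCLM.comp (fderiv ℝ (x r) z)) z :=
    Complex.ofRealCLM.hasFDerivAt.comp z a.hasFDerivAt
  refine ⟨hd.differentiableAt, by simpa using b, ?_⟩
  rw [hd.fderiv]
  refine (ContinuousLinearMap.opNorm_comp_le _ _).trans ?_
  rw [Complex.ofRealCLM_norm, one_mul]
  exact c

theorem norm_eb_le (β : Fin 2) (F : C2 → ℂ) (z : C2) : ‖eb β F z‖ ≤ ‖fderiv ℝ F z‖ := by
  have hv : ‖cFrame β‖ = 1 := by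
    fin_cases β
    · exact norm_realFrame 0
    · exact norm_realFrame 2
  have h1 := (fderiv ℝ F z).le_opNorm (cFrame β)
  have h2 := (fderiv ℝ F z).le_opNorm (Complex.I • cFrame β)
  rw [norm_smul, Complex.norm_I, one_mul] at h2
  rw [hv, mul_one] at h1 h2
  rw [eb, dbar, norm_mul]
  have h3 : ‖fderiv ℝ F z (cFrame β) + Complex.I * fderiv ℝ F z (Complex.I • cFrame β)‖ ≤
      2 * ‖fderiv ℝ F z‖ := by
    refine (norm_add_le _ _).trans ?_
    rw [norm_mul, Complex.norm_I, one_mul]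
    linarith
  norm_num
  linarith

theorem Bd.eb {x : ℝ → C2 → ℂ} (hx : Bd r₀ n x) (β : Fin 2) : Od r₀ (n + 1) fun r => eb β (x r) := by
  obtain ⟨C, hC, hx⟩ := hx
  exact ⟨C, hC, fun r hr z h1 h2 => (norm_eb_le _ _ _).trans (hx r hr z h1 h2).2.2⟩

/-- The family is constant in `r`, so at the point `z` the bound may be used with `r = ‖z‖`. -/
theorem Od.tendsto {x : C2 → ℂ} (hx : Od r₀ (n + 1) fun _ => x) :
    Filter.Tendsto x (Bornology.cobounded C2) (nhds 0) := by
  obtain ⟨C, hC, hx⟩ := hx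
  rw [tendsto_zero_iff_norm_tendsto_zero]
  refine squeeze_zero' (Filter.Eventually.of_forall fun _ => norm_nonneg _)
    (g := fun z => C / ‖z‖ ^ (n + 1)) ?_ ?_
  · refine eventually_cobounded (R := r₀) fun z hz => ?_
    exact hx ‖z‖ hz z le_rfl (by linarith [norm_nonneg z])
  · exact ((Filter.tendsto_pow_atTop (Nat.succ_ne_zero n)).comp
      tendsto_norm_cobounded_atTop).const_div_atTop C

/-! ### Rescaled functions -/

theorem fderiv_scale {p : C2 → E} {c : ℝ} {z : C2} (hp : DifferentiableAt ℝ p (c • z)) :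
    HasFDerivAt (fun w => p (c • w)) (c • fderiv ℝ p (c • z)) z := by
  have h1 : HasFDerivAt (fun w : C2 => c • w) (c • ContinuousLinearMap.id ℝ C2) z :=
    (hasFDerivAt_id z).const_smul c
  have := hp.hasFDerivAt.comp z h1
  have hL : c • fderiv ℝ p (c • z) =
      (fderiv ℝ p (c • z)).comp (c • ContinuousLinearMap.id ℝ C2) := by
    ext v
    simp
  rw [hL]
  exact this

/-- Rescaling maps the annulus `r ≤ ‖z‖ ≤ 2 r` to a fixed compact annulus, where `p` and its
derivative are bounded; the chain rule contributes the factor `1 / r`. -/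
theorem bd_scale {p : C2 → E} (hp : ContDiffOn ℝ ∞ p {0}ᶜ) (hr₀ : 0 < r₀) :
    Bd r₀ 0 fun r z => p (r⁻¹ • z) := by
  have hK : IsCompact {z : C2 | 1 ≤ ‖z‖ ∧ ‖z‖ ≤ 2} := by
    have : {z : C2 | 1 ≤ ‖z‖ ∧ ‖z‖ ≤ 2} = Metric.closedBall 0 2 ∩ {z | 1 ≤ ‖z‖} := by
      ext z; simp [and_comm]
    rw [this]
    exact (isCompact_closedBall 0 2).inter_right (isClosed_le continuous_const continuous_norm)
  have hsub : {z : C2 | 1 ≤ ‖z‖ ∧ ‖z‖ ≤ 2} ⊆ {0}ᶜ := by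
    rintro z ⟨h, -⟩ rfl
    rw [norm_zero] at h
    linarith
  have ho : IsOpen ({0}ᶜ : Set C2) := isOpen_compl_singleton
  obtain ⟨C, hC⟩ := hK.exists_bound_of_continuousOn (hp.continuousOn.mono hsub)
  obtain ⟨D, hD⟩ := hK.exists_bound_of_continuousOn
    ((hp.continuousOn_fderiv_of_isOpen ho (by simp)).mono hsub)
  refine ⟨|C| + |D|, by positivity, fun r hr z h1 h2 => ?_⟩
  have hr0 : 0 < r := hr₀.trans_le hr
  have hmem : r⁻¹ • z ∈ {z : C2 | 1 ≤ ‖z‖ ∧ ‖z‖ ≤ 2} := by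
    have : ‖r⁻¹ • z‖ = ‖z‖ / r := by
      rw [norm_smul, norm_inv, Real.norm_of_nonneg hr0.le]; ring
    simp only [Set.mem_ofPred_eq, this]
    rw [le_div_iff₀ hr0, div_le_iff₀ hr0]
    exact ⟨by linarith, h2⟩
  have hd := fderiv_scale ((hp.contDiffAt (ho.mem_nhds (hsub hmem))).differentiableAt (by simp))
  refine ⟨hd.differentiableAt, ?_, ?_⟩
  · rw [pow_zero, div_one]
    have := hC _ hmem
    have := le_abs_self C
    have := abs_nonneg D
    linarith
  · rw [hd.fderiv, norm_smul, norm_inv, Real.norm_of_nonneg hr0.le, zero_add, pow_one, div_eq_inv_mul]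
    have := hD _ hmem
    have := le_abs_self D
    have := abs_nonneg C
    gcongr
    linarith

theorem eb_scale {p : C2 → ℂ} (hp : ContDiffOn ℝ ∞ p {0}ᶜ) {r : ℝ} (hr : 0 < r) {z : C2}
    (hz : z ≠ 0) (β : Fin 2) : eb β (fun w => p (r⁻¹ • w)) z = (r⁻¹ : ℝ) * eb β p (r⁻¹ • z) := by
  have hmem : r⁻¹ • z ∈ ({0}ᶜ : Set C2) := by simp [hr.ne', hz]
  have hd := fderiv_scale ((hp.contDiffAt (isOpen_compl_singleton.mem_nhds hmem)).differentiableAt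
    (by simp))
  simp only [eb, dbar, hd.fderiv, smul_apply, Complex.real_smul]
  ring

/-- `∂̄` of a rescaled function is `1 / r` times another rescaled function. The derivative bound in
`Bd` therefore controls second derivatives of the cut-off. -/
theorem bd_eb_scale {p : C2 → ℂ} (hp : ContDiffOn ℝ ∞ p {0}ᶜ) (hr₀ : 0 < r₀) (β : Fin 2) :
    Bd r₀ 1 fun r => eb β fun z => p (r⁻¹ • z) := by
  have h0 : Bd r₀ 1 fun r (_ : C2) => ((r⁻¹ : ℝ) : ℂ) := by
    refine ⟨1, zero_le_one, fun r hr z _ _ => ⟨by fun_prop, ?_, ?_⟩⟩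
    · have : 0 < r := hr₀.trans_le hr
      simp [abs_of_pos this]
    · have : 0 < r := hr₀.trans_le hr
      simp only [fderiv_fun_const, Pi.zero_apply, norm_zero]
      positivity
  have h1 := h0.mul (bd_scale (contDiffOn_eb isOpen_compl_singleton hp β) hr₀)
  refine Bd.congr h1 fun r hr z hz => ?_
  have hr0 : 0 < r := hr₀.trans_le hr
  have hz0 : z ≠ 0 := norm_pos_iff.mp (hr0.trans_le hz)
  filter_upwards [isOpen_compl_singleton.mem_nhds (show z ∈ ({0}ᶜ : Set C2) from hz0)] with w hw
  exact eb_scale hp hr0 hw β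

/-! ### Bounds for the gradient operators -/

/-- The metric is uniformly close to a constant one near infinity. -/
structure MetricBounds (r₀ : ℝ) (G : Comp 2) : Prop where
  comps : ∀ i j, Bd r₀ 0 fun _ z => G z ![i, j]
  vol_ge : ∀ z, r₀ ≤ ‖z‖ → 1 / 2 ≤ vol G z
  pos : ∀ z, r₀ ≤ ‖z‖ → 1 / 2 ≤ G z ![0, 0]

namespace MetricBounds

variable {G : Comp 2}

theorem hmat (h : MetricBounds r₀ G) (α β : Fin 2) : Bd r₀ 0 fun _ z => hmat G z α β := by
  have s := fun i j => (h.comps i j).ofReal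
  fin_cases α <;> fin_cases β
  · exact s 0 0
  · exact (s 0 2).add ((s 0 3).const_mul _)
  · exact (s 0 2).sub ((s 0 3).const_mul _)
  · exact s 2 2

theorem vol_inv (h : MetricBounds r₀ G) : Bd r₀ 0 fun _ z => ((vol G z)⁻¹ : ℝ) := by
  refine Bd.inv (c := 1 / 2) ?_ (by norm_num) fun r hr z hz _ => h.vol_ge z (hr.trans hz)
  exact (((h.comps 0 0).mul (h.comps 2 2)).sub (h.comps 0 2).sq).sub (h.comps 0 3).sq

theorem vol_inv' (h : MetricBounds r₀ G) : Bd r₀ 0 fun _ z => (vol G z : ℂ)⁻¹ := by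
  have := h.vol_inv.ofReal
  simpa only [Complex.ofReal_inv] using this

theorem bd_gv (h : MetricBounds r₀ G) {u : ℝ → C2 → ℝ}
    (hu : ∀ β, Bd r₀ n fun r => eb β fun z => (u r z : ℂ)) (δ : Fin 2) :
    Bd r₀ n fun r z => gv G (u r) z δ := by
  have key : ∀ α β γ δ : Fin 2, ∀ a b : Fin 2, Bd r₀ n fun r z => (vol G z : ℂ)⁻¹ *
      (ALEKahler.hmat G z α β * ALEKahler.eb a (fun z => (u r z : ℂ)) z -
        ALEKahler.hmat G z γ δ * ALEKahler.eb b (fun z => (u r z : ℂ)) z) := by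
    intro α β γ δ a b
    have := h.vol_inv'.mul (((h.hmat α β).mul (hu a)).sub ((h.hmat γ δ).mul (hu b)))
    simpa only [zero_add] using this
  fin_cases δ
  · exact key 1 1 1 0 0 1
  · exact key 0 0 0 1 1 0

theorem od_gv (h : MetricBounds r₀ G) {u : ℝ → C2 → ℝ}
    (hu : ∀ β, Od r₀ n fun r => eb β fun z => (u r z : ℂ)) (δ : Fin 2) :
    Od r₀ n fun r z => gv G (u r) z δ := by
  have key : ∀ α β γ δ : Fin 2, ∀ a b : Fin 2, Od r₀ n fun r z => (vol G z : ℂ)⁻¹ *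
      (ALEKahler.hmat G z α β * ALEKahler.eb a (fun z => (u r z : ℂ)) z -
        ALEKahler.hmat G z γ δ * ALEKahler.eb b (fun z => (u r z : ℂ)) z) := by
    intro α β γ δ a b
    have := h.vol_inv'.od.mul (((h.hmat α β).od.mul (hu a)).add
      (((h.hmat γ δ).od.mul (hu b)).const_mul (-1)))
    simpa only [zero_add, neg_one_mul, ← sub_eq_add_neg] using this
  fin_cases δ
  · exact key 1 1 1 0 0 1
  · exact key 0 0 0 1 1 0

theorem od_bv (h : MetricBounds r₀ G) {x : C2 → ℂ} (hx : ∀ β, Od r₀ n fun _ => eb β x)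
    (α : Fin 2) : Od r₀ n fun _ z => bv G x z α := by
  have key : ∀ α β γ δ : Fin 2, ∀ a b : Fin 2, Od r₀ n fun _ z => (vol G z : ℂ)⁻¹ *
      (ALEKahler.hmat G z α β * ALEKahler.eb a x z - ALEKahler.hmat G z γ δ * ALEKahler.eb b x z) := by
    intro α β γ δ a b
    have := h.vol_inv'.od.mul (((h.hmat α β).od.mul (hx a)).add
      (((h.hmat γ δ).od.mul (hx b)).const_mul (-1)))
    simpa only [zero_add, neg_one_mul, ← sub_eq_add_neg] using this
  fin_cases α
  · exact key 0 0 0 1 1 0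
  · exact key 1 0 1 1 1 0

theorem bd_coefF (h : MetricBounds r₀ G) {φ : Comp 2} (hφ : ∀ i j, Bd r₀ n fun _ z => φ z ![i, j]) :
    Bd r₀ n fun _ z => coefF G φ z := by
  have := (hφ 0 1).mul (Bd.inv (h.comps 0 0) (c := 1 / 2) (by norm_num)
    fun r hr z hz _ => h.pos z (hr.trans hz))
  exact Bd.congr this fun r hr z hz => Filter.Eventually.of_forall fun w => div_eq_mul_inv _ _

end MetricBounds

theorem bd_hcoef {φ : Comp 2} (hφ : ∀ i j, Bd r₀ n fun _ z => φ z ![i, j]) :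
    Bd r₀ n fun _ z => hcoef φ z :=
  (((hφ 0 2).sub (hφ 1 3)).const_mul _).ofReal.add
    ((((hφ 1 2).add (hφ 0 3)).const_mul _).ofReal.const_mul _)

/-! ### Bounds for the cut-off functions -/

/-- The profile of the cut-off functions. -/
def profile (w : C2) : ℝ := Real.smoothTransition (2 - ‖w‖)

theorem contDiffOn_profile : ContDiffOn ℝ ∞ profile {0}ᶜ := fun z hz =>
  (Real.smoothTransition.contDiffAt.comp z (contDiffAt_const.sub (contDiffAt_norm ℂ hz))).contDiffWithinAt

/-- Here `f = O(r⁻²)` and `∂̄f = O(r⁻³)`, each derivative of the cut-off gains `r⁻¹`, and two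
derivatives occur in total in every term; hence order `4`. -/
theorem MetricBounds.od_cutoffError {G : Comp 2} (h : MetricBounds r₀ G) (hr₀ : 0 < r₀) {f : C2 → ℝ}
    (hf : Bd r₀ 2 fun _ => f) :
    ∀ δ ε, Od r₀ 4 fun r z => cutoffError G (fun z => profile (r⁻¹ • z)) f z δ ε := by
  intro δ ε
  have hp := HermComps.contDiffOn_ofReal contDiffOn_profile
  have hpp := HermComps.contDiffOn_ofReal (contDiffOn_profile.mul contDiffOn_profile)
  have e1 := fun β => bd_eb_scale hp hr₀ β
  have e2 := fun β => bd_eb_scale hpp hr₀ β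
  have ef := fun β => hf.ofReal.eb β
  have g1 := fun δ => h.bd_gv (u := fun r z => profile (r⁻¹ • z)) e1 δ
  have g2 := fun δ => h.bd_gv (u := fun r z => profile (r⁻¹ • z) * profile (r⁻¹ • z)) e2 δ
  have gf := fun δ => h.od_gv (u := fun _ => f) ef δ
  have h2 := (g2 δ).eb ε
  have t1 := ((e2 ε).od.mul (gf δ)).const_mul 2
  have t2 := ((ef ε).mul (g2 δ).od).const_mul 2
  have t3 := (hf.ofReal.od.mul h2).const_mul 2
  have t4 := (hf.ofReal.od.mul ((e1 ε).od.mul (g1 δ).od)).const_mul 8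
  exact ((t1.add t2).add t3).add t4

end Bounds

end

/-! ### Unique continuation, solutions of `S^* φ = 0`, and `∂̄ grad f = 0` -/

section

open scoped ComplexConjugate

open MeasureTheory

theorem norm_fderiv_le (f : C2 → ℝ) (z : C2) : ‖fderiv ℝ f z‖ ≤ ∑ i, |pd i f z| := by
  refine ContinuousLinearMap.opNorm_le_bound _ (by positivity) fun v => ?_
  have h1 : ∀ i, |realCoord v i| ≤ ‖v‖ := fun i => by
    refine abs_le_of_sq_le_sq ?_ (norm_nonneg v)
    rw [← sum_sq_realCoord]
    exact Finset.single_le_sum (f := fun i => realCoord v i ^ 2) (fun _ _ => sq_nonneg _)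
      (Finset.mem_univ i)
  conv_lhs => rw [← sum_realCoord v, map_sum]
  rw [Finset.sum_mul]
  refine (norm_sum_le _ _).trans (Finset.sum_le_sum fun i _ => ?_)
  rw [map_smul, norm_smul, Real.norm_eq_abs, Real.norm_eq_abs, mul_comm]
  exact mul_le_mul_of_nonneg_left (h1 i) (abs_nonneg _)

theorem Od.conj {r₀ : ℝ} {n : ℕ} {x : ℝ → C2 → ℂ} (hx : Od r₀ n x) :
    Od r₀ n fun r z => conj (x r z) := by
  obtain ⟨C, hC, hx⟩ := hx
  exact ⟨C, hC, fun r hr z h1 h2 => by rw [RCLike.norm_conj]; exact hx r hr z h1 h2⟩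

theorem Od.re {r₀ : ℝ} {n : ℕ} {x : ℝ → C2 → ℂ} (hx : Od r₀ n x) :
    Od r₀ n fun r z => (x r z).re := by
  obtain ⟨C, hC, hx⟩ := hx
  exact ⟨C, hC, fun r hr z h1 h2 => (Complex.abs_re_le_norm _).trans (hx r hr z h1 h2)⟩

theorem Od.hpair {r₀ : ℝ} {n : ℕ} {M : ℝ → C2 → M2} (hM : ∀ i j, Od r₀ n fun r z => M r z i j) :
    Od r₀ (n + n) fun r z => hpair (M r z) (M r z) := by
  simp only [hpair_apply]
  exact ((((hM _ _).mul (hM _ _).conj).add ((hM _ _).mul (hM _ _).conj)).add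
    (((hM _ _).mul (hM _ _).conj).add ((hM _ _).mul (hM _ _).conj))).re

section Surface

variable {X : Type*} [TopologicalSpace X] [ChartedSpace C2 X]
  [IsManifold 𝓘(ℂ, C2) ω X] {g φ : CovTensorField X 2} {F : C2 → X} {U : Set C2}
  {e : OpenPartialHomeomorph X C2} {k : ℕ}

theorem ALEBounds.metricBounds {A : ALEEnd g k} {R C : ℝ} (B : ALEBounds A R C)
    (hg : IsKahlerMetric g) : MetricBounds R (comps A.chart g) where
  comps i j := by
    have hC := B.C_pos
    refine ⟨2 + 4 * C, by positivity, fun r hr z h1 h2 => ?_⟩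
    have hz : R ≤ ‖z‖ := hr.trans h1
    have hr1 : 1 ≤ r := B.one_le.trans hr
    have hU : z ∈ {z | A.radius < ‖z‖} := B.radius_lt.trans_le hz
    have hd := ((A.isParam.contDiffOn_comps hg.smooth ![i, j]).contDiffAt
      (A.isParam.isOpen.mem_nhds hU)).differentiableAt (by simp)
    refine ⟨hd, ?_, ?_⟩
    · have := B.small z hz i j
      rw [pow_zero, div_one, Real.norm_eq_abs]
      rw [abs_le] at this ⊢
      split_ifs at this <;> constructor <;> linarith
    · refine (norm_fderiv_le _ _).trans ?_
      have hb : ∀ l, |pd l (fun w => ALEKahler.comps A.chart g w ![i, j]) z| ≤ C / r := by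
        intro l
        refine (B.deriv z hz l i j).trans ?_
        rw [div_eq_mul_inv]
        refine mul_le_mul_of_nonneg_left ?_ hC.le
        rw [zpow_neg]
        have hz1 : (1 : ℝ) ≤ ‖z‖ := hr1.trans h1
        have : r ≤ ‖z‖ ^ (3 : ℤ) := by
          refine h1.trans ?_
          have : (3 : ℤ) = ((3 : ℕ) : ℤ) := rfl
          rw [this, zpow_natCast]
          exact le_self_pow₀ hz1 (by norm_num)
        gcongr
      calc ∑ l, |pd l (fun w => ALEKahler.comps A.chart g w ![i, j]) z| ≤ ∑ _l : Fin 4, C / r :=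
            Finset.sum_le_sum fun l _ => hb l
        _ = 4 * C / r := by simp; ring
        _ ≤ (2 + 4 * C) / r ^ (0 + 1) := by
          rw [zero_add, pow_one]
          gcongr
          linarith
  vol_ge z hz := by
    have h := B.small z hz
    have h0 := h 0 0
    have h2 := h 2 2
    have h3 := h 0 2
    have h4 := h 0 3
    simp only [if_true, abs_le] at h0 h2
    rw [if_neg (by decide), sub_zero, abs_le] at h3 h4
    rw [vol]
    nlinarith
  pos z hz := by
    have h0 := B.small z hz 0 0
    simp only [if_true, abs_le] at h0
    linarith

/-- Unique continuation of holomorphic relations on a connected surface. -/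
theorem identity_principle [ConnectedSpace X] {ι : Type*} [Finite ι] {D : X → Prop}
    (H : OpenPartialHomeomorph X C2 → ι → C2 → ℂ)
    (hH : ∀ e ∈ atlas C2 X, ∀ i, DifferentiableOn ℂ (H e i) e.target)
    (hD : ∀ e ∈ atlas C2 X, ∀ z ∈ e.target, D (e.symm z) ↔ ∀ i, H e i z = 0) {x₀ : X}
    (h0 : ∀ᶠ x in nhds x₀, D x) (x : X) : D x := by
  let Z : Set X := {x | ∀ᶠ y in nhds x, D y}
  have hZo : IsOpen Z := isOpen_setOfPred_eventually_nhds
  have hZc : IsClosed Z := by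
    refine isClosed_of_closure_subset fun x hx => ?_
    set e := chartAt C2 x
    have he : e ∈ atlas C2 X := chart_mem_atlas C2 x
    have hxe : x ∈ e.source := mem_chart_source C2 x
    obtain ⟨ε, hε, hball⟩ := Metric.isOpen_iff.mp e.open_target (e x) (e.map_source hxe)
    have hN : IsOpen (e.source ∩ e ⁻¹' Metric.ball (e x) ε) :=
      e.continuousOn.isOpen_inter_preimage e.open_source Metric.isOpen_ball
    obtain ⟨y, ⟨hye, hyb⟩, hyZ⟩ := mem_closure_iff.mp hx _ hN ⟨hxe, Metric.mem_ball_self hε⟩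
    have hev : ∀ i, H e i =ᶠ[nhds (e y)] 0 := by
      intro i
      have ht : Filter.Tendsto e.symm (nhds (e y)) (nhds y) := by
        have := e.continuousAt_symm (e.map_source hye)
        rwa [ContinuousAt, e.left_inv hye] at this
      filter_upwards [ht.eventually hyZ, e.open_target.mem_nhds (e.map_source hye)] with w hw hwt
      exact (hD e he w hwt).mp hw i
    change ∀ᶠ y in nhds x, D y
    filter_upwards [hN.mem_nhds ⟨hxe, Metric.mem_ball_self hε⟩] with y' hy'
    have := (hD e he (e y') (e.map_source hy'.1)).mpr fun i =>
      eqOn_zero_of_ball ((hH e he i).mono hball) hyb (hev i) hy'.2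
    rwa [e.left_inv hy'.1] at this
  have hZ : Z = Set.univ := IsClopen.eq_univ ⟨hZc, hZo⟩ ⟨x₀, h0⟩
  have : x ∈ Z := by rw [hZ]; trivial
  exact this.self_of_nhds

/-- Smooth self-dual solutions of `S^* φ = 0`. -/
structure IsSolution (g φ : CovTensorField X 2) : Prop where
  smooth : IsSmooth φ
  selfDual : ∀ e ∈ atlas C2 X, ∀ z ∈ e.target, IsSelfDualAt (comps e.symm g) (comps e.symm φ) z
  eqn : ∀ e ∈ atlas C2 X, ∀ z ∈ e.target, Sstar (comps e.symm g) (comps e.symm φ) z = 0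

namespace IsSolution

theorem comps_eq (h : IsSolution g φ) (hg : IsKahlerMetric g) (hF : IsParam F U)
    (he : e ∈ atlas C2 X) {z : C2} (hz : z ∈ overlap F U e) (i j : Fin 4) :
    comps F φ z ![i, j] = sdMat (comps F g) (coefF (comps e.symm g) (comps e.symm φ) (e (F z)))
      ((jac (e ∘ F) z).det * hcoef (comps e.symm φ) (e (F z))).re
      ((jac (e ∘ F) z).det * hcoef (comps e.symm φ) (e (F z))).im z i j := by
  have P := hF.pull hg he
  exact P.sdMat_eq (fun z hz i j => hF.comps_eq_sum he φ hz i j) hz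
    ((hg.kahlerComps he).eq_sdMat (P.maps z hz) (h.selfDual e he _ (P.maps z hz))) i j

theorem coefF_eq (h : IsSolution g φ) (hg : IsKahlerMetric g) (hF : IsParam F U)
    (he : e ∈ atlas C2 X) {z : C2} (hz : z ∈ overlap F U e) :
    coefF (comps F g) (comps F φ) z = coefF (comps e.symm g) (comps e.symm φ) (e (F z)) := by
  rw [coefF, h.comps_eq hg hF he hz]
  simp only [sdMat, Matrix.of_apply, Matrix.cons_val', Matrix.cons_val_one, Matrix.cons_val_zero]
  exact mul_div_cancel_right₀ _ (comps_pos hg hF hz.1).1.ne'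

/-- The coefficient of `dz₁ ∧ dz₂` is a section of the canonical bundle, whereas the coefficient of
`ω` is a function. -/
theorem hcoef_eq (h : IsSolution g φ) (hg : IsKahlerMetric g) (hF : IsParam F U)
    (he : e ∈ atlas C2 X) {z : C2} (hz : z ∈ overlap F U e) :
    hcoef (comps F φ) z = (jac (e ∘ F) z).det * hcoef (comps e.symm φ) (e (F z)) := by
  have c := h.comps_eq hg hF he hz
  have ht := hermTable hg F
  rw [hcoef, coefP, coefQ, c, c, c, c]
  generalize (jac (e ∘ F) z).det * hcoef (comps e.symm φ) (e (F z)) = w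
  have h1 : (sdMat (comps F g) (coefF (comps e.symm g) (comps e.symm φ) (e (F z))) w.re w.im z 0 2
    - sdMat (comps F g) (coefF (comps e.symm g) (comps e.symm φ) (e (F z))) w.re w.im z 1 3) =
      2 * w.re := by simp [sdMat]; ring
  have h2 : (sdMat (comps F g) (coefF (comps e.symm g) (comps e.symm φ) (e (F z))) w.re w.im z 1 2
    + sdMat (comps F g) (coefF (comps e.symm g) (comps e.symm φ) (e (F z))) w.re w.im z 0 3) =
      -(2 * w.im) := by simp [sdMat]; ring
  rw [h1, h2]
  apply Complex.ext <;> simp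

end IsSolution

/-- The coefficient of the Kähler form in a self-dual form. -/
def formCoef (g φ : CovTensorField X 2) (x : X) : ℝ :=
  coefF (comps (chartAt C2 x).symm g) (comps (chartAt C2 x).symm φ) (chartAt C2 x x)

namespace IsSolution

theorem formCoef_eq (h : IsSolution g φ) (hg : IsKahlerMetric g) (hF : IsParam F U) {z : C2}
    (hz : z ∈ U) : formCoef g φ (F z) = coefF (comps F g) (comps F φ) z :=
  (h.coefF_eq hg hF (chart_mem_atlas C2 (F z)) ⟨hz, mem_chart_source C2 _⟩).symm

theorem smoothFn_formCoef (h : IsSolution g φ) (hg : IsKahlerMetric g) :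
    SmoothFn (formCoef g φ) := by
  intro e he
  have hp := isParam_of_mem_atlas he
  refine ContDiffOn.congr ?_ fun z hz => h.formCoef_eq hg hp hz
  exact (h.smooth e he _).div (hg.smooth e he _) fun z hz => (comps_pos hg hp hz).1.ne'

theorem nullOperator [T2Space X] (h : IsSolution g φ) (hg : IsKahlerMetric g) (hs : IsScalarFlat g) :
    NullOperator g (hessPair g (formCoef g φ)) where
  map_sum s u hu x := hessPair_sum hg s u hu x
  map_eventually_zero u x hu := by rw [hessPair_congr hu, hessPair_zero]
  continuous u hu := continuous_hessPair hg (h.smoothFn_formCoef hg) hu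
  integral e he K hK hKe u hu hu0 := by
    have hp := isParam_of_mem_atlas he
    have hf := h.smoothFn_formCoef hg
    have I := (hg.kahlerComps he).setIntegral_hpair (U := ⟨e.target, e.open_target⟩)
      (fun z hz => hs e he z hz) (fun I => h.smooth e he I) (h.selfDual e he) (h.eqn e he)
      (hK.image_of_continuousOn (e.continuousOn.mono hKe))
      (by rintro z ⟨x, hx, rfl⟩; exact e.map_source (hKe hx)) (hu e he) (fun z hz hzK => by
        refine hu0 _ fun hmem => hzK ⟨_, hmem, e.right_inv hz⟩)
    rw [← I]
    refine setIntegral_congr_fun e.open_target.measurableSet fun z hz => ?_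
    rw [hessPair_eq hp hg hf hu hz]
    congr 2
    refine hess_congr ?_
    filter_upwards [e.open_target.mem_nhds hz] with w hw using h.formCoef_eq hg hp hw

theorem hessPair_self_nonneg (hg : IsKahlerMetric g) {f : X → ℝ} (hf : SmoothFn f) (x : X) :
    0 ≤ hessPair g f f x := by
  have hp := isParam_of_mem_atlas (chart_mem_atlas C2 x)
  have hx := (chartAt C2 x).map_source (mem_chart_source C2 x)
  exact ((hp.hermComps hg).posHerm hx).hpair_self_nonneg (hp.hess_symm hg hf hx)

theorem profile_eq_cutoff (A : ALEEnd g k) {r : ℝ} {z : C2} (hr : 0 < r) (hz : A.radius < ‖z‖) :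
    A.cutoff r (A.chart z) = profile (r⁻¹ • z) := by
  rw [ALEEnd.cutoff, A.rad_chart hz, profile, norm_smul, norm_inv, Real.norm_of_nonneg hr.le,
    div_eq_inv_mul]

/-- Apply `NullOperator.eq_zero` to `|∂̄ grad f|²` with the test functions `χ_r⁴ f`. Inside radius
`r` the operator returns the density itself; on the annulus the Caccioppoli inequality bounds it
below by `-¼ |E|²` with `E = O(r⁻⁴)`. -/
theorem hess_formCoef_eq_zero [T2Space X] [Nonempty X] [SecondCountableTopology X]
    (h : IsSolution g φ) (hg : IsKahlerMetric g) (hs : IsScalarFlat g) {A : ALEEnd g k}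
    {R C : ℝ} (B : ALEBounds A R C) (hdec : ∀ i j, Bd R 2 fun _ z => comps A.chart φ z ![i, j])
    (hF : IsParam F U) {z : C2} (hz : z ∈ U) :
    hess (comps F g) (fun w => formCoef g φ (F w)) z = 0 := by
  let _ : MeasurableSpace X := borel X
  have : BorelSpace X := ⟨rfl⟩
  obtain ⟨μ, hμ⟩ := exists_isVolume hg
  have hf := h.smoothFn_formCoef hg
  set f := formCoef g φ
  have hR := B.one_le
  have hA := A.isParam
  have hfA : Bd R 2 fun _ w => f (A.chart w) := by
    refine Bd.congr ((B.metricBounds hg).bd_coefF hdec) fun r hr w hw => ?_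
    filter_upwards [hA.isOpen.mem_nhds (B.radius_lt.trans_le (hr.trans hw))] with y hy
    exact h.formCoef_eq hg hA hy
  obtain ⟨M, hM, hbound⟩ := Od.hpair
    ((B.metricBounds hg).od_cutoffError (by linarith) hfA)
  have hq : ∀ x, hessPair g f f x = 0 := by
    refine (h.nullOperator hg hs).eq_zero hg hμ (M := 1 / 4 * M) (r₀ := R + 1) B
      (u := fun r x => (A.cutoff r x * A.cutoff r x * (A.cutoff r x * A.cutoff r x)) * f x)
      (continuous_hessPair hg hf hf) (hessPair_self_nonneg hg hf) ?_ ?_ ?_ ?_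
    · intro r hr
      have hc := A.smoothFn_cutoff hg B hr
      exact ((hc.mul hc).mul (hc.mul hc)).mul hf
    · intro r hr x hx
      simp [A.cutoff_eq_zero (by linarith) hx]
    · intro r hr x hx
      refine le_of_eq (hessPair_congr ?_).symm
      filter_upwards [(A.isOpen_rad_lt hg B hr).mem_nhds hx] with y hy
      simp [A.cutoff_eq_one (by linarith) (le_of_lt hy)]
    · intro r hr z h1 h2
      have hr0 : 0 < r := by linarith
      have hc := A.smoothFn_cutoff hg B hr
      have hzU : z ∈ {z | A.radius < ‖z‖} := B.radius_lt.trans_le (by linarith)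
      have hu : SmoothFn fun x => (A.cutoff r x * A.cutoff r x * (A.cutoff r x * A.cutoff r x)) * f x :=
        ((hc.mul hc).mul (hc.mul hc)).mul hf
      rw [hessPair_eq hA hg hf hu hzU]
      have hev : (fun w => (A.cutoff r (A.chart w) * A.cutoff r (A.chart w) *
          (A.cutoff r (A.chart w) * A.cutoff r (A.chart w))) * f (A.chart w)) =ᶠ[nhds z]
          fun w => (profile (r⁻¹ • w) * profile (r⁻¹ • w) *
            (profile (r⁻¹ • w) * profile (r⁻¹ • w))) * f (A.chart w) := by
        filter_upwards [hA.isOpen.mem_nhds hzU] with w hw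
        rw [profile_eq_cutoff A hr0 hw]
      have hN := hA.hess_symm hg hu hzU
      have hprof : ContDiffOn ℝ ∞ (fun w : C2 => profile (r⁻¹ • w)) {z | A.radius < ‖z‖} := by
        refine contDiffOn_profile.comp (contDiff_const_smul _).contDiffOn fun w hw => ?_
        have : w ≠ 0 := norm_pos_iff.mp (A.radius_pos.trans hw)
        simp [this, hr0.ne']
      have hcut := hess_cutoff (hA.hermComps hg) hprof (hA.contDiffOn_comp hf) hzU
      rw [hess_congr hev] at hN ⊢
      have key := ((hA.hermComps hg).posHerm hzU).caccioppoli (hA.hess_symm hg hf hzU) hN hcut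
      refine le_trans ?_ key
      have hb := hbound r (by linarith) z h1 h2
      rw [Real.norm_eq_abs] at hb
      rw [mul_div_assoc]
      linarith
  have hq' := hq (F z)
  rw [hessPair_eq hF hg hf hf hz] at hq'
  exact ((hF.hermComps hg).posHerm hz).eq_zero_of_hpair_self (hF.hess_symm hg hf hz) hq'

end IsSolution

end Surface

end

/-! ### Liouville arguments for holomorphic vector fields, forms and sections -/

section

open scoped ComplexConjugate

theorem eb_of_gv {G : Comp 2} {u : C2 → ℝ} {z : C2} (hv : vol G z ≠ 0) (h : gv G u z = 0)
    (β : Fin 2) : eb β (fun w => (u w : ℂ)) z = 0 := by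
  have hv' : (vol G z : ℂ) ≠ 0 := by exact_mod_cast hv
  have hd := det_hmat G z
  rw [Matrix.det_fin_two] at hd
  have h0 := congrFun h 0
  have h1 := congrFun h 1
  simp only [gv, Matrix.cons_val_zero, Matrix.cons_val_one, Pi.zero_apply, mul_eq_zero, inv_eq_zero,
    hv', false_or] at h0 h1
  refine (mul_eq_zero.mp ?_).resolve_left hv'
  rw [← hd]
  fin_cases β
  · simp only [Fin.zero_eta]
    linear_combination hmat G z 0 0 * h0 + hmat G z 1 0 * h1
  · simp only [Fin.mk_one]
    linear_combination hmat G z 0 1 * h0 + hmat G z 1 1 * h1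

theorem eb_of_bv {G : Comp 2} {u : C2 → ℂ} {z : C2} (hv : vol G z ≠ 0) (h : bv G u z = 0)
    (β : Fin 2) : eb β u z = 0 := by
  have hv' : (vol G z : ℂ) ≠ 0 := by exact_mod_cast hv
  have hd := det_hmat G z
  rw [Matrix.det_fin_two] at hd
  have h0 := congrFun h 0
  have h1 := congrFun h 1
  simp only [bv, Matrix.cons_val_zero, Matrix.cons_val_one, Pi.zero_apply, mul_eq_zero, inv_eq_zero,
    hv', false_or] at h0 h1
  refine (mul_eq_zero.mp ?_).resolve_left hv'
  rw [← hd]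
  fin_cases β
  · simp only [Fin.zero_eta]
    linear_combination hmat G z 1 0 * h0 - hmat G z 0 0 * h1
  · simp only [Fin.mk_one]
    linear_combination hmat G z 1 1 * h0 - hmat G z 0 1 * h1

theorem fderiv_eq_zero_of_eb {u : C2 → ℝ} {z : C2} (hu : DifferentiableAt ℝ u z)
    (h : ∀ β, eb β (fun w => (u w : ℂ)) z = 0) : fderiv ℝ u z = 0 := by
  have hd : fderiv ℝ (fun w => (u w : ℂ)) z = Complex.ofRealCLM.comp (fderiv ℝ u z) :=
    (Complex.ofRealCLM.hasFDerivAt.comp z hu.hasFDerivAt).fderiv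
  have h0 := h 0
  have h1 := h 1
  rw [eb_zero, hd] at h0
  rw [eb_one, hd] at h1
  have k : ∀ a b : ℝ, (1 / 2 * ((a : ℂ) + Complex.I * b) : ℂ) = 0 → a = 0 ∧ b = 0 := by
    intro a b hab
    have r := congrArg Complex.re hab
    have i := congrArg Complex.im hab
    norm_num at r i
    exact ⟨r, i⟩
  obtain ⟨a0, a1⟩ := k (fderiv ℝ u z (realFrame 0)) (fderiv ℝ u z (realFrame 1)) h0
  obtain ⟨a2, a3⟩ := k (fderiv ℝ u z (realFrame 2)) (fderiv ℝ u z (realFrame 3)) h1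
  ext v
  rw [← sum_realCoord v, map_sum]
  simp [Fin.sum_univ_four, a0, a1, a2, a3]

section Surface

variable {X : Type*} [TopologicalSpace X] [ChartedSpace C2 X]
  [IsManifold 𝓘(ℂ, C2) ω X] {g φ : CovTensorField X 2} {F : C2 → X} {U : Set C2}
  {e : OpenPartialHomeomorph X C2} {k : ℕ}

/-- Holomorphic relations that hold asymptotically hold everywhere. -/
theorem liouville_principle [T2Space X] [ConnectedSpace X] (A : ALEEnd g k) {R : ℝ}
    (hR : A.radius < R) {ι : Type*} [Finite ι] {D : X → Prop}
    (H : OpenPartialHomeomorph X C2 → ι → C2 → ℂ)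
    (hH : ∀ e ∈ atlas C2 X, ∀ i, DifferentiableOn ℂ (H e i) e.target)
    (hD : ∀ e ∈ atlas C2 X, ∀ z ∈ e.target, D (e.symm z) ↔ ∀ i, H e i z = 0)
    (HA : ι → C2 → ℂ) (hHA : ∀ i, DifferentiableOn ℂ (HA i) {z | R < ‖z‖})
    (ht : ∀ i, Filter.Tendsto (HA i) (Bornology.cobounded C2) (nhds 0))
    (hDA : ∀ z, R < ‖z‖ → (∀ i, HA i z = 0) → D (A.chart z)) (x : X) : D x := by
  have hR0 : 0 < R := A.radius_pos.trans hR
  have hz : 2 * R < ‖((2 * R + 1 : ℝ) • realFrame 0 : C2)‖ := by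
    rw [norm_smul, norm_realFrame, mul_one, Real.norm_of_nonneg (by linarith)]
    linarith
  refine identity_principle H hH hD (x₀ := A.chart ((2 * R + 1 : ℝ) • realFrame 0)) ?_ x
  filter_upwards [(A.isOpen_image (r := 2 * R) (by linarith)).mem_nhds ⟨_, hz, rfl⟩] with y hy
  obtain ⟨z, hz, rfl⟩ := hy
  have hz' : 2 * R < ‖z‖ := hz
  exact hDA z (by linarith) fun i => eq_zero_of_tendsto_cobounded hR0.le (hHA i) (ht i) hz'

theorem IsParam.gv_eq_zero_iff (hF : IsParam F U) (hg : IsKahlerMetric g) (he : e ∈ atlas C2 X)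
    {u : X → ℝ} (hu : SmoothFn u) {z : C2} (hz : z ∈ overlap F U e) :
    gv (comps F g) (fun w => u (F w)) z = 0 ↔
      gv (comps e.symm g) (fun w => u (e.symm w)) (e (F z)) = 0 := by
  have h1 : (jac (e ∘ F) z).mulVec (gv (comps F g) (fun w => u (F w)) z) =
      gv (comps e.symm g) (fun w => u (e.symm w)) (e (F z)) := by
    rw [gv_congr (hF.comp_eventuallyEq u hz)]
    ext a
    rw [Matrix.mulVec, dotProduct, Fin.sum_univ_two]
    exact Pull.gv_eq (u := fun w => u (e.symm w)) (hF.pull hg he) hz (hu e he) a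
  rw [← h1]
  constructor
  · intro h; rw [h, Matrix.mulVec_zero]
  · exact Matrix.eq_zero_of_mulVec_eq_zero ((hF.pull hg he).det z hz)

theorem HermComps.differentiableOn_gv {U : Set C2} {G : Comp 2} (h : HermComps U G) {u : C2 → ℝ}
    (hu : ContDiffOn ℝ ∞ u U) (h0 : ∀ z ∈ U, hess G u z = 0) (δ : Fin 2) :
    DifferentiableOn ℂ (fun z => gv G u z δ) U := by
  intro z hz
  refine (differentiableAt_of_eb ?_ fun ε => ?_).differentiableWithinAt
  · exact ((h.contDiffOn_gv hu δ).contDiffAt (h.isOpen.mem_nhds hz)).differentiableAt (by simp)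
  · exact congrFun (congrFun (h0 z hz) δ) ε

theorem HermComps.differentiableOn_bv {U : Set C2} {G : Comp 2} (h : HermComps U G) {u : C2 → ℂ}
    (hu : ContDiffOn ℝ ∞ u U) (h0 : ∀ z ∈ U, pmat G u z = 0) (δ : Fin 2) :
    DifferentiableOn ℂ (fun z => bv G u z δ) U := by
  intro z hz
  refine (differentiableAt_of_eb ?_ fun ε => ?_).differentiableWithinAt
  · exact ((h.contDiffOn_bv hu δ).contDiffAt (h.isOpen.mem_nhds hz)).differentiableAt (by simp)
  · exact congrFun (congrFun (h0 z hz) δ) ε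

theorem isOpen_norm_gt (R : ℝ) : IsOpen {z : C2 | R < ‖z‖} := isOpen_lt continuous_const continuous_norm

/-- A function with holomorphic gradient that decays at infinity vanishes. -/
theorem SmoothFn.eq_zero_of_hess [T2Space X] [ConnectedSpace X] {A : ALEEnd g k} {R C : ℝ}
    (B : ALEBounds A R C) (hg : IsKahlerMetric g) {f : X → ℝ} (hf : SmoothFn f)
    (hfA : Bd R 2 fun _ w => f (A.chart w))
    (h0 : ∀ (F : C2 → X) (U : Set C2), IsParam F U → ∀ z ∈ U,
      hess (comps F g) (fun w => f (F w)) z = 0) (x : X) : f x = 0 := by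
  -- By `h0` the gradient is a holomorphic vector field. Its coefficients at infinity are `O(r⁻³)`,
  -- so it vanishes.
  have hgv : ∀ x : X, gv (comps (chartAt C2 x).symm g) (fun w => f ((chartAt C2 x).symm w))
      (chartAt C2 x x) = 0 := by
    have hsub : {z : C2 | R < ‖z‖} ⊆ {z | A.radius < ‖z‖} := fun z hz => B.radius_lt.trans hz
    have hA := A.isParam.mono (isOpen_norm_gt R) hsub
    refine liouville_principle A B.radius_lt
      (fun e i z => gv (comps e.symm g) (fun w => f (e.symm w)) z i) ?_ ?_
      (fun i z => gv (comps A.chart g) (fun w => f (A.chart w)) z i) ?_ ?_ ?_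
    · intro e he i
      have hp := isParam_of_mem_atlas he
      exact (hp.hermComps hg).differentiableOn_gv (hf e he) (h0 _ _ hp) i
    · intro e he z hz
      rw [← IsParam.gv_eq_zero_iff (isParam_of_mem_atlas he) hg (chart_mem_atlas C2 _) hf
        ⟨hz, mem_chart_source C2 _⟩]
      exact ⟨fun h i => congrFun h i, fun h => funext h⟩
    · intro i
      exact (hA.hermComps hg).differentiableOn_gv (hA.contDiffOn_comp hf) (h0 _ _ hA) i
    · intro i
      exact Od.tendsto ((B.metricBounds hg).od_gv (u := fun _ w => f (A.chart w))
        (fun β => hfA.ofReal.eb β) i)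
    · intro z hz h
      rw [← IsParam.gv_eq_zero_iff hA hg (chart_mem_atlas C2 _) hf ⟨hz, mem_chart_source C2 _⟩]
      exact funext h
  -- A real function with zero gradient has `∂̄f = 0`, hence `df = 0`. Being constant and tending to
  -- zero along the end, it is zero.
  have hconst : IsLocallyConstant f := by
    rw [IsLocallyConstant.iff_eventually_eq]
    intro x
    set e := chartAt C2 x
    have he : e ∈ atlas C2 X := chart_mem_atlas C2 x
    have hxe : x ∈ e.source := mem_chart_source C2 x
    obtain ⟨ε, hε, hball⟩ := Metric.isOpen_iff.mp e.open_target (e x) (e.map_source hxe)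
    have hp := isParam_of_mem_atlas he
    have hd : ∀ w ∈ e.target, DifferentiableAt ℝ (fun w => f (e.symm w)) w := fun w hw =>
      ((hf e he).contDiffAt (e.open_target.mem_nhds hw)).differentiableAt (by simp)
    have hz : ∀ w ∈ e.target, fderiv ℝ (fun w => f (e.symm w)) w = 0 := by
      intro w hw
      refine fderiv_eq_zero_of_eb (hd w hw) fun β => ?_
      refine eb_of_gv ((hp.hermComps hg).vol_pos w hw).ne' ?_ β
      rw [IsParam.gv_eq_zero_iff hp hg (chart_mem_atlas C2 (e.symm w)) hf ⟨hw, mem_chart_source C2 _⟩]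
      exact hgv _
    filter_upwards [(e.continuousOn.isOpen_inter_preimage e.open_source Metric.isOpen_ball).mem_nhds
      ⟨hxe, Metric.mem_ball_self hε⟩] with y hy
    have := Metric.isOpen_ball.is_const_of_fderiv_eq_zero
      (convex_ball (e x) ε).isPreconnected
      (fun w hw => (hd w (hball hw)).differentiableWithinAt) (fun w hw => hz w (hball hw))
      hy.2 (Metric.mem_ball_self hε)
    simpa [e.left_inv hy.1, e.left_inv hxe] using this
  have ht := Od.tendsto (n := 1) hfA.ofReal.od
  have hc : (fun w => (f (A.chart w) : ℂ)) = fun _ => (f x : ℂ) := by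
    ext w
    rw [hconst.apply_eq_of_preconnectedSpace (A.chart w) x]
  rw [hc] at ht
  have hne : (Bornology.cobounded C2).NeBot := inferInstance
  exact_mod_cast tendsto_nhds_unique tendsto_const_nhds ht

/-- A section of a power of the canonical bundle with `∂̄`-parallel gradient that decays at
infinity vanishes. -/
theorem eq_zero_of_pmat [T2Space X] [ConnectedSpace X] {A : ALEEnd g k} {R C : ℝ}
    (B : ALEBounds A R C) (hg : IsKahlerMetric g) (x : (C2 → X) → C2 → ℂ) (n : ℕ)
    (hx : ∀ (F : C2 → X) (U : Set C2), IsParam F U → ∀ e ∈ atlas C2 X, ∀ z ∈ overlap F U e,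
      x F z = (jac (e ∘ F) z).det ^ n * (jac (e ∘ F) z).det * x e.symm (e (F z)))
    (hsm : ∀ e ∈ atlas C2 X, ContDiffOn ℝ ∞ (x e.symm) e.target)
    (h0 : ∀ e ∈ atlas C2 X, ∀ z ∈ e.target, pmat (comps e.symm g) (x e.symm) z = 0)
    (hA : Bd R 2 fun _ => x A.chart) : ∀ e ∈ atlas C2 X, ∀ z ∈ e.target, x e.symm z = 0 := by
  have hdet : ∀ (F : C2 → X) (U : Set C2), IsParam F U → ∀ e ∈ atlas C2 X,
      DifferentiableOn ℂ (fun w => (jac (e ∘ F) w).det ^ n) (overlap F U e) := by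
    intro F U hF e he
    have P := hF.pull hg he
    simp only [Matrix.det_fin_two]
    have j := P.differentiableOn_jac
    exact (((j 0 0).mul (j 1 1)).sub ((j 0 1).mul (j 1 0))).pow n
  have hsmF : ∀ (F : C2 → X) (U : Set C2), IsParam F U → ContDiffOn ℝ ∞ (x F) U := by
    intro F U hF
    refine contDiffOn_of_overlap (fun e he => ?_) hF
    have P := hF.pull hg he
    have hd : ContDiffOn ℝ ∞ (fun w => (jac (e ∘ F) w).det) (overlap F U e) := by
      simp only [Matrix.det_fin_two]
      have j := fun a b => (contDiffOn_of_differentiableOn P.herm.isOpen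
        (P.differentiableOn_jac a b)).restrict_scalars ℝ
      exact ((j 0 0).mul (j 1 1)).sub ((j 0 1).mul (j 1 0))
    refine ContDiffOn.congr (((hd.pow n).mul hd).mul (P.contDiffOn_comp (hsm e he))) ?_
    intro z hz
    exact hx F U hF e he z hz
  have hbv : ∀ (F : C2 → X) (U : Set C2), IsParam F U → ∀ e ∈ atlas C2 X, ∀ z ∈ overlap F U e,
      (bv (comps F g) (x F) z = 0 ↔ bv (comps e.symm g) (x e.symm) (e (F z)) = 0) := by
    intro F U hF e he z hz
    have P := hF.pull hg he
    have h1 : bv (comps F g) (x F) z = (jac (e ∘ F) z).det ^ n •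
        (jac (e ∘ F) z).transpose.mulVec (bv (comps e.symm g) (x e.symm) (e (F z))) := by
      ext α
      rw [Pi.smul_apply, Matrix.mulVec, dotProduct, Fin.sum_univ_two, smul_eq_mul]
      exact P.bv_eq hz (hsm e he) (hdet F U hF e he) (hx F U hF e he) α
    rw [h1]
    constructor
    · intro h
      have h2 := (smul_eq_zero.mp h).resolve_left (pow_ne_zero n (P.det z hz))
      exact Matrix.eq_zero_of_mulVec_eq_zero (by rw [Matrix.det_transpose]; exact P.det z hz) h2
    · intro h; rw [h, Matrix.mulVec_zero, smul_zero]
  -- The condition is assumed in the charts of the atlas only; its tensorial character carries it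
  -- over to the chart at infinity.
  have hpm : ∀ (F : C2 → X) (U : Set C2), IsParam F U → ∀ z ∈ U, pmat (comps F g) (x F) z = 0 := by
    intro F U hF z hz
    have he := chart_mem_atlas C2 (F z)
    have hze : z ∈ overlap F U (chartAt C2 (F z)) := ⟨hz, mem_chart_source C2 _⟩
    have P := hF.pull hg he
    rw [P.pmat_eq hze (hsm _ he) (hdet F U hF _ he) (hx F U hF _ he), h0 _ he _ (P.maps z hze)]
    simp
  have hsub : {z : C2 | R < ‖z‖} ⊆ {z | A.radius < ‖z‖} := fun z hz => B.radius_lt.trans hz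
  have hAp := A.isParam.mono (isOpen_norm_gt R) hsub
  -- First application of the Liouville principle, to the holomorphic (1,0)-form `b` with values in
  -- `K^n`, which is `O(r⁻³)`.
  have hb0 : ∀ y : X, bv (comps (chartAt C2 y).symm g) (x (chartAt C2 y).symm) (chartAt C2 y y) = 0 := by
    refine liouville_principle A B.radius_lt (fun e i z => bv (comps e.symm g) (x e.symm) z i) ?_ ?_
      (fun i z => bv (comps A.chart g) (x A.chart) z i) ?_ ?_ ?_
    · intro e he i
      exact ((isParam_of_mem_atlas he).hermComps hg).differentiableOn_bv (hsm e he) (h0 e he) i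
    · intro e he z hz
      rw [← hbv _ _ (isParam_of_mem_atlas he) _ (chart_mem_atlas C2 _) z ⟨hz, mem_chart_source C2 _⟩]
      exact ⟨fun h i => congrFun h i, fun h => funext h⟩
    · intro i
      exact (hAp.hermComps hg).differentiableOn_bv (hsmF _ _ hAp) (hpm _ _ hAp) i
    · intro i
      exact Od.tendsto ((B.metricBounds hg).od_bv (fun β => hA.eb β) i)
    · intro z hz h
      rw [← hbv _ _ hAp _ (chart_mem_atlas C2 _) z ⟨hz, mem_chart_source C2 _⟩]
      exact funext h
  -- Since `b` determines `∂̄x`, the section `x` is now holomorphic, and the Liouville principle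
  -- applies a second time, to `x` itself.
  have hhol : ∀ (F : C2 → X) (U : Set C2), IsParam F U → DifferentiableOn ℂ (x F) U := by
    intro F U hF z hz
    have hn := hF.isOpen.mem_nhds hz
    refine (differentiableAt_of_eb (((hsmF F U hF).contDiffAt hn).differentiableAt (by simp))
      fun ε => ?_).differentiableWithinAt
    refine eb_of_bv ((hF.hermComps hg).vol_pos z hz).ne' ?_ ε
    rw [hbv F U hF _ (chart_mem_atlas C2 (F z)) z ⟨hz, mem_chart_source C2 _⟩]
    exact hb0 _
  have hiff : ∀ (F : C2 → X) (U : Set C2), IsParam F U → ∀ e ∈ atlas C2 X, ∀ z ∈ overlap F U e,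
      (x F z = 0 ↔ x e.symm (e (F z)) = 0) := by
    intro F U hF e he z hz
    have hd := (hF.pull hg he).det z hz
    rw [hx F U hF e he z hz]
    simp [hd]
  have hfin : ∀ y : X, x (chartAt C2 y).symm (chartAt C2 y y) = 0 := by
    refine liouville_principle A B.radius_lt (ι := Unit) (fun e _ => x e.symm) ?_ ?_
      (fun _ => x A.chart) ?_ ?_ ?_
    · exact fun e he _ => hhol _ _ (isParam_of_mem_atlas he)
    · intro e he z hz
      rw [← hiff _ _ (isParam_of_mem_atlas he) _ (chart_mem_atlas C2 _) z ⟨hz, mem_chart_source C2 _⟩]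
      simp
    · exact fun _ => hhol _ _ hAp
    · exact fun _ => Od.tendsto (n := 1) hA.od
    · intro z hz h
      rw [← hiff _ _ hAp _ (chart_mem_atlas C2 _) z ⟨hz, mem_chart_source C2 _⟩]
      exact h ()
  intro e he z hz
  rw [hiff _ _ (isParam_of_mem_atlas he) _ (chart_mem_atlas C2 _) z ⟨hz, mem_chart_source C2 _⟩]
  exact hfin _

end Surface

end

/-! ### The null Lagrangian on the surface and the vanishing of solutions of `S^* φ = 0` -/

section

open scoped ComplexConjugate

open MeasureTheory

/-- The null Lagrangian attached to the `(1,0)` form `b` dual to `∂̄h`. -/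
def mixLoc (G : Comp 2) (h : C2 → ℂ) (u : C2 → ℝ) (z : C2) : ℝ :=
  -((u z : ℂ) * mix (pmat G h z) (pmat G h z) +
    mix (Matrix.vecMulVec (bv G h z) fun β => eb β (fun w => (u w : ℂ)) z) (pmat G h z)).re / vol G z

theorem mix_add_left (M M' P : M2) : mix (M + M') P = mix M P + mix M' P := by
  simp [mix]; ring

theorem mix_smul_left (c : ℂ) (M P : M2) : mix (c • M) P = c * mix M P := by
  simp [mix]; ring

theorem mix_zero_left (P : M2) : mix 0 P = 0 := by simp [mix]

theorem mixLoc_congr {G : Comp 2} {h : C2 → ℂ} {u v : C2 → ℝ} {z : C2} (huv : u =ᶠ[nhds z] v) :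
    mixLoc G h u z = mixLoc G h v z := by
  have e : ∀ β, eb β (fun w => (u w : ℂ)) z = eb β (fun w => (v w : ℂ)) z := fun β =>
    eb_congr (huv.fun_comp (fun t : ℝ => (t : ℂ))) β
  simp only [mixLoc, e, huv.eq_of_nhds]

theorem mixLoc_const {G : Comp 2} {h : C2 → ℂ} (c : ℝ) (z : C2) :
    mixLoc G h (fun _ => c) z = -(c * (mix (pmat G h z) (pmat G h z)).re) / vol G z := by
  have e : (fun β : Fin 2 => eb β (fun _ => (c : ℂ)) z) = 0 := by
    ext β; simp [eb, dbar]
  rw [mixLoc, e]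
  simp [mix_zero_left]

theorem mixLoc_add {G : Comp 2} {h : C2 → ℂ} {u v : C2 → ℝ} {z : C2} (hu : DifferentiableAt ℝ u z)
    (hv : DifferentiableAt ℝ v z) :
    mixLoc G h (fun w => u w + v w) z = mixLoc G h u z + mixLoc G h v z := by
  have e : (fun β => eb β (fun w => ((u w + v w : ℝ) : ℂ)) z) =
      (fun β => eb β (fun w => (u w : ℂ)) z) + fun β => eb β (fun w => (v w : ℂ)) z := by
    ext β
    rw [Pi.add_apply, ← eb_add (differentiableAt_ofReal hu) (differentiableAt_ofReal hv)]
    congr 1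
    ext w
    push_cast
    rfl
  rw [mixLoc, e, Matrix.vecMulVec_add, mix_add_left, mixLoc, mixLoc, ← add_div]
  congr 1
  push_cast
  simp only [add_mul, Complex.add_re]
  ring

/-- The numerator is a determinant of forms and scales by `|det J|²`, as does `vol`; the quotient is
a function on the surface. -/
theorem Pull.mixLoc_eq {τ : C2 → C2} {V U' : Set C2} {G G' : Comp 2} (P : Pull τ V G U' G')
    {x x' : C2 → ℂ} (hx' : ContDiffOn ℝ ∞ x' U') (hx : ∀ w ∈ V, x w = (jac τ w).det * x' (τ w))
    {u : C2 → ℝ} (hu : ContDiffOn ℝ ∞ u U') {z : C2} (hz : z ∈ V) :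
    mixLoc G x (fun w => u (τ w)) z = mixLoc G' x' u (τ z) := by
  have hx1 : ∀ w ∈ V, x w = (fun _ => (1 : ℂ)) w * (jac τ w).det * x' (τ w) := by
    intro w hw; simp [hx w hw]
  have hp := P.pmat_eq hz hx' (differentiableOn_const _) hx1
  have hb := P.bv_eq hz hx' (differentiableOn_const _) hx1
  have he := P.eb_comp hz (HermComps.contDiffOn_ofReal hu)
  simp only [one_smul, one_mul] at hp hb
  have hM : Matrix.vecMulVec (bv G x z) (fun β => eb β (fun w => (u (τ w) : ℂ)) z) =
      (jac τ z).transpose * Matrix.vecMulVec (bv G' x' (τ z))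
        (fun β => eb β (fun w => (u w : ℂ)) (τ z)) * (jac τ z).map conj := by
    ext α β
    simp only [Matrix.vecMulVec_apply, hb, he, Matrix.mul_apply, Fin.sum_univ_two,
      Matrix.transpose_apply, Matrix.map_apply]
    ring
  have hv := P.vol_eq hz
  rw [Complex.mul_conj] at hv
  have hv' : vol G z = Complex.normSq (jac τ z).det * vol G' (τ z) := by exact_mod_cast hv
  have hd : Complex.normSq (jac τ z).det ≠ 0 := by simpa using P.det z hz
  rw [mixLoc, hp, hM, mix_congr, mix_congr, Complex.mul_conj, hv', mixLoc]
  rw [show ((u (τ z) : ℝ) : ℂ) * ((Complex.normSq (jac τ z).det : ℂ) * mix (pmat G' x' (τ z))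
      (pmat G' x' (τ z))) + (Complex.normSq (jac τ z).det : ℂ) *
      mix (Matrix.vecMulVec (bv G' x' (τ z)) fun β => eb β (fun w => (u w : ℂ)) (τ z))
        (pmat G' x' (τ z)) = (Complex.normSq (jac τ z).det : ℂ) *
      ((u (τ z) : ℂ) * mix (pmat G' x' (τ z)) (pmat G' x' (τ z)) +
      mix (Matrix.vecMulVec (bv G' x' (τ z)) fun β => eb β (fun w => (u w : ℂ)) (τ z))
        (pmat G' x' (τ z))) by ring, Complex.re_ofReal_mul, ← mul_neg,
    mul_div_mul_left _ _ hd]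

theorem HermTraceFree.congr {J h k P : M2} (hh : h = J.transpose * k * J.map conj)
    (hP : HermTraceFree k P) : HermTraceFree h (J.transpose * P * J.map conj) := by
  have c0 : conj (P 0 0) = P 0 0 := Complex.conj_eq_iff_im.mpr hP.r0
  have c1 : conj (P 1 1) = P 1 1 := Complex.conj_eq_iff_im.mpr hP.r1
  refine ⟨?_, ?_, ?_, ?_⟩
  · rw [← Complex.conj_eq_iff_im]
    simp [Matrix.mul_apply, Fin.sum_univ_two, hP.off, c0, c1]
    ring
  · rw [← Complex.conj_eq_iff_im]
    simp [Matrix.mul_apply, Fin.sum_univ_two, hP.off, c0, c1]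
    ring
  · simp [Matrix.mul_apply, Fin.sum_univ_two, hP.off, c0, c1]
    ring
  · rw [hh, mix_congr, hP.tr, mul_zero]

section Surface

variable {X : Type*} [TopologicalSpace X] [ChartedSpace C2 X]
  [IsManifold 𝓘(ℂ, C2) ω X] {g φ : CovTensorField X 2} {F : C2 → X} {U : Set C2}
  {e : OpenPartialHomeomorph X C2} {k : ℕ}

/-- The null Lagrangian of a self-dual form. -/
def mixOp (g φ : CovTensorField X 2) (u : X → ℝ) (x : X) : ℝ :=
  mixLoc (comps (chartAt C2 x).symm g) (hcoef (comps (chartAt C2 x).symm φ))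
    (fun w => u ((chartAt C2 x).symm w)) (chartAt C2 x x)

theorem tendsto_chart_symm (x : X) :
    Filter.Tendsto (chartAt C2 x).symm (nhds (chartAt C2 x x)) (nhds x) := by
  have := (chartAt C2 x).continuousAt_symm ((chartAt C2 x).map_source (mem_chart_source C2 x))
  rwa [ContinuousAt, (chartAt C2 x).left_inv (mem_chart_source C2 x)] at this

theorem mixOp_congr {u v : X → ℝ} {x : X} (h : ∀ᶠ y in nhds x, u y = v y) :
    mixOp g φ u x = mixOp g φ v x :=
  mixLoc_congr ((tendsto_chart_symm x).eventually h)

theorem contDiffOn_hcoef {φ : Comp 2} {U : Set C2} (h : ∀ I, ContDiffOn ℝ ∞ (fun z => φ z I) U) :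
    ContDiffOn ℝ ∞ (hcoef φ) U :=
  (HermComps.contDiffOn_ofReal (contDiffOn_const.mul ((h _).sub (h _)))).add
    (contDiffOn_const.mul (HermComps.contDiffOn_ofReal (contDiffOn_const.mul ((h _).add (h _)))))

theorem mixOp_add {u v : X → ℝ} (hu : SmoothFn u) (hv : SmoothFn v) (x : X) :
    mixOp g φ (fun y => u y + v y) x = mixOp g φ u x + mixOp g φ v x := by
  have he := chart_mem_atlas C2 x
  have hn := (chartAt C2 x).open_target.mem_nhds ((chartAt C2 x).map_source (mem_chart_source C2 x))
  exact mixLoc_add (((hu _ he).contDiffAt hn).differentiableAt (by simp))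
    (((hv _ he).contDiffAt hn).differentiableAt (by simp))

theorem mixOp_zero (x : X) : mixOp g φ (fun _ => 0) x = 0 := by
  rw [mixOp, mixLoc_const]; simp

theorem mixOp_sum {ι : Type*} (s : Finset ι) (u : ι → X → ℝ)
    (hu : ∀ i, SmoothFn (u i)) (x : X) :
    mixOp g φ (fun y => ∑ i ∈ s, u i y) x = ∑ i ∈ s, mixOp g φ (u i) x := by
  classical
  induction s using Finset.induction_on with
  | empty => simpa using mixOp_zero x
  | insert i s hi ih =>
    simp only [Finset.sum_insert hi]
    rw [mixOp_add (hu i) (SmoothFn.sum s hu), ih]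

namespace IsSolution

theorem mixOp_eq (h : IsSolution g φ) (hg : IsKahlerMetric g) (hF : IsParam F U) {u : X → ℝ}
    (hu : SmoothFn u) {z : C2} (hz : z ∈ U) :
    mixOp g φ u (F z) = mixLoc (comps F g) (hcoef (comps F φ)) (fun w => u (F w)) z := by
  have he := chart_mem_atlas C2 (F z)
  have hze : z ∈ overlap F U (chartAt C2 (F z)) := ⟨hz, mem_chart_source C2 _⟩
  rw [mixLoc_congr (hF.comp_eventuallyEq u hze)]
  exact (Pull.mixLoc_eq (u := fun w => u ((chartAt C2 (F z)).symm w)) (hF.pull hg he)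
    (contDiffOn_hcoef (h.smooth _ he)) (fun w hw => h.hcoef_eq hg hF he hw) (hu _ he) hze).symm

theorem continuous_mixOp (h : IsSolution g φ) (hg : IsKahlerMetric g) {u : X → ℝ}
    (hu : SmoothFn u) : Continuous (mixOp g φ u) := by
  refine continuous_of_charts fun e he => ?_
  have hp := isParam_of_mem_atlas he
  have hH := hp.hermComps hg
  refine ContinuousOn.congr ?_ fun z hz => h.mixOp_eq hg hp hu hz
  have hx := contDiffOn_hcoef (h.smooth e he)
  have hb := fun α => (hH.contDiffOn_bv hx α).continuousOn
  have hP : ∀ α β, ContinuousOn (fun z => pmat (comps e.symm g) (hcoef (comps e.symm φ)) z α β)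
      e.target := fun α β =>
    (contDiffOn_eb e.open_target (hH.contDiffOn_bv hx α) β).continuousOn
  have hu' := fun β => (contDiffOn_eb e.open_target (HermComps.contDiffOn_ofReal (hu e he)) β).continuousOn
  have hm : ∀ {M N : C2 → M2}, (∀ i j, ContinuousOn (fun z => M z i j) e.target) →
      (∀ i j, ContinuousOn (fun z => N z i j) e.target) →
      ContinuousOn (fun z => mix (M z) (N z)) e.target := fun hM hN =>
    ((((hM _ _).mul (hN _ _)).add ((hM _ _).mul (hN _ _))).sub ((hM _ _).mul (hN _ _))).sub
      ((hM _ _).mul (hN _ _))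
  refine ContinuousOn.div (Complex.continuous_re.comp_continuousOn ?_).neg hH.continuousOn_vol
    fun z hz => (hH.vol_pos z hz).ne'
  refine ((Complex.continuous_ofReal.comp_continuousOn (hu e he).continuousOn).mul (hm hP hP)).add
    (hm (fun α β => ?_) hP)
  simp only [Matrix.vecMulVec_apply]
  exact (hb α).mul (hu' β)

theorem nullOperator_mixOp [T2Space X] (h : IsSolution g φ) (hg : IsKahlerMetric g) :
    NullOperator g (mixOp g φ) where
  map_sum s u hu x := mixOp_sum s u hu x
  map_eventually_zero u x hu := by rw [mixOp_congr hu, mixOp_zero]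
  continuous u hu := h.continuous_mixOp hg hu
  integral e he K hK hKe u hu hu0 := by
    have hp := isParam_of_mem_atlas he
    have I := (hg.kahlerComps he).setIntegral_mix (U := ⟨e.target, e.open_target⟩)
      (contDiffOn_hcoef (h.smooth e he))
      (hK.image_of_continuousOn (e.continuousOn.mono hKe))
      (by rintro z ⟨x, hx, rfl⟩; exact e.map_source (hKe hx)) (hu e he) (fun z hz hzK => by
        refine hu0 _ fun hmem => hzK ⟨_, hmem, e.right_inv hz⟩)
    rw [← neg_eq_zero, ← integral_neg, ← I]
    refine setIntegral_congr_fun e.open_target.measurableSet fun z hz => ?_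
    have hv := (comps_pos hg hp hz).2
    rw [h.mixOp_eq hg hp hu hz, mixLoc]
    field_simp

theorem hermTraceFree (h : IsSolution g φ) (hg : IsKahlerMetric g) (hs : IsScalarFlat g)
    (h0 : ∀ x, formCoef g φ x = 0) (hF : IsParam F U) {z : C2} (hz : z ∈ U) :
    HermTraceFree (hmat (comps F g) z) (pmat (comps F g) (hcoef (comps F φ)) z) := by
  have he := chart_mem_atlas C2 (F z)
  set e := chartAt C2 (F z)
  have hze : z ∈ overlap F U e := ⟨hz, mem_chart_source C2 _⟩
  have P := hF.pull hg he
  have hT := (hg.kahlerComps he).hermTraceFree_pmat (U := ⟨e.target, e.open_target⟩)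
    (fun z hz => hs e he z hz) (fun I => h.smooth e he I) (h.selfDual e he) (h.eqn e he)
    (fun w hw => by rw [← h.formCoef_eq hg (isParam_of_mem_atlas he) hw]; exact h0 _)
    (P.maps z hze)
  have hp := P.pmat_eq (c := fun _ => 1) (x := hcoef (comps F φ)) hze (contDiffOn_hcoef (h.smooth e he))
    (differentiableOn_const _) (fun w hw => by rw [one_mul]; exact h.hcoef_eq hg hF he hw)
  rw [hp, one_smul]
  exact hT.congr (P.pull.hmat_eq P.herm'.table hze)

/-- For `u = 1` the operator is `-2 det P / vol` with `P` Hermitian and trace-free; the sign in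
`mixLoc` is chosen to make this nonnegative. -/
theorem mixOp_one_nonneg (h : IsSolution g φ) (hg : IsKahlerMetric g) (hs : IsScalarFlat g)
    (h0 : ∀ x, formCoef g φ x = 0) (x : X) : 0 ≤ mixOp g φ (fun _ => 1) x := by
  have hp := isParam_of_mem_atlas (chart_mem_atlas C2 x)
  have hx := (chartAt C2 x).map_source (mem_chart_source C2 x)
  rw [mixOp, mixLoc_const, one_mul]
  exact div_nonneg ((h.hermTraceFree hg hs h0 hp hx).mix_self_nonneg ((hp.hermComps hg).posHerm hx))
    (comps_pos hg hp hx).2.le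

end IsSolution

theorem Od.mix {r₀ : ℝ} {n m : ℕ} {M N : ℝ → C2 → M2} (hM : ∀ i j, Od r₀ n fun r z => M r z i j)
    (hN : ∀ i j, Od r₀ m fun r z => N r z i j) : Od r₀ (n + m) fun r z => mix (M r z) (N r z) := by
  have := (((hM 0 0).mul (hN 1 1)).add ((hM 1 1).mul (hN 0 0))).add
    ((((hM 0 1).mul (hN 1 0)).add ((hM 1 0).mul (hN 0 1))).const_mul (-1))
  refine Od.congr this fun r hr z hz => ?_
  simp only [ALEKahler.mix]
  ring

theorem SmoothFn.const (c : ℝ) : SmoothFn fun _ : X => c := fun _ _ => contDiffOn_const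

namespace IsSolution

/-- The test functions are `χ_r²`. On the annulus the terms `χ² mix P P + 2 χ mix (b ⊗ ∂̄χ) P` are
completed to a square, which leaves only `b ⊗ ∂̄χ = O(r⁻⁴)` squared. No bound on `P`, that is on
second derivatives of `x`, is needed. -/
theorem pmat_eq_zero [T2Space X] [Nonempty X] [SecondCountableTopology X]
    (h : IsSolution g φ) (hg : IsKahlerMetric g) (hs : IsScalarFlat g)
    (h0 : ∀ x, formCoef g φ x = 0) {A : ALEEnd g k}
    {R C : ℝ} (B : ALEBounds A R C) (hdec : ∀ i j, Bd R 2 fun _ z => comps A.chart φ z ![i, j])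
    (hF : IsParam F U) {z : C2} (hz : z ∈ U) : pmat (comps F g) (hcoef (comps F φ)) z = 0 := by
  let _ : MeasurableSpace X := borel X
  have : BorelSpace X := ⟨rfl⟩
  obtain ⟨μ, hμ⟩ := exists_isVolume hg
  have hR := B.one_le
  have hA := A.isParam
  have hMB := B.metricBounds hg
  set G := comps A.chart g with hG
  set x := hcoef (comps A.chart φ)
  have hx : Bd R 2 fun _ => x := bd_hcoef hdec
  let N : ℝ → C2 → M2 := fun r z =>
    Matrix.vecMulVec (bv G x z) fun β => eb β (fun w => (profile (r⁻¹ • w) : ℂ)) z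
  have hN : ∀ i j, Od R 4 fun r z => N r z i j := fun i j =>
    (hMB.od_bv (fun β => hx.eb β) i).mul
      (bd_eb_scale (HermComps.contDiffOn_ofReal contDiffOn_profile) (by linarith) j).od
  let m : ℝ → C2 → M2 := fun r z => (1 / 2 : ℂ) • (N r z + (N r z).conjTranspose)
  have hm : ∀ i j, Od R 4 fun r z => m r z i j := fun i j =>
    ((hN i j).add (hN j i).conj).const_mul (1 / 2)
  -- The lower bound supplied by `complete_square`, divided by the volume density; it is quadratic
  -- in `m` and hence of order `8`.
  let E : ℝ → C2 → ℝ := fun r z => ((mix (m r z) (m r z)).re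
    + -(1 / 2) * ((mix (hmat G z) (m r z)).re * (mix (hmat G z) (m r z)).re * (vol G z)⁻¹)) * (vol G z)⁻¹
  have hE : Od R 8 E := by
    have e1 : Od R 8 fun r z => (mix (m r z) (m r z)).re := (Od.mix hm hm).re
    have e2 : Od R 4 fun r z => (mix (hmat G z) (m r z)).re := by
      have := (Od.mix (M := fun _ z => hmat G z) (fun i j => (hMB.hmat i j).od) hm).re
      rwa [zero_add] at this
    have e3 : Od R 0 fun _ z => (vol G z)⁻¹ := hMB.vol_inv.od
    exact (e1.add (((e2.mul e2).mul e3).const_mul _)).mul e3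
  obtain ⟨M, hM, hbound⟩ := hE
  have hq : ∀ x, mixOp g φ (fun _ => 1) x = 0 := by
    refine (h.nullOperator_mixOp hg).eq_zero hg hμ (M := M) (r₀ := R + 1) B
      (u := fun r x => A.cutoff r x * A.cutoff r x)
      (h.continuous_mixOp hg (SmoothFn.const 1)) (h.mixOp_one_nonneg hg hs h0) ?_ ?_ ?_ ?_
    · intro r hr
      have hc := A.smoothFn_cutoff hg B hr
      exact hc.mul hc
    · intro r hr x hx
      simp [A.cutoff_eq_zero (by linarith) hx]
    · intro r hr x hx
      refine le_of_eq (mixOp_congr ?_).symm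
      filter_upwards [(A.isOpen_rad_lt hg B hr).mem_nhds hx] with y hy
      simp [A.cutoff_eq_one (by linarith) (le_of_lt hy)]
    · intro r hr z h1 h2
      have hr0 : 0 < r := by linarith
      have hc := A.smoothFn_cutoff hg B hr
      have hzU : z ∈ {z | A.radius < ‖z‖} := B.radius_lt.trans_le (by linarith)
      rw [h.mixOp_eq hg hA (hc.mul hc) hzU]
      have hev : (fun w => A.cutoff r (A.chart w) * A.cutoff r (A.chart w)) =ᶠ[nhds z]
          fun w => profile (r⁻¹ • w) * profile (r⁻¹ • w) := by
        filter_upwards [hA.isOpen.mem_nhds hzU] with w hw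
        rw [profile_eq_cutoff A hr0 hw]
      rw [mixLoc_congr hev]
      have hprof : DifferentiableAt ℝ (fun w : C2 => profile (r⁻¹ • w)) z := by
        have hz0 : z ≠ 0 := norm_pos_iff.mp (A.radius_pos.trans hzU)
        have hmem : r⁻¹ • z ∈ ({0}ᶜ : Set C2) := by simp [hr0.ne', hz0]
        exact (fderiv_scale ((contDiffOn_profile.contDiffAt
          (isOpen_compl_singleton.mem_nhds hmem)).differentiableAt (by simp))).differentiableAt
      have hHm := (hA.hermComps hg).posHerm hzU
      have hv := (comps_pos hg hA hzU).2
      have hdet : G z ![0, 0] * G z ![2, 2] -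
          Complex.normSq (G z ![0, 2] + Complex.I * G z ![0, 3]) = vol G z := by
        rw [vol]; simp [Complex.normSq_apply]; ring
      have key := (h.hermTraceFree hg hs h0 hA hzU).complete_square hHm (N r z) (profile (r⁻¹ • z))
      have hdbl : (fun β => eb β (fun w => ((profile (r⁻¹ • w) * profile (r⁻¹ • w) : ℝ) : ℂ)) z) =
          (2 * profile (r⁻¹ • z) : ℂ) • fun β => eb β (fun w => (profile (r⁻¹ • w) : ℂ)) z := by
        ext β
        rw [eb_ofReal_mul hprof hprof, Pi.smul_apply, smul_eq_mul]
        ring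
      rw [mixLoc, hdbl, Matrix.vecMulVec_smul, mix_smul_left]
      have hb := hbound r (by linarith) z h1 h2
      rw [Real.norm_eq_abs] at hb
      have hb' := (abs_le.mp hb).1
      refine hb'.trans ?_
      rw [div_eq_mul_inv]
      refine mul_le_mul_of_nonneg_right ?_ (inv_nonneg.mpr hv.le)
      rw [hdet] at key
      refine le_trans (le_of_eq ?_) (key.trans (le_of_eq ?_))
      · field_simp
        ring
      · push_cast
        rfl
  have hq' := hq (F z)
  rw [h.mixOp_eq hg hF (SmoothFn.const 1) hz, mixLoc_const, one_mul] at hq'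
  have hv := (comps_pos hg hF hz).2
  refine (h.hermTraceFree hg hs h0 hF hz).eq_zero ((hF.hermComps hg).posHerm hz) ?_
  rcases div_eq_zero_iff.mp hq' with h1 | h1
  · exact neg_eq_zero.mp h1
  · exact absurd h1 hv.ne'

end IsSolution

/-- A tensor field with vanishing components vanishes. -/
theorem eq_zero_of_comps {n : ℕ} {T : CovTensorField X n}
    (h : ∀ e ∈ atlas C2 X, ∀ z ∈ e.target, ∀ I, comps e.symm T z I = 0) : T = 0 := by
  funext x
  set e := chartAt C2 x
  have he : e ∈ atlas C2 X := chart_mem_atlas C2 x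
  have hxe : x ∈ e.source := mem_chart_source C2 x
  have hp := isParam_of_mem_atlas he
  have hpull : pullAt e.symm T (e x) = 0 := by
    refine Module.Basis.ext_multilinear (fun _ => realBasis) fun I => ?_
    simp only [realBasis_apply]
    exact h e he (e x) (e.map_source hxe) I
  have hx : e.symm (e x) = x := e.left_inv hxe
  have key : ∀ y, y = x → T y = 0 → T x = 0 := by rintro y rfl h; exact h
  refine key _ hx ?_
  ext v
  have hb := (hp.bij (e x) (e.map_source hxe)).2
  choose w hw using fun a => hb (v a)
  have := congrArg (fun M : MultilinearMap ℝ (fun _ : Fin n => C2) ℝ => M w) hpull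
  have hv : (fun a => mfderiv 𝓘(ℂ, C2) 𝓘(ℂ, C2) e.symm (e x) (w a)) = v := funext hw
  rw [← hv]
  exact this

namespace IsSolution

/-- Decaying solutions of `S^* φ = 0` vanish. -/
theorem eq_zero [T2Space X] [ConnectedSpace X] [SecondCountableTopology X]
    (h : IsSolution g φ) (hg : IsKahlerMetric g) (hs : IsScalarFlat g) {A : ALEEnd g k}
    {R C : ℝ} (B : ALEBounds A R C) (hdec : ∀ i j, Bd R 2 fun _ z => comps A.chart φ z ![i, j]) :
    φ = 0 := by
  have hf := h.smoothFn_formCoef hg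
  have hfA : Bd R 2 fun _ w => formCoef g φ (A.chart w) := by
    refine Bd.congr ((B.metricBounds hg).bd_coefF hdec) fun r hr w hw => ?_
    filter_upwards [A.isParam.isOpen.mem_nhds (B.radius_lt.trans_le (hr.trans hw))] with y hy
    exact h.formCoef_eq hg A.isParam hy
  have h0 : ∀ x, formCoef g φ x = 0 := hf.eq_zero_of_hess B hg hfA fun F U hF z hz =>
    h.hess_formCoef_eq_zero hg hs B hdec hF hz
  have hx := eq_zero_of_pmat B hg (fun F => hcoef (comps F φ)) 0
    (fun F U hF e he z hz => by rw [pow_zero, one_mul]; exact h.hcoef_eq hg hF he hz)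
    (fun e he => contDiffOn_hcoef (h.smooth e he))
    (fun e he z hz => h.pmat_eq_zero hg hs h0 B hdec (isParam_of_mem_atlas he) hz) (bd_hcoef hdec)
  refine eq_zero_of_comps fun e he z hz I => ?_
  have hI : I = ![I 0, I 1] := by ext a; fin_cases a <;> rfl
  have hc := h.formCoef_eq hg (isParam_of_mem_atlas he) hz
  rw [h0] at hc
  have hh := hx e he z hz
  have hP : coefP (comps e.symm φ) z = 0 := by
    have := congrArg Complex.re hh
    simpa [hcoef] using this
  have hQ : coefQ (comps e.symm φ) z = 0 := by
    have := congrArg Complex.im hh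
    simpa [hcoef] using this
  rw [hI, (hg.kahlerComps he).eq_sdMat hz (h.selfDual e he z hz), ← hc, hP, hQ]
  generalize I 0 = i
  generalize I 1 = j
  fin_cases i <;> fin_cases j <;> simp [sdMat]

end IsSolution

end Surface

end

/-! ### From the decay of the tensor norm to bounds on components -/

section

open scoped ComplexConjugate

theorem sum_sq_le_of_near_one {ι : Type*} [Fintype ι] [DecidableEq ι] {M : ι → ι → ℝ} {ε : ℝ}
    (hM : ∀ i j, |M i j - if i = j then 1 else 0| ≤ ε) (hε : ε * Fintype.card ι ≤ 1 / 2) (t : ι → ℝ) :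
    1 / 2 * ∑ i, t i ^ 2 ≤ ∑ i, ∑ j, M i j * (t i * t j) := by
  have e : ∑ i, ∑ j, M i j * (t i * t j) = ∑ i, t i ^ 2 +
      ∑ i, ∑ j, (M i j - if i = j then 1 else 0) * (t i * t j) := by
    simp only [sub_mul, Finset.sum_sub_distrib, ite_mul, one_mul, zero_mul, Finset.sum_ite_eq,
      Finset.mem_univ, if_true, ← pow_two]
    ring
  have b : |∑ i, ∑ j, (M i j - if i = j then 1 else 0) * (t i * t j)| ≤ ε * (∑ i, |t i|) ^ 2 := by
    refine (Finset.abs_sum_le_sum_abs _ _).trans ?_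
    rw [pow_two, Finset.sum_mul_sum, Finset.mul_sum]
    refine Finset.sum_le_sum fun i _ => (Finset.abs_sum_le_sum_abs _ _).trans ?_
    rw [Finset.mul_sum]
    refine Finset.sum_le_sum fun j _ => ?_
    rw [abs_mul, abs_mul]
    exact mul_le_mul_of_nonneg_right (hM i j) (by positivity)
  have cs : (∑ i, |t i|) ^ 2 ≤ Fintype.card ι * ∑ i, t i ^ 2 := by
    have := sq_sum_le_card_mul_sum_sq (s := Finset.univ) (f := fun i => |t i|)
    simpa [sq_abs, Finset.card_univ] using this
  by_cases hne : IsEmpty ι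
  · simp
  · rw [not_isEmpty_iff] at hne
    obtain ⟨i⟩ := hne
    have hε0 : 0 ≤ ε := (abs_nonneg _).trans (hM i i)
    have h1 : ε * (∑ i, |t i|) ^ 2 ≤ 1 / 2 * ∑ i, t i ^ 2 := by
      calc ε * (∑ i, |t i|) ^ 2 ≤ ε * (Fintype.card ι * ∑ i, t i ^ 2) := by gcongr
        _ = ε * Fintype.card ι * ∑ i, t i ^ 2 := by ring
        _ ≤ _ := by gcongr
    have := (abs_le.mp b).1
    rw [e]
    linarith

section Surface

variable {X : Type*} [TopologicalSpace X] [ChartedSpace C2 X] {g : CovTensorField X 2} {k : ℕ}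

theorem ALEBounds.mono {A : ALEEnd g k} {R R' C : ℝ} (B : ALEBounds A R C) (h : R ≤ R') :
    ALEBounds A R' C :=
  ⟨B.one_le.trans h, B.radius_lt.trans_le h, B.C_pos, fun z hz => B.metric z (h.trans hz),
    fun z hz => B.small z (h.trans hz), fun z hz => B.deriv z (h.trans hz)⟩

theorem ALEBounds.tendsto_metricInv {A : ALEEnd g k} {R C : ℝ} (B : ALEBounds A R C) (i j : Fin 4) :
    Filter.Tendsto (fun z => metricInv (comps A.chart g) z i j) (Bornology.cobounded C2)
      (nhds (if i = j then 1 else 0)) := by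
  have h1 : Filter.Tendsto (metricMatrix (comps A.chart g)) (Bornology.cobounded C2) (nhds 1) := by
    refine tendsto_pi_nhds.mpr fun a => tendsto_pi_nhds.mpr fun b => ?_
    have : Filter.Tendsto (fun z : C2 => C * ‖z‖ ^ (-2 : ℤ)) (Bornology.cobounded C2) (nhds 0) := by
      rw [← mul_zero C]
      exact ((tendsto_zpow_atTop_zero (by norm_num)).comp tendsto_norm_cobounded_atTop).const_mul C
    have h2 : Filter.Tendsto (fun z => comps A.chart g z ![a, b] - if a = b then 1 else 0)
        (Bornology.cobounded C2) (nhds 0) := by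
      rw [tendsto_zero_iff_abs_tendsto_zero]
      exact squeeze_zero' (Filter.Eventually.of_forall fun _ => abs_nonneg _)
        (eventually_cobounded fun z hz => B.metric z hz a b) this
    have h3 := h2.add_const (if a = b then (1 : ℝ) else 0)
    simp only [sub_add_cancel, zero_add] at h3
    rw [Matrix.one_apply]
    exact h3
  have hd : Filter.Tendsto (fun z => (metricMatrix (comps A.chart g) z).det) (Bornology.cobounded C2)
      (nhds 1) := by
    have := ((continuous_id (X := Matrix (Fin 4) (Fin 4) ℝ)).matrix_det.tendsto 1).comp h1
    rwa [id, Matrix.det_one] at this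
  have ha : Filter.Tendsto (fun z => (metricMatrix (comps A.chart g) z).adjugate i j)
      (Bornology.cobounded C2) (nhds (if i = j then 1 else 0)) := by
    have := ((continuous_id (X := Matrix (Fin 4) (Fin 4) ℝ)).matrix_adjugate.tendsto 1).comp h1
    have := (continuous_apply_apply i j).continuousAt.tendsto.comp this
    rwa [id, Matrix.adjugate_one, Matrix.one_apply] at this
  have h4 := (hd.inv₀ one_ne_zero).mul ha
  rw [inv_one, one_mul] at h4
  refine h4.congr fun z => ?_
  rw [metricInv, Matrix.inv_def, Matrix.smul_apply, smul_eq_mul, Ring.inverse_eq_inv]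

/-- The inverse metric tends to the identity, so the induced quadratic form on tensors is eventually
at least half the Euclidean one. The tolerance `1 / (2 N)`, with `N` the number of components, is
what the perturbation of the identity allows. -/
theorem ALEBounds.eventually_le_tensorNorm {A : ALEEnd g k} {R C : ℝ} (B : ALEBounds A R C) (n : ℕ) :
    ∀ᶠ z in Bornology.cobounded C2, ∀ (T : Comp n) (I : Fin n → Fin 4),
      |T z I| ≤ 2 * tensorNorm (comps A.chart g) T z := by
  classical
  set N : ℝ := (Fintype.card (Fin n → Fin 4) : ℝ)
  have hN : 0 < N := by
    have : 0 < Fintype.card (Fin n → Fin 4) := Fintype.card_pos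
    exact Nat.cast_pos.mpr this
  have hprod : ∀ I J : Fin n → Fin 4, ∀ᶠ z in Bornology.cobounded C2,
      |∏ a, metricInv (comps A.chart g) z (I a) (J a) - if I = J then 1 else 0| ≤ 1 / (2 * N) := by
    intro I J
    have ht := tendsto_finsetProd (Finset.univ : Finset (Fin n))
      fun a _ => B.tendsto_metricInv (I a) (J a)
    have hlim : ∏ a, (if I a = J a then (1 : ℝ) else 0) = if I = J then 1 else 0 := by
      by_cases h : I = J
      · simp [h]
      · rw [if_neg h]
        obtain ⟨a, ha⟩ := Function.ne_iff.mp h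
        exact Finset.prod_eq_zero (Finset.mem_univ a) (if_neg ha)
    rw [hlim] at ht
    have := (Metric.tendsto_nhds.mp ht) (1 / (2 * N)) (by positivity)
    filter_upwards [this] with z hz
    rw [Real.dist_eq] at hz
    exact hz.le
  have hall := Filter.eventually_all.mpr fun I => Filter.eventually_all.mpr fun J => hprod I J
  filter_upwards [hall] with z hz T I
  have h1 := sum_sq_le_of_near_one hz (by change 1 / (2 * N) * N ≤ 1 / 2; field_simp; rfl) (T z)
  have h2 : T z I ^ 2 ≤ ∑ I, T z I ^ 2 :=
    Finset.single_le_sum (f := fun I => T z I ^ 2) (fun _ _ => sq_nonneg _) (Finset.mem_univ I)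
  have h3 : tensorNorm (comps A.chart g) T z ^ 2 = ∑ I : Fin n → Fin 4, ∑ J : Fin n → Fin 4,
      (∏ a, metricInv (comps A.chart g) z (I a) (J a)) * (T z I * T z J) := by
    rw [tensorNorm, Real.sq_sqrt]
    refine le_trans ?_ h1
    positivity
  refine abs_le_of_sq_le_sq ?_ (by rw [tensorNorm]; positivity)
  rw [mul_pow, h3]
  have : 0 ≤ ∑ I, T z I ^ 2 := by positivity
  linarith

variable [IsManifold 𝓘(ℂ, C2) ω X]

/-- The decay condition bounds the components and their first derivatives. -/
theorem DecaysToOrder.exists_bd {A : ALEEnd g k} {R C : ℝ} (B : ALEBounds A R C) {n : ℕ}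
    {T : CovTensorField X n} (hT : IsSmooth T) (hd : DecaysToOrder A T 2) :
    ∃ R', R ≤ R' ∧ ∀ I, Bd R' 2 fun _ z => comps A.chart T z I := by
  obtain ⟨R0, C0, hC0, h0⟩ := exists_bound_of_isBigO (hd 0)
  obtain ⟨R1, C1, hC1, h1⟩ := exists_bound_of_isBigO (hd 1)
  have hinv : ∀ i j, ∀ᶠ z in Bornology.cobounded C2, |metricInv (comps A.chart g) z i j| ≤ 2 := by
    intro i j
    have := (B.tendsto_metricInv i j).abs.eventually_le_const (u := 2) (by split_ifs <;> norm_num)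
    exact this
  have hall := ((B.eventually_le_tensorNorm n).and (B.eventually_le_tensorNorm (n + 1))).and
    (Filter.eventually_all.mpr fun i => Filter.eventually_all.mpr fun j => hinv i j)
  obtain ⟨R2, hR2⟩ : ∃ R2 : ℝ, ∀ z : C2, R2 ≤ ‖z‖ → _ := by
    rw [Filter.Eventually, ← comap_norm_atTop, Filter.mem_comap] at hall
    obtain ⟨s, hs, hsub⟩ := hall
    obtain ⟨R2, hR2⟩ := Filter.mem_atTop_sets.mp hs
    exact ⟨R2, fun z hz => hsub (show z ∈ (fun z : C2 => ‖z‖) ⁻¹' s from hR2 _ hz)⟩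
  have hC := B.C_pos
  -- The partial derivative is the covariant one plus terms `Γ ∗ T`. The first contributes `2 C1`.
  -- Each Christoffel symbol is at most `½ · 4 · 2 · 3 C = 12 C` times `‖z‖⁻³`, each component of
  -- `T` at most `2 C0`, and there are `n` slots with four summands each.
  set D := 2 * C1 + n * (4 * (12 * C * (2 * C0)))
  have hD : 0 ≤ D := by positivity
  refine ⟨max (max R R0) (max R1 R2), (le_max_left _ _).trans (le_max_left _ _), fun I =>
    ⟨2 * C0 + 4 * D, by positivity, fun r hr z hrz _ => ?_⟩⟩
  have hzr := hr.trans hrz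
  have hzR : R ≤ ‖z‖ := ((le_max_left _ _).trans (le_max_left _ _)).trans hzr
  have hz0 : R0 ≤ ‖z‖ := ((le_max_right _ _).trans (le_max_left _ _)).trans hzr
  have hz1 : R1 ≤ ‖z‖ := ((le_max_left _ _).trans (le_max_right _ _)).trans hzr
  have hz2 : R2 ≤ ‖z‖ := ((le_max_right _ _).trans (le_max_right _ _)).trans hzr
  have hr1 : 1 ≤ r := B.one_le.trans (((le_max_left _ _).trans (le_max_left _ _)).trans hr)
  have hn1 : 1 ≤ ‖z‖ := hr1.trans hrz
  obtain ⟨⟨t0, t1⟩, ti⟩ := hR2 z hz2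
  have zp : ∀ m : ℕ, ‖z‖ ^ (-(m : ℤ)) = 1 / ‖z‖ ^ m := fun m => by
    rw [zpow_neg, zpow_natCast, one_div]
  have b0 : ∀ I, |comps A.chart T z I| ≤ 2 * C0 / ‖z‖ ^ 2 := by
    intro I
    have h := h0 z hz0
    rw [Real.norm_eq_abs] at h
    have h' := (le_abs_self _).trans h
    have e : ((2 : ℕ) : ℤ) + ((0 : ℕ) : ℤ) = ((2 : ℕ) : ℤ) := rfl
    rw [e, zp] at h'
    refine (t0 (comps A.chart T) I).trans ?_
    calc 2 * tensorNorm (comps A.chart g) (comps A.chart T) z ≤ 2 * (C0 * (1 / ‖z‖ ^ 2)) := by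
          exact mul_le_mul_of_nonneg_left h' (by norm_num)
      _ = _ := by ring
  have b1 : ∀ J, |cov (comps A.chart g) (comps A.chart T) z J| ≤ 2 * C1 / ‖z‖ ^ 3 := by
    intro J
    have h := h1 z hz1
    rw [Real.norm_eq_abs] at h
    have h' := (le_abs_self _).trans h
    have e : ((2 : ℕ) : ℤ) + ((1 : ℕ) : ℤ) = ((3 : ℕ) : ℤ) := rfl
    rw [e, zp] at h'
    refine (t1 (cov (comps A.chart g) (comps A.chart T)) J).trans ?_
    calc 2 * tensorNorm (comps A.chart g) (cov (comps A.chart g) (comps A.chart T)) z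
        ≤ 2 * (C1 * (1 / ‖z‖ ^ 3)) := mul_le_mul_of_nonneg_left h' (by norm_num)
      _ = _ := by ring
  have bΓ : ∀ p i j, |christoffel (comps A.chart g) p i j z| ≤ 12 * C / ‖z‖ ^ 3 := by
    intro p i j
    have hder : ∀ i a b, |pd i (fun w => comps A.chart g w ![a, b]) z| ≤ C / ‖z‖ ^ 3 := by
      intro i a b
      have := B.deriv z hzR i a b
      have e : (-3 : ℤ) = -((3 : ℕ) : ℤ) := rfl
      rwa [e, zp, mul_one_div] at this
    rw [christoffel, abs_mul, abs_of_pos (by norm_num : (0 : ℝ) < 1 / 2)]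
    have : |∑ l, metricInv (comps A.chart g) z p l *
        (pd i (fun w => comps A.chart g w ![j, l]) z + pd j (fun w => comps A.chart g w ![i, l]) z
          - pd l (fun w => comps A.chart g w ![i, j]) z)| ≤ ∑ _l : Fin 4, 2 * (3 * (C / ‖z‖ ^ 3)) := by
      refine (Finset.abs_sum_le_sum_abs _ _).trans (Finset.sum_le_sum fun l _ => ?_)
      rw [abs_mul]
      refine mul_le_mul (ti p l) ?_ (abs_nonneg _) (by norm_num)
      have u1 := hder i j l
      have u2 := hder j i l
      have u3 := hder l i j
      have v1 := abs_sub (pd i (fun w => comps A.chart g w ![j, l]) z +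
        pd j (fun w => comps A.chart g w ![i, l]) z) (pd l (fun w => comps A.chart g w ![i, j]) z)
      have v2 := abs_add_le (pd i (fun w => comps A.chart g w ![j, l]) z)
        (pd j (fun w => comps A.chart g w ![i, l]) z)
      linarith
    simp only [Finset.sum_const, Finset.card_univ, Fintype.card_fin, nsmul_eq_mul] at this
    have e : 12 * C / ‖z‖ ^ 3 = 12 * (C / ‖z‖ ^ 3) := by ring
    rw [e]
    push_cast at this
    linarith
  have hpd : ∀ i, |pd i (fun w => comps A.chart T w I) z| ≤ D / ‖z‖ ^ 3 := by
    intro i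
    have hcov := b1 (Fin.cons i I)
    have e : pd i (fun w => comps A.chart T w I) z =
        cov (comps A.chart g) (comps A.chart T) z (Fin.cons i I) +
        ∑ a : Fin n, ∑ p : Fin 4, christoffel (comps A.chart g) p i (I a) z *
          comps A.chart T z (Function.update I a p) := by
      simp only [cov, Fin.cons_zero, Fin.tail_cons, Fin.cons_succ]
      ring
    rw [e]
    refine (abs_add_le _ _).trans ?_
    have hs : |∑ a : Fin n, ∑ p : Fin 4, christoffel (comps A.chart g) p i (I a) z *
          comps A.chart T z (Function.update I a p)| ≤
        ∑ _a : Fin n, ∑ _p : Fin 4, 12 * C / ‖z‖ ^ 3 * (2 * C0) := by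
      refine (Finset.abs_sum_le_sum_abs _ _).trans (Finset.sum_le_sum fun a _ => ?_)
      refine (Finset.abs_sum_le_sum_abs _ _).trans (Finset.sum_le_sum fun p _ => ?_)
      rw [abs_mul]
      refine mul_le_mul (bΓ _ _ _) ((b0 _).trans ?_) (abs_nonneg _) (by positivity)
      refine div_le_self (by positivity) (one_le_pow₀ hn1)
    simp only [Finset.sum_const, Finset.card_univ, Fintype.card_fin, nsmul_eq_mul] at hs
    have eD : D / ‖z‖ ^ 3 = 2 * C1 / ‖z‖ ^ 3 + n * ((4 : ℕ) * (12 * C / ‖z‖ ^ 3 * (2 * C0))) := by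
      push_cast
      simp only [D]
      ring
    rw [eD]
    linarith
  have hU : z ∈ {z | A.radius < ‖z‖} := B.radius_lt.trans_le hzR
  refine ⟨((A.isParam.contDiffOn_comps hT I).contDiffAt
      (A.isParam.isOpen.mem_nhds hU)).differentiableAt (by simp), ?_, ?_⟩
  · rw [Real.norm_eq_abs]
    refine (b0 I).trans ?_
    gcongr
    linarith
  · refine (norm_fderiv_le _ _).trans ?_
    calc ∑ i, |pd i (fun w => comps A.chart T w I) z| ≤ ∑ _i : Fin 4, D / ‖z‖ ^ 3 :=
          Finset.sum_le_sum fun i _ => hpd i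
      _ = 4 * D / ‖z‖ ^ 3 := by simp; ring
      _ ≤ (2 * C0 + 4 * D) / r ^ (2 + 1) := by
          norm_num
          gcongr
          linarith

end Surface

end

/-! ### The coupled operator on tensors that are self-dual in the last two indices -/

section

open scoped ComplexConjugate

section
variable {U : Set C2} {G : Comp 2}

theorem sdMat_linear (f p q : ℝ) (z : C2) (i j : Fin 4) : sdMat G f p q z i j =
    f * sdMat G 1 0 0 z i j + p * sdMat G 0 1 0 z i j + q * sdMat G 0 0 1 z i j := by
  fin_cases i <;> fin_cases j <;> simp [sdMat] <;> ring

theorem sdMat_square_symm (p q : ℝ) (z : C2) (a b c d : Fin 4) :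
    sdMat G 0 (sdMat G 0 p q z a b) (sdMat G 0 q (-p) z a b) z c d =
      sdMat G 0 (sdMat G 0 p q z c d) (sdMat G 0 q (-p) z c d) z a b := by
  rw [sdMat_linear, sdMat_linear (G := G) 0 p q z a b, sdMat_linear (G := G) 0 q (-p) z a b,
    sdMat_linear (G := G) 0 (sdMat G 0 p q z c d), sdMat_linear (G := G) 0 p q z c d,
    sdMat_linear (G := G) 0 q (-p) z c d]
  ring

theorem sum_mul_sdMat {ι : Type*} (s : Finset ι) (c f p q : ι → ℝ) (z : C2) (i j : Fin 4) :
    ∑ a ∈ s, c a * sdMat G (f a) (p a) (q a) z i j =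
      sdMat G (∑ a ∈ s, c a * f a) (∑ a ∈ s, c a * p a) (∑ a ∈ s, c a * q a) z i j := by
  rw [sdMat_linear, Finset.sum_mul, Finset.sum_mul, Finset.sum_mul, ← Finset.sum_add_distrib,
    ← Finset.sum_add_distrib]
  refine Finset.sum_congr rfl fun a _ => ?_
  rw [sdMat_linear (f a)]
  ring

namespace KahlerComps

/-- The covariant derivative of a tensor that is self-dual in its last two indices. -/
theorem cov_four_eq_sdMat (h : KahlerComps U G) {T : Comp 4} {F P Q : Comp 2}
    (hF : ∀ I, ContDiffOn ℝ ∞ (fun z => F z I) U) (hP : ∀ I, ContDiffOn ℝ ∞ (fun z => P z I) U)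
    (hQ : ∀ I, ContDiffOn ℝ ∞ (fun z => Q z I) U)
    (hT : ∀ z ∈ U, ∀ a b c d, T z ![a, b, c, d] =
      sdMat G (F z ![a, b]) (P z ![a, b]) (Q z ![a, b]) z c d) {z : C2} (hz : z ∈ U)
    (m a b c d : Fin 4) : cov G T z ![m, a, b, c, d] = sdMat G (cov G F z ![m, a, b])
      (cov G P z ![m, a, b] - (P z ![a, b] * traceRe G m z - Q z ![a, b] * traceIm G m z))
      (cov G Q z ![m, a, b] - (P z ![a, b] * traceIm G m z + Q z ![a, b] * traceRe G m z)) z c d := by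
  have hd : ∀ {F : C2 → ℝ}, ContDiffOn ℝ ∞ F U → DifferentiableAt ℝ F z := fun hF =>
    (hF.contDiffAt (h.isOpen.mem_nhds hz)).differentiableAt (by simp)
  have key := h.cov_sdMat hz (hd (hF ![a, b])) (hd (hP ![a, b])) (hd (hQ ![a, b])) m c d
  rw [cov_four, pd_congr h.isOpen hz (fun w hw => hT w hw a b c d) m]
  simp only [hT z hz, cov_two]
  rw [sum_mul_sdMat (G := G) Finset.univ (fun p => christoffel G p m a z),
    sum_mul_sdMat (G := G) Finset.univ (fun p => christoffel G p m b z)]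
  rw [sdMat_linear (∑ p, _), sdMat_linear (∑ p, _)]
  rw [sdMat_linear (_ - _ - _)]
  rw [sdMat_linear (pd _ _ _)] at key
  linear_combination key

theorem cov_three_eq_sdMat (h : KahlerComps U G) {T : Comp 3} {F P Q : Comp 1}
    (hF : ∀ I, ContDiffOn ℝ ∞ (fun z => F z I) U) (hP : ∀ I, ContDiffOn ℝ ∞ (fun z => P z I) U)
    (hQ : ∀ I, ContDiffOn ℝ ∞ (fun z => Q z I) U)
    (hT : ∀ z ∈ U, ∀ a c d, T z ![a, c, d] = sdMat G (F z ![a]) (P z ![a]) (Q z ![a]) z c d)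
    {z : C2} (hz : z ∈ U)
    (m a c d : Fin 4) : cov G T z ![m, a, c, d] = sdMat G (cov G F z ![m, a])
      (cov G P z ![m, a] - (P z ![a] * traceRe G m z - Q z ![a] * traceIm G m z))
      (cov G Q z ![m, a] - (P z ![a] * traceIm G m z + Q z ![a] * traceRe G m z)) z c d := by
  have hd : ∀ {F : C2 → ℝ}, ContDiffOn ℝ ∞ F U → DifferentiableAt ℝ F z := fun hF =>
    (hF.contDiffAt (h.isOpen.mem_nhds hz)).differentiableAt (by simp)
  have key := h.cov_sdMat hz (hd (hF ![a])) (hd (hP ![a])) (hd (hQ ![a])) m c d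
  rw [cov_three, pd_congr h.isOpen hz (fun w hw => hT w hw a c d) m]
  simp only [hT z hz, cov_one]
  rw [sum_mul_sdMat (G := G) Finset.univ (fun p => christoffel G p m a z)]
  rw [sdMat_linear (∑ p, _)]
  rw [sdMat_linear (_ - _)]
  rw [sdMat_linear (pd _ _ _)] at key
  linear_combination key

/-- The codifferential of a form with values in self-dual forms. -/
theorem codiff_eq_sdMat (h : KahlerComps U G) {T : Comp 4} {F P Q : Comp 2}
    (hF : ∀ I, ContDiffOn ℝ ∞ (fun z => F z I) U) (hP : ∀ I, ContDiffOn ℝ ∞ (fun z => P z I) U)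
    (hQ : ∀ I, ContDiffOn ℝ ∞ (fun z => Q z I) U)
    (hT : ∀ z ∈ U, ∀ a b c d, T z ![a, b, c, d] =
      sdMat G (F z ![a, b]) (P z ![a, b]) (Q z ![a, b]) z c d) {z : C2} (hz : z ∈ U)
    (j c d : Fin 4) : codiff (k := 2) G T z ![j, c, d] = sdMat G (codiff (k := 0) G F z ![j])
      (-∑ m, ∑ a, metricInv G z m a * (cov G P z ![m, a, j] -
        (P z ![a, j] * traceRe G m z - Q z ![a, j] * traceIm G m z)))
      (-∑ m, ∑ a, metricInv G z m a * (cov G Q z ![m, a, j] -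
        (P z ![a, j] * traceIm G m z + Q z ![a, j] * traceRe G m z))) z c d := by
  have e : codiff (k := 2) G T z ![j, c, d] =
    -∑ m, ∑ a, metricInv G z m a * cov G T z ![m, a, j, c, d] := rfl
  rw [e, codiff_zero_apply]
  simp only [h.cov_four_eq_sdMat hF hP hQ hT hz]
  simp only [sum_mul_sdMat]
  have one := sum_mul_sdMat (G := G) (Finset.univ : Finset (Fin 4)) (fun _ => -1)
    (fun m => ∑ a, metricInv G z m a * cov G F z ![m, a, j])
    (fun m => ∑ a, metricInv G z m a * (cov G P z ![m, a, j] -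
        (P z ![a, j] * traceRe G m z - Q z ![a, j] * traceIm G m z)))
    (fun m => ∑ a, metricInv G z m a * (cov G Q z ![m, a, j] -
        (P z ![a, j] * traceIm G m z + Q z ![a, j] * traceRe G m z))) z c d
  simp only [neg_one_mul, Finset.sum_neg_distrib] at one
  exact one

theorem contDiffOn_sum_metricInv (h : KahlerComps U G) {H : Fin 4 → Fin 4 → C2 → ℝ}
    (hH : ∀ m a, ContDiffOn ℝ ∞ (H m a) U) :
    ContDiffOn ℝ ∞ (fun z => -∑ m, ∑ a, metricInv G z m a * H m a z) U :=
  (ContDiffOn.sum fun m _ => ContDiffOn.sum fun a _ =>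
    (h.contDiffOn_metricInv m a).mul (hH m a)).neg

theorem contDiffOn_cov_two (h : KahlerComps U G) {T : Comp 2}
    (hT : ∀ I, ContDiffOn ℝ ∞ (fun z => T z I) U) (m a b : Fin 4) :
    ContDiffOn ℝ ∞ (fun z => cov G T z ![m, a, b]) U := by
  simp only [cov_two]
  exact ((contDiffOn_pd h.isOpen (hT _) m).sub (ContDiffOn.sum fun p _ =>
    (h.contDiffOn_christoffel p m a).mul (hT _))).sub (ContDiffOn.sum fun p _ =>
    (h.contDiffOn_christoffel p m b).mul (hT _))

/-- As `ω` is parallel, the coupled operator respects the splitting `ℝω ⊕ Re K` of the second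
factor, and its `ω` component is the uncoupled operator applied to `F`. The indices `0, 1` isolate
this component because `Re (dz₁ ∧ dz₂)` has no entry there. -/
theorem coupledOp_contract (h : KahlerComps U G) {T : Comp 4} {F P Q : Comp 2}
    (hF : ∀ I, ContDiffOn ℝ ∞ (fun z => F z I) U) (hP : ∀ I, ContDiffOn ℝ ∞ (fun z => P z I) U)
    (hQ : ∀ I, ContDiffOn ℝ ∞ (fun z => Q z I) U)
    (hT : ∀ z ∈ U, ∀ a b c d, T z ![a, b, c, d] =
      sdMat G (F z ![a, b]) (P z ![a, b]) (Q z ![a, b]) z c d) {z : C2} (hz : z ∈ U) (i j : Fin 4) :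
    Dstar G T z ![i, j, 0, 1] = Sstar G F z ![i, j] * G z ![0, 0] := by
  have ht : ∀ m, ContDiffOn ℝ ∞ (traceRe G m) U ∧ ContDiffOn ℝ ∞ (traceIm G m) U := fun m =>
    ⟨(h.contDiffOn_christoffel _ _ _).add (h.contDiffOn_christoffel _ _ _),
      (h.contDiffOn_christoffel _ _ _).add (h.contDiffOn_christoffel _ _ _)⟩
  let P' : Comp 1 := fun z I => -∑ m, ∑ a, metricInv G z m a * (cov G P z ![m, a, I 0] -
        (P z ![a, I 0] * traceRe G m z - Q z ![a, I 0] * traceIm G m z))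
  let Q' : Comp 1 := fun z I => -∑ m, ∑ a, metricInv G z m a * (cov G Q z ![m, a, I 0] -
        (P z ![a, I 0] * traceIm G m z + Q z ![a, I 0] * traceRe G m z))
  have hF' : ∀ I, ContDiffOn ℝ ∞ (fun z => codiff (k := 0) G F z I) U := fun I => by
    obtain ⟨j, rfl⟩ : ∃ j, I = ![j] := ⟨I 0, by ext a; fin_cases a; rfl⟩
    exact h.contDiffOn_sum_metricInv fun m a => h.contDiffOn_cov_two hF m a j
  have hP' : ∀ I, ContDiffOn ℝ ∞ (fun z => P' z I) U := fun I =>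
    h.contDiffOn_sum_metricInv fun m a => (h.contDiffOn_cov_two hP m a _).sub
      (((hP _).mul (ht m).1).sub ((hQ _).mul (ht m).2))
  have hQ' : ∀ I, ContDiffOn ℝ ∞ (fun z => Q' z I) U := fun I =>
    h.contDiffOn_sum_metricInv fun m a => (h.contDiffOn_cov_two hQ m a _).sub
      (((hP _).mul (ht m).2).add ((hQ _).mul (ht m).1))
  have key : ∀ i j, extDiff (k := 2) G (codiff (k := 2) G T) z ![i, j, 0, 1] =
      extDiff (k := 0) G (codiff (k := 0) G F) z ![i, j] * G z ![0, 0] := by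
    intro i j
    have e : extDiff (k := 2) G (codiff (k := 2) G T) z ![i, j, 0, 1] =
      cov G (codiff (k := 2) G T) z ![i, j, 0, 1] - cov G (codiff (k := 2) G T) z ![j, i, 0, 1] := by
      rfl
    have e' : extDiff (k := 0) G (codiff (k := 0) G F) z ![i, j] =
      cov G (codiff (k := 0) G F) z ![i, j] - cov G (codiff (k := 0) G F) z ![j, i] := by rfl
    have c := h.cov_three_eq_sdMat hF' hP' hQ'
      (fun z hz a c d => h.codiff_eq_sdMat hF hP hQ hT hz a c d) hz
    rw [e, e', c, c]
    simp [sdMat]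
    ring
  have hT' : ∀ i j, T z ![i, j, 0, 1] = F z ![i, j] * G z ![0, 0] := fun i j => by
    rw [hT z hz]; simp [sdMat]
  have e : ∀ i j, Dstar G T z ![i, j, 0, 1] =
      1 / 2 * (extDiff (k := 2) G (codiff (k := 2) G T) z ![i, j, 0, 1] -
        starMat G (fun i j => extDiff (k := 2) G (codiff (k := 2) G T) z ![i, j, 0, 1]) z i j) +
      -(1 / 2) * ∑ c, ∑ d, metricInv G z c d *
    (tracelessRicci G i c z * T z ![d, j, 0, 1] + tracelessRicci G j c z * T z ![i, d, 0, 1]) :=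
    fun i j => rfl
  have e' : ∀ i j, Sstar G F z ![i, j] =
      1 / 2 * (extDiff (k := 0) G (codiff (k := 0) G F) z ![i, j] -
        starMat G (fun i j => extDiff (k := 0) G (codiff (k := 0) G F) z ![i, j]) z i j) +
      -(1 / 2) * ∑ c, ∑ d, metricInv G z c d *
    (tracelessRicci G i c z * F z ![d, j] + tracelessRicci G j c z * F z ![i, d]) :=
    fun i j => rfl
  rw [e, e']
  simp only [key, hT', starMat]
  simp only [sub_mul, add_mul, mul_sub, Finset.sum_mul, Finset.mul_sum, ← mul_assoc]
  congr 1
  simp only [mul_add, Finset.sum_mul, Finset.mul_sum, add_mul, ← mul_assoc]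

end KahlerComps
end

end

/-! ### The equation `D^* ψ = 0` for squares of the canonical form -/

section

open scoped ComplexConjugate

namespace KahlerComps
open SmoothAlg
variable {U : Opens C2} {G : Comp 2}

set_option maxHeartbeats 1000000 in
/-- For `ψ = Re (x (dz₁ ∧ dz₂)²)`, the equation `D^* ψ = 0` says that `x` is annihilated by the
second order operator `pmat`. -/
theorem pmat_eq_zero_of_dstar (h : KahlerComps U G) (hs : ∀ z ∈ U, scalarCurv G z = 0)
    {T : Comp 4} {p q : C2 → ℝ} (hp : ContDiffOn ℝ ∞ p U) (hq : ContDiffOn ℝ ∞ q U)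
    (hT : ∀ z ∈ U, ∀ a b c d, T z ![a, b, c, d] =
      sdMat G 0 (sdMat G 0 (p z) (q z) z a b) (sdMat G 0 (q z) (-p z) z a b) z c d)
    (h0 : ∀ z ∈ U, Dstar G T z = 0) {z : C2} (hz : z ∈ U) :
    pmat G (fun w => p w + Complex.I * q w) z = 0 := by
  set x : SmoothAlg U := ofReal p hp + Complex.I • ofReal q hq with hx
  have hd : ∀ {H : C2 → ℝ}, ContDiffOn ℝ ∞ H U → ∀ z ∈ U, DifferentiableAt ℝ H z :=
    fun hH z hz => (hH.contDiffAt (h.isOpen.mem_nhds hz)).differentiableAt (by simp)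
  obtain ⟨r1, s1, hr1, hs1, e1⟩ := (h.b1 x).exists_re_im
  obtain ⟨r2, s2, hr2, hs2, e2⟩ := (h.b2 x).exists_re_im
  have sm : ∀ {p q : C2 → ℝ}, ContDiffOn ℝ ∞ p U → ContDiffOn ℝ ∞ q U → ∀ i j,
      ContDiffOn ℝ ∞ (fun z => sdMat G 0 (p z) (q z) z i j) U := by
    intro p q hp hq i j
    fin_cases i <;> fin_cases j <;> simp [sdMat] <;> first
      | exact contDiffOn_const | exact hp | exact hq | exact hp.neg | exact hq.neg
  let P : Comp 2 := fun z I => sdMat G 0 (p z) (q z) z (I 0) (I 1)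
  let Q : Comp 2 := fun z I => sdMat G 0 (q z) (-p z) z (I 0) (I 1)
  have c0 : ∀ z m i j, cov G (0 : Comp 2) z ![m, i, j] = 0 := fun z m i j => by
    rw [cov_two]; simp [pd_const]
  -- The codifferential is `2 Re (b ⊗ dz₁ ∧ dz₂)`: the two rows are the components of `2 Re b` and
  -- of `2 Re (-i b) = 2 Im b`.
  have hcod : ∀ z ∈ U, ∀ j c d, codiff (k := 2) G T z ![j, c, d] = sdMat G 0
      (![2 * r1 z, -(2 * s1 z), 2 * r2 z, -(2 * s2 z)] j)
      (![2 * s1 z, 2 * r1 z, 2 * s2 z, 2 * r2 z] j) z c d := by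
    intro z hz j c d
    rw [h.codiff_eq_sdMat (F := 0) (P := P) (Q := Q) (fun _ => contDiffOn_const)
      (fun I => sm hp hq _ _) (fun I => sm hq hp.neg _ _) hT hz, codiff_zero_apply]
    have b := h.contraction_b ⟨z, hz⟩ hp hq (fun _ => 0) 2
    have b' := h.contraction_b ⟨z, hz⟩ hq hp.neg (fun _ => 0) 2
    -- The second coefficient form `Q` is the first one with `x` replaced by `-i x`, so its
    -- codifferential follows from complex linearity of `b`.
    have hx' : ofReal q hq + Complex.I • ofReal (fun z => -p z) hp.neg = (-Complex.I) • x := by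
      ext w; simp [hx]; linear_combination q w * Complex.I_sq
    have l1 : h.b1 (-Complex.I • x) = -Complex.I • h.b1 x := by
      simp only [b1, Derivation.map_smul, mul_sub, smul_sub, Algebra.mul_smul_comm]
    have l2 : h.b2 (-Complex.I • x) = -Complex.I • h.b2 x := by
      simp only [b2, Derivation.map_smul, mul_sub, smul_sub, Algebra.mul_smul_comm]
    rw [← hx] at b
    rw [hx'] at b'
    simp only [l1, l2, e1, e2] at b b'
    have cP : ∀ m a, cov G P z ![m, a, j] -
        (P z ![a, j] * traceRe G m z - Q z ![a, j] * traceIm G m z) = sdMat G 0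
        (pd m p z - 2 * (p z * traceRe G m z - q z * traceIm G m z))
        (pd m q z - 2 * (p z * traceIm G m z + q z * traceRe G m z)) z a j := by
      intro m a
      rw [h.cov_eq_sdMat (f := fun _ => 0) contDiffOn_const hp hq (fun z hz i j => rfl) hz, pd_const]
      simp only [P, Q, Matrix.cons_val_zero, Matrix.cons_val_one]
      rw [sdMat_linear (0 : ℝ) (p z), sdMat_linear (0 : ℝ) (q z), sdMat_linear (0 : ℝ) (_ - _),
        sdMat_linear (0 : ℝ) (_ - 2 * _)]
      ring
    have cQ : ∀ m a, cov G Q z ![m, a, j] -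
        (P z ![a, j] * traceIm G m z + Q z ![a, j] * traceRe G m z) = sdMat G 0
        (pd m q z - 2 * (q z * traceRe G m z - (-p z) * traceIm G m z))
        (pd m (fun z => -p z) z - 2 * (q z * traceIm G m z + (-p z) * traceRe G m z)) z a j := by
      intro m a
      rw [h.cov_eq_sdMat (f := fun _ => 0) contDiffOn_const hq hp.neg (fun z hz i j => rfl) hz,
        pd_const]
      simp only [P, Q, Matrix.cons_val_zero, Matrix.cons_val_one]
      rw [sdMat_linear (0 : ℝ) (p z), sdMat_linear (0 : ℝ) (q z), sdMat_linear (0 : ℝ) (_ - _),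
        sdMat_linear (0 : ℝ) (_ - 2 * _)]
      ring
    simp only [cP, cQ, c0, mul_zero, Finset.sum_const_zero, neg_zero]
    congr 1
    · fin_cases j
      · simpa using b.1
      · simpa using b.2.1
      · simpa using b.2.2.1
      · simpa using b.2.2.2
    · fin_cases j
      · simpa using b'.1
      · simpa using b'.2.1
      · simpa using b'.2.2.1
      · simpa using b'.2.2.2
  let P' : Comp 1 := fun z I => ![2 * r1 z, -(2 * s1 z), 2 * r2 z, -(2 * s2 z)] (I 0)
  let Q' : Comp 1 := fun z I => ![2 * s1 z, 2 * r1 z, 2 * s2 z, 2 * r2 z] (I 0)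
  have two : ∀ {H : C2 → ℝ}, ContDiffOn ℝ ∞ H U → ContDiffOn ℝ ∞ (fun w => 2 * H w) U :=
    fun hH => contDiffOn_const.mul hH
  have hP' : ∀ I, ContDiffOn ℝ ∞ (fun z => P' z I) U := fun I => by
    simp only [P']
    generalize I 0 = j
    fin_cases j
    exacts [two hr1, (two hs1).neg, two hr2, (two hs2).neg]
  have hQ' : ∀ I, ContDiffOn ℝ ∞ (fun z => Q' z I) U := fun I => by
    simp only [Q']
    generalize I 0 = j
    fin_cases j
    exacts [two hs1, two hr1, two hs2, two hr2]
  have c1 : ∀ z m i, cov G (0 : Comp 1) z ![m, i] = 0 := fun z m i => by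
    rw [cov_one]; simp [pd_const]
  have hcov := fun i j c d => h.cov_three_eq_sdMat (F := 0) (fun _ => contDiffOn_const) hP' hQ'
    (fun z hz a c d => hcod z hz a c d) hz i j c d
  have hext : ∀ i j c d, extDiff (k := 2) G (codiff (k := 2) G T) z ![i, j, c, d] =
      cov G (codiff (k := 2) G T) z ![i, j, c, d] - cov G (codiff (k := 2) G T) z ![j, i, c, d] :=
    fun _ _ _ _ => rfl
  have hN2 : ∀ i j, extDiff (k := 2) G (codiff (k := 2) G T) z ![i, j, 0, 2] =
      pd i (fun w => P' w ![j]) z - pd j (fun w => P' w ![i]) z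
      - (P' z ![j] * traceRe G i z - Q' z ![j] * traceIm G i z)
      + (P' z ![i] * traceRe G j z - Q' z ![i] * traceIm G j z) := by
    intro i j
    rw [hext, hcov, hcov, c1, c1, cov_one, cov_one, cov_one, cov_one]
    simp only [christoffel_comm h.symm _ j i]
    simp [sdMat]
    ring
  have hN3 : ∀ i j, extDiff (k := 2) G (codiff (k := 2) G T) z ![i, j, 0, 3] =
      -(pd i (fun w => Q' w ![j]) z - pd j (fun w => Q' w ![i]) z
      - (P' z ![j] * traceIm G i z + Q' z ![j] * traceRe G i z)
      + (P' z ![i] * traceIm G j z + Q' z ![i] * traceRe G j z)) := by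
    intro i j
    rw [hext, hcov, hcov, c1, c1, cov_one, cov_one, cov_one, cov_one]
    simp only [christoffel_comm h.symm _ j i]
    simp [sdMat]
    ring
  set N2 : Fin 4 → Fin 4 → ℝ := fun i j => extDiff (k := 2) G (codiff (k := 2) G T) z ![i, j, 0, 2]
    with hN2'
  set N3 : Fin 4 → Fin 4 → ℝ := fun i j => extDiff (k := 2) G (codiff (k := 2) G T) z ![i, j, 0, 3]
    with hN3'
  -- The last two indices `0, 2` and `0, 3` extract the real part and minus the imaginary part of
  -- the `K` component. Neither has a component along `ω` in the first factor, so the Ricci term is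
  -- absent.
  obtain ⟨E1, E2, E3, E4⟩ := h.coupledOp_equations hz (h.hermitianRicci hz) (hs z hz) (k := 2) T
    ![0, 2] (f := 0) (p := p z) (q := q z) (fun i j => (hT z hz i j 0 2).trans (by simp [sdMat]))
    (N := N2) (fun i j => rfl) (fun i j => extDiff_antisymm (k := 2) _ _ _ _ _)
    (fun i j => congrFun (h0 z hz) ![i, j, 0, 2])
  obtain ⟨D1, D2, D3, D4⟩ := h.coupledOp_equations hz (h.hermitianRicci hz) (hs z hz) (k := 2) T
    ![0, 3] (f := 0) (p := -q z) (q := p z) (fun i j => (hT z hz i j 0 3).trans (by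
      fin_cases i <;> fin_cases j <;> simp [sdMat]))
    (N := N3) (fun i j => rfl) (fun i j => extDiff_antisymm (k := 2) _ _ _ _ _)
    (fun i j => congrFun (h0 z hz) ![i, j, 0, 3])
  set t2 := lambdaTrace G N2 z
  set t3 := lambdaTrace G N3 z
  clear_value t2 t3
  obtain ⟨j1, j2, j3, j4⟩ := traceRe_J h hz
  have pt : ∀ {H : C2 → ℝ} (_ : ContDiffOn ℝ ∞ H U) i, pd i (fun w => 2 * H w) z = 2 * pd i H z :=
    fun hH i => by rw [pd_mul (differentiableAt_const _) (hd hH z hz), pd_const]; ring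
  simp [hN2', hN3', hN2, hN3, P', Q', pd_neg, pt hr1, pt hs1, pt hr2, pt hs2, j1, j2, j3, j4]
    at E1 E2 E3 E4 D1 D2 D3 D4
  obtain ⟨m1, m2, m3, m4⟩ := h.fn_pmat (x := x) (H := fun w => p w + Complex.I * q w)
    (fun w => by simp [hx]) ⟨z, hz⟩
  -- The projection to `Λ⁻` kills multiples of `ω`, so both equations together say that `∂̄b` is a
  -- complex multiple of the metric; no conjugate of `b` appears, unlike in the case of forms.
  have key : pmat G (fun w => p w + Complex.I * q w) z =
      (-(1 / 8 : ℂ) * (t3 + Complex.I * t2)) • hmat G z := by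
    ext α β
    fin_cases α <;> fin_cases β <;>
      simp only [Fin.zero_eta, Fin.mk_one, Fin.isValue, ← m1, ← m2, ← m3, ← m4] <;> 
      simp only [e1, e2] <;> apply Complex.ext <;> simp [dir_ofReal, hmat] <;> linarith
  have hx' : ContDiffOn ℝ ∞ (fun w => (p w + Complex.I * q w : ℂ)) U :=
    (HermComps.contDiffOn_ofReal hp).add (contDiffOn_const.mul (HermComps.contDiffOn_ofReal hq))
  have hm := h.mix_pmat hx' hz
  have hv : (vol G z : ℂ) ≠ 0 := by exact_mod_cast (h.vol_pos hz).ne'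
  rw [key] at hm ⊢
  -- The trace of `∂̄b` is zero while that of the metric is not, so the multiple vanishes.
  have hm' : (-(1 / 8 : ℂ) * (t3 + Complex.I * t2)) * (2 * vol G z) = 0 := by
    rw [← hm, ← det_hmat, Matrix.det_fin_two]
    simp [mix]
    ring
  rcases mul_eq_zero.mp hm' with h' | h'
  · rw [h', zero_smul]
  · exact absurd h' (mul_ne_zero two_ne_zero hv)

end KahlerComps

end

/-! ### The structure of `S²₀Λ⁺` and contraction with the Kähler form -/

section

open scoped ComplexConjugate

theorem quad_expand_right (M : MultilinearMap ℝ (fun _ : Fin 4 => C2) ℝ) (v w a b : C2) :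
    M ![v, w, a, b] = ∑ k, ∑ l, realCoord a k * realCoord b l * M ![v, w, realFrame k, realFrame l] :=
  bilin_expand ((M.curryLeft v).curryLeft w) a b

theorem quad_expand_left (M : MultilinearMap ℝ (fun _ : Fin 4 => C2) ℝ) (v w a b : C2) :
    M ![v, w, a, b] = ∑ k, ∑ l, realCoord v k * realCoord w l * M ![realFrame k, realFrame l, a, b] := by
  have e : ∀ v w : C2, M ![v, w, a, b] =
      (((M.domDomCongr (Equiv.addRight (2 : Fin 4))).curryLeft a).curryLeft b) ![v, w] := by
    intro v w
    change M ![v, w, a, b] = M _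
    congr 1
    ext i : 1
    fin_cases i <;> rfl
  rw [e, bilin_expand]
  simp only [← e]

section
variable {U : Set C2} {G : Comp 2} {ψ : Comp 4} {z : C2}

theorem KahlerComps.eq_sdMat_left (h : KahlerComps U G) (hz : z ∈ U) (hψ : IsS20SelfDualAt G ψ z)
    (a b c d : Fin 4) : ψ z ![a, b, c, d] = sdMat G (ψ z ![0, 1, c, d] / G z ![0, 0])
      (1 / 2 * (ψ z ![0, 2, c, d] - ψ z ![1, 3, c, d]))
      (-(1 / 2) * (ψ z ![1, 2, c, d] + ψ z ![0, 3, c, d])) z a b :=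
  sdMat_of_star h hz (N := fun a b => ψ z ![a, b, c, d]) (fun a b => hψ.1 a b c d)
    (fun a b => hψ.2.2.1 ![a, b, c, d]) a b

theorem KahlerComps.eq_sdMat_right (h : KahlerComps U G) (hz : z ∈ U) (hψ : IsS20SelfDualAt G ψ z)
    (a b c d : Fin 4) : ψ z ![a, b, c, d] = sdMat G (ψ z ![0, 1, a, b] / G z ![0, 0])
      (1 / 2 * (ψ z ![0, 2, a, b] - ψ z ![1, 3, a, b]))
      (-(1 / 2) * (ψ z ![1, 2, a, b] + ψ z ![0, 3, a, b])) z c d :=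
  (hψ.2.1 a b c d).trans (h.eq_sdMat_left hz hψ c d a b)

/-- `Λ^{2,0}` is a line, so raising both indices of `Re (x dz₁ ∧ dz₂)` amounts to multiplication by
the inverse determinant. -/
theorem KahlerComps.raise_sdMat (h : KahlerComps U G) (hz : z ∈ U) (p q : ℝ) (c d : Fin 4) :
    ∑ a, ∑ b, metricInv G z a c * metricInv G z b d * sdMat G 0 p q z a b =
      (vol G z)⁻¹ * sdMat G 0 p q z c d := by
  have hv := (h.vol_pos hz).ne'
  have hv' : (vol G z)⁻¹ * (G z ![0, 0] * G z ![2, 2] - G z ![0, 2] ^ 2 - G z ![0, 3] ^ 2) = 1 := by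
    rw [inv_mul_eq_one₀ hv, vol]
  rw [h.metricInv_eq hz]
  generalize (vol G z)⁻¹ = v at *
  fin_cases c <;> fin_cases d <;> simp [Fin.sum_univ_four, sdMat] <;> first
    | ring1
    | linear_combination (v * p) * hv'
    | linear_combination (-(v * p)) * hv'
    | linear_combination (v * q) * hv'
    | linear_combination (-(v * q)) * hv'

/-- A section of `S²₀Λ⁺` without component along the Kähler form is `Re (x (dz₁ ∧ dz₂)²)`. -/
theorem KahlerComps.eq_square (h : KahlerComps U G) (hz : z ∈ U) (hψ : IsS20SelfDualAt G ψ z)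
    (h0 : ∀ c d, ψ z ![0, 1, c, d] = 0) (a b c d : Fin 4) : ψ z ![a, b, c, d] =
      sdMat G 0 (sdMat G 0 (ψ z ![0, 2, 0, 2]) (-ψ z ![0, 2, 0, 3]) z a b)
        (sdMat G 0 (-ψ z ![0, 2, 0, 3]) (-ψ z ![0, 2, 0, 2]) z a b) z c d := by
  have L : ∀ a b c d, ψ z ![a, b, c, d] =
      sdMat G 0 (ψ z ![0, 2, c, d]) (-ψ z ![0, 3, c, d]) z a b := by
    intro a b c d
    have := fun a b => h.eq_sdMat_left hz hψ a b c d
    simp only [h0, zero_div] at this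
    have e1 := this 0 2
    have e2 := this 0 3
    rw [this a b]
    congr 1
    · exact (e1.trans (by simp [sdMat])).symm
    · simp [sdMat] at e2
      linarith
  have comb : ∀ a b c d, ψ z ![a, b, c, d] =
      sdMat G 0 (sdMat G 0 (ψ z ![0, 2, 0, 2]) (-ψ z ![0, 2, 0, 3]) z a b)
        (-sdMat G 0 (ψ z ![0, 2, 0, 3]) (-ψ z ![0, 3, 0, 3]) z a b) z c d := by
    intro a b c d
    rw [hψ.2.1 a b c d, L c d a b, hψ.2.1 0 2 a b, hψ.2.1 0 3 a b, L a b 0 2, L a b 0 3,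
      hψ.2.1 0 3 0 2]
  -- The symmetric square of `Re K` has rank three; the trace condition removes the part `|dz₁ ∧
  -- dz₂|²` and leaves the real part of `K²`. By `raise_sdMat` the metric trace is the naive one up
  -- to the factor `vol⁻¹`.
  have tr : ∑ c, ∑ d, ψ z ![c, d, c, d] = 0 := by
    have e : ∀ c d, ∑ a, ∑ b, metricInv G z a c * metricInv G z b d * ψ z ![a, b, c, d] =
        (vol G z)⁻¹ * ψ z ![c, d, c, d] := by
      intro c d
      rw [L c d c d, ← h.raise_sdMat hz]
      exact Finset.sum_congr rfl fun a _ => Finset.sum_congr rfl fun b _ =>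
        congrArg _ (L a b c d)
    have sw := Finset.sum_comm (s := Finset.univ) (t := Finset.univ)
      (f := fun (x y : Fin 4 × Fin 4) =>
        metricInv G z x.1 y.1 * metricInv G z x.2 y.2 * ψ z ![x.1, x.2, y.1, y.2])
    simp only [Fintype.sum_prod_type] at sw
    have := sw.symm.trans hψ.2.2.2
    simp only [e, ← Finset.mul_sum] at this
    exact (mul_eq_zero.mp this).resolve_left (inv_ne_zero (h.vol_pos hz).ne')
  have hγ : ψ z ![0, 3, 0, 3] = -ψ z ![0, 2, 0, 2] := by
    rw [Finset.sum_congr rfl fun c _ => Finset.sum_congr rfl fun d _ => comb c d c d] at tr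
    simp [Fin.sum_univ_four, sdMat] at tr
    linarith
  rw [comb a b c d, hγ]
  congr 1
  fin_cases a <;> fin_cases b <;> simp [sdMat]

end

section Surface

variable {X : Type*} [TopologicalSpace X] [ChartedSpace C2 X]
  [IsManifold 𝓘(ℂ, C2) ω X] {g : CovTensorField X 2} {ψ : CovTensorField X 4} {F : C2 → X}
  {U : Set C2} {e : OpenPartialHomeomorph X C2} {k : ℕ}

theorem comps_four (F : C2 → X) (T : CovTensorField X 4) (z : C2) (i j k l : Fin 4) :
    comps F T z ![i, j, k, l] =
      pullAt F T z ![realFrame i, realFrame j, realFrame k, realFrame l] := by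
  rw [comps_eq_pullAt]; congr 1; ext a; fin_cases a <;> rfl

theorem pullAt_four (F : C2 → X) (T : CovTensorField X 4) (z u v w y : C2) :
    pullAt F T z ![u, v, w, y] = T (F z) ![mfderiv 𝓘(ℂ, C2) 𝓘(ℂ, C2) F z u,
      mfderiv 𝓘(ℂ, C2) 𝓘(ℂ, C2) F z v, mfderiv 𝓘(ℂ, C2) 𝓘(ℂ, C2) F z w,
      mfderiv 𝓘(ℂ, C2) 𝓘(ℂ, C2) F z y] := by
  rw [pullAt_apply]; congr 1; ext a; fin_cases a <;> rfl

/-- Smooth solutions of `D^* ψ = 0` in `S²₀Λ⁺`. -/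
structure IsTensorSolution (g : CovTensorField X 2) (ψ : CovTensorField X 4) : Prop where
  smooth : IsSmooth ψ
  selfDual : ∀ e ∈ atlas C2 X, ∀ z ∈ e.target,
    IsS20SelfDualAt (comps e.symm g) (comps e.symm ψ) z
  eqn : ∀ e ∈ atlas C2 X, ∀ z ∈ e.target, Dstar (comps e.symm g) (comps e.symm ψ) z = 0

/-- A non-zero tangent vector. -/
def tangentUnit (x : X) : TangentSpace 𝓘(ℂ, C2) x := realFrame 0

/-- The component along the Kähler form of a section of `Λ⁺ ⊗ Λ⁺`. -/
def contract (g : CovTensorField X 2) (ψ : CovTensorField X 4) : CovTensorField X 2 := fun x =>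
  (g x ![tangentUnit x, tangentUnit x])⁻¹ •
    ((ψ x).curryLeft (tangentUnit x)).curryLeft (Complex.I • tangentUnit x)

theorem contract_apply (x : X) (v w : TangentSpace 𝓘(ℂ, C2) x) : contract g ψ x ![v, w] =
    (g x ![tangentUnit x, tangentUnit x])⁻¹ *
      ψ x ![tangentUnit x, Complex.I • tangentUnit x, v, w] := rfl

namespace IsTensorSolution

/-- On a pair `(u, J u)` the form `dz₁ ∧ dz₂` vanishes and `ω` equals `|u|²`. So evaluating the
first factor there reads off the component along `ω` and shows that `contract` does not depend on
the tangent vector used. -/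
theorem exists_contraction (h : IsTensorSolution g ψ) (hg : IsKahlerMetric g) (x : X)
    (a b : TangentSpace 𝓘(ℂ, C2) x) : ∃ f : ℝ, ∀ u, ψ x ![u, Complex.I • u, a, b] = f * g x ![u, u] := by
  obtain ⟨e, he, z, hz, rfl⟩ : ∃ e ∈ atlas C2 X, ∃ z ∈ e.target, e.symm z = x :=
    ⟨chartAt C2 x, chart_mem_atlas C2 x, _, (chartAt C2 x).map_source (mem_chart_source C2 x),
      (chartAt C2 x).left_inv (mem_chart_source C2 x)⟩
  have hp := isParam_of_mem_atlas he
  have hb := (hp.bij z hz).2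
  obtain ⟨(a' : C2), rfl⟩ := hb a
  obtain ⟨(b' : C2), rfl⟩ := hb b
  have hK := hg.kahlerComps he
  have L := hK.eq_sdMat_left hz (h.selfDual e he z hz)
  set G := comps e.symm g
  set M := pullAt e.symm ψ z with hM
  have key : ∃ f p q : ℝ, ∀ i j, M ![realFrame i, realFrame j, a', b'] = sdMat G f p q z i j := by
    refine ⟨∑ k, ∑ l, realCoord a' k * realCoord b' l * (comps e.symm ψ z ![0, 1, k, l] / G z ![0, 0]),
      ∑ k, ∑ l, realCoord a' k * realCoord b' l *
        (1 / 2 * (comps e.symm ψ z ![0, 2, k, l] - comps e.symm ψ z ![1, 3, k, l])),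
      ∑ k, ∑ l, realCoord a' k * realCoord b' l *
        (-(1 / 2) * (comps e.symm ψ z ![1, 2, k, l] + comps e.symm ψ z ![0, 3, k, l])),
      fun i j => ?_⟩
    rw [quad_expand_right]
    simp only [hM, ← comps_four]
    rw [Finset.sum_congr rfl fun k _ => Finset.sum_congr rfl fun l _ =>
      congrArg (fun t => realCoord a' k * realCoord b' l * t) (L i j k l)]
    simp only [sum_mul_sdMat]
    have one := sum_mul_sdMat (G := G) (Finset.univ : Finset (Fin 4)) (fun _ => 1)
    simp only [one_mul] at one
    exact one _ _ _ _ _ _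
  obtain ⟨f, p, q, hf⟩ := key
  refine ⟨f, fun u => ?_⟩
  obtain ⟨(u' : C2), rfl⟩ := hb u
  have hI : Complex.I • mfderiv 𝓘(ℂ, C2) 𝓘(ℂ, C2) e.symm z u' =
      (mfderiv 𝓘(ℂ, C2) 𝓘(ℂ, C2) e.symm z (Complex.I • u') : TangentSpace 𝓘(ℂ, C2) (e.symm z)) :=
    ((mfderiv 𝓘(ℂ, C2) 𝓘(ℂ, C2) e.symm z).map_smul Complex.I u').symm
  rw [hI]
  refine (pullAt_four e.symm ψ z u' _ a' b').symm.trans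
    (Eq.trans ?_ (congrArg (f * ·) (pullAt_two e.symm g z u' u')))
  rw [quad_expand_left, pullAt_expand]
  simp only [← hM, hf]
  have r : realCoord (Complex.I • u') =
      ![-realCoord u' 1, realCoord u' 0, -realCoord u' 3, realCoord u' 2] := by
    ext i; fin_cases i <;> simp [realCoord]
  have ht := hK
  simp only [r, Fin.sum_univ_four]
  simp [sdMat, ht.h11, ht.h33, ht.h13, ht.h12, ht.h01, ht.h23, ht.symm z 1 0, ht.symm z 2 0,
    ht.symm z 3 0, ht.symm z 2 1, ht.symm z 3 1, ht.symm z 3 2, G]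
  ring

theorem contract_spec (h : IsTensorSolution g ψ) (hg : IsKahlerMetric g) (x : X)
    (a b u : TangentSpace 𝓘(ℂ, C2) x) :
    ψ x ![u, Complex.I • u, a, b] = contract g ψ x ![a, b] * g x ![u, u] := by
  obtain ⟨f, hf⟩ := h.exists_contraction hg x a b
  have h0 : tangentUnit x ≠ 0 := fun h => by
    have h' : realFrame 0 = 0 := h
    have := congrArg (fun v : C2 => v 0) h'
    simp [realFrame] at this
  rw [contract_apply, hf, hf, mul_comm f (g x ![tangentUnit x, _]),
    inv_mul_cancel_left₀ (hg.pos x _ h0).ne']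

theorem comps_contract (h : IsTensorSolution g ψ) (hg : IsKahlerMetric g) (F : C2 → X) (z : C2)
    (i j : Fin 4) : comps F ψ z ![0, 1, i, j] = comps F (contract g ψ) z ![i, j] * comps F g z ![0, 0] := by
  rw [comps_four, comps_two, comps_two, realFrame_one, pullAt_four, pullAt_two, pullAt_two,
    ← h.contract_spec hg]
  have hI : (mfderiv 𝓘(ℂ, C2) 𝓘(ℂ, C2) F z (Complex.I • realFrame 0) : TangentSpace 𝓘(ℂ, C2) (F z)) =
      Complex.I • mfderiv 𝓘(ℂ, C2) 𝓘(ℂ, C2) F z (realFrame 0) :=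
    (mfderiv 𝓘(ℂ, C2) 𝓘(ℂ, C2) F z).map_smul Complex.I (realFrame 0)
  rw [hI]

theorem comps_contract_eq_div (h : IsTensorSolution g ψ) (hg : IsKahlerMetric g) (hF : IsParam F U)
    {z : C2} (hz : z ∈ U) (i j : Fin 4) :
    comps F (contract g ψ) z ![i, j] = comps F ψ z ![0, 1, i, j] / comps F g z ![0, 0] := by
  rw [h.comps_contract hg, mul_div_cancel_right₀ _ (comps_pos hg hF hz).1.ne']

/-- By the symmetry of `ψ` the first or the second factor may be contracted: self-duality is
inherited from the remaining factor, and the equation comes from `coupledOp_contract`, where the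
second factor is contracted. -/
theorem isSolution_contract (h : IsTensorSolution g ψ) (hg : IsKahlerMetric g) :
    IsSolution g (contract g ψ) := by
  have two : ∀ I : Fin 2 → Fin 4, I = ![I 0, I 1] := fun I => by ext a; fin_cases a <;> rfl
  have hsm : IsSmooth (contract g ψ) := by
    intro e he I
    rw [two I]
    have hp := isParam_of_mem_atlas he
    refine ContDiffOn.congr ?_ fun z hz => h.comps_contract_eq_div hg hp hz _ _
    exact (h.smooth e he _).div (hg.smooth e he _) fun z hz => (comps_pos hg hp hz).1.ne'
  refine ⟨hsm, fun e he z hz => ?_, fun e he z hz => ?_⟩ <;> have hp := isParam_of_mem_atlas he <;>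
    have hK := hg.kahlerComps he
  · have hd := h.selfDual e he z hz
    have hc : ∀ i j, comps e.symm (contract g ψ) z ![i, j] =
        comps e.symm ψ z ![i, j, 0, 1] * (comps e.symm g z ![0, 0])⁻¹ := fun i j => by
      rw [h.comps_contract_eq_div hg hp hz, hd.2.1, div_eq_mul_inv]
    refine ⟨fun a b => by rw [hc, hc, hd.1 a b, neg_mul], fun I => ?_⟩
    rw [two I]
    have e1 : star (k := 0) (comps e.symm g) (comps e.symm (contract g ψ)) z ![I 0, I 1] =
        starMat (comps e.symm g) (fun i j => comps e.symm (contract g ψ) z ![i, j]) z (I 0) (I 1) := rfl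
    have e2 : star (k := 2) (comps e.symm g) (comps e.symm ψ) z ![I 0, I 1, 0, 1] =
        starMat (comps e.symm g) (fun i j => comps e.symm ψ z ![i, j, 0, 1]) z (I 0) (I 1) := rfl
    rw [e1, hc, ← hd.2.2.1, e2]
    simp only [hc, starMat, Finset.mul_sum, Finset.sum_mul, mul_assoc]
  · ext I
    rw [two I]
    have h0 := hK.coupledOp_contract (T := comps e.symm ψ) (F := comps e.symm (contract g ψ))
      (P := fun z I => 1 / 2 * (comps e.symm ψ z ![0, 2, I 0, I 1] - comps e.symm ψ z ![1, 3, I 0, I 1]))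
      (Q := fun z I => -(1 / 2) *
        (comps e.symm ψ z ![1, 2, I 0, I 1] + comps e.symm ψ z ![0, 3, I 0, I 1]))
      (hsm e he) (fun I => contDiffOn_const.mul ((h.smooth e he _).sub (h.smooth e he _)))
      (fun I => contDiffOn_const.mul ((h.smooth e he _).add (h.smooth e he _)))
      (fun z hz a b c d => by
        rw [h.comps_contract_eq_div hg hp hz]
        exact hK.eq_sdMat_right hz (h.selfDual e he z hz) a b c d) hz (I 0) (I 1)
    rw [h.eqn e he z hz] at h0
    exact (mul_eq_zero.mp h0.symm).resolve_right (hK.pos z hz).ne'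

end IsTensorSolution

end Surface

end

/-! ### The vanishing of decaying solutions of `D^* ψ = 0` -/

section

open scoped ComplexConjugate

section Surface

variable {X : Type*} [TopologicalSpace X] [ChartedSpace C2 X]
  [IsManifold 𝓘(ℂ, C2) ω X] {g : CovTensorField X 2} {ψ : CovTensorField X 4} {F : C2 → X}
  {U : Set C2} {e : OpenPartialHomeomorph X C2} {k : ℕ}

/-- The coefficient of `(dz₁ ∧ dz₂)²`. -/
def sqCoef (ψ : Comp 4) (z : C2) : ℂ := ψ z ![0, 2, 0, 2] - Complex.I * ψ z ![0, 2, 0, 3]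

theorem IsParam.comps_four_eq_sum (h : IsParam F U) (he : e ∈ atlas C2 X) (T : CovTensorField X 4)
    {z : C2} (hz : z ∈ overlap F U e) (i j k l : Fin 4) : comps F T z ![i, j, k, l] =
      ∑ c, ∑ d, realCoord (fderiv ℂ (e ∘ F) z (realFrame k)) c *
        realCoord (fderiv ℂ (e ∘ F) z (realFrame l)) d *
        ∑ a, ∑ b, realCoord (fderiv ℂ (e ∘ F) z (realFrame i)) a *
          realCoord (fderiv ℂ (e ∘ F) z (realFrame j)) b *
          comps e.symm T ((e ∘ F) z) ![a, b, c, d] := by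
  have e1 : comps F T z ![i, j, k, l] = pullAt e.symm T ((e ∘ F) z)
      ![fderiv ℂ (e ∘ F) z (realFrame i), fderiv ℂ (e ∘ F) z (realFrame j),
        fderiv ℂ (e ∘ F) z (realFrame k), fderiv ℂ (e ∘ F) z (realFrame l)] := by
    rw [comps_four, h.pullAt_eq he T hz]
    congr 1; ext a; fin_cases a <;> rfl
  rw [e1, quad_expand_right]
  simp only [comps_four]
  refine Finset.sum_congr rfl fun c _ => Finset.sum_congr rfl fun d _ => ?_
  rw [← quad_expand_left]

/-- A coefficient of `(dz₁ ∧ dz₂)²` is a section of `K²`: each pair of indices contributes one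
Jacobian determinant, by the transformation rule for self-dual forms applied twice. -/
theorem sqCoef_eq (hg : IsKahlerMetric g) (hF : IsParam F U) (he : e ∈ atlas C2 X)
    (hψ : ∀ z ∈ e.target, ∀ a b c d, comps e.symm ψ z ![a, b, c, d] = sdMat (comps e.symm g) 0
      (sdMat (comps e.symm g) 0 (sqCoef (comps e.symm ψ) z).re (sqCoef (comps e.symm ψ) z).im z a b)
      (sdMat (comps e.symm g) 0 (sqCoef (comps e.symm ψ) z).im (-(sqCoef (comps e.symm ψ) z).re) z a b)
      z c d) {z : C2} (hz : z ∈ overlap F U e) :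
    sqCoef (comps F ψ) z = (jac (e ∘ F) z).det * (jac (e ∘ F) z).det *
      sqCoef (comps e.symm ψ) (e (F z)) := by
  have P := hF.pull hg he
  have hw := P.maps z hz
  set τ := e ∘ F with hτ
  set x := sqCoef (comps e.symm ψ) (τ z) with hx
  set δ := (jac τ z).det with hδ
  have inner : ∀ c d, ∑ a, ∑ b, realCoord (fderiv ℂ τ z (realFrame 0)) a *
      realCoord (fderiv ℂ τ z (realFrame 2)) b * comps e.symm ψ (τ z) ![a, b, c, d] =
      sdMat (comps e.symm g) 0 (δ * x).re (δ * x).im (τ z) c d := by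
    intro c d
    have := P.sdMat_eq (φ := fun w I => ∑ a, ∑ b, realCoord (fderiv ℂ τ w (realFrame (I 0))) a *
      realCoord (fderiv ℂ τ w (realFrame (I 1))) b * comps e.symm ψ (τ w) ![a, b, c, d])
      (φ' := fun w I => comps e.symm ψ w ![I 0, I 1, c, d]) (fun w hw i j => rfl) hz
      (f := 0) (p := sdMat (comps e.symm g) 0 x.re x.im (τ z) c d)
      (q := sdMat (comps e.symm g) 0 x.im (-x.re) (τ z) c d) (fun a b =>
        (hψ _ hw a b c d).trans (sdMat_square_symm _ _ _ _ _ _ _)) 0 2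
    refine this.trans ?_
    fin_cases c <;> fin_cases d <;> simp [sdMat] <;> ring
  have outer : ∀ k l, comps F ψ z ![0, 2, k, l] = sdMat (comps F g) 0 (δ * (δ * x)).re
      (δ * (δ * x)).im z k l := by
    intro k l
    rw [hF.comps_four_eq_sum he ψ hz]
    have := P.sdMat_eq (φ := fun w I => ∑ c, ∑ d, realCoord (fderiv ℂ τ w (realFrame (I 0))) c *
      realCoord (fderiv ℂ τ w (realFrame (I 1))) d *
      sdMat (comps e.symm g) 0 (δ * x).re (δ * x).im (τ w) c d)
      (φ' := fun w I => sdMat (comps e.symm g) 0 (δ * x).re (δ * x).im w (I 0) (I 1))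
      (fun w hw i j => rfl) hz (f := 0) (p := (δ * x).re) (q := (δ * x).im) (fun a b => rfl) k l
    rw [mul_comm Complex.I, Complex.re_add_im] at this
    rw [← this]
    simp only [← hτ, inner]
    rfl
  rw [show sqCoef (comps e.symm ψ) (e (F z)) = x from rfl, sqCoef, outer, outer, mul_assoc]
  apply Complex.ext <;> simp [sdMat]

namespace IsTensorSolution

/-- Decaying solutions of `D^* ψ = 0` vanish. -/
theorem eq_zero [T2Space X] [ConnectedSpace X] [SecondCountableTopology X]
    (h : IsTensorSolution g ψ) (hg : IsKahlerMetric g) (hs : IsScalarFlat g) {A : ALEEnd g k}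
    {R C : ℝ} (B : ALEBounds A R C) (hdec : ∀ I, Bd R 2 fun _ z => comps A.chart ψ z I) :
    ψ = 0 := by
  have hc : contract g ψ = 0 := by
    refine (h.isSolution_contract hg).eq_zero hg hs B fun i j => ?_
    have := (hdec ![0, 1, i, j]).mul (Bd.inv ((B.metricBounds hg).comps 0 0) (c := 1 / 2)
      (by norm_num) fun r hr z hz _ => (B.metricBounds hg).pos z (hr.trans hz))
    refine Bd.congr this fun r hr z hz => ?_
    filter_upwards [A.isParam.isOpen.mem_nhds (B.radius_lt.trans_le (hr.trans hz))] with w hw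
    rw [h.comps_contract_eq_div hg A.isParam hw, div_eq_mul_inv]
  have h0 : ∀ (F : C2 → X) (z : C2) (c d : Fin 4), comps F ψ z ![0, 1, c, d] = 0 := by
    intro F z c d
    rw [h.comps_contract hg, hc]
    exact zero_mul _
  have hsq : ∀ e ∈ atlas C2 X, ∀ z ∈ e.target, ∀ a b c d, comps e.symm ψ z ![a, b, c, d] =
      sdMat (comps e.symm g) 0 (sdMat (comps e.symm g) 0 (sqCoef (comps e.symm ψ) z).re
        (sqCoef (comps e.symm ψ) z).im z a b) (sdMat (comps e.symm g) 0
        (sqCoef (comps e.symm ψ) z).im (-(sqCoef (comps e.symm ψ) z).re) z a b) z c d := by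
    intro e he z hz a b c d
    rw [(hg.kahlerComps he).eq_square hz (h.selfDual e he z hz) (h0 _ z) a b c d]
    simp [sqCoef]
  have hx0 : ∀ e ∈ atlas C2 X, ∀ z ∈ e.target, sqCoef (comps e.symm ψ) z = 0 := by
    -- The exponent is `n = 1`, since `x` is a section of `K²`.
    refine eq_zero_of_pmat B hg (fun F => sqCoef (comps F ψ)) 1 (fun F U hF e he z hz => ?_)
      (fun e he => ?_) (fun e he z hz => ?_) ?_
    · rw [pow_one]
      exact sqCoef_eq hg hF he (hsq e he) hz
    · exact (HermComps.contDiffOn_ofReal (h.smooth e he _)).sub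
        (contDiffOn_const.mul (HermComps.contDiffOn_ofReal (h.smooth e he _)))
    · have hp : ContDiffOn ℝ ∞ (fun z => (sqCoef (comps e.symm ψ) z).re) e.target := by
        refine ContDiffOn.congr (h.smooth e he ![0, 2, 0, 2]) fun w _ => ?_
        simp [sqCoef]
      have hq : ContDiffOn ℝ ∞ (fun z => (sqCoef (comps e.symm ψ) z).im) e.target := by
        refine ContDiffOn.congr (h.smooth e he ![0, 2, 0, 3]).neg fun w _ => ?_
        simp [sqCoef]
      have key := KahlerComps.pmat_eq_zero_of_dstar (U := ⟨e.target, e.open_target⟩)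
        (hg.kahlerComps he) (fun z hz => hs e he z hz) hp hq (hsq e he) (h.eqn e he) hz
      simp only [mul_comm Complex.I, Complex.re_add_im] at key
      exact key
    · exact (hdec _).ofReal.sub ((hdec _).ofReal.const_mul _)
  refine eq_zero_of_comps fun e he z hz I => ?_
  have hI : I = ![I 0, I 1, I 2, I 3] := by ext a; fin_cases a <;> rfl
  rw [hI, hsq e he z hz, hx0 e he z hz]
  generalize I 0 = a
  generalize I 1 = b
  generalize I 2 = c
  generalize I 3 = d
  have z1 : ∀ i j, sdMat (comps e.symm g) 0 0 0 z i j = 0 := fun i j => by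
    rw [sdMat_linear]; ring
  simp only [Complex.zero_re, Complex.zero_im, neg_zero, z1]

end IsTensorSolution

end Surface

/-! ### Countability of the surface and the zero tensor -/

section Surface

variable {X : Type*} [TopologicalSpace X] [ChartedSpace C2 X]

/-- The complements of the regions `‖z‖ > radius + n + 1` are compact and exhaust the surface. A
point in all of these regions would have preimages of arbitrarily large norm, while all its
preimages lie in one `Γ`-orbit. -/
theorem ALEEnd.sigmaCompactSpace {g : CovTensorField X 2} {k : ℕ} (A : ALEEnd g k) :
    SigmaCompactSpace X := by
  refine ⟨⟨fun n => (A.chart '' {z | A.radius + n + 1 < ‖z‖})ᶜ,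
    fun n => A.isCompact_compl _ (by have := n.cast_nonneg (α := ℝ); linarith), ?_⟩⟩
  refine Set.eq_univ_of_forall fun x => ?_
  by_contra hx
  simp only [Set.mem_iUnion, Set.mem_compl_iff, not_exists, not_not] at hx
  obtain ⟨z, hz, rfl⟩ := hx 0
  obtain ⟨n, hn⟩ := exists_nat_gt ‖z‖
  obtain ⟨w, hw, hwz⟩ := hx n
  have hr := A.radius_pos
  simp only [Set.mem_ofPred_eq] at hz hw
  have hn0 : (0 : ℝ) ≤ n := n.cast_nonneg
  obtain ⟨γ, _, hγ⟩ := (A.eq_iff w z (by linarith) (by push_cast at hz; linarith)).mp hwz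
  have : ‖w‖ = ‖z‖ := by rw [← hγ, γ.norm_map]
  linarith

theorem isSmooth_zero (n : ℕ) : IsSmooth (0 : CovTensorField X n) :=
  fun _ _ _ => contDiffOn_const

theorem comps_zero (F : C2 → X) (n : ℕ) : comps F (0 : CovTensorField X n) = 0 := rfl

end Surface

theorem cov_zero (G : Comp 2) (k : ℕ) : cov G (0 : Comp k) = 0 := by
  funext z I
  simp [cov, pd_const]

theorem covIter_zero (G : Comp 2) (k j : ℕ) : covIter G (0 : Comp k) j = 0 := by
  induction j with
  | zero => rfl
  | succ j ih => rw [covIter, ih, cov_zero]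

theorem coupledOp_zero (G : Comp 2) (k : ℕ) : coupledOp G (0 : Comp (k + 2)) = 0 := by
  have h1 : codiff G (0 : Comp (k + 2)) = 0 := by
    funext z I
    simp [codiff, cov_zero]
  have h2 : extDiff G (0 : Comp (k + 1)) = 0 := by
    funext z I
    simp [extDiff, cov_zero]
  funext z I
  simp [coupledOp, h1, h2, asdPart, star, ricciAction]

theorem decaysToOrder_zero {X : Type*} [TopologicalSpace X] [ChartedSpace C2 X]
    {g : CovTensorField X 2} {k : ℕ} (A : ALEEnd g k) (n m : ℕ) :
    DecaysToOrder A (0 : CovTensorField X n) m := by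
  intro j
  have : ∀ z, tensorNorm (comps A.chart g) (covIter (comps A.chart g)
      (comps A.chart (0 : CovTensorField X n)) j) z = 0 := by
    intro z
    rw [show comps A.chart (0 : CovTensorField X n) = 0 from rfl, covIter_zero]
    simp [tensorNorm]
  simp only [this]
  exact Asymptotics.isBigO_zero _ _

end

end ALEKahler

end

theorem mainTheorem12 {X : Type*} [TopologicalSpace X] [T2Space X] [ConnectedSpace X]
    [ChartedSpace ALEKahler.C2 X] [IsManifold 𝓘(ℂ, ALEKahler.C2) ω X]
    (g : ALEKahler.CovTensorField X 2) (hg : ALEKahler.IsKahlerMetric g)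
    (hs : ALEKahler.IsScalarFlat g)
    (k : ℕ) (hk : 2 ≤ k) (A : ALEKahler.ALEEnd g k) :
    ALEKahler.H2 A = {0} ∧ ALEKahler.H2J A = {0} := by
  -- Second countability is not assumed; it follows from the end and is needed for the volume
  -- measure.
  have := A.sigmaCompactSpace
  have : SecondCountableTopology X := ChartedSpace.secondCountable_of_sigmaCompact ALEKahler.C2 X
  obtain ⟨R, C, B⟩ := A.exists_bounds hk
  constructor <;> ext T <;> rw [Set.mem_singleton_iff] <;> constructor
  · rintro ⟨h1, h2, h3, h4⟩
    obtain ⟨R', hR, hbd⟩ := ALEKahler.DecaysToOrder.exists_bd B h1 h4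
    exact ALEKahler.IsTensorSolution.eq_zero ⟨h1, h2, h3⟩ hg hs (B.mono hR) hbd
  · rintro rfl
    refine ⟨ALEKahler.isSmooth_zero 4, fun e _ z _ => ?_, fun e _ z _ => ?_,
      ALEKahler.decaysToOrder_zero A 4 2⟩ <;> rw [ALEKahler.comps_zero]
    · simp [ALEKahler.IsS20SelfDualAt, ALEKahler.star]
    · exact congrFun (ALEKahler.coupledOp_zero _ 2) z
  · rintro ⟨h1, h2, h3, h4⟩
    obtain ⟨R', hR, hbd⟩ := ALEKahler.DecaysToOrder.exists_bd B h1 h4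
    exact ALEKahler.IsSolution.eq_zero ⟨h1, h2, h3⟩ hg hs (B.mono hR) fun i j => hbd _
  · rintro rfl
    refine ⟨ALEKahler.isSmooth_zero 2, fun e _ z _ => ?_, fun e _ z _ => ?_,
      ALEKahler.decaysToOrder_zero A 2 2⟩ <;> rw [ALEKahler.comps_zero]
    · simp [ALEKahler.IsSelfDualAt, ALEKahler.star]
    · exact congrFun (ALEKahler.coupledOp_zero _ 0) z
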